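/- **Setting.** A $2$-multimode graph $\mathcal G=(V,E_1,E_2)$ consists of two undirected, unweighted graphs $G_1=(V,E_1)$ and $G_2=(V,E_2)$ on the same non-empty finite vertex set $V$. Put $n=|V|$, $m=|E_1|+|E_2|$, and assume $m\ge n$. Let $d_i(u,v)\in\mathbb N\cup\{\infty\}$ be the shortest-path distance in $G_i$. The $2$-mode distance is $d_{\mathcal G}(u,v)=\min(d_1(u,v),d_2(u,v))$, and the $2$-mode diameter is $D(\mathcal G)=\max_{u,v\in V}d_{\mathcal G}(u,v)$. Running times refer to a word RAM with words of $\Theta(\log(\text{input length}))$ bits or more, in which each input number fits in one word; randomized algorithms may also draw fair random bits at unit cost. The exponent of matrix multiplication $\omega$ is the infimum of all $\tau$ such that two $N\times N$ matrices of nonnegative integers (the entries of the factors and of the product fitting in a word) can be multiplied deterministically in time $O(N^\tau)$. We say that $\omega$ *is attained up to logarithms* if this can be done in time $O(N^\omega(1+\log N)^k)$ for some constant $k$. **Theorem.** Put $$T(n,m)=m\,n^{3/4}\ \text{ if }\omega=2,\qquad T(n,m)=m\left(\frac{n^{3/2}}{(m\sqrt n)^{1/\omega}}+\Big(\frac mn\Big)^{1/(\omega-2)}\right)\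 \text{ if }\omega>2 .$$ For every constant $\varepsilon>0$ there is a randomized algorithm with running time $O(T(n,m)\,n^{\varepsilon})$ (for every outcome of the random bits), which, given a $2$-multimode graph $\mathcal G$ as above and an integer $D$ divisible by $4$, does one of the following with high probability: 1. it finds a pair of points $a,b\in V$ with $d_{\mathcal G}(a,b)\ge D/2$; 2. it determines, correctly, that $D(\mathcal G)<D$. If moreover $\omega$ is attained up to logarithms, then there is a constant $k$ such that the running time can be taken to be $O(T(n,m)\,(1+\log n)^{k})$. Here "with high probability" means: for every constant $c\ge 0$ the algorithm can be chosen so that the probability is at least $1-n^{-c}$ on every input. The constants in $O(\cdot)$ may depend on $c$ and on $\varepsilon$; the constant $k$ does not depend on $c$. -/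

import Mathlib

open MeasureTheory

/-! ### Randomized word RAM

Words have `w` bits. There is a memory addressed by words, and a program uses finitely many
registers. Control flow is structured (sequence, branch, loop). Every elementary operation and
every test of a branch or loop costs one time unit; so does drawing one fair random bit. -/

namespace WordRAM

/-- The binary word operations (unsigned, modulo `2 ^ w`). -/
inductive Op where
  | add | sub | mul | div | mod | and | or | xor | shl | shr | lt | eq

def Op.eval {w : ℕ} : Op → BitVec w → BitVec w → BitVec w
  | .add, x, y => x + y
  | .sub, x, y => x - y
  | .mul, x, y => x * y
  | .div, x, y => x / y
  | .mod, x, y => x % y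
  | .and, x, y => x &&& y
  | .or, x, y => x ||| y
  | .xor, x, y => x ^^^ y
  | .shl, x, y => x <<< y
  | .shr, x, y => x >>> y
  | .lt, x, y => if x < y then 1 else 0
  | .eq, x, y => if x = y then 1 else 0

/-- Programs. A program does not depend on the word size. -/
inductive Prog where
  /-- register `r` := the constant `k` -/
  | const (r k : ℕ)
  /-- register `r` := `o` applied to registers `a`, `b` -/
  | op (o : Op) (r a b : ℕ)
  /-- register `r` := memory cell whose address is in register `a` -/
  | load (r a : ℕ)
  /-- memory cell whose address is in register `a` := register `r` -/
  | store (a r : ℕ)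
  /-- register `r` := a fresh fair random bit -/
  | coin (r : ℕ)
  | seq (p q : Prog)
  /-- if register `r` is nonzero run `p`, else run `q` -/
  | branch (r : ℕ) (p q : Prog)
  /-- while register `r` is nonzero run `p` -/
  | loop (r : ℕ) (p : Prog)

/-- Registers, memory, and the number of random bits drawn so far. -/
structure State (w : ℕ) where
  reg : ℕ → BitVec w
  mem : BitVec w → BitVec w
  drawn : ℕ

def State.setReg {w : ℕ} (s : State w) (r : ℕ) (x : BitVec w) : State w :=
  { s with reg := Function.update s.reg r x }

def State.setMem {w : ℕ} (s : State w) (a x : BitVec w) : State w :=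
  { s with mem := Function.update s.mem a x }

/-- The start of a computation: the input is in the memory cells `0, 1, 2, …`; all other cells
and all registers are zero. -/
def State.init (w : ℕ) (input : List ℕ) : State w where
  reg := fun _ => 0
  mem := fun a => BitVec.ofNat w (input.getD a.toNat 0)
  drawn := 0

/-- `Run tape p s t s'`: with the random bits `tape`, the program `p` started in `s` halts
after exactly `t` time units in `s'`. -/
inductive Run {w : ℕ} (tape : ℕ → Bool) : Prog → State w → ℕ → State w → Prop where
  | const (r k : ℕ) (s : State w) :
      Run tape (.const r k) s 1 (s.setReg r (BitVec.ofNat w k))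
  | op (o : Op) (r a b : ℕ) (s : State w) :
      Run tape (.op o r a b) s 1 (s.setReg r (o.eval (s.reg a) (s.reg b)))
  | load (r a : ℕ) (s : State w) :
      Run tape (.load r a) s 1 (s.setReg r (s.mem (s.reg a)))
  | store (a r : ℕ) (s : State w) :
      Run tape (.store a r) s 1 (s.setMem (s.reg a) (s.reg r))
  | coin (r : ℕ) (s : State w) :
      Run tape (.coin r) s 1
        { s.setReg r (if tape s.drawn then 1 else 0) with drawn := s.drawn + 1 }
  | seq {p q : Prog} {s s₁ s₂ : State w} {t₁ t₂ : ℕ} :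
      Run tape p s t₁ s₁ → Run tape q s₁ t₂ s₂ → Run tape (.seq p q) s (t₁ + t₂) s₂
  | branch_true {r : ℕ} {p q : Prog} {s s₁ : State w} {t : ℕ} :
      s.reg r ≠ 0 → Run tape p s t s₁ → Run tape (.branch r p q) s (t + 1) s₁
  | branch_false {r : ℕ} {p q : Prog} {s s₁ : State w} {t : ℕ} :
      s.reg r = 0 → Run tape q s t s₁ → Run tape (.branch r p q) s (t + 1) s₁
  | loop_true {r : ℕ} {p : Prog} {s s₁ s₂ : State w} {t₁ t₂ : ℕ} :
      s.reg r ≠ 0 → Run tape p s t₁ s₁ → Run tape (.loop r p) s₁ t₂ s₂ →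
        Run tape (.loop r p) s (t₁ + t₂ + 1) s₂
  | loop_false {r : ℕ} {p : Prog} {s : State w} :
      s.reg r = 0 → Run tape (.loop r p) s 1 s

/-- The usual assumption on the word size: every input number fits in a word, and words have
at least `K * log₂ (input length)` bits. -/
def WordSizeOK (K w : ℕ) (input : List ℕ) : Prop :=
  (∀ x ∈ input, x < 2 ^ w) ∧ (input.length + 2) ^ K ≤ 2 ^ w

/-- Independent fair random bits. -/
noncomputable def coinMeasure : Measure (ℕ → Bool) :=
  Measure.infinitePi fun _ => (PMF.uniformOfFintype Bool).toMeasure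

end WordRAM

/-! ### Matrix multiplication -/

/-- A pair of `N × N` matrices as an input: `N`, then both matrices in row-major order. -/
def encodeMatrices {N : ℕ} (A B : Matrix (Fin N) (Fin N) ℕ) : List ℕ :=
  N :: ((List.ofFn fun i => List.ofFn fun j => A i j).flatten ++
    (List.ofFn fun i => List.ofFn fun j => B i j).flatten)

/-- Two `N × N` matrices of nonnegative integers (with the entries of the factors and of the
product fitting in a word) can be multiplied in time `O(T N)`. The product is written in
row-major order directly behind the input. -/
def MatMulInTime (T : ℕ → ℝ) : Prop :=
  ∃ (P : WordRAM.Prog) (K : ℕ) (C : ℝ),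
    ∀ (N w : ℕ) (A B : Matrix (Fin N) (Fin N) ℕ), 0 < N →
      WordRAM.WordSizeOK K w (encodeMatrices A B) → (∀ i j, (A * B) i j < 2 ^ w) →
      ∀ tape : ℕ → Bool, ∃ (t : ℕ) (s : WordRAM.State w),
        WordRAM.Run tape P (WordRAM.State.init w (encodeMatrices A B)) t s ∧
        (t : ℝ) ≤ C * T N ∧
        ∀ i j : Fin N,
          s.mem (BitVec.ofNat w (1 + 2 * N ^ 2 + N * i + j)) = BitVec.ofNat w ((A * B) i j)

/-- The exponent `ω` of matrix multiplication. -/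
noncomputable def matMulExponent : ℝ :=
  sInf {τ : ℝ | MatMulInTime fun N => (N : ℝ) ^ τ}

/-! ### Multimode graphs -/

/-- An undirected, unweighted `k`-multimode graph `(V, E₁, …, E_k)`. -/
abbrev MultimodeGraph (k : ℕ) (V : Type*) := Fin k → SimpleGraph V

namespace MultimodeGraph

variable {k : ℕ} {V : Type*}

/-- The `k`-mode distance: the minimum over the modes of the shortest-path distance (which is
`∞` for points that are not connected). -/
noncomputable def dist (G : MultimodeGraph k V) (u v : V) : ℕ∞ := ⨅ i, (G i).edist u v

/-- The `k`-mode diameter: the largest `k`-mode distance. -/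
noncomputable def diam (G : MultimodeGraph k V) : ℕ∞ := ⨆ (u : V) (v : V), G.dist u v

/-- The number of edges, over all modes. -/
noncomputable def numEdges (G : MultimodeGraph k V) : ℕ := ∑ i, (G i).edgeSet.ncard

end MultimodeGraph

/-- `L` lists every edge of `G` exactly once, in any order and with any orientation. -/
def IsEdgeList {n : ℕ} (L : List (Fin n × Fin n)) (G : SimpleGraph (Fin n)) : Prop :=
  (L.map fun e => s(e.1, e.2)).Nodup ∧
    ∀ u v : Fin n, G.Adj u v ↔ s(u, v) ∈ L.map fun e => s(e.1, e.2)

/-- A 2-multimode graph, given by its two edge lists, and an integer `D` as an input. -/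
def encodeInstance {n : ℕ} (L : Fin 2 → List (Fin n × Fin n)) (D : ℤ) : List ℕ :=
  [n, (L 0).length, (L 1).length, D.toNat, (-D).toNat] ++
    (L 0 ++ L 1).flatMap fun e => [(e.1 : ℕ), (e.2 : ℕ)]

/-- A correct final state: either register 0 is 1 and registers 1 and 2 hold points `a`, `b`
whose 2-mode distance is at least `D / 2`, or register 0 is 0 (the answer
"the diameter is less than `D`") and the 2-mode diameter is indeed less than `D`. -/
def CorrectAnswer {n w : ℕ} (G : MultimodeGraph 2 (Fin n)) (D : ℤ) (s : WordRAM.State w) :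
    Prop :=
  (s.reg 0 = 1 ∧ ∃ a b : Fin n,
      s.reg 1 = BitVec.ofNat w a ∧ s.reg 2 = BitVec.ofNat w b ∧
      (((D : ℝ) / 2 : ℝ) : EReal) ≤ ((G.dist a b : ENNReal) : EReal)) ∨
  (s.reg 0 = 0 ∧ ((G.diam : ENNReal) : EReal) < ((D : ℝ) : EReal))

/-- There is a randomized algorithm that takes a 2-multimode graph with `n ≥ 1` vertices and
`m ≥ n` edges and an integer `D` divisible by 4, always halts in time `O(T n m)`, and with high
probability (at least `1 - n ^ (-c)`, for any prescribed constant `c`) answers correctly. -/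
def DiameterGapInTime (T : ℕ → ℕ → ℝ) : Prop :=
  ∀ c : ℕ, ∃ (P : WordRAM.Prog) (K : ℕ) (C : ℝ),
    ∀ (n w : ℕ) (G : MultimodeGraph 2 (Fin n)) (L : Fin 2 → List (Fin n × Fin n)) (D : ℤ),
      0 < n → n ≤ G.numEdges → (4 : ℤ) ∣ D → (∀ i, IsEdgeList (L i) (G i)) →
      WordRAM.WordSizeOK K w (encodeInstance L D) →
      (∀ tape : ℕ → Bool, ∃ (t : ℕ) (s : WordRAM.State w),
        WordRAM.Run tape P (WordRAM.State.init w (encodeInstance L D)) t s ∧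
        (t : ℝ) ≤ C * T n G.numEdges) ∧
      ENNReal.ofReal (1 - (n : ℝ) ^ (-(c : ℝ))) ≤
        WordRAM.coinMeasure {tape | ∃ (t : ℕ) (s : WordRAM.State w),
          WordRAM.Run tape P (WordRAM.State.init w (encodeInstance L D)) t s ∧
          CorrectAnswer G D s}

/-! For `D ≤ 0` any pair of points is an answer. Otherwise let `q = min (D / 4) n`; replacing `D /
4` by `n` loses nothing, since finite distances are below `n`. Call a vertex near a point `u` in a
mode if its distance is at most `q`, and far if it is at least `3 * q`. If the diameter is at least
`D`, there are `x`, `y` at distance at least `4 * q` in both modes, and it suffices to find some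
pair at distance at least `2 * q` in both. The basic operation `test` looks for such a pair with one
end prescribed, by one breadth-first search in each mode. Each search is arranged so that an
existing pair `x`, `y` forces some test to succeed; a search without success therefore excludes `x`,
`y`.

Let `a` be a power of two of order `n ^ (1 / 4)`, let `H = 2 ^ j` and `N = a ^ 3 / H`, and draw
random vertices. With `l` of order `log n`, with high probability every ball of radius `q` that
misses the first `N` samples has at most `r = a * H * l` vertices, and every ball that misses the
first `a ^ 2` samples has at most `a ^ 2 * l` (`coin_bad_le`). There are three cases for `x`.

(1) In both modes `x` is near one of the `N` samples, say `s` in mode 0 and `s'` in mode 1. Then `y`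
is far from `s` in mode 0 and from `s'` in mode 1. Whether a pair of samples separates two vertices
in this way can be read off the digits of one entry of a matrix product (`Inst.noSep_of_digits`),
and one separating pair is enough to find an answer (`Inst.noSep_of`).

(2) In mode `1 - i`, `x` is near none of the `N` samples, but in mode `i` it is near one of the
first `a ^ 2`, say `s`. Any vertex `W` with these two properties can stand in for `x`: unless `test`
succeeds at `W`, `y` is within `2 * q` of `W` in mode `1 - i`, and the middle of a shortest path is
one of the at most `r` vertices of a ball about `W` (`Inst.noStar_of`).

(3) `x` is near none of the `N` samples in mode `1 - i` and near none of the first `a ^ 2` in mode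
`i`. Again any such `W` can stand in for `x`; both its balls are small, and some pair of their
members separates `x` from `y` (`Inst.noUnhit_of`).

Cases (2) and (3) take about `a ^ 2 * r`, that is `a ^ 3 * H`, breadth-first searches up to
logarithms. In case (1) the product of an `N × n` and an `n × N` matrix is cut into `a * H` products
of `N × N` matrices, each of which may take time of order `m * a ^ 2`; this costs `m * a ^ 3 * H` as
well. The program tries `H = 1, 2, 4, …` until the products finish in the allotted time. If the size
`2 * N` was too slow, then `m * a ^ 2` is less than about `N ^ τ`, so `N` is at least about `(m *
√n) ^ (1 / τ)`, and the total `m * a ^ 6 / N` is about `m * n ^ (3 / 2) / (m * √n) ^ (1 / τ)`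
(`matMulBound_le`). If `H = 1` succeeds, the total is `m * n ^ (3 / 4)`, which is below the claimed
bound by `m ≥ n` if `ω = 2` and by `rpow_le_gapTerms` if `ω > 2`.

All this runs on the word RAM by way of a small structured language with exact natural numbers, a
calculus of total correctness with time, and a compiler (`HRun.comp`). The given multiplication
program is simulated with a fuel bound, on words of its own size and in its own part of the memory
(`Prog.sim_spec`). -/

/-! ### A structured language over the natural numbers, compiled to the word RAM -/

namespace WordRAM

/-- Expressions. `bin` is exact arithmetic on natural numbers, `raw` is the word operation. -/
inductive Exp where
  | lit (k : ℕ)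
  | var (r : ℕ)
  | bin (o : Op) (a b : Exp)
  | raw (o : Op) (a b : Exp)

instance : Add Exp := ⟨Exp.bin .add⟩
instance : Sub Exp := ⟨Exp.bin .sub⟩
instance : Mul Exp := ⟨Exp.bin .mul⟩
instance : Div Exp := ⟨Exp.bin .div⟩
instance : Mod Exp := ⟨Exp.bin .mod⟩
instance (k : ℕ) : OfNat Exp k := ⟨Exp.lit k⟩

/-- Commands. -/
inductive Cmd where
  | asg (r : ℕ) (e : Exp)
  | ld (r a : ℕ) (e : Exp)
  | inp (r : ℕ) (e : Exp)
  | st (a : ℕ) (e f : Exp)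
  | coin (r : ℕ)
  | seq (c d : Cmd)
  | ite (e : Exp) (c d : Cmd)
  | whl (e : Exp) (c : Cmd)

infixr:30 ";;" => Cmd.seq

/-- States of the structured language: registers, arrays, random bits drawn, and time. -/
structure HState where
  reg : ℕ → ℕ
  arr : ℕ → ℕ → ℕ
  drawn : ℕ
  time : ℕ

namespace HState

def set (h : HState) (r x : ℕ) : HState :=
  { h with reg := Function.update h.reg r x, time := h.time + 1 }

def put (h : HState) (a i x : ℕ) : HState :=
  { h with arr := Function.update h.arr a (Function.update (h.arr a) i x), time := h.time + 1 }

def tick (h : HState) : HState := { h with time := h.time + 1 }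

def toss (h : HState) (r : ℕ) (b : Bool) : HState :=
  { h with
    reg := Function.update h.reg r (if b then 1 else 0)
    drawn := h.drawn + 1
    time := h.time + 1 }

variable (h : HState) (r r' x a a' i j : ℕ) (b : Bool)

@[simp] theorem set_reg : (h.set r x).reg r' = if r' = r then x else h.reg r' := by
  simp [set, Function.update_apply]
@[simp] theorem set_arr : (h.set r x).arr = h.arr := rfl
@[simp] theorem set_drawn : (h.set r x).drawn = h.drawn := rfl
@[simp] theorem set_time : (h.set r x).time = h.time + 1 := rfl
@[simp] theorem put_reg : (h.put a i x).reg = h.reg := rfl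
@[simp] theorem put_arr : (h.put a i x).arr a' j = if a' = a ∧ j = i then x else h.arr a' j := by
  simp only [put, Function.update_apply]
  by_cases h1 : a' = a
  · subst h1; simp [Function.update_apply]
  · simp [h1]
theorem put_arr_of_ne (ha : a' ≠ a) : (h.put a i x).arr a' = h.arr a' := by
  simp [put, ha]
@[simp] theorem put_drawn : (h.put a i x).drawn = h.drawn := rfl
@[simp] theorem put_time : (h.put a i x).time = h.time + 1 := rfl
@[simp] theorem tick_reg : h.tick.reg = h.reg := rfl
@[simp] theorem tick_arr : h.tick.arr = h.arr := rfl
@[simp] theorem tick_drawn : h.tick.drawn = h.drawn := rfl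
@[simp] theorem tick_time : h.tick.time = h.time + 1 := rfl
@[simp] theorem toss_reg :
    (h.toss r b).reg r' = if r' = r then (if b then 1 else 0) else h.reg r' := by
  simp [toss, Function.update_apply]
@[simp] theorem toss_arr : (h.toss r b).arr = h.arr := rfl
@[simp] theorem toss_drawn : (h.toss r b).drawn = h.drawn + 1 := rfl
@[simp] theorem toss_time : (h.toss r b).time = h.time + 1 := rfl

end HState

/-- What a computation depends on: word size, bound for numbers and indices, length and content
of the input, random bits. -/
structure Env where
  w : ℕ
  B : ℕ
  len : ℕ
  inp : ℕ → ℕ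
  tape : ℕ → Bool

/-- The bitwise operations and shifts get the default `0`, which is harmless because `Op.Fits`
rejects them. -/
def Op.nat : Op → ℕ → ℕ → ℕ
  | .add, x, y => x + y
  | .sub, x, y => x - y
  | .mul, x, y => x * y
  | .div, x, y => x / y
  | .mod, x, y => x % y
  | .lt, x, y => if x < y then 1 else 0
  | .eq, x, y => if x = y then 1 else 0
  | _, _, _ => 0

/-- The operation is exact, with bound `B` for its result. -/
def Op.Fits (B : ℕ) : Op → ℕ → ℕ → Prop
  | .add, x, y => x + y < B
  | .sub, x, y => y ≤ x
  | .mul, x, y => x * y < B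
  | .div, _, _ => True
  | .mod, _, _ => True
  | .lt, _, _ => True
  | .eq, _, _ => True
  | _, _, _ => False

/-- Only the simulation of a foreign program needs it: there the operations must wrap around as they
do on the machine. -/
def Op.word (w : ℕ) (o : Op) (x y : ℕ) : ℕ :=
  (o.eval (BitVec.ofNat w x) (BitVec.ofNat w y)).toNat

namespace Exp

def ev (E : Env) (h : HState) : Exp → ℕ
  | lit k => k
  | var r => h.reg r
  | bin o a b => o.nat (a.ev E h) (b.ev E h)
  | raw o a b => o.word E.w (a.ev E h) (b.ev E h)

/-- A word operation cannot fail, so `raw` carries no condition on its result. For exact arithmetic,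
`Op.Fits` excludes overflow and negative differences. -/
def ok (E : Env) (h : HState) : Exp → Prop
  | lit k => k < E.B
  | var _ => True
  | bin o a b => a.ok E h ∧ b.ok E h ∧ o.Fits E.B (a.ev E h) (b.ev E h)
  | raw _ a b => a.ok E h ∧ b.ok E h

def size : Exp → ℕ
  | lit _ => 1
  | var _ => 1
  | bin _ a b => a.size + b.size + 1
  | raw _ a b => a.size + b.size + 1

/-- The expression `a < b`. -/
def lt (a b : Exp) : Exp := bin .lt a b
/-- The expression `a = b`. -/
def eq (a b : Exp) : Exp := bin .eq a b

variable (E : Env) (h : HState) (a b : Exp) (k r : ℕ) (o : Op)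

@[simp] theorem ev_lit : (lit k).ev E h = k := rfl
@[simp] theorem ev_ofNat : (no_index (OfNat.ofNat k) : Exp).ev E h = k := rfl
@[simp] theorem ev_var : (var r).ev E h = h.reg r := rfl
@[simp] theorem ev_add : (a + b).ev E h = a.ev E h + b.ev E h := rfl
@[simp] theorem ev_sub : (a - b).ev E h = a.ev E h - b.ev E h := rfl
@[simp] theorem ev_mul : (a * b).ev E h = a.ev E h * b.ev E h := rfl
@[simp] theorem ev_div : (a / b).ev E h = a.ev E h / b.ev E h := rfl
@[simp] theorem ev_mod : (a % b).ev E h = a.ev E h % b.ev E h := rfl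
@[simp] theorem ev_lt : (lt a b).ev E h = if a.ev E h < b.ev E h then 1 else 0 := rfl
@[simp] theorem ev_eq : (eq a b).ev E h = if a.ev E h = b.ev E h then 1 else 0 := rfl
@[simp] theorem ev_raw : (raw o a b).ev E h = o.word E.w (a.ev E h) (b.ev E h) := rfl
@[simp] theorem ok_lit : (lit k).ok E h ↔ k < E.B := Iff.rfl
@[simp] theorem ok_ofNat : (no_index (OfNat.ofNat k) : Exp).ok E h ↔ k < E.B := Iff.rfl
@[simp] theorem ok_var : (var r).ok E h := trivial
@[simp] theorem ok_add :
    (a + b).ok E h ↔ a.ok E h ∧ b.ok E h ∧ a.ev E h + b.ev E h < E.B := Iff.rfl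
@[simp] theorem ok_sub :
    (a - b).ok E h ↔ a.ok E h ∧ b.ok E h ∧ b.ev E h ≤ a.ev E h := Iff.rfl
@[simp] theorem ok_mul :
    (a * b).ok E h ↔ a.ok E h ∧ b.ok E h ∧ a.ev E h * b.ev E h < E.B := Iff.rfl
@[simp] theorem ok_div : (a / b).ok E h ↔ a.ok E h ∧ b.ok E h :=
  ⟨fun x => ⟨x.1, x.2.1⟩, fun x => ⟨x.1, x.2, trivial⟩⟩
@[simp] theorem ok_mod : (a % b).ok E h ↔ a.ok E h ∧ b.ok E h :=
  ⟨fun x => ⟨x.1, x.2.1⟩, fun x => ⟨x.1, x.2, trivial⟩⟩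
@[simp] theorem ok_lt : (lt a b).ok E h ↔ a.ok E h ∧ b.ok E h :=
  ⟨fun x => ⟨x.1, x.2.1⟩, fun x => ⟨x.1, x.2, trivial⟩⟩
@[simp] theorem ok_eq : (eq a b).ok E h ↔ a.ok E h ∧ b.ok E h :=
  ⟨fun x => ⟨x.1, x.2.1⟩, fun x => ⟨x.1, x.2, trivial⟩⟩
@[simp] theorem ok_raw : (raw o a b).ok E h ↔ a.ok E h ∧ b.ok E h := Iff.rfl

end Exp

/-- Big-step semantics of commands. -/
inductive HRun (E : Env) : Cmd → HState → HState → Prop where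
  | asg {r e h} : e.ok E h → HRun E (.asg r e) h (h.set r (e.ev E h))
  | ld {r a e h} : e.ok E h → a < 16 → e.ev E h < E.B →
      HRun E (.ld r a e) h (h.set r (h.arr a (e.ev E h)))
  | inp {r e h} : e.ok E h → e.ev E h < E.len →
      HRun E (.inp r e) h (h.set r (E.inp (e.ev E h)))
  | st {a e f h} : e.ok E h → f.ok E h → a < 16 → e.ev E h < E.B →
      HRun E (.st a e f) h (h.put a (e.ev E h) (f.ev E h))
  | coin {r h} : HRun E (.coin r) h (h.toss r (E.tape h.drawn))
  | seq {c d h h₁ h₂} : HRun E c h h₁ → HRun E d h₁ h₂ → HRun E (.seq c d) h h₂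
  | ite_true {e c d h h'} : e.ok E h → e.ev E h ≠ 0 → HRun E c h.tick h' →
      HRun E (.ite e c d) h h'
  | ite_false {e c d h h'} : e.ok E h → e.ev E h = 0 → HRun E d h.tick h' →
      HRun E (.ite e c d) h h'
  | whl_true {e c h h₁ h₂} : e.ok E h → e.ev E h ≠ 0 → HRun E c h.tick h₁ →
      HRun E (.whl e c) h₁ h₂ → HRun E (.whl e c) h h₂
  | whl_false {e c h} : e.ok E h → e.ev E h = 0 → HRun E (.whl e c) h h.tick

/-! #### Frames -/

namespace Cmd

/-- The command writes register `r`. -/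
def W : Cmd → ℕ → Bool
  | asg r _, x => x == r
  | ld r _ _, x => x == r
  | inp r _, x => x == r
  | st _ _ _, _ => false
  | coin r, x => x == r
  | seq c d, x => c.W x || d.W x
  | ite _ c d, x => c.W x || d.W x
  | whl _ c, x => c.W x

/-- The command writes array `a`. -/
def WA : Cmd → ℕ → Bool
  | st a _ _, x => x == a
  | seq c d, x => c.WA x || d.WA x
  | ite _ c d, x => c.WA x || d.WA x
  | whl _ c, x => c.WA x
  | _, _ => false

/-- The command draws random bits. -/
def WD : Cmd → Bool
  | coin _ => true
  | seq c d => c.WD || d.WD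
  | ite _ c d => c.WD || d.WD
  | whl _ c => c.WD
  | _ => false

end Cmd

/-- Whatever a command cannot write by its syntax stays as it was. Specifications can thus be
limited to what changes, and preservation is mostly settled by evaluating `W` and `WA`. -/
structure Frame (c : Cmd) (h h' : HState) : Prop where
  reg : ∀ r, c.W r = false → h'.reg r = h.reg r
  arr : ∀ a, c.WA a = false → h'.arr a = h.arr a
  drawn : c.WD = false → h'.drawn = h.drawn
  time : h.time ≤ h'.time

theorem Frame.trans {c : Cmd} {h h' h'' : HState} (h1 : Frame c h h') (h2 : Frame c h' h'') :
    Frame c h h'' :=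
  ⟨fun r hr => (h2.reg r hr).trans (h1.reg r hr), fun a ha => (h2.arr a ha).trans (h1.arr a ha),
    fun hd => (h2.drawn hd).trans (h1.drawn hd), h1.time.trans h2.time⟩

theorem HRun.frame {E : Env} {c : Cmd} {h h' : HState} (H : HRun E c h h') : Frame c h h' := by
  induction H with
  | asg _ => exact ⟨fun r hr => by simp_all [Cmd.W], fun _ _ => rfl, fun _ => rfl, by simp⟩
  | ld _ _ _ => exact ⟨fun r hr => by simp_all [Cmd.W], fun _ _ => rfl, fun _ => rfl, by simp⟩
  | inp _ _ => exact ⟨fun r hr => by simp_all [Cmd.W], fun _ _ => rfl, fun _ => rfl, by simp⟩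
  | st _ _ _ _ =>
    exact ⟨fun r hr => rfl, fun a ha => HState.put_arr_of_ne _ _ _ _ _ (by simpa [Cmd.WA] using ha),
      fun _ => rfl, by simp⟩
  | coin => exact ⟨fun r hr => by simp_all [Cmd.W], fun _ _ => rfl, fun h => by simp [Cmd.WD] at h,
      by simp⟩
  | seq _ _ h1 h2 =>
    refine ⟨fun r hr => ?_, fun a ha => ?_, fun hd => ?_, h1.time.trans h2.time⟩
    · simp only [Cmd.W, Bool.or_eq_false_iff] at hr
      rw [h2.reg r hr.2, h1.reg r hr.1]
    · simp only [Cmd.WA, Bool.or_eq_false_iff] at ha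
      rw [h2.arr a ha.2, h1.arr a ha.1]
    · simp only [Cmd.WD, Bool.or_eq_false_iff] at hd
      rw [h2.drawn hd.2, h1.drawn hd.1]
  | ite_true _ _ _ h1 =>
    refine ⟨fun r hr => ?_, fun a ha => ?_, fun hd => ?_, by have := h1.time; simp at this; omega⟩
    · simp only [Cmd.W, Bool.or_eq_false_iff] at hr
      rw [h1.reg r hr.1]; rfl
    · simp only [Cmd.WA, Bool.or_eq_false_iff] at ha
      rw [h1.arr a ha.1]; rfl
    · simp only [Cmd.WD, Bool.or_eq_false_iff] at hd
      rw [h1.drawn hd.1]; rfl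
  | ite_false _ _ _ h1 =>
    refine ⟨fun r hr => ?_, fun a ha => ?_, fun hd => ?_, by have := h1.time; simp at this; omega⟩
    · simp only [Cmd.W, Bool.or_eq_false_iff] at hr
      rw [h1.reg r hr.2]; rfl
    · simp only [Cmd.WA, Bool.or_eq_false_iff] at ha
      rw [h1.arr a ha.2]; rfl
    · simp only [Cmd.WD, Bool.or_eq_false_iff] at hd
      rw [h1.drawn hd.2]; rfl
  | whl_true _ _ _ _ h1 h2 =>
    refine ⟨fun r hr => ?_, fun a ha => ?_, fun hd => ?_,
      by have := h1.time; have := h2.time; simp at *; omega⟩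
    · rw [h2.reg r hr, h1.reg r hr]; rfl
    · rw [h2.arr a ha, h1.arr a ha]; rfl
    · rw [h2.drawn hd, h1.drawn hd]; rfl
  | whl_false _ _ => exact ⟨fun _ _ => rfl, fun _ _ => rfl, fun _ => rfl, by simp⟩

/-! #### Total correctness -/

/-- The command, started in `h`, halts without error in a state that satisfies `Q`. -/
def wp (E : Env) (c : Cmd) (Q : HState → Prop) (h : HState) : Prop := ∃ h', HRun E c h h' ∧ Q h'

variable {E : Env} {Q Q' : HState → Prop} {h : HState}

theorem wp.mono {c : Cmd} (H : wp E c Q h) (hQ : ∀ h', Q h' → Q' h') : wp E c Q' h :=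
  let ⟨h', h1, h2⟩ := H; ⟨h', h1, hQ h' h2⟩

theorem wp.framed {c : Cmd} (H : wp E c Q h) : wp E c (fun h' => Frame c h h' ∧ Q h') h :=
  let ⟨h', h1, h2⟩ := H; ⟨h', h1, h1.frame, h2⟩

/-- Use of a specification. -/
theorem wp.call {c : Cmd} (H : wp E c Q h) (hQ : ∀ h', Frame c h h' → Q h' → Q' h') :
    wp E c Q' h :=
  H.framed.mono fun h' x => hQ h' x.1 x.2

theorem wp_asg {r : ℕ} {e : Exp} :
    wp E (.asg r e) Q h ↔ e.ok E h ∧ Q (h.set r (e.ev E h)) :=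
  ⟨fun ⟨_, h1, h2⟩ => by cases h1; exact ⟨‹_›, h2⟩, fun ⟨h1, h2⟩ => ⟨_, .asg h1, h2⟩⟩

theorem wp_ld {r a : ℕ} {e : Exp} : wp E (.ld r a e) Q h ↔
    e.ok E h ∧ a < 16 ∧ e.ev E h < E.B ∧ Q (h.set r (h.arr a (e.ev E h))) :=
  ⟨fun ⟨_, h1, h2⟩ => by cases h1; exact ⟨‹_›, ‹_›, ‹_›, h2⟩,
    fun ⟨h1, h2, h3, h4⟩ => ⟨_, .ld h1 h2 h3, h4⟩⟩

theorem wp_inp {r : ℕ} {e : Exp} : wp E (.inp r e) Q h ↔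
    e.ok E h ∧ e.ev E h < E.len ∧ Q (h.set r (E.inp (e.ev E h))) :=
  ⟨fun ⟨_, h1, h2⟩ => by cases h1; exact ⟨‹_›, ‹_›, h2⟩,
    fun ⟨h1, h2, h3⟩ => ⟨_, .inp h1 h2, h3⟩⟩

theorem wp_st {a : ℕ} {e f : Exp} : wp E (.st a e f) Q h ↔
    e.ok E h ∧ f.ok E h ∧ a < 16 ∧ e.ev E h < E.B ∧ Q (h.put a (e.ev E h) (f.ev E h)) :=
  ⟨fun ⟨_, h1, h2⟩ => by cases h1; exact ⟨‹_›, ‹_›, ‹_›, ‹_›, h2⟩,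
    fun ⟨h1, h2, h3, h4, h5⟩ => ⟨_, .st h1 h2 h3 h4, h5⟩⟩

theorem wp_coin {r : ℕ} : wp E (.coin r) Q h ↔ Q (h.toss r (E.tape h.drawn)) :=
  ⟨fun ⟨_, h1, h2⟩ => by cases h1; exact h2, fun h1 => ⟨_, .coin, h1⟩⟩

theorem wp_seq {c d : Cmd} : wp E (c ;; d) Q h ↔ wp E c (fun h' => wp E d Q h') h :=
  ⟨fun ⟨_, h1, h2⟩ => by cases h1 with | seq a b => exact ⟨_, a, _, b, h2⟩,
    fun ⟨_, h1, _, h2, h3⟩ => ⟨_, .seq h1 h2, h3⟩⟩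

theorem wp_ite {e : Exp} {c d : Cmd} : wp E (.ite e c d) Q h ↔
    e.ok E h ∧ (e.ev E h ≠ 0 → wp E c Q h.tick) ∧ (e.ev E h = 0 → wp E d Q h.tick) := by
  constructor
  · rintro ⟨_, h1, h2⟩
    cases h1 with
    | ite_true a b c => exact ⟨a, fun _ => ⟨_, c, h2⟩, fun h => absurd h b⟩
    | ite_false a b c => exact ⟨a, fun h => absurd b h, fun _ => ⟨_, c, h2⟩⟩
  · rintro ⟨h1, h2, h3⟩
    by_cases hz : e.ev E h = 0
    · obtain ⟨_, h4, h5⟩ := h3 hz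
      exact ⟨_, .ite_false h1 hz h4, h5⟩
    · obtain ⟨_, h4, h5⟩ := h2 hz
      exact ⟨_, .ite_true h1 hz h4, h5⟩

theorem wp_whl {e : Exp} {c : Cmd} : wp E (.whl e c) Q h ↔
    e.ok E h ∧ (e.ev E h ≠ 0 → wp E c (fun h' => wp E (.whl e c) Q h') h.tick) ∧
      (e.ev E h = 0 → Q h.tick) := by
  constructor
  · rintro ⟨_, h1, h2⟩
    cases h1 with
    | whl_true a b c d => exact ⟨a, fun _ => ⟨_, c, _, d, h2⟩, fun h => absurd h b⟩
    | whl_false a b => exact ⟨a, fun h => absurd b h, fun _ => h2⟩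
  · rintro ⟨h1, h2, h3⟩
    by_cases hz : e.ev E h = 0
    · exact ⟨_, .whl_false h1 hz, h3 hz⟩
    · obtain ⟨_, h4, _, h5, h6⟩ := h2 hz
      exact ⟨_, .whl_true h1 hz h4 h5, h6⟩

theorem wp_whl_lt {a b : Exp} {c : Cmd} : wp E (.whl (.lt a b) c) Q h ↔
    (a.ok E h ∧ b.ok E h) ∧
      (a.ev E h < b.ev E h → wp E c (fun h' => wp E (.whl (.lt a b) c) Q h') h.tick) ∧
      (b.ev E h ≤ a.ev E h → Q h.tick) := by
  rw [wp_whl, Exp.ok_lt, Exp.ev_lt]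
  by_cases hlt : a.ev E h < b.ev E h
  · simp [hlt]
  · simp [hlt, not_lt.1 hlt]

theorem wp_iff {c : Cmd} : wp E c Q h ↔ ∃ h', HRun E c h h' ∧ Q h' := Iff.rfl

attribute [irreducible] wp

namespace Cmd

/-- Do nothing. -/
def skip : Cmd := .asg 63 0

/-- `for i := 0, …, reg b - 1 do c` -/
def for' (i b : ℕ) (c : Cmd) : Cmd :=
  .seq (.asg i 0) (.whl (.lt (.var i) (.var b)) (.seq c (.asg i (.var i + 1))))

end Cmd

/-- The rule for counting loops: the invariant may use the frame of the whole loop. -/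
theorem wp_for {i b : ℕ} {c : Cmd} (I : ℕ → HState → Prop) (hib : i ≠ b)
    (hi : c.W i = false) (hb : c.W b = false) (hB : 0 < E.B) (hB' : h.reg b < E.B)
    (h0 : I 0 (h.set i 0))
    (hs : ∀ k < h.reg b, ∀ h₁, Frame (Cmd.for' i b c) h h₁ → h₁.reg i = k →
      h₁.reg b = h.reg b → I k h₁ → wp E c (fun h₂ => I (k + 1) (h₂.set i (k + 1))) h₁.tick)
    (hQ : ∀ h₁, Frame (Cmd.for' i b c) h h₁ → I (h.reg b) h₁ → Q h₁.tick) : wp E (Cmd.for' i b c) Q h := by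
  -- Induction on the number `j` of passes that are left.
  have key : ∀ j k h₁, k + j = h.reg b → Frame (Cmd.for' i b c) h h₁ → h₁.reg i = k →
      h₁.reg b = h.reg b → I k h₁ →
      wp E (.whl (.lt (.var i) (.var b)) (.seq c (.asg i (.var i + 1)))) Q h₁ := by
    intro j
    induction j with
    | zero =>
      intro k h₁ hk hf h1 h2 h3
      rw [wp_whl]
      simp only [Exp.ok_lt, Exp.ok_var, Exp.ev_lt, Exp.ev_var, h1, h2]
      have : k = h.reg b := by omega
      subst this
      simp only [true_and, lt_irrefl, if_false, ne_eq, not_true, false_imp_iff, true_imp_iff]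
      exact hQ _ hf h3
    | succ j ih =>
      intro k h₁ hk hf h1 h2 h3
      rw [wp_whl]
      have hlt : k < h.reg b := by omega
      simp only [Exp.ok_lt, Exp.ok_var, Exp.ev_lt, Exp.ev_var, h1, h2, hlt, if_true, ne_eq,
        one_ne_zero, not_false_iff, true_imp_iff, true_and, false_imp_iff, and_true]
      rw [wp_seq]
      refine (hs k hlt h₁ hf h1 h2 h3).call fun h₂ hf2 hI => ?_
      have e1 : h₂.reg i = k := by rw [hf2.reg i hi]; exact h1
      have e2 : h₂.reg b = h.reg b := by rw [hf2.reg b hb]; exact h2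
      rw [wp_asg]
      simp only [Exp.ok_add, Exp.ok_var, Exp.ok_ofNat, Exp.ev_add, Exp.ev_var, Exp.ev_ofNat, e1]
      refine ⟨⟨trivial, by omega, by omega⟩, ih (k + 1) _ (by omega) ?_ (by simp) ?_ hI⟩
      · refine hf.trans ⟨fun r hr => ?_, fun a ha => ?_, fun hd => ?_, ?_⟩
        · simp only [Cmd.for', Cmd.W, Bool.or_eq_false_iff, beq_eq_false_iff_ne] at hr
          simp only [HState.set_reg, hr.1, if_false]
          exact hf2.reg r hr.2.1
        · simp only [Cmd.for', Cmd.WA, Bool.or_eq_false_iff] at ha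
          exact hf2.arr a ha.2.1
        · simp only [Cmd.for', Cmd.WD, Bool.or_eq_false_iff] at hd
          exact hf2.drawn hd.2.1
        · have := hf2.time
          simp only [HState.tick_time, HState.set_time] at this ⊢; omega
      · simp only [HState.set_reg, Ne.symm hib, if_false, e2]
  unfold Cmd.for'
  rw [wp_seq, wp_asg]
  refine ⟨hB, key (h.reg b) 0 _ (by omega) ?_ (by simp) (by simp [Ne.symm hib]) h0⟩
  refine ⟨fun r hr => ?_, fun a ha => rfl, fun hd => rfl, by simp⟩
  simp only [Cmd.for', Cmd.W, Bool.or_eq_false_iff, beq_eq_false_iff_ne] at hr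
  simp [hr.1]

/-! #### Compilation -/

/-- Evaluate an expression into register `2 * d + 1`. -/
def Exp.comp (d : ℕ) : Exp → Prog
  | .lit k => .const (2 * d + 1) k
  -- There is no move instruction; the conjunction of a register with itself copies it. Variables
  -- live in the even registers from `2` on, intermediate values in the odd ones, and register `0`
  -- holds the length of the input.
  | .var r => .op .and (2 * d + 1) (2 * r + 2) (2 * r + 2)
  | .bin o a b => .seq (a.comp d) (.seq (b.comp (d + 1))
      (.op o (2 * d + 1) (2 * d + 1) (2 * d + 3)))
  | .raw o a b => .seq (a.comp d) (.seq (b.comp (d + 1))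
      (.op o (2 * d + 1) (2 * d + 1) (2 * d + 3)))

/-- Replace the index in register 1 by its address in array `a`. -/
def addrProg (a : ℕ) : Prog :=
  .seq (.const 5 16) (.seq (.op .mul 1 1 5) (.seq (.const 5 a) (.seq (.op .add 1 1 5)
    (.op .add 1 1 0))))

def Cmd.comp : Cmd → Prog
  | .asg r e => .seq (e.comp 0) (.op .and (2 * r + 2) 1 1)
  | .ld r a e => .seq (e.comp 0) (.seq (addrProg a) (.load (2 * r + 2) 1))
  | .inp r e => .seq (e.comp 0) (.load (2 * r + 2) 1)
  | .st a e f => .seq (e.comp 0) (.seq (f.comp 1) (.seq (addrProg a) (.store 1 3)))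
  | .coin r => .coin (2 * r + 2)
  | .seq c d => .seq c.comp d.comp
  | .ite e c d => .seq (e.comp 0) (.branch 1 c.comp d.comp)
  | .whl e c => .seq (e.comp 0) (.loop 1 (.seq c.comp (e.comp 0)))

/-- A bound for the time that one step takes after compilation. -/
def Cmd.cost : Cmd → ℕ
  | .asg _ e => e.size + 1
  | .ld _ _ e => e.size + 6
  | .inp _ e => e.size + 1
  | .st _ e f => e.size + f.size + 6
  | .coin _ => 1
  | .seq c d => c.cost + d.cost
  | .ite e c d => e.size + c.cost + d.cost + 1
  | .whl e c => e.size + c.cost + 1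

/-- The machine state `s` represents `h`. -/
structure Rel (E : Env) (h : HState) (s : State E.w) : Prop where
  base : (s.reg 0).toNat = E.len
  reg : ∀ r, (s.reg (2 * r + 2)).toNat = h.reg r
  inp : ∀ p < E.len, (s.mem (BitVec.ofNat E.w p)).toNat = E.inp p
  arr : ∀ a < 16, ∀ x < E.B, (s.mem (BitVec.ofNat E.w (E.len + 16 * x + a))).toNat = h.arr a x
  drawn : s.drawn = h.drawn

/-- The bound `B` is admissible for the word size. -/
structure Env.Valid (E : Env) : Prop where
  one_lt : 1 < E.B
  fits : E.len + 16 * E.B + 16 ≤ 2 ^ E.w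

theorem Env.Valid.w_pos (hE : E.Valid) : 0 < E.w := by
  have h1 := hE.fits
  by_contra h0
  have : E.w = 0 := by omega
  rw [this] at h1
  omega

theorem toNat_boole (w : ℕ) (hw : 0 < w) (p : Prop) [Decidable p] :
    (if p then (1 : BitVec w) else 0).toNat = if p then 1 else 0 := by
  split
  · exact BitVec.toNat_one hw
  · simp

theorem Op.eval_of_fits (hE : E.Valid) {o : Op} {x y : BitVec E.w}
    (hf : o.Fits E.B x.toNat y.toNat) : (o.eval x y).toNat = o.nat x.toNat y.toNat := by
  have hB := hE.fits
  cases o <;> simp only [Op.Fits, Op.eval, Op.nat] at hf ⊢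
  · rw [BitVec.toNat_add, Nat.mod_eq_of_lt (by omega)]
  · rw [BitVec.toNat_sub_of_le (by simpa [BitVec.le_def] using hf)]
  · rw [BitVec.toNat_mul, Nat.mod_eq_of_lt (by omega)]
  · simp
  · simp
  · rw [toNat_boole _ hE.w_pos]; rfl
  · rw [toNat_boole _ hE.w_pos]; simp only [BitVec.toNat_inj]

theorem Rel.congr {s s' : State E.w} (H : Rel E h s) (hr : ∀ r, r % 2 = 0 → s'.reg r = s.reg r)
    (hm : s'.mem = s.mem) (hd : s'.drawn = s.drawn) : Rel E h s' :=
  ⟨by rw [hr 0 rfl]; exact H.base, fun r => by rw [hr _ (by omega)]; exact H.reg r,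
    by rw [hm]; exact H.inp, by rw [hm]; exact H.arr, by rw [hd]; exact H.drawn⟩

theorem Rel.tick {s : State E.w} (H : Rel E h s) : Rel E h.tick s :=
  ⟨H.base, H.reg, H.inp, H.arr, H.drawn⟩

/-- The odd registers act as a stack of height `d`: evaluation leaves everything below `2 * d + 1`
alone, so the left operand survives the evaluation of the right one. -/
theorem Exp.comp_run (hE : E.Valid) (e : Exp) : ∀ (d : ℕ) (s : State E.w), Rel E h s →
    e.ok E h → ∃ s', Run E.tape (e.comp d) s e.size s' ∧ (s'.reg (2 * d + 1)).toNat = e.ev E h ∧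
      (∀ r, r % 2 = 0 ∨ r < 2 * d + 1 → s'.reg r = s.reg r) ∧ s'.mem = s.mem ∧
      s'.drawn = s.drawn := by
  have hB := hE.fits
  induction e with
  | lit k =>
    intro d s hs hk
    refine ⟨_, .const _ _ _, ?_, fun r hr => ?_, rfl, rfl⟩
    · have : k < E.B := hk
      simp [State.setReg, Exp.ev, Nat.mod_eq_of_lt (show k < 2 ^ E.w by omega)]
    · simp [State.setReg, show r ≠ 2 * d + 1 by omega]
  | var r =>
    intro d s hs _
    refine ⟨_, .op _ _ _ _ _, ?_, fun r hr => ?_, rfl, rfl⟩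
    · simpa [State.setReg, Op.eval, Exp.ev] using hs.reg r
    · simp [State.setReg, show r ≠ 2 * d + 1 by omega]
  | bin o a b iha ihb =>
    intro d s hs hk
    obtain ⟨s1, r1, v1, f1, m1, d1⟩ := iha d s hs hk.1
    have hs1 := hs.congr (fun r hr => f1 r (Or.inl hr)) m1 d1
    obtain ⟨s2, r2, v2, f2, m2, d2⟩ := ihb (d + 1) s1 hs1 hk.2.1
    have e1 : (s2.reg (2 * d + 1)).toNat = a.ev E h := by rw [f2 _ (by omega), v1]
    have e2 : (s2.reg (2 * d + 3)).toNat = b.ev E h := v2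
    have ht : (Exp.bin o a b).size = a.size + (b.size + 1) := by simp only [Exp.size]; omega
    rw [ht]
    refine ⟨_, .seq r1 (.seq r2 (.op _ _ _ _ _)), ?_, fun r hr => ?_, ?_, ?_⟩
    · simp only [State.setReg, Function.update_self]
      rw [Op.eval_of_fits hE, e1, e2]; · rfl
      rw [e1, e2]; exact hk.2.2
    · rw [← f1 r (by omega), ← f2 r (by omega)]
      simp [State.setReg, show r ≠ 2 * d + 1 by omega]
    · simp [State.setReg, m1, m2]
    · simp [State.setReg, d1, d2]
  | raw o a b iha ihb =>
    intro d s hs hk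
    obtain ⟨s1, r1, v1, f1, m1, d1⟩ := iha d s hs hk.1
    have hs1 := hs.congr (fun r hr => f1 r (Or.inl hr)) m1 d1
    obtain ⟨s2, r2, v2, f2, m2, d2⟩ := ihb (d + 1) s1 hs1 hk.2
    have e1 : s2.reg (2 * d + 1) = BitVec.ofNat E.w (a.ev E h) := by
      rw [f2 _ (by omega), ← v1, BitVec.ofNat_toNat, BitVec.setWidth_eq]
    have e2 : s2.reg (2 * d + 3) = BitVec.ofNat E.w (b.ev E h) := by
      rw [← v2, BitVec.ofNat_toNat, BitVec.setWidth_eq]; rfl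
    have ht : (Exp.raw o a b).size = a.size + (b.size + 1) := by simp only [Exp.size]; omega
    rw [ht]
    refine ⟨_, .seq r1 (.seq r2 (.op _ _ _ _ _)), ?_, fun r hr => ?_, ?_, ?_⟩
    · simp only [State.setReg, Function.update_self, e1, e2]
      rfl
    · rw [← f1 r (by omega), ← f2 r (by omega)]
      simp [State.setReg, show r ≠ 2 * d + 1 by omega]
    · simp [State.setReg, m1, m2]
    · simp [State.setReg, d1, d2]

theorem Rel.set {s s' : State E.w} (H : Rel E h s) (r x : ℕ)
    (hr : (s'.reg (2 * r + 2)).toNat = x)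
    (hr' : ∀ r', r' % 2 = 0 → r' ≠ 2 * r + 2 → s'.reg r' = s.reg r')
    (hm : s'.mem = s.mem) (hd : s'.drawn = s.drawn) : Rel E (h.set r x) s' := by
  refine ⟨by rw [hr' 0 rfl (by omega)]; exact H.base, fun r' => ?_, by rw [hm]; exact H.inp,
    by rw [hm]; exact H.arr, by rw [hd]; exact H.drawn⟩
  by_cases hh : r' = r
  · subst hh; simpa using hr
  · rw [hr' _ (by omega) (by omega)]; simp [hh, H.reg]

theorem addrProg_run {s : State E.w} (hb : (s.reg 0).toNat = E.len) {a x : ℕ}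
    (hx : (s.reg 1).toNat = x) :
    ∃ s', Run E.tape (addrProg a) s 5 s' ∧ s'.reg 1 = BitVec.ofNat E.w (E.len + 16 * x + a) ∧
      (∀ r, r ≠ 1 → r ≠ 5 → s'.reg r = s.reg r) ∧ s'.mem = s.mem ∧ s'.drawn = s.drawn := by
  refine ⟨_, .seq (.const _ _ _) (.seq (.op _ _ _ _ _) (.seq (.const _ _ _) (.seq (.op _ _ _ _ _)
    (.op _ _ _ _ _)))), ?_, fun r h1 h5 => ?_, rfl, rfl⟩
  · have e1 : s.reg 1 = BitVec.ofNat E.w x := by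
      rw [← hx, BitVec.ofNat_toNat, BitVec.setWidth_eq]
    have e0 : s.reg 0 = BitVec.ofNat E.w E.len := by
      rw [← hb, BitVec.ofNat_toNat, BitVec.setWidth_eq]
    simp only [State.setReg, Function.update_apply, Op.eval]
    simp only [if_true, OfNat.ofNat_ne_one, OfNat.one_ne_ofNat, if_false, OfNat.zero_ne_ofNat,
      zero_ne_one, e1, e0]
    rw [← BitVec.ofNat_mul, ← BitVec.ofNat_add, ← BitVec.ofNat_add]
    congr 1; ring
  · simp [State.setReg, h1, h5]

/-- The cost `κ` of a step is any bound for the cost of the whole command, so that the induction can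
use the same `κ` for subcommands. In the additive form of the estimate the times of successive parts
telescope. -/
theorem HRun.comp (hE : E.Valid) {c : Cmd} {h h' : HState} (H : HRun E c h h') :
    ∀ (κ : ℕ) (s : State E.w), c.cost ≤ κ → Rel E h s → ∃ t s', Run E.tape c.comp s t s' ∧
      Rel E h' s' ∧ t + κ * h.time ≤ κ * h'.time := by
  have hB := hE.fits
  induction H with
  | @asg r e h hok =>
    intro κ s hκ hs
    obtain ⟨s1, r1, v1, f1, m1, d1⟩ := e.comp_run hE 0 s hs hok
    refine ⟨_, _, .seq r1 (.op _ _ _ _ _), hs.set _ _ ?_ ?_ m1 d1, ?_⟩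
    · simpa [State.setReg, Op.eval] using v1
    · intro r' h1 h2
      simp [State.setReg, h2, f1 r' (Or.inl h1)]
    · simp only [HState.set_time, Nat.mul_add, Nat.mul_one]; simp only [Cmd.cost] at hκ; omega
  | @ld r a e h hok ha hx =>
    intro κ s hκ hs
    obtain ⟨s1, r1, v1, f1, m1, d1⟩ := e.comp_run hE 0 s hs hok
    obtain ⟨s2, r2, v2, f2, m2, d2⟩ := addrProg_run (a := a) (x := e.ev E h)
      (by rw [f1 0 (by omega)]; exact hs.base) v1
    refine ⟨_, _, .seq r1 (.seq r2 (.load _ _ _)), hs.set _ _ ?_ ?_ (by simp [State.setReg, m1, m2])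
      (by simp [State.setReg, d1, d2]), ?_⟩
    · simp only [State.setReg, Function.update_self, v2, m2, m1]
      exact hs.arr a ha _ hx
    · intro r' h1 h2
      simp [State.setReg, h2, f1 r' (Or.inl h1), f2 r' (by omega) (by omega)]
    · simp only [HState.set_time, Nat.mul_add, Nat.mul_one]; simp only [Cmd.cost] at hκ; omega
  | @inp r e h hok hx =>
    intro κ s hκ hs
    obtain ⟨s1, r1, v1, f1, m1, d1⟩ := e.comp_run hE 0 s hs hok
    refine ⟨_, _, .seq r1 (.load _ _ _), hs.set _ _ ?_ ?_ (by simp [State.setReg, m1])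
      (by simp [State.setReg, d1]), ?_⟩
    · have : s1.reg 1 = BitVec.ofNat E.w (e.ev E h) := by
        rw [← v1, BitVec.ofNat_toNat, BitVec.setWidth_eq]
      simp only [State.setReg, Function.update_self, this, m1]
      exact hs.inp _ hx
    · intro r' h1 h2
      simp [State.setReg, h2, f1 r' (Or.inl h1)]
    · simp only [HState.set_time, Nat.mul_add, Nat.mul_one]; simp only [Cmd.cost] at hκ; omega
  | @st a e f h hok hok' ha hx =>
    intro κ s hκ hs
    obtain ⟨s1, r1, v1, f1, m1, d1⟩ := e.comp_run hE 0 s hs hok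
    have hs1 := hs.congr (fun r hr => f1 r (Or.inl hr)) m1 d1
    obtain ⟨s2, r2, v2, f2, m2, d2⟩ := f.comp_run hE 1 s1 hs1 hok'
    have hs2 := hs1.congr (fun r hr => f2 r (Or.inl hr)) m2 d2
    obtain ⟨s3, r3, v3, f3, m3, d3⟩ := addrProg_run hs2.base (a := a) (x := e.ev E h)
      (by rw [f2 1 (by omega)]; exact v1)
    have hs3 := hs2.congr (fun r hr => f3 r (by omega) (by omega)) m3 d3
    have e3 : (s3.reg 3).toNat = f.ev E h := by rw [f3 3 (by omega) (by omega)]; exact v2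
    -- The sixteen arrays are interleaved behind the input; below `2 ^ w` different cells have
    -- different addresses.
    have key : ∀ y z, y < 2 ^ E.w → z < 2 ^ E.w → BitVec.ofNat E.w y = BitVec.ofNat E.w z →
        y = z := by
      intro y z hy hz hyz
      have := congrArg BitVec.toNat hyz
      simpa [Nat.mod_eq_of_lt hy, Nat.mod_eq_of_lt hz] using this
    refine ⟨_, _, .seq r1 (.seq r2 (.seq r3 (.store _ _ _))),
      ⟨hs3.base, hs3.reg, fun p hp => ?_, fun a' ha' x hx' => ?_, hs3.drawn⟩, ?_⟩
    · simp only [State.setMem, v3, Function.update_apply]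
      rw [if_neg, hs3.inp p hp]
      intro hh
      have := key _ _ (by omega) (by omega) hh
      omega
    · simp only [State.setMem, v3, Function.update_apply, HState.put_arr]
      split_ifs with h1 h2 h2
      · exact e3
      · have := key _ _ (by omega) (by omega) h1
        omega
      · exact absurd (by rw [h2.1, h2.2]) h1
      · exact hs3.arr a' ha' x hx'
    · simp only [HState.put_time, Nat.mul_add, Nat.mul_one]; simp only [Cmd.cost] at hκ; omega
  | @coin r h =>
    intro κ s hκ hs
    refine ⟨_, _, .coin _ _, ⟨by simpa [State.setReg] using hs.base, fun r' => ?_, hs.inp, hs.arr,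
      by simp [hs.drawn]⟩, ?_⟩
    · by_cases hh : r' = r
      · subst hh
        simp only [State.setReg, Function.update_self, HState.toss_reg, if_true, hs.drawn]
        exact toNat_boole _ hE.w_pos _
      · simp [State.setReg, hh, hs.reg]
    · simp only [HState.toss_time, Nat.mul_add, Nat.mul_one]; simp only [Cmd.cost] at hκ; omega
  | seq _ _ ih1 ih2 =>
    intro κ s hκ hs
    simp only [Cmd.cost] at hκ
    obtain ⟨t1, s1, r1, hs1, b1⟩ := ih1 κ s (by omega) hs
    obtain ⟨t2, s2, r2, hs2, b2⟩ := ih2 κ s1 (by omega) hs1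
    exact ⟨_, _, .seq r1 r2, hs2, by omega⟩
  | @ite_true e c d h h' hok hev _ ih =>
    intro κ s hκ hs
    simp only [Cmd.cost] at hκ
    obtain ⟨s1, r1, v1, f1, m1, d1⟩ := e.comp_run hE 0 s hs hok
    have hs1 := hs.congr (fun r hr => f1 r (Or.inl hr)) m1 d1
    obtain ⟨t2, s2, r2, hs2, b2⟩ := ih κ s1 (by omega) hs1.tick
    refine ⟨_, _, .seq r1 (.branch_true (fun h0 => hev ?_) r2), hs2, ?_⟩
    · rw [← v1]; simp [h0]
    · simp only [HState.tick_time, Nat.mul_add, Nat.mul_one] at b2; omega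
  | @ite_false e c d h h' hok hev _ ih =>
    intro κ s hκ hs
    simp only [Cmd.cost] at hκ
    obtain ⟨s1, r1, v1, f1, m1, d1⟩ := e.comp_run hE 0 s hs hok
    have hs1 := hs.congr (fun r hr => f1 r (Or.inl hr)) m1 d1
    obtain ⟨t2, s2, r2, hs2, b2⟩ := ih κ s1 (by omega) hs1.tick
    refine ⟨_, _, .seq r1 (.branch_false ?_ r2), hs2, ?_⟩
    · exact BitVec.eq_of_toNat_eq (by simpa using v1.trans hev)
    · simp only [HState.tick_time, Nat.mul_add, Nat.mul_one] at b2; omega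
  | @whl_true e c h h1 h2 hok hev _ _ ih1 ih2 =>
    intro κ s hκ hs
    simp only [Cmd.cost] at hκ ih2
    obtain ⟨s1, r1, v1, f1, m1, d1⟩ := e.comp_run hE 0 s hs hok
    have hs1 := hs.congr (fun r hr => f1 r (Or.inl hr)) m1 d1
    obtain ⟨t2, s2, r2, hs2, b2⟩ := ih1 κ s1 (by omega) hs1.tick
    obtain ⟨t3, s3, r3, hs3, b3⟩ := ih2 κ s2 hκ hs2
    -- The compiled loop evaluates its guard before the loop and again at the end of its body. The
    -- first evaluation in the remaining run becomes the one that ends the present pass.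
    cases r3 with
    | seq ra rb =>
      refine ⟨_, _, .seq r1 (.loop_true (fun h0 => hev ?_) (.seq r2 ra) rb), hs3, ?_⟩
      · rw [← v1]; simp [h0]
      · simp only [HState.tick_time, Nat.mul_add, Nat.mul_one] at b2; omega
  | @whl_false e c h hok hev =>
    intro κ s hκ hs
    simp only [Cmd.cost] at hκ
    obtain ⟨s1, r1, v1, f1, m1, d1⟩ := e.comp_run hE 0 s hs hok
    have hs1 := hs.congr (fun r hr => f1 r (Or.inl hr)) m1 d1
    refine ⟨_, _, .seq r1 (.loop_false ?_), hs1.tick, ?_⟩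
    · exact BitVec.eq_of_toNat_eq (by simpa using v1.trans hev)
    · simp only [HState.tick_time, Nat.mul_add, Nat.mul_one]; omega

end WordRAM

/-! ### The data of an instance -/

namespace WordRAM

/-- The other endpoint of the edge is in the neighbouring input cell. -/
def partner (p : ℕ) : ℕ := p + 2 * (p % 2) - 1

/-- An instance as the program sees it: `n` vertices, `m` edges, modes `0` and `1`, the ends of
the edges of mode `i` in the input cells from `lo i` to `hi i`, truncated distances `d i`, the
threshold `q`, and the parameters `a = 2 ^ e` (about `n ^ (1 / 4)`), `l` (logarithmic), `κ`
(exponent of the memory size for matrix multiplication), `fuel` and the sample `smp`. -/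
structure Inst (E : Env) where
  n : ℕ
  m : ℕ
  q : ℕ
  e : ℕ
  l : ℕ
  κ : ℕ
  fuel : ℕ
  smp : ℕ → ℕ
  lo : ℕ → ℕ
  hi : ℕ → ℕ
  d : ℕ → ℕ → ℕ → ℕ
  q_pos : 0 < q
  q_le : q ≤ n
  n_le_m : n ≤ m
  lo_odd : ∀ i, lo i % 2 = 1
  hi_odd : ∀ i, hi i % 2 = 1
  lo_pos : ∀ i, 0 < lo i
  lo_le : ∀ i, lo i ≤ hi i
  hi_le : ∀ i < 2, hi i ≤ E.len
  cells : ∀ i < 2, hi i - lo i ≤ 2 * m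
  cell_lt : ∀ i < 2, ∀ p, lo i ≤ p → p < hi i → E.inp p < n
  d_self : ∀ i u, d i u u = 0
  d_comm : ∀ i u v, d i u v = d i v u
  d_tri : ∀ i u v w, d i u w ≤ d i u v + d i v w
  d_le : ∀ i u v, d i u v ≤ 4 * n
  d_lt : ∀ i u v, d i u v ≠ 4 * n → d i u v < n
  d_zero : ∀ i, ∀ u < n, ∀ v < n, d i u v = 0 → u = v
  d_adj : ∀ i < 2, ∀ p, lo i ≤ p → p < hi i → d i (E.inp p) (E.inp (partner p)) ≤ 1
  d_pred : ∀ i < 2, ∀ u < n, ∀ v < n, ∀ k, d i u v = k + 1 → k + 1 ≠ 4 * n →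
    ∃ p, lo i ≤ p ∧ p < hi i ∧ E.inp (partner p) = v ∧ d i u (E.inp p) = k
  n_le_a : n ≤ (2 ^ e) ^ 4
  a_le_n : (2 ^ e) ^ 4 ≤ 16 * n
  smp_lt : ∀ k, smp k < n
  len_lt : E.len + 100 < E.B
  fuel_lt : fuel + 1 < E.B
  bound : (8 * (2 ^ e) ^ 6) ^ (κ + 3) * (l + 1) < E.B

namespace Inst

variable {E : Env} (X : Inst E)

def a : ℕ := 2 ^ X.e
-- The base of the digits that code counts of vertices, hence larger than `n`. It also exceeds the
-- length of a pair of `N × N` matrices for `N ≤ a ^ 3`, and it is a power of two.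
def β : ℕ := 8 * X.a ^ 6
-- The number of memory cells of one simulated multiplication, and at the same time the modulus of
-- its words.
def Z : ℕ := X.β ^ X.κ

theorem n_pos : 0 < X.n := X.q_pos.trans_le X.q_le
theorem a_pos : 0 < X.a := Nat.pos_of_ne_zero (by simp [a])
theorem n_le : X.n ≤ X.a ^ 4 := X.n_le_a
theorem le_n : X.a ^ 4 ≤ 16 * X.n := X.a_le_n

theorem β_ge : 8 ≤ X.β := by
  have := Nat.one_le_pow 6 X.a X.a_pos
  unfold β; omega

theorem pow_β_lt {k : ℕ} (hk : k ≤ X.κ + 3) : X.β ^ k * (X.l + 1) < E.B := by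
  have h1 := X.bound
  have h2 : X.β ^ k ≤ X.β ^ (X.κ + 3) := Nat.pow_le_pow_right (by have := X.β_ge; omega) hk
  exact (Nat.mul_le_mul_right _ h2).trans_lt h1

theorem pow_β_lt' {k : ℕ} (hk : k ≤ X.κ + 3) : X.β ^ k < E.B :=
  (Nat.le_mul_of_pos_right _ (by omega)).trans_lt (X.pow_β_lt hk)

theorem pow_a_le {k : ℕ} (hk : k ≤ 6) : 8 * X.a ^ k ≤ X.β :=
  Nat.mul_le_mul_left _ (Nat.pow_le_pow_right X.a_pos hk)

theorem β_lt : X.β < E.B := by simpa using X.pow_β_lt' (k := 1) (by omega)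
theorem β2_lt : X.β ^ 2 < E.B := X.pow_β_lt' (k := 2) (by omega)

theorem n8_le : 8 * X.n ≤ X.β := by
  have := X.pow_a_le (k := 4) (by omega)
  have := X.n_le
  omega

theorem hundred_lt (X : Inst E) : 100 < E.B := by have := X.len_lt; omega

theorem partner_mem {i p : ℕ} (h1 : X.lo i ≤ p) (h2 : p < X.hi i) :
    X.lo i ≤ partner p ∧ partner p < X.hi i := by
  have := X.lo_odd i
  have := X.hi_odd i
  unfold partner
  rcases Nat.mod_two_eq_zero_or_one p with h | h <;> omega

end Inst

/-- Registers that keep their value after the initialization. -/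
def ctxReg (r : ℕ) : Bool := (1 ≤ r && r ≤ 4) || (8 ≤ r && r ≤ 19)

/-- Arrays that keep their value after the initialization. -/
def ctxArr (a : ℕ) : Bool := a == 0 || a == 1 || a == 4

/-- The last cell below `c` and from `lo` on with content `v`, or `0`. -/
def lastCell (inp : ℕ → ℕ) (lo v : ℕ) : ℕ → ℕ
  | 0 => 0
  | c + 1 => if lo ≤ c ∧ inp c = v then c else lastCell inp lo v c

notation "ρn" => 1
notation "ρa" => 2
notation "ρq" => 3
notation "ρinf" => 4
notation "ρfound" => 5
notation "ρoutA" => 6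
notation "ρoutB" => 7
notation "ρ3q" => 8
notation "ρ2q" => 9
notation "ρa2" => 10
notation "ρa3" => 11
notation "ρa4" => 12
notation "ρ2n" => 13
notation "ρl" => 14
notation "ρβ" => 15
notation "ρZ" => 16
notation "ρβ2" => 17
notation "ρfuel" => 18
notation "ρa2l" => 19

notation "αhead" => 0
notation "αnext" => 1
notation "αdist" => 2
notation "αqueue" => 3
notation "αsmp" => 4
notation "αhit" => 5

/-- The state after the initialization. -/
structure Ctx {E : Env} (X : Inst E) (h : HState) : Prop where
  rn : h.reg ρn = X.n
  ra : h.reg ρa = X.a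
  rq : h.reg ρq = X.q
  rinf : h.reg ρinf = 4 * X.n
  r3q : h.reg ρ3q = 3 * X.q
  r2q : h.reg ρ2q = 2 * X.q
  ra2 : h.reg ρa2 = X.a ^ 2
  ra3 : h.reg ρa3 = X.a ^ 3
  ra4 : h.reg ρa4 = X.a ^ 4
  r2n : h.reg ρ2n = 2 * X.n
  rl : h.reg ρl = X.l
  rβ : h.reg ρβ = X.β
  rZ : h.reg ρZ = X.Z
  rβ2 : h.reg ρβ2 = X.β ^ 2
  rfuel : h.reg ρfuel = X.fuel
  ra2l : h.reg ρa2l = X.a ^ 2 * X.l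
  head : ∀ i < 2, ∀ v < X.n, h.arr αhead (2 * v + i) = lastCell E.inp (X.lo i) v (X.hi i)
  next : ∀ i < 2, ∀ p, X.lo i ≤ p → p < X.hi i →
    h.arr αnext p = lastCell E.inp (X.lo i) (E.inp p) p
  smp : ∀ k < X.a ^ 3, h.arr αsmp k = X.smp k

namespace Ctx

variable {E : Env} {X : Inst E} {h h' : HState}

theorem congr (H : Ctx X h) (hr : ∀ r, ctxReg r = true → h'.reg r = h.reg r)
    (ha : ∀ a, ctxArr a = true → h'.arr a = h.arr a) : Ctx X h' := by
  obtain ⟨h1, h2, h3, h4, h5, h6, h7, h8, h9, h10, h11, h12, h13, h14, h15, h16, h17, h18, h19⟩ := H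
  constructor <;> first
    | (rw [hr _ rfl]; assumption)
    | (rw [ha _ rfl]; assumption)

theorem set (H : Ctx X h) {r x : ℕ} (hr : ctxReg r = false) : Ctx X (h.set r x) :=
  H.congr (fun r' hr' => by
    have : r' ≠ r := by rintro rfl; simp [hr] at hr'
    simp [this]) (fun _ _ => rfl)

theorem put (H : Ctx X h) {a i x : ℕ} (ha : ctxArr a = false) : Ctx X (h.put a i x) :=
  H.congr (fun _ _ => rfl) (fun a' ha' => by
    have : a' ≠ a := by rintro rfl; simp [ha] at ha'
    exact HState.put_arr_of_ne _ _ _ _ _ this)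

theorem tick (H : Ctx X h) : Ctx X h.tick := H.congr (fun _ _ => rfl) (fun _ _ => rfl)

end Ctx

/-- The command leaves the context as it is. -/
def Cmd.Keeps (c : Cmd) : Bool :=
  (List.range 20).all (fun r => !(ctxReg r && c.W r)) && (List.range 5).all
    (fun a => !(ctxArr a && c.WA a))

theorem Ctx.frame {E : Env} {X : Inst E} {h h' : HState} (H : Ctx X h) {c : Cmd}
    (hf : Frame c h h') (hc : c.Keeps = true) : Ctx X h' := by
  simp only [Cmd.Keeps, Bool.and_eq_true, List.all_eq_true, List.mem_range] at hc
  refine H.congr (fun r hr => hf.reg r ?_) (fun a ha => hf.arr a ?_)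
  · have h2 : r < 20 := by
      simp only [ctxReg, Bool.or_eq_true, Bool.and_eq_true, decide_eq_true_eq] at hr
      omega
    have := hc.1 r h2
    simpa [hr] using this
  · have h2 : a < 5 := by
      simp only [ctxArr, Bool.or_eq_true, beq_iff_eq] at ha
      omega
    have := hc.2 a h2
    simpa [ha] using this

/-! ### Breadth-first search -/

notation "ρI" => 20
notation "ρs" => 21
notation "ρv" => 22
notation "ρhd" => 23
notation "ρtl" => 24
notation "ρu" => 25
notation "ρdu" => 26
notation "ρp" => 27
notation "ρx" => 28
notation "ρdx" => 29

/-- The cells that contain a given vertex form a linked list through `αnext`, and the neighbour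
stands in the partner cell. Edge cells start at `5`, so the pointer `0` ends a list. -/
def bfsScan : Cmd :=
  .whl (.var ρp) (
    .inp ρx (.var ρp + 2 * (.var ρp % 2) - 1) ;;
    .ld ρdx αdist (2 * .var ρx + .var ρI) ;;
    .ite (.eq (.var ρdx) (.var ρinf))
      (.st αdist (2 * .var ρx + .var ρI) (.var ρdu + 1) ;;
        .st αqueue (.var ρtl) (.var ρx) ;;
        .asg ρtl (.var ρtl + 1))
      .skip ;;
    .ld ρp αnext (.var ρp))

def bfsLoop : Cmd :=
  .whl (.lt (.var ρhd) (.var ρtl)) (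
    .ld ρu αqueue (.var ρhd) ;;
    .ld ρdu αdist (2 * .var ρu + .var ρI) ;;
    .ld ρp αhead (2 * .var ρu + .var ρI) ;;
    bfsScan ;;
    .asg ρhd (.var ρhd + 1))

/-- Distances in mode `reg ρI` from the vertex `reg ρs`. -/
def bfs : Cmd :=
  .for' ρv ρn (.st αdist (2 * .var ρv + .var ρI) (.var ρinf)) ;;
  .st αdist (2 * .var ρs + .var ρI) 0 ;;
  .st αqueue 0 (.var ρs) ;;
  .asg ρhd 0 ;;
  .asg ρtl 1 ;;
  bfsLoop

variable {E : Env} (X : Inst E)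

/-- The invariant of breadth-first search from `s` in mode `i`. -/
structure BfsInv (i s : ℕ) (D Q : ℕ → ℕ) (hd tl : ℕ) : Prop where
  hd_le : hd ≤ tl
  Q_lt : ∀ j < tl, Q j < X.n
  -- Together with `tl ≤ n` this keeps the values in the queue below `n`, away from the mark `4 * n`
  -- of vertices not yet reached.
  D_le : ∀ j < tl, D (Q j) ≤ j
  disc : ∀ v < X.n, D v ≠ 4 * X.n → ∃ j < tl, Q j = v
  inj : ∀ j < tl, ∀ j' < tl, Q j = Q j' → j = j'
  upper : ∀ v < X.n, X.d i s v ≤ D v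
  sorted : ∀ j j', j ≤ j' → j' < tl → D (Q j) ≤ D (Q j')
  -- The queue never reaches more than one level beyond its head.
  win : ∀ j < tl, hd < tl → D (Q j) ≤ D (Q hd) + 1
  fin : ∀ p, X.lo i ≤ p → p < X.hi i → (∃ j < hd, Q j = E.inp p) →
    D (E.inp (partner p)) ≤ D (E.inp p) + 1
  src : D s = 0

namespace BfsInv

variable {X} {i s hd tl : ℕ} {D Q : ℕ → ℕ}

theorem tl_le (H : BfsInv X i s D Q hd tl) : tl ≤ X.n := by
  have := Finset.card_le_card_of_injOn (s := Finset.range tl) (t := Finset.range X.n) Q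
    (fun j hj => by simpa using H.Q_lt j (by simpa using hj))
    (fun j hj j' hj' h => H.inj j (by simpa using hj) j' (by simpa using hj') h)
  simpa using this

/-- A vertex with the mark `4 * n` cannot be in the queue, where values are less than `n`. The new
value is at least that of every queued vertex by `win`, so the queue stays sorted. -/
theorem push (H : BfsInv X i s D Q hd tl) (hi : i < 2) (hlt : hd < tl) {p : ℕ} (h1 : X.lo i ≤ p)
    (h2 : p < X.hi i) (hp : E.inp p = Q hd) (hx : D (E.inp (partner p)) = 4 * X.n) :
    BfsInv X i s (Function.update D (E.inp (partner p)) (D (Q hd) + 1))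
      (Function.update Q tl (E.inp (partner p))) hd (tl + 1) := by
  have hpm := X.partner_mem h1 h2
  have hxn : E.inp (partner p) < X.n := X.cell_lt i hi _ hpm.1 hpm.2
  have hd1 := X.d_adj i hi p h1 h2
  generalize E.inp (partner p) = x at *
  have htl := H.tl_le
  have hn := X.n_pos
  have hQx : ∀ j < tl, Q j ≠ x := by
    intro j hj hh
    have := H.D_le j hj
    rw [hh, hx] at this
    omega
  have e1 : ∀ j < tl, Function.update Q tl x j = Q j := fun j hj => by simp [hj.ne]
  have e2 : ∀ j < tl, Function.update D x (D (Q hd) + 1) (Q j) = D (Q j) := fun j hj => by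
    simp [hQx j hj]
  have e3 : Function.update Q tl x tl = x := by simp
  have e4 : Function.update D x (D (Q hd) + 1) x = D (Q hd) + 1 := by simp
  have split : ∀ j < tl + 1, j < tl ∨ j = tl := fun j hj => by omega
  refine ⟨by have := H.hd_le; omega, fun j hj => ?_, fun j hj => ?_, fun v hv hD => ?_,
    fun j hj j' hj' hh => ?_, fun v hv => ?_, fun j j' hjj hj' => ?_, fun j hj _ => ?_,
    fun p' hp1 hp2 hp3 => ?_, ?_⟩
  · rcases split j hj with h | rfl
    · rw [e1 j h]; exact H.Q_lt j h
    · rw [e3]; exact hxn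
  · rcases split j hj with h | rfl
    · rw [e1 j h, e2 j h]; exact H.D_le j h
    · rw [e3, e4]; have := H.D_le hd hlt; omega
  · by_cases hvx : v = x
    · exact ⟨tl, by omega, by rw [e3, hvx]⟩
    · rw [Function.update_of_ne hvx] at hD
      obtain ⟨j, hj, hh⟩ := H.disc v hv hD
      exact ⟨j, by omega, by rw [e1 j hj, hh]⟩
  · rcases split j hj with h | rfl <;> rcases split j' hj' with h' | rfl
    · rw [e1 j h, e1 j' h'] at hh; exact H.inj j h j' h' hh
    · rw [e1 j h, e3] at hh; exact absurd hh (hQx j h)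
    · rw [e1 j' h', e3] at hh; exact absurd hh.symm (hQx j' h')
    · rfl
  · by_cases hvx : v = x
    · rw [hvx, e4]
      have h3 := X.d_tri i s (Q hd) x
      have h4 := H.upper (Q hd) (H.Q_lt hd hlt)
      rw [hp] at hd1
      omega
    · rw [Function.update_of_ne hvx]; exact H.upper v hv
  · rcases split j' hj' with h' | rfl
    · rw [e1 j (by omega), e2 j (by omega), e1 j' h', e2 j' h']; exact H.sorted j j' hjj h'
    · rw [e3, e4]
      rcases split j (by omega) with h | rfl
      · rw [e1 j h, e2 j h]; exact H.win j h hlt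
      · rw [e3, e4]
  · rw [e1 hd hlt, e2 hd hlt]
    rcases split j hj with h | rfl
    · rw [e1 j h, e2 j h]; exact H.win j h hlt
    · rw [e3, e4]
  · obtain ⟨j, hj, hh⟩ := hp3
    have h5 := H.fin p' hp1 hp2 ⟨j, hj, by rw [← e1 j (by omega)]; exact hh⟩
    rw [e1 j (by omega)] at hh
    rw [← hh] at h5 ⊢
    rw [e2 j (by omega)]
    by_cases hvx : E.inp (partner p') = x
    · rw [hvx, hx] at h5
      have := H.D_le j (by omega)
      omega
    · rw [Function.update_of_ne hvx]; exact h5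
  · rw [Function.update_of_ne]
    · exact H.src
    · rintro rfl; have := H.src; omega

theorem next (H : BfsInv X i s D Q hd tl) (hlt : hd < tl)
    (hs : ∀ p, X.lo i ≤ p → p < X.hi i → E.inp p = Q hd →
      D (E.inp (partner p)) ≤ D (Q hd) + 1) : BfsInv X i s D Q (hd + 1) tl := by
  refine { H with hd_le := hlt, win := fun j hj h => ?_, fin := fun p hp1 hp2 hp3 => ?_ }
  · have h1 := H.win j hj hlt
    have h2 := H.sorted hd (hd + 1) (by omega) h
    omega
  · obtain ⟨j, hj, hh⟩ := hp3
    by_cases hjh : j = hd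
    · subst hjh
      rw [← hh]
      exact hs p hp1 hp2 hh.symm
    · exact H.fin p hp1 hp2 ⟨j, by omega, hh⟩

/-- One inequality is `upper`. The other goes by induction on the true distance: the predecessor on
a shortest path has been reached, hence processed since the queue is exhausted, and `fin` bounds the
value across the last edge. -/
theorem eq_dist (H : BfsInv X i s D Q tl tl) (hi : i < 2) (hs : s < X.n) {v : ℕ} (hv : v < X.n) :
    D v = X.d i s v := by
  have htl := H.tl_le
  have hn := X.n_pos
  have low : ∀ k, ∀ v < X.n, X.d i s v = k → k ≠ 4 * X.n → D v ≤ k := by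
    intro k
    induction k with
    | zero =>
      intro v hv h0 _
      rw [← X.d_zero i s hs v hv h0, H.src]
    | succ k ih =>
      intro v hv hk hk'
      obtain ⟨p, hp1, hp2, hp3, hp4⟩ := X.d_pred i hi s hs v hv k hk hk'
      have hun := X.cell_lt i hi p hp1 hp2
      have hk4 : k ≠ 4 * X.n := by
        have := X.d_lt i s v (by omega)
        omega
      have h1 := ih _ hun hp4 hk4
      have h2 : D (E.inp p) ≠ 4 * X.n := by
        have := X.d_lt i s (E.inp p) (by omega)
        omega
      obtain ⟨j, hj, hjj⟩ := H.disc _ hun h2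
      have h3 := H.fin p hp1 hp2 ⟨j, hj, hjj⟩
      rw [hp3] at h3
      omega
  have hup := H.upper v hv
  by_cases h4 : X.d i s v = 4 * X.n
  · by_contra hne
    have h5 : D v ≠ 4 * X.n := by omega
    obtain ⟨j, hj, hjj⟩ := H.disc v hv h5
    have := H.D_le j hj
    rw [hjj] at this
    omega
  · have := low _ v hv rfl h4
    omega

end BfsInv

end WordRAM

namespace WordRAM

attribute [simp] wp_asg wp_ld wp_inp wp_st wp_coin wp_seq wp_ite

variable {E : Env} (X : Inst E)

/-- The array of distances in mode `i`. -/
def HState.D (h : HState) (i v : ℕ) : ℕ := h.arr αdist (2 * v + i)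

namespace HState

variable (h : HState) (r a i x y : ℕ)

theorem D_put : (h.put αdist (2 * x + i) y).D i = Function.update (h.D i) x y := by
  ext v
  by_cases hv : v = x
  · simp [D, hv]
  · simp [D, hv]

theorem D_put' (i' v : ℕ) (hi : i < 2) (hi' : i' < 2) (hne : i ≠ i') :
    (h.put αdist (2 * x + i) y).D i' v = h.D i' v := by
  have : 2 * v + i' ≠ 2 * x + i := by omega
  simp [D, this]

theorem D_put_of_ne (ha : αdist ≠ a) : (h.put a x y).D = h.D := by
  ext; simp [D, ha]

@[simp] theorem D_set : (h.set r x).D = h.D := rfl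
@[simp] theorem D_tick : h.tick.D = h.D := rfl
@[simp] theorem D_eq (v : ℕ) : h.arr αdist (2 * v + i) = h.D i v := rfl

theorem put_arr_self : (h.put a i x).arr a = Function.update (h.arr a) i x := by
  simp [put]

end HState

/-- The number of cells of the vertex `u` below `c` in mode `i`. -/
def cnt (i u c : ℕ) : ℕ := ((Finset.Ico (X.lo i) c).filter fun p => E.inp p = u).card

/-- The cells of `u` from `c` on are done; `c` occurs in the proof only, the program knows just the
pointer. The state `h₀` is the one at the start of the scan. -/
structure ScanInv (i s u c : ℕ) (h₀ h : HState) : Prop where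
  ctx : Ctx X h
  rI : h.reg ρI = i
  inv : BfsInv X i s (h.D i) (h.arr αqueue) (h.reg ρhd) (h.reg ρtl)
  lt : h.reg ρhd < h.reg ρtl
  hu : h.arr αqueue (h.reg ρhd) = u
  hdu : h.reg ρdu = h.D i u
  scanned : ∀ p, c ≤ p → X.lo i ≤ p → p < X.hi i → E.inp p = u →
    h.D i (E.inp (partner p)) ≤ h.D i u + 1
  ptr : h.reg ρp = lastCell E.inp (X.lo i) u c
  other : ∀ v, h.D (1 - i) v = h₀.D (1 - i) v
  hd : h.reg ρhd = h₀.reg ρhd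
  pref : ∀ j ≤ h.reg ρhd, h.arr αqueue j = h₀.arr αqueue j

/-- Induction on the bound `c` of the cells still to be seen. Cells with another vertex are skipped
by the linked list, so they take no time and only those counted by `cnt` are charged. -/
theorem bfsScan_spec {i s u : ℕ} (hi : i < 2) {h₀ : HState} : ∀ c ≤ X.hi i, ∀ h,
    ScanInv X i s u c h₀ h →
    wp E bfsScan (fun h' => ScanInv X i s u 0 h₀ h' ∧ h'.time ≤ h.time + 8 * cnt X i u c + 1) h := by
  intro c
  have hB := X.hundred_lt
  have hl := X.len_lt
  induction c with
  | zero =>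
    intro _ h H
    have hp : h.reg ρp = 0 := H.ptr
    rw [bfsScan, wp_whl]
    simp only [Exp.ok_var, Exp.ev_var, hp, ne_eq, not_true, false_imp_iff, true_and, true_imp_iff]
    exact ⟨⟨H.ctx.tick, H.rI, H.inv, H.lt, H.hu, H.hdu, H.scanned, H.ptr, H.other, H.hd,
      H.pref⟩,
      by simp [cnt]⟩
  | succ c ih =>
    intro hc h H
    by_cases hcu : X.lo i ≤ c ∧ E.inp c = u
    · have hp : h.reg ρp = c := by rw [H.ptr, lastCell, if_pos hcu]
      have hcpos := X.lo_pos i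
      have hci : c < X.hi i := hc
      have hlen := X.hi_le i hi
      have hcn : cnt X i u (c + 1) = cnt X i u c + 1 := by
        unfold cnt
        rw [← Finset.insert_Ico_right_eq_Ico_add_one hcu.1, Finset.filter_insert, if_pos hcu.2,
          Finset.card_insert_of_notMem (by simp)]
      have hpm := X.partner_mem hcu.1 hci
      have hxn : E.inp (partner c) < X.n := X.cell_lt i hi _ hpm.1 hpm.2
      have hpe : c + 2 * (c % 2) - 1 = partner c := rfl
      have hn8 := X.n8_le
      have hβ := X.β_lt
      have htl := H.inv.tl_le
      have hDu : h.D i u ≤ X.n := by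
        rw [← H.hu]; have := H.inv.D_le _ H.lt; have := H.lt; omega
      have hxu : h.D i (E.inp (partner c)) = 4 * X.n → u ≠ E.inp (partner c) := by
        intro h1 h2; rw [← h2] at h1; have := X.n_pos; omega
      rw [bfsScan, wp_whl]
      simp only [Exp.ok_var, Exp.ev_var, hp, ne_eq]
      refine ⟨trivial, fun _ => ?_, fun h0 => by omega⟩
      simp [Cmd.skip, hp, H.rI, hpe, H.ctx.rinf]
      repeat refine ⟨by omega, ?_⟩
      have hnext : h.arr αnext c = lastCell E.inp (X.lo i) u c := by
        rw [H.ctx.next i hi c hcu.1 hci, hcu.2]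
      have hcu2 : E.inp c = h.arr αqueue (h.reg ρhd) := hcu.2.trans H.hu.symm
      constructor
      · intro hD
        have hdu := H.hdu
        repeat refine ⟨by omega, ?_⟩
        have hpush := H.inv.push hi H.lt hcu.1 hci hcu2 hD
        rw [← hcu2, hcu.2] at hpush
        have hux := hxu hD
        refine (ih (by omega) _ ?_).mono fun h' hh => ⟨hh.1, by
          have := hh.2
          simp at this
          omega⟩
        refine ScanInv.mk
          (((((((H.ctx.tick.set rfl).set rfl).tick.put rfl).put rfl).set rfl).set rfl))
          (by simp [H.rI]) ?_ (by simp; have := H.lt; omega) ?_ ?_ ?_ (by simp [hnext]) ?_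
          (by simp [H.hd]) ?_
        · simp only [HState.D_set, HState.D_tick, HState.D_put_of_ne _ αqueue _ _ (by decide),
            HState.D_put, hdu, HState.set_arr, HState.put_arr_self, HState.tick_arr,
            HState.put_arr_of_ne _ _ _ _ _ (show αqueue ≠ αdist by decide), HState.set_reg,
            HState.put_reg, HState.tick_reg]
          exact hpush
        · have := H.lt
          simp [H.hu, this.ne]
        · simp only [HState.D_set, HState.D_tick, HState.D_put_of_ne _ αqueue _ _ (by decide),
            HState.D_put]
          simp [hux, hdu]
        · intro p hp1 hp2 hp3 hp4
          simp only [HState.D_set, HState.D_tick, HState.D_put_of_ne _ αqueue _ _ (by decide),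
            HState.D_put, Function.update_of_ne hux]
          by_cases hpx : E.inp (partner p) = E.inp (partner c)
          · rw [hpx]; simp [hdu]
          · rw [Function.update_of_ne hpx]
            rcases Nat.eq_or_lt_of_le hp1 with rfl | h5
            · exact absurd rfl hpx
            · exact H.scanned p h5 hp2 hp3 hp4
        · intro v
          simp only [HState.D_set, HState.D_put_of_ne _ αqueue _ _ (by decide)]
          rw [HState.D_put' _ _ _ _ _ _ hi (by omega) (by omega)]
          exact H.other v
        · intro j hj
          have hj' : j ≤ h.reg ρhd := by simpa using hj
          have := H.lt
          simp [show j ≠ h.reg ρtl by omega, H.pref j hj']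
      · intro hD
        repeat refine ⟨by omega, ?_⟩
        refine (ih (by omega) _ ?_).mono fun h' hh => ⟨hh.1, by
          have := hh.2
          simp at this
          omega⟩
        refine ScanInv.mk
          (((((H.ctx.tick.set rfl).set rfl).tick.set rfl).set rfl))
          (by simp [H.rI]) (by simpa using H.inv) (by simp; exact H.lt) (by simp [H.hu])
          (by simp [H.hdu]) ?_ (by simp [hnext]) (by simpa using H.other)
          (by simp [H.hd]) (by simpa using H.pref)
        · intro p hp1 hp2 hp3 hp4
          rcases Nat.eq_or_lt_of_le hp1 with rfl | h5
          · by_contra hlt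
            have hle : h.D i (E.inp (partner c)) ≤ X.n := by
              obtain ⟨j, hj, hjj⟩ := H.inv.disc _ hxn hD
              have := H.inv.D_le j hj
              rw [hjj] at this
              omega
            have := H.inv.disc _ hxn hD
            obtain ⟨j, hj, hjj⟩ := this
            -- A neighbour that is already in the queue satisfies the estimate because of the
            -- window.
            have h6 := H.inv.win j hj H.lt
            rw [hjj, ← hcu2, hcu.2] at h6
            exact hlt h6
          · exact H.scanned p h5 hp2 hp3 hp4
    · have hcn : cnt X i u (c + 1) = cnt X i u c := by
        unfold cnt
        congr 1
        ext p
        simp only [Finset.mem_filter, Finset.mem_Ico]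
        constructor
        · rintro ⟨⟨h1, h2⟩, h3⟩
          refine ⟨⟨h1, ?_⟩, h3⟩
          rcases Nat.lt_succ_iff_lt_or_eq.1 h2 with h4 | rfl
          · exact h4
          · exact absurd ⟨h1, h3⟩ hcu
        · rintro ⟨⟨h1, h2⟩, h3⟩
          exact ⟨⟨h1, by omega⟩, h3⟩
      rw [hcn]
      refine ih (by omega) h { H with scanned := ?_, ptr := ?_ }
      · intro p hp1 hp2 hp3 hp4
        rcases Nat.eq_or_lt_of_le hp1 with rfl | h5
        · exact absurd ⟨hp2, hp4⟩ hcu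
        · exact H.scanned p h5 hp2 hp3 hp4
      · rw [H.ptr, lastCell, if_neg hcu]

/-- The invariant of the main loop of breadth-first search. -/
structure LoopInv (i s : ℕ) (h₀ h : HState) : Prop where
  ctx : Ctx X h
  rI : h.reg ρI = i
  inv : BfsInv X i s (h.D i) (h.arr αqueue) (h.reg ρhd) (h.reg ρtl)
  other : ∀ v, h.D (1 - i) v = h₀.D (1 - i) v

/-- Every cell belongs to one vertex and every vertex enters the queue at most once. This makes
breadth-first search linear in the number of edges. -/
theorem sum_cnt_le (i : ℕ) (hi : i < 2) (Q : ℕ → ℕ) (tl : ℕ) (hQ : ∀ j < tl, Q j < X.n)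
    (hinj : ∀ j < tl, ∀ j' < tl, Q j = Q j' → j = j') :
    ∑ j ∈ Finset.range tl, cnt X i (Q j) (X.hi i) ≤ 2 * X.m := by
  rw [← Finset.sum_image (f := fun v => cnt X i v (X.hi i)) (g := Q) (s := Finset.range tl)
    (fun j hj j' hj' h => hinj j (by simpa using hj) j' (by simpa using hj') h)]
  calc ∑ v ∈ (Finset.range tl).image Q, cnt X i v (X.hi i)
      ≤ ∑ v ∈ Finset.range X.n, cnt X i v (X.hi i) :=
        Finset.sum_le_sum_of_subset (by
          intro v hv
          simp only [Finset.mem_image, Finset.mem_range] at hv ⊢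
          obtain ⟨j, hj, rfl⟩ := hv
          exact hQ j hj)
    _ = (Finset.Ico (X.lo i) (X.hi i)).card :=
        (Finset.card_eq_sum_card_fiberwise (f := E.inp) (t := Finset.range X.n) (by
          intro p hp
          simp only [Finset.coe_Ico, Set.mem_Ico] at hp
          simpa using X.cell_lt i hi p hp.1 hp.2)).symm
    _ ≤ 2 * X.m := by rw [Nat.card_Ico]; exact X.cells i hi

theorem bfsLoop_spec {i s : ℕ} (hi : i < 2) (h₀ : HState) (h : HState)
    (H : LoopInv X i s h₀ h) (h0 : h.reg ρhd = 0) :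
    wp E bfsLoop (fun h' => LoopInv X i s h₀ h' ∧ h'.reg ρhd = h'.reg ρtl ∧
      h'.time ≤ h.time + 16 * X.m + 6 * X.n + 1) h := by
  have hB := X.hundred_lt
  have hn8 := X.n8_le
  have hβ := X.β_lt
  have key : ∀ k h₁, LoopInv X i s h₀ h₁ → h₁.reg ρhd + k = X.n →
      h₁.time ≤ h.time + ∑ j ∈ Finset.range (h₁.reg ρhd),
        (8 * cnt X i (h₁.arr αqueue j) (X.hi i) + 6) →
      wp E bfsLoop (fun h' => LoopInv X i s h₀ h' ∧ h'.reg ρhd = h'.reg ρtl ∧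
        h'.time ≤ h.time + 16 * X.m + 6 * X.n + 1) h₁ := by
    intro k
    induction k with
    | zero =>
      intro h₁ H₁ hk ht
      have htl := H₁.inv.tl_le
      have hle := H₁.inv.hd_le
      rw [bfsLoop, wp_whl_lt]
      refine ⟨by simp, fun hne => ?_, fun _ => ⟨⟨H₁.ctx.tick, H₁.rI, H₁.inv, H₁.other⟩, ?_, ?_⟩⟩
      · simp at hne; omega
      · simp; omega
      · have := sum_cnt_le X i hi (h₁.arr αqueue) (h₁.reg ρtl) H₁.inv.Q_lt H₁.inv.inj
        rw [show h₁.reg ρhd = h₁.reg ρtl by omega, Finset.sum_add_distrib, ← Finset.mul_sum] at ht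
        simp at ht ⊢
        omega
    | succ k ih =>
      intro h₁ H₁ hk ht
      have htl := H₁.inv.tl_le
      have hle := H₁.inv.hd_le
      rw [bfsLoop, wp_whl_lt]
      refine ⟨by simp, fun hne => ?_, fun heq => ⟨⟨H₁.ctx.tick, H₁.rI, H₁.inv, H₁.other⟩, ?_, ?_⟩⟩
      · have hlt : h₁.reg ρhd < h₁.reg ρtl := by simpa using hne
        have hun := H₁.inv.Q_lt _ hlt
        simp [H₁.rI]
        repeat refine ⟨by omega, ?_⟩
        refine (bfsScan_spec X hi (i := i) (s := s) (u := h₁.arr αqueue (h₁.reg ρhd)) (h₀ := h₁)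
          (X.hi i) le_rfl _ ?_).mono ?_
        · exact ScanInv.mk (((H₁.ctx.tick.set rfl).set rfl).set rfl) (by simp [H₁.rI])
            (by simpa using H₁.inv) (by simpa using hlt) (by simp) (by simp)
            (fun p h1 _ h2 => by omega) (by simp [H₁.ctx.head i hi _ hun]) (by simp) (by simp)
            (by simp)
        · rintro h₂ ⟨H₂, ht₂⟩
          have hle₂ := H₂.inv.tl_le
          have hlt₂ := H₂.lt
          have hhd := H₂.hd
          refine ⟨by omega, ih _ ⟨H₂.ctx.set rfl, by simp [H₂.rI], ?_, ?_⟩ ?_ ?_⟩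
          · have := H₂.inv.next H₂.lt (by
              intro p h1 h2 h3
              rw [H₂.hu] at h3 ⊢
              exact H₂.scanned p (by omega) h1 h2 h3)
            simpa using this
          · simpa using fun v => (H₂.other v).trans (H₁.other v)
          · simp; omega
          · have e1 : ∑ j ∈ Finset.range (h₁.reg ρhd), (8 * cnt X i (h₂.arr αqueue j) (X.hi i) + 6)
                = ∑ j ∈ Finset.range (h₁.reg ρhd), (8 * cnt X i (h₁.arr αqueue j) (X.hi i) + 6) :=
              Finset.sum_congr rfl fun j hj => by
                rw [H₂.pref j (by have := Finset.mem_range.1 hj; omega)]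
            have e2 := H₂.pref (h₁.reg ρhd) (by omega)
            simp only [HState.set_time, HState.tick_time, HState.set_reg, HState.set_arr, if_true,
              hhd] at ht₂ ⊢
            rw [Finset.sum_range_succ, e1, e2]
            omega
      · simp at heq ⊢; omega
      · have := sum_cnt_le X i hi (h₁.arr αqueue) (h₁.reg ρtl) H₁.inv.Q_lt H₁.inv.inj
        have hge : h₁.reg ρtl ≤ h₁.reg ρhd := by simpa using heq
        rw [show h₁.reg ρhd = h₁.reg ρtl by omega, Finset.sum_add_distrib, ← Finset.mul_sum] at ht
        simp at ht ⊢
        omega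
  exact key X.n h H (by omega) (by simp [h0])

/-- The distances of the other mode survive, so that the results of two searches, one in each mode
and perhaps from different sources, can be used side by side. Constant and linear terms are absorbed
by `n ≤ m`. -/
theorem bfs_spec {i s : ℕ} (hi : i < 2) (hs : s < X.n) {h : HState} (hc : Ctx X h)
    (hI : h.reg ρI = i) (hS : h.reg ρs = s) :
    wp E bfs (fun h' => (∀ v < X.n, h'.D i v = X.d i s v) ∧ (∀ v, h'.D (1 - i) v = h.D (1 - i) v) ∧
      h'.time ≤ h.time + 40 * X.m) h := by
  have hB := X.hundred_lt
  have hn8 := X.n8_le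
  have hβ := X.β_lt
  have hnpos := X.n_pos
  have hnm := X.n_le_m
  rw [bfs, wp_seq]
  refine wp_for (fun k h₁ => (∀ v < k, h₁.D i v = 4 * X.n) ∧
    (∀ v, h₁.D (1 - i) v = h.D (1 - i) v) ∧ h₁.time ≤ h.time + 1 + 3 * k) (by decide) rfl rfl
    (by omega) (by rw [hc.rn]; omega) ⟨by simp, by simp, by simp⟩ ?_ ?_
  · rintro k hk h₁ hf h1 h2 ⟨h3, h4, h5⟩
    have hc₁ := hc.frame hf rfl
    rw [hc.rn] at hk
    have hI₁ : h₁.reg ρI = i := by rw [hf.reg _ rfl, hI]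
    simp [hI₁, h1, hc₁.rinf]
    repeat refine ⟨by omega, ?_⟩
    refine ⟨fun v hv => ?_, fun v => ?_, by omega⟩
    · rw [HState.D_put]
      by_cases hvk : v = k
      · simp [hvk]
      · rw [Function.update_of_ne hvk]; exact h3 v (by omega)
    · rw [HState.D_put' _ _ _ _ _ _ hi (by omega) (by omega)]; exact h4 v
  · rintro h₁ hf ⟨h3, h4, h5⟩
    have hc₁ := hc.frame hf rfl
    rw [hc.rn] at h3 h5
    have hI₁ : h₁.reg ρI = i := by rw [hf.reg _ rfl, hI]
    have hS₁ : h₁.reg ρs = s := by rw [hf.reg _ rfl, hS]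
    simp [hI₁, hS₁]
    repeat refine ⟨by omega, ?_⟩
    refine (bfsLoop_spec X (i := i) (s := s) hi h _ ⟨?_, ?_, ?_, ?_⟩ (by simp)).mono ?_
    · exact (((hc₁.tick.put rfl).put rfl).set rfl).set rfl
    · simp [hI₁]
    · have e1 : ((((h₁.tick.put αdist (2 * s + i) 0).put αqueue 0 s).set ρhd 0).set ρtl 1).D i =
          Function.update (h₁.D i) s 0 := by
        simp only [HState.D_set, HState.D_put_of_ne _ αqueue _ _ (by decide), HState.D_put,
          HState.D_tick]
      rw [e1]
      simp only [HState.set_reg, HState.set_arr, HState.put_arr_self]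
      have e2 : ∀ v < X.n, Function.update (h₁.D i) s 0 v = if v = s then 0 else 4 * X.n := by
        intro v hv
        by_cases hvs : v = s
        · simp [hvs]
        · rw [Function.update_of_ne hvs, h3 v hv, if_neg hvs]
      have e3 : Function.update ((h₁.tick.put αdist (2 * s + i) 0).arr αqueue) 0 s 0 = s := by simp
      have e4 : Function.update (h₁.D i) s 0 s = 0 := by simp
      refine ⟨by simp, ?_, ?_, ?_, ?_, ?_, ?_, ?_, ?_, e4⟩
      · intro j hj
        obtain rfl : j = 0 := by simpa using hj
        rw [e3]; exact hs
      · intro j hj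
        obtain rfl : j = 0 := by simpa using hj
        rw [e3, e4]
      · intro v hv hD
        refine ⟨0, by simp, ?_⟩
        rw [e3]
        by_contra hne
        rw [e2 v hv, if_neg (Ne.symm hne)] at hD
        exact hD rfl
      · intro j hj j' hj' _
        simp at hj hj'; omega
      · intro v hv
        rw [e2 v hv]
        split_ifs with hvs
        · rw [hvs, X.d_self]
        · exact X.d_le i s v
      · intro j j' hjj hj'
        obtain rfl : j' = 0 := by simpa using hj'
        obtain rfl : j = 0 := by omega
        exact le_rfl
      · intro j hj _
        obtain rfl : j = 0 := by simpa using hj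
        simp
      · rintro p _ _ ⟨j, hj, _⟩
        simp at hj
    · intro v
      simp only [HState.D_set, HState.D_put_of_ne _ αqueue _ _ (by decide)]
      rw [HState.D_put' _ _ _ _ _ _ hi (by omega) (by omega)]
      exact h4 v
    · rintro h₂ ⟨H₂, h6, h7⟩
      refine ⟨fun v hv => ?_, H₂.other, ?_⟩
      · have := H₂.inv
        rw [h6] at this
        exact this.eq_dist hi hs hv
      · simp at h7
        omega

end WordRAM

namespace WordRAM

/-! ### Searching -/

namespace Exp

variable (E : Env) (h : HState) (a b : Exp)

/-- The expression `a ≤ b`. -/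
def le (a b : Exp) : Exp := eq (lt b a) 0
/-- The conjunction. -/
def and (a b : Exp) : Exp := lt (eq a 0) (lt 0 b)

@[simp] theorem ev_le : (le a b).ev E h = if a.ev E h ≤ b.ev E h then 1 else 0 := by
  simp only [le, ev_eq, ev_lt, ev_ofNat]
  split_ifs <;> first | rfl | omega
@[simp] theorem ok_le : (le a b).ok E h ↔ a.ok E h ∧ b.ok E h ∧ 0 < E.B := by
  simp only [le, ok_eq, ok_lt, ok_ofNat]; tauto
@[simp] theorem ev_and :
    (and a b).ev E h = if a.ev E h ≠ 0 ∧ b.ev E h ≠ 0 then 1 else 0 := by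
  simp only [and, ev_eq, ev_lt, ev_ofNat]
  by_cases h1 : a.ev E h = 0 <;> by_cases h2 : b.ev E h = 0 <;>
    simp [h1, h2, Nat.pos_iff_ne_zero]
@[simp] theorem ok_and : (and a b).ok E h ↔ a.ok E h ∧ b.ok E h ∧ 0 < E.B := by
  simp only [and, ok_eq, ok_lt, ok_ofNat]; tauto

end Exp

variable {E : Env} (X : Inst E)

/-- The registers `outA`, `outB` are a correct answer if `found` is set. -/
structure Snd (h : HState) : Prop where
  le_one : h.reg ρfound ≤ 1
  A_lt : h.reg ρfound = 1 → h.reg ρoutA < X.n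
  B_lt : h.reg ρfound = 1 → h.reg ρoutB < X.n
  far : h.reg ρfound = 1 → ∀ i < 2, 2 * X.q ≤ X.d i (h.reg ρoutA) (h.reg ρoutB)

/-- A sound search in time `t`, which excludes `¬ F` if it finds nothing. -/
structure Srch (F : Prop) (t : ℕ) (h h' : HState) : Prop where
  snd : Snd X h → Snd X h'
  fin : h'.reg ρfound = 0 → h.reg ρfound = 0 ∧ F
  time : h'.time ≤ h.time + t

variable {X}

theorem Snd.congr {h h' : HState} (H : Snd X h) (h1 : h'.reg ρfound = h.reg ρfound)
    (h2 : h'.reg ρoutA = h.reg ρoutA) (h3 : h'.reg ρoutB = h.reg ρoutB) : Snd X h' := by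
  obtain ⟨a, b, c, d⟩ := H
  constructor <;> rw [h1] <;> simpa only [h2, h3]

namespace Srch

variable {F G : Prop} {t s : ℕ} {h h' h'' : HState}

theorem of_eq (h1 : h'.reg ρfound = h.reg ρfound)
    (h2 : h'.reg ρoutA = h.reg ρoutA) (h3 : h'.reg ρoutB = h.reg ρoutB)
    (ht : h'.time ≤ h.time + t) (hF : F) : Srch X F t h h' :=
  ⟨fun H => H.congr h1 h2 h3, fun h0 => ⟨h1 ▸ h0, hF⟩, ht⟩

theorem of_frame {c : Cmd} (hf : Frame c h h') (h1 : c.W ρfound = false) (h2 : c.W ρoutA = false)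
    (h3 : c.W ρoutB = false) (ht : h'.time ≤ h.time + t) (hF : F) : Srch X F t h h' :=
  of_eq (hf.reg _ h1) (hf.reg _ h2) (hf.reg _ h3) ht hF

theorem trans (h1 : Srch X F t h h') (h2 : Srch X G s h' h'') : Srch X (F ∧ G) (t + s) h h'' :=
  ⟨fun H => h2.snd (h1.snd H), fun h0 => by
    obtain ⟨h3, h4⟩ := h2.fin h0
    obtain ⟨h5, h6⟩ := h1.fin h3
    exact ⟨h5, h6, h4⟩, by have := h1.time; have := h2.time; omega⟩

theorem mono {u : ℕ} (h1 : Srch X F t h h') (hF : F → G) (ht : t ≤ u) : Srch X G u h h' :=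
  ⟨h1.snd, fun h0 => ⟨(h1.fin h0).1, hF (h1.fin h0).2⟩, by have := h1.time; omega⟩

theorem set (h1 : Srch X F t h h') {r x : ℕ} (hr : r ≠ ρfound) (hr2 : r ≠ ρoutA)
    (hr3 : r ≠ ρoutB) : Srch X F (t + 1) h (h'.set r x) :=
  (h1.trans (of_eq (F := True) (t := 1) (by simp [hr.symm]) (by simp [hr2.symm])
    (by simp [hr3.symm]) (by simp) trivial)).mono (fun x => x.1) le_rfl

theorem tick (h1 : Srch X F t h h') : Srch X F (t + 1) h h'.tick :=
  (h1.trans (of_eq (F := True) (t := 1) (h' := h'.tick) rfl rfl rfl (by simp) trivial)).mono (fun x => x.1) le_rfl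

end Srch

variable {h : HState} {Q : HState → Prop}

/-- A loop of searches. -/
theorem wp_for_srch {i b : ℕ} {c : Cmd} (J : ℕ → HState → Prop) (F : ℕ → Prop) (t : ℕ)
    (hib : i ≠ b) (hi : c.W i = false) (hb : c.W b = false) (hi' : 7 < i)
    (hB' : h.reg b < E.B) (h0 : J 0 (h.set i 0))
    (hs : ∀ k < h.reg b, ∀ h₁, Frame (Cmd.for' i b c) h h₁ → h₁.reg i = k →
      h₁.reg b = h.reg b → J k h₁ →
      wp E c (fun h₂ => Srch X (F k) t h₁.tick h₂ ∧ J (k + 1) (h₂.set i (k + 1))) h₁.tick)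
    (hQ : ∀ h₁, Frame (Cmd.for' i b c) h h₁ → J (h.reg b) h₁ →
      Srch X (∀ k < h.reg b, F k) ((t + 2) * h.reg b + 2) h h₁.tick → Q h₁.tick) :
    wp E (Cmd.for' i b c) Q h := by
  refine wp_for (fun k h₁ => Srch X (∀ j < k, F j) ((t + 2) * k + 1) h h₁ ∧ J k h₁) hib hi hb
    (by have := X.hundred_lt; omega) hB' ⟨?_, h0⟩ ?_ fun h₁ hf hI => hQ h₁ hf hI.2 hI.1.tick
  · exact Srch.of_eq (by simp [show ρfound ≠ i by omega]) (by simp [show ρoutA ≠ i by omega])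
      (by simp [show ρoutB ≠ i by omega]) (by simp) (by simp)
  · rintro k hk h₁ hf h1 h2 ⟨h3, h4⟩
    refine (hs k hk h₁ hf h1 h2 h4).mono fun h₂ hh => ⟨?_, hh.2⟩
    refine ((h3.tick.trans hh.1).set (r := i) (x := k + 1) (by omega) (by omega)
      (by omega)).mono (fun hF j hj => ?_) (by ring_nf; omega)
    rcases Nat.lt_succ_iff_lt_or_eq.1 hj with h5 | rfl
    · exact hF.1 j h5
    · exact hF.2

/-- `reg r := v + 1` for some vertex `v` for which `cond`, evaluated after `c`, holds, `0` if there
is none. -/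
def findv (r v : ℕ) (c : Cmd) (cond : Exp) : Cmd :=
  .asg r 0 ;; .for' v ρn (c ;; .ite cond (.asg r (.var v + 1)) .skip)

theorem findv_spec {r v : ℕ} {c : Cmd} {cond : Exp} (hc : Ctx X h) (P : ℕ → Prop) (T : ℕ)
    (hrv : r ≠ v) (hr1 : r ≠ ρn) (hv1 : v ≠ ρn) (hr63 : r ≠ 63) (hv63 : v ≠ 63)
    (hcr : c.W r = false) (hcv : c.W v = false)
    (hc1 : c.W ρn = false)
    (hs : ∀ k < X.n, ∀ h₁, Frame (findv r v c cond) h h₁ → h₁.reg v = k →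
      wp E c (fun h₂ => cond.ok E h₂ ∧ (cond.ev E h₂ ≠ 0 ↔ P k) ∧ h₂.time ≤ h₁.time + T) h₁) :
    wp E (findv r v c cond) (fun h' => ((h'.reg r = 0 ∧ ∀ v < X.n, ¬ P v) ∨
      ∃ v < X.n, h'.reg r = v + 1 ∧ P v) ∧ h'.time ≤ h.time + (T + 5) * X.n + 3) h := by
  have hB := X.hundred_lt
  have hn8 := X.n8_le
  have hβ := X.β_lt
  rw [findv, wp_seq, wp_asg]
  refine ⟨by simp; omega, ?_⟩
  refine wp_for (fun k h₁ => ((h₁.reg r = 0 ∧ ∀ v < k, ¬ P v) ∨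
      ∃ v < k, h₁.reg r = v + 1 ∧ P v) ∧ h₁.time ≤ h.time + (T + 5) * k + 2) hv1 ?_ ?_
      (by omega) ?_ ?_ ?_ ?_
  · simp [Cmd.W, Cmd.skip, hcv, hrv.symm, hv63]
  · simp [Cmd.W, Cmd.skip, hc1, hr1.symm]
  · simp [hr1.symm, hc.rn]; omega
  · simp [hrv]
  · rintro k hk h₁ hf h1 h2 ⟨h3, h4⟩
    simp [hr1.symm, hc.rn] at hk
    rw [wp_seq]
    have hf' : Frame (findv r v c cond) h h₁.tick := by
      refine ⟨fun x hx => ?_, fun x hx => ?_, fun hx => ?_, ?_⟩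
      · simp only [findv, Cmd.W, Bool.or_eq_false_iff, beq_eq_false_iff_ne] at hx
        have := hf.reg x hx.2
        simpa [hx.1] using this
      · simp only [findv, Cmd.WA, Bool.or_eq_false_iff] at hx
        exact hf.arr x hx.2
      · simp only [findv, Cmd.WD, Bool.or_eq_false_iff] at hx
        exact hf.drawn hx.2
      · have := hf.time; simp at this ⊢; omega
    refine (hs k hk h₁.tick hf' h1).call fun h₂ hf₂ hh => ?_
    obtain ⟨h5, h6, h7⟩ := hh
    have e1 : h₂.reg r = h₁.reg r := hf₂.reg _ hcr
    have e2 : h₂.reg v = k := (hf₂.reg _ hcv).trans h1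
    simp [Cmd.skip, e2]
    simp at h7
    refine ⟨h5, fun hcond => ?_, fun hcond => ?_⟩
    · refine ⟨by omega, h6.1 hcond, ?_⟩
      simp only [Nat.mul_add, Nat.mul_one]; omega
    · refine ⟨by omega, ?_, by simp only [Nat.mul_add, Nat.mul_one]; omega⟩
      have hnP : ¬ P k := fun hP => h6.2 hP hcond
      simp [hrv, e1, hr63]
      rcases h3 with ⟨h8, h9⟩ | ⟨v, hv, h8, h9⟩
      · refine Or.inl ⟨h8, fun v hv => ?_⟩
        rcases Nat.lt_succ_iff_lt_or_eq.1 (Nat.lt_succ_of_le hv) with h10 | rfl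
        · exact h9 v h10
        · exact hnP
      · exact Or.inr ⟨v, by omega, h8, h9⟩
  · rintro h₁ hf ⟨h3, h4⟩
    simp [hr1.symm, hc.rn] at h3 h4 ⊢
    exact ⟨h3, by omega⟩

notation "ρt" => 30
notation "ρy" => 31
notation "ρd0" => 32
notation "ρd1" => 33

/-- Breadth-first search from `reg ρt` in both modes. -/
def bfs2 : Cmd :=
  .asg ρs (.var ρt) ;; .asg ρI 0 ;; bfs ;; .asg ρI 1 ;; bfs

theorem bfs2_spec (hc : Ctx X h) (ht : h.reg ρt < X.n) :
    wp E bfs2 (fun h' => (∀ i < 2, ∀ v < X.n, h'.D i v = X.d i (h.reg ρt) v) ∧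
      h'.time ≤ h.time + 83 * X.m) h := by
  have hB := X.hundred_lt
  have hn := X.n_pos
  have hnm := X.n_le_m
  simp [bfs2]
  refine ⟨by omega, ?_⟩
  refine (bfs_spec X (i := 0) (s := h.reg ρt) (by omega) ht ((hc.set rfl).set rfl) (by simp)
    (by simp)).call ?_
  rintro h₁ hf ⟨h1, h2, h3⟩
  have hc₁ := ((hc.set rfl).set rfl).frame hf rfl
  have hs₁ : h₁.reg ρs = h.reg ρt := by rw [hf.reg _ rfl]; simp
  refine ⟨by omega, ?_⟩
  refine (bfs_spec X (i := 1) (s := h.reg ρt) (by omega) ht (hc₁.set rfl) (by simp)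
    (by simp [hs₁])).call ?_
  rintro h₂ hf₂ ⟨h4, h5, h6⟩
  simp at h3 h6
  refine ⟨fun i hi v hv => ?_, by omega⟩
  obtain rfl | rfl : i = 0 ∨ i = 1 := by omega
  · rw [h5 v]; exact h1 v hv
  · exact h4 v hv

/-- Search for a point that is far from `reg ρt` in both modes. -/
def test : Cmd :=
  bfs2 ;;
  .for' ρy ρn (
    .ld ρd0 αdist (2 * .var ρy) ;;
    .ld ρd1 αdist (2 * .var ρy + 1) ;;
    .ite (.and (.le (.var ρ2q) (.var ρd0)) (.le (.var ρ2q) (.var ρd1)))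
      (.asg ρfound 1 ;; .asg ρoutA (.var ρt) ;; .asg ρoutB (.var ρy)) .skip)

/-- No vertex is far from `t` in both modes. -/
def Inst.NoFar (X : Inst E) (t : ℕ) : Prop :=
  ∀ v < X.n, ∀ i < 2, ¬ (2 * X.q ≤ X.d i t v ∧ 2 * X.q ≤ X.d (1 - i) t v)

theorem test_spec (hc : Ctx X h) (ht : h.reg ρt < X.n) :
    wp E test (fun h' => (∀ i < 2, ∀ v < X.n, h'.D i v = X.d i (h.reg ρt) v) ∧
      Srch X (X.NoFar (h.reg ρt)) (100 * X.m) h h') h := by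
  have hB := X.hundred_lt
  have hn8 := X.n8_le
  have hβ := X.β_lt
  have hn := X.n_pos
  have hnm := X.n_le_m
  rw [test, wp_seq]
  refine (bfs2_spec hc ht).call ?_
  rintro h₁ hf ⟨h1, h2⟩
  have hc₁ := hc.frame hf rfl
  have ht₁ : h₁.reg ρt = h.reg ρt := hf.reg _ rfl
  refine wp_for_srch (X := X) (J := fun _ _ => True) (F := fun v => ∀ i < 2,
    ¬ (2 * X.q ≤ X.d i (h.reg ρt) v ∧ 2 * X.q ≤ X.d (1 - i) (h.reg ρt) v)) (t := 6) (by decide)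
    rfl rfl (by omega) (by rw [hc₁.rn]; omega) trivial ?_ ?_
  · intro k hk h₂ hf₂ h3 h4 _
    rw [hc₁.rn] at hk
    have hc₂ := hc₁.frame hf₂ rfl
    have e0 : h₂.D 0 k = X.d 0 (h.reg ρt) k := by
      rw [HState.D, hf₂.arr _ rfl]; exact h1 0 (by omega) k hk
    have e1 : h₂.D 1 k = X.d 1 (h.reg ρt) k := by
      rw [HState.D, hf₂.arr _ rfl]; exact h1 1 (by omega) k hk
    have e0' : h₂.arr αdist (2 * k) = X.d 0 (h.reg ρt) k := e0
    have ht₂ : h₂.reg ρt = h.reg ρt := by rw [hf₂.reg _ rfl, ht₁]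
    simp [h3, hc₂.r2q, e0', e1, Cmd.skip, ht₂]
    repeat refine ⟨by omega, ?_⟩
    refine ⟨fun h5 h6 => ⟨by omega, ⟨fun _ => ⟨by simp, by simp [ht], by simp [hk],
      fun _ i hi => ?_⟩, by simp, by simp⟩⟩, fun h5 => ⟨by omega, Srch.of_eq (by simp) (by simp)
      (by simp) (by simp) fun i hi => ?_⟩⟩
    · obtain rfl | rfl : i = 0 ∨ i = 1 := by omega
      · simpa using h5
      · simpa using h6
    · obtain rfl | rfl : i = 0 ∨ i = 1 := by omega
      · simpa using h5
      · simp; intro h6; by_contra h7; have := h5 (by omega); omega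
  · intro h₂ hf₂ _ hS
    refine ⟨fun i hi v hv => ?_, ?_⟩
    · rw [HState.D_tick, HState.D, hf₂.arr _ rfl]; exact h1 i hi v hv
    · have hS₁ : Srch X True (83 * X.m) h h₁ := Srch.of_frame hf rfl rfl rfl h2 trivial
      rw [hc₁.rn] at hS
      exact (hS₁.trans hS).mono (fun hF => hF.2) (by omega)

/-- `test` at the vertex `reg r - 1`, if `reg r` is not `0`. -/
def testIf (r : ℕ) : Cmd :=
  .ite (.var r) (.asg ρt (.var r - 1) ;; test) .skip

theorem testIf_spec {r : ℕ} (hc : Ctx X h) (hr : h.reg r ≤ X.n) :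
    wp E (testIf r) (Srch X (h.reg r ≠ 0 → X.NoFar (h.reg r - 1)) (100 * X.m + 2) h) h := by
  have hB := X.hundred_lt
  simp [testIf, Cmd.skip]
  refine ⟨fun h0 => ⟨⟨by omega, by omega⟩, ?_⟩, fun h0 => ⟨by omega, ?_⟩⟩
  · refine (test_spec (hc.tick.set rfl) (by simp; omega)).mono fun h' hh => ?_
    have h1 : Srch X True 2 h (h.tick.set ρt (h.reg r - 1)) :=
      Srch.of_eq (by simp) (by simp) (by simp) (by simp) trivial
    exact (h1.trans hh.2).mono (fun hF _ => by simpa using hF.2) (by omega)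
  · exact Srch.of_eq (by simp) (by simp) (by simp) (by simp) (fun h1 => absurd h0 h1)

end WordRAM

/-! ### Pairs of points that separate two vertices -/

namespace WordRAM

variable {E : Env} {X : Inst E} {h : HState} {Q : HState → Prop}

notation "αfar" => 9
notation "αball" => 10

notation "ρM" => 34
notation "ρJ" => 35
notation "ρpa" => 36
notation "ρpb" => 37
notation "ρca" => 38
notation "ρcb" => 39

/-- Near `u` in mode `i`. -/
def Inst.Near (X : Inst E) (i u v : ℕ) : Prop := X.d i u v ≤ X.q
/-- Far from `u` in mode `i`. -/
def Inst.Far (X : Inst E) (i u v : ℕ) : Prop := 3 * X.q ≤ X.d i u v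

/-- The points `u` (in mode `i`) and `v` (in mode `j`) do not separate two vertices. -/
def Inst.NoSep (X : Inst E) (i u j v : ℕ) : Prop :=
  (∀ x < X.n, ∀ y < X.n, X.Near i u x → X.Near j v x → X.Far i u y → X.Far j v y → False) ∧
  (∀ x < X.n, ∀ y < X.n, X.Near i u x → X.Far j v x → X.Far i u y → X.Near j v y → False)

/-- Search with a vertex `reg ρpa` in mode `reg ρM` and a vertex `reg ρpb` in mode `reg ρJ`. -/
def pairCheck : Cmd :=
  .asg ρI (.var ρM) ;; .asg ρs (.var ρpa) ;; bfs ;;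
  .asg ρI (.var ρJ) ;; .asg ρs (.var ρpb) ;; bfs ;;
  findv ρca ρy
    (.ld ρd0 αdist (2 * .var ρy + .var ρM) ;; .ld ρd1 αdist (2 * .var ρy + .var ρJ))
    (.and (.le (.var ρd0) (.var ρq)) (.le (.var ρd1) (.var ρq))) ;;
  findv ρcb ρy
    (.ld ρd0 αdist (2 * .var ρy + .var ρM) ;; .ld ρd1 αdist (2 * .var ρy + .var ρJ))
    (.and (.le (.var ρd0) (.var ρq)) (.le (.var ρ3q) (.var ρd1))) ;;
  testIf ρca ;; testIf ρcb

/-- If `x` and `y` are separated, any `z` of the same kind as `x` is at distance at least `3 * q -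
q` from `y` in both modes, by the triangle inequality. So one arbitrary representative per clause
has to be tested. -/
theorem Inst.noSep_of {i u v : ℕ} (hi : i < 2) {A B : ℕ}
    (hA : (A = 0 ∧ ∀ x < X.n, ¬ (X.Near i u x ∧ X.Near (1 - i) v x)) ∨
      ∃ x < X.n, A = x + 1 ∧ (X.Near i u x ∧ X.Near (1 - i) v x))
    (hB : (B = 0 ∧ ∀ x < X.n, ¬ (X.Near i u x ∧ X.Far (1 - i) v x)) ∨
      ∃ x < X.n, B = x + 1 ∧ (X.Near i u x ∧ X.Far (1 - i) v x))
    (hA' : A ≠ 0 → X.NoFar (A - 1)) (hB' : B ≠ 0 → X.NoFar (B - 1)) :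
    X.NoSep i u (1 - i) v := by
  unfold Inst.Near Inst.Far at *
  constructor
  · intro x hx y hy h1 h2 h3 h4
    rcases hA with ⟨-, hA⟩ | ⟨z, hz, rfl, h5, h6⟩
    · exact hA x hx ⟨h1, h2⟩
    · have h7 := hA' (by omega) y hy i hi
      -- Here `z` is near both points and `y` far from both.
      have t1 := X.d_tri i u z y
      have t2 := X.d_tri (1 - i) v z y
      simp only [Nat.add_sub_cancel] at h7
      simp only [Inst.Near, Inst.Far] at *
      omega
  · intro x hx y hy h1 h2 h3 h4
    rcases hB with ⟨-, hB⟩ | ⟨z, hz, rfl, h5, h6⟩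
    · exact hB x hx ⟨h1, h2⟩
    · have h7 := hB' (by omega) y hy i hi
      have t1 := X.d_tri i u z y
      -- In mode `1 - i` the roles are exchanged: `y` is the near one and `z` the far one.
      have t2 := X.d_tri (1 - i) v y z
      have t3 := X.d_comm (1 - i) y z
      simp only [Nat.add_sub_cancel] at h7
      simp only [Inst.Near, Inst.Far] at *
      omega

theorem pairCheck_spec (hc : Ctx X h) {i : ℕ} (hi : i < 2) (hM : h.reg ρM = i)
    (hJ : h.reg ρJ = 1 - i) (ha : h.reg ρpa < X.n) (hb : h.reg ρpb < X.n) :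
    wp E pairCheck (Srch X (X.NoSep i (h.reg ρpa) (1 - i) (h.reg ρpb)) (320 * X.m) h) h := by
  have hB := X.hundred_lt
  have hn8 := X.n8_le
  have hβ := X.β_lt
  have hn := X.n_pos
  have hnm := X.n_le_m
  generalize hu : h.reg ρpa = u at *
  generalize hv : h.reg ρpb = v at *
  simp only [pairCheck, wp_seq, wp_asg, Exp.ok_var, true_and, Exp.ev_var]
  refine (bfs_spec X (i := i) (s := u) hi ha ((hc.set rfl).set rfl) (by simp [hM])
    (by simp [hu])).call ?_
  rintro h₁ hf ⟨h1, h2, h3⟩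
  have hc₁ := ((hc.set rfl).set rfl).frame hf rfl
  have hM₁ : h₁.reg ρM = i := by rw [hf.reg _ rfl]; simp [hM]
  have hJ₁ : h₁.reg ρJ = 1 - i := by rw [hf.reg _ rfl]; simp [hJ]
  have hv₁ : h₁.reg ρpb = v := by rw [hf.reg _ rfl]; simp [hv]
  have hS₁ : Srch X True (40 * X.m + 2) h h₁ :=
    (((Srch.of_eq (t := 0) (F := True) rfl rfl rfl (by omega) trivial).set (by decide) (by decide)
      (by decide)).set (by decide) (by decide) (by decide)).trans
      (Srch.of_frame (F := True) hf rfl rfl rfl h3 trivial) |>.mono (fun _ => trivial) (by omega)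
  refine (bfs_spec X (i := 1 - i) (s := v) (by omega) hb ((hc₁.set rfl).set rfl) (by simp [hJ₁])
    (by simp [hv₁])).call ?_
  rintro h₂ hf₂ ⟨h4, h5, h6⟩
  have hc₂ := ((hc₁.set rfl).set rfl).frame hf₂ rfl
  have hM₂ : h₂.reg ρM = i := by rw [hf₂.reg _ rfl]; simp [hM₁]
  have hJ₂ : h₂.reg ρJ = 1 - i := by rw [hf₂.reg _ rfl]; simp [hJ₁]
  have hS₂ : Srch X True (80 * X.m + 4) h h₂ :=
    ((hS₁.set (by decide) (by decide) (by decide)).set (by decide) (by decide) (by decide)).trans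
      (Srch.of_frame (F := True) hf₂ rfl rfl rfl h6 trivial) |>.mono (fun _ => trivial) (by omega)
  have hDi : ∀ x < X.n, h₂.D i x = X.d i u x := by
    intro x hx
    have := h5 x
    rw [show 1 - (1 - i) = i by omega] at this
    rw [this]; exact h1 x hx
  refine (findv_spec hc₂ (P := fun x => X.Near i u x ∧ X.Near (1 - i) v x) 2 (by decide) (by decide)
    (by decide) (by decide) (by decide) rfl rfl rfl ?_).call ?_
  · rintro k hk h₃ hf₃ h7
    have hc₃ := hc₂.frame hf₃ rfl
    have hM₃ : h₃.reg ρM = i := by rw [hf₃.reg _ rfl, hM₂]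
    have hJ₃ : h₃.reg ρJ = 1 - i := by rw [hf₃.reg _ rfl, hJ₂]
    have e0 : h₃.D i k = X.d i u k := by rw [HState.D, hf₃.arr _ rfl]; exact hDi k hk
    have e1 : h₃.D (1 - i) k = X.d (1 - i) v k := by
      rw [HState.D, hf₃.arr _ rfl]; exact h4 k hk
    simp [h7, hM₃, hJ₃, e0, e1, hc₃.rq, Inst.Near]
    omega
  rintro h₃ hf₃ ⟨hA, h7⟩
  have hc₃ := hc₂.frame hf₃ rfl
  have hM₃ : h₃.reg ρM = i := by rw [hf₃.reg _ rfl, hM₂]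
  have hJ₃ : h₃.reg ρJ = 1 - i := by rw [hf₃.reg _ rfl, hJ₂]
  have hS₃ := hS₂.trans (Srch.of_frame (F := True) (t := 7 * X.n + 3) hf₃ rfl rfl rfl
    (by omega) trivial)
  have e0 : ∀ x < X.n, h₃.D i x = X.d i u x := fun x hx => by
    rw [HState.D, hf₃.arr _ rfl]; exact hDi x hx
  have e1 : ∀ x < X.n, h₃.D (1 - i) x = X.d (1 - i) v x := fun x hx => by
    rw [HState.D, hf₃.arr _ rfl]; exact h4 x hx
  refine (findv_spec hc₃ (P := fun x => X.Near i u x ∧ X.Far (1 - i) v x) 2 (by decide) (by decide)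
    (by decide) (by decide) (by decide) rfl rfl rfl ?_).call ?_
  · rintro k hk h₄ hf₄ h7
    have hc₄ := hc₃.frame hf₄ rfl
    have hM₄ : h₄.reg ρM = i := by rw [hf₄.reg _ rfl, hM₃]
    have hJ₄ : h₄.reg ρJ = 1 - i := by rw [hf₄.reg _ rfl, hJ₃]
    have e0 : h₄.D i k = X.d i u k := by rw [HState.D, hf₄.arr _ rfl]; exact e0 k hk
    have e1 : h₄.D (1 - i) k = X.d (1 - i) v k := by
      rw [HState.D, hf₄.arr _ rfl]; exact e1 k hk
    clear hA
    simp [h7, hM₄, hJ₄, e0, e1, hc₄.rq, hc₄.r3q, Inst.Near, Inst.Far]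
    omega
  rintro h₄ hf₄ ⟨hB', h8⟩
  have hc₄ := hc₃.frame hf₄ rfl
  have hS₄ := hS₃.trans (Srch.of_frame (F := True) (t := 7 * X.n + 3) hf₄ rfl rfl rfl
    (by omega) trivial)
  have hca : h₄.reg ρca = h₃.reg ρca := hf₄.reg _ rfl
  rw [← hca] at hA
  have lA : h₄.reg ρca ≤ X.n := by rcases hA with ⟨h, -⟩ | ⟨x, hx, h, -⟩ <;> omega
  have lB : h₄.reg ρcb ≤ X.n := by rcases hB' with ⟨h, -⟩ | ⟨x, hx, h, -⟩ <;> omega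
  refine (testIf_spec hc₄ lA).call fun h₅ hf₅ hS₅ => ?_
  have hcb : h₅.reg ρcb = h₄.reg ρcb := hf₅.reg _ rfl
  have hc₅ := hc₄.frame hf₅ rfl
  refine (testIf_spec hc₅ (hcb ▸ lB)).call fun h₆ hf₆ hS₆ => ?_
  refine ((hS₄.trans hS₅).trans hS₆).mono (fun hF => ?_) (by omega)
  rw [hcb] at hF
  exact Inst.noSep_of hi hA hB' hF.1.2 hF.2

/-! ### Balls -/

notation "ρK" => 40
notation "ρcap" => 41
notation "ρcnt" => 42

/-- List at most `reg ρcap` vertices near the source of the last search in mode `reg ρK`. -/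
def collect : Cmd :=
  .asg ρcnt 0 ;;
  .for' ρy ρn (
    .ld ρd0 αdist (2 * .var ρy + .var ρK) ;;
    .ite (.and (.le (.var ρd0) (.var ρq)) (.lt (.var ρcnt) (.var ρcap)))
      (.st αball (2 * .var ρcnt + .var ρK) (.var ρy) ;; .asg ρcnt (.var ρcnt + 1)) .skip)

/-- The ball of radius `q` about `u`. -/
noncomputable def Inst.ball (X : Inst E) (i u : ℕ) : Finset ℕ :=
  (Finset.range X.n).filter fun v => X.d i u v ≤ X.q

/-- The list is complete only if the ball is not larger than the cap. For a bad sample it is cut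
off, which costs correctness but keeps the time bounded for every outcome of the random bits. -/
theorem collect_spec (hc : Ctx X h) {i u : ℕ} (hi : i < 2) (hK : h.reg ρK = i)
    (hcap : h.reg ρcap < E.B) (hD : ∀ v < X.n, h.D i v = X.d i u v) :
    wp E collect (fun h' => (∀ t, h'.arr αball (2 * t + (1 - i)) = h.arr αball (2 * t + (1 - i))) ∧
      (∀ t < h'.reg ρcnt, h'.arr αball (2 * t + i) < X.n) ∧ h'.reg ρcnt ≤ h.reg ρcap ∧
      ((X.ball i u).card ≤ h.reg ρcap →
        ∀ x < X.n, X.Near i u x → ∃ t < h'.reg ρcnt, h'.arr αball (2 * t + i) = x) ∧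
      h'.time ≤ h.time + 10 * X.m) h := by
  have hB := X.hundred_lt
  have hn8 := X.n8_le
  have hβ := X.β_lt
  have hn := X.n_pos
  have hnm := X.n_le_m
  simp only [collect, wp_seq, wp_asg]
  refine ⟨by simp; omega, ?_⟩
  refine wp_for (fun k h₁ => (∀ t, h₁.arr αball (2 * t + (1 - i)) = h.arr αball (2 * t + (1 - i))) ∧
      (∀ t < h₁.reg ρcnt, h₁.arr αball (2 * t + i) < X.n) ∧ h₁.reg ρcnt ≤ h.reg ρcap ∧
      h₁.reg ρcnt ≤ k ∧
      -- Either everything near has been listed so far, or the ball is larger than the cap.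
      ((∀ x < k, X.Near i u x → ∃ t < h₁.reg ρcnt, h₁.arr αball (2 * t + i) = x) ∧
        h₁.reg ρcnt = ((Finset.range k).filter fun v => X.d i u v ≤ X.q).card ∨
        h.reg ρcap < ((Finset.range k).filter fun v => X.d i u v ≤ X.q).card) ∧
      h₁.time ≤ h.time + 6 * k + 2) (by decide) rfl rfl (by omega) (by simp [hc.rn]; omega) ?_ ?_ ?_
  · simp
  · rintro k hk h₁ hf h1 h2 ⟨h3, h4, h5, h6, h7, h8⟩
    have hcx := (hc.set (r := ρcnt) (x := (0 : Exp).ev E h) rfl)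
    have hc₁ := hcx.frame hf rfl
    rw [hcx.rn] at hk
    have hK₁ : h₁.reg ρK = i := by rw [hf.reg _ rfl]; simp [hK]
    have hcap₁ : h₁.reg ρcap = h.reg ρcap := by rw [hf.reg _ rfl]; simp
    have e0 : h₁.D i k = X.d i u k := by
      rw [HState.D, hf.arr _ rfl]; exact hD k hk
    simp only [wp_seq, wp_ld, wp_ite, wp_st, wp_asg]
    simp [h1, hK₁, e0, hc₁.rq, hcap₁, Cmd.skip]
    repeat refine ⟨by omega, ?_⟩
    have hcard : ((Finset.range (k + 1)).filter fun v => X.d i u v ≤ X.q).card =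
        ((Finset.range k).filter fun v => X.d i u v ≤ X.q).card +
          if X.d i u k ≤ X.q then 1 else 0 := by
      rw [Finset.range_add_one, Finset.filter_insert]
      split_ifs
      · rw [Finset.card_insert_of_notMem (by simp)]
      · rfl
    rw [hcard]
    refine ⟨fun h9 h10 => ?_, fun h9 => ?_⟩
    · repeat refine ⟨by omega, ?_⟩
      refine ⟨fun t => ?_, fun t ht => ?_, by omega, by omega, ?_, by omega⟩
      · rw [if_neg (by omega)]; exact h3 t
      · split_ifs with h11
        · exact hk
        · exact h4 t (by omega)
      · rw [if_pos h9]
        rcases h7 with ⟨h7, h12⟩ | h7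
        · refine Or.inl ⟨fun x hx hxn => ?_, by omega⟩
          rcases Nat.lt_succ_iff_lt_or_eq.1 (Nat.lt_succ_of_le hx) with h13 | rfl
          · obtain ⟨t, ht, hh⟩ := h7 x h13 hxn
            exact ⟨t, by omega, by rw [if_neg (by omega)]; exact hh⟩
          · exact ⟨h₁.reg ρcnt, by omega, by simp⟩
        · exact Or.inr (by omega)
    · repeat refine ⟨by omega, ?_⟩
      refine ⟨?_, by omega⟩
      by_cases h10 : X.d i u k ≤ X.q
      · have h11 := h9 h10
        rw [if_pos h10]
        right
        rcases h7 with ⟨h7, h12⟩ | h7 <;> omega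
      · rw [if_neg h10]
        rcases h7 with ⟨h7, h12⟩ | h7
        · refine Or.inl ⟨fun x hx hxn => ?_, h12⟩
          rcases Nat.lt_succ_iff_lt_or_eq.1 (Nat.lt_succ_of_le hx) with h13 | rfl
          · exact h7 x h13 hxn
          · exact absurd hxn h10
        · exact Or.inr h7
  · rintro h₁ hf ⟨h3, h4, h5, h6, h7, h8⟩
    have hrn : (h.set ρcnt ((0 : Exp).ev E h)).reg ρn = X.n := by simp [hc.rn]
    rw [hrn] at h7 h8
    refine ⟨h3, h4, h5, fun hb => ?_, by simp; omega⟩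
    rcases h7 with ⟨h7, -⟩ | h7
    · exact h7
    · exact absurd hb (by unfold Inst.ball; omega)

end WordRAM

/-! ### Why the searches about an unhit vertex are exhaustive -/

namespace WordRAM

variable {E : Env} {X : Inst E} {h : HState} {Q : HState → Prop}

namespace Inst

/-- Walk back from `y` on a shortest path until the distance from `w` is at most `q`. Less than `q`
remains because the whole distance is less than `2 * q`. -/
theorem midpoint {i w y : ℕ} (hi : i < 2) (hw : w < X.n) (hy : y < X.n)
    (hd : X.d i w y < 2 * X.q) :
    ∃ z < X.n, X.d i w z ≤ X.q ∧ X.d i z y < X.q := by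
  have hq := X.q_pos
  have hqn := X.q_le
  have key : ∀ j ≤ X.d i w y, ∃ z < X.n, X.d i w z = X.d i w y - j ∧ X.d i z y ≤ j := by
    intro j
    induction j with
    | zero => exact fun _ => ⟨y, hy, by simp, by simp [X.d_self]⟩
    | succ j ih =>
      intro hj
      obtain ⟨z, hz, h1, h2⟩ := ih (by omega)
      -- The distance is below `2 * q ≤ 2 * n`, so it is not the mark `4 * n` and predecessors
      -- exist.
      obtain ⟨p, hp1, hp2, hp3, hp4⟩ := X.d_pred i hi w hw z hz (X.d i w y - (j + 1)) (by omega)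
        (by omega)
      have h3 := X.d_adj i hi p hp1 hp2
      rw [hp3] at h3
      have h4 := X.d_tri i (E.inp p) z y
      exact ⟨E.inp p, X.cell_lt i hi p hp1 hp2, hp4, by omega⟩
  by_cases h1 : X.d i w y ≤ X.q
  · exact ⟨y, hy, h1, by rw [X.d_self]; exact hq⟩
  · obtain ⟨z, hz, h2, h3⟩ := key (X.d i w y - X.q) (by omega)
    exact ⟨z, hz, by omega, by omega⟩

/-- The vertex `v` is near one of the first `N` samples. -/
def Hit (X : Inst E) (i N v : ℕ) : Prop := ∃ k < N, X.Near i (X.smp k) v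

/-- A vertex that is near none of the first `N` samples has at most `r` vertices in its balls. -/
def Good (X : Inst E) (N r : ℕ) : Prop :=
  ∀ i < 2, ∀ v < X.n, ¬ X.Hit i N v → (X.ball i v).card ≤ r

/-- The outcome of the search from a sample `s` in mode `i`. -/
def NoStar (X : Inst E) (N i s : ℕ) : Prop :=
  ∀ x < X.n, ∀ y < X.n, X.Near i s x → X.Far i s y → ¬ X.Hit (1 - i) N x →
    4 * X.q ≤ X.d (1 - i) x y → False

/-- In mode `i`, `W` is near `s` and `y` far from it, so `W` and `y` are `2 * q` apart; as the test
of `W` failed, they are closer than `2 * q` in mode `1 - i`, with a midpoint `z` in the ball about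
`W`. The search from `z` finds a vertex `v` that is far from `s` in mode `i` and within `q` of `z`
in mode `1 - i`, for `y` is one. Then `v` is at least `2 * q` from `x` in both modes, in mode `1 -
i` because `v` is within `2 * q` of `y`. So the test of `v` cannot have failed. -/
theorem noStar_of {N i s W : ℕ} (hi : i < 2) (hW : W < X.n) (hWs : X.Near i s W)
    (hWt : X.NoFar W)
    (hball : ∀ z < X.n, X.Near (1 - i) W z → ∃ b, ((b = 0 ∧ ∀ v < X.n,
      ¬ (X.d (1 - i) z v ≤ X.q ∧ X.Far i s v)) ∨ ∃ v < X.n, b = v + 1 ∧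
        (X.d (1 - i) z v ≤ X.q ∧ X.Far i s v)) ∧ (b ≠ 0 → X.NoFar (b - 1))) :
    X.NoStar N i s := by
  intro x hx y hy h1 h2 h3 h4
  have hq := X.q_pos
  simp only [Near, Far] at *
  have t1 := X.d_tri i s W y
  have h5 := hWt y hy i hi
  obtain ⟨z, hz, h6, h7⟩ := X.midpoint (i := 1 - i) (by omega) hW hy (by omega)
  obtain ⟨b, hb, hb'⟩ := hball z hz h6
  rcases hb with ⟨-, hb⟩ | ⟨v, hv, rfl, hb1, hb2⟩
  -- The search from `z` cannot come back empty, since `y` itself qualifies.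
  · exact hb y hy ⟨h7.le, h2⟩
  · have h8 := hb' (by omega) x hx i hi
    simp only [Nat.add_sub_cancel] at h8
    have t2 := X.d_tri i s x v
    have t3 := X.d_comm i x v
    have t4 := X.d_tri (1 - i) x v y
    have t5 := X.d_tri (1 - i) v z y
    have t6 := X.d_comm (1 - i) v z
    have t7 := X.d_comm (1 - i) v x
    omega

/-- The outcome of the search from a vertex that is not hit. -/
def NoUnhit (X : Inst E) (N i : ℕ) : Prop :=
  ∀ x < X.n, ∀ y < X.n, ¬ X.Hit (1 - i) N x → ¬ X.Hit i (X.a ^ 2) x →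
    4 * X.q ≤ X.d i x y → 4 * X.q ≤ X.d (1 - i) x y → False

/-- Since the test of `W` failed, each of `x` and `y` is closer than `2 * q` to `W` in some mode;
they cannot share this mode, being `4 * q` apart. Take a midpoint in each of the two modes: either
is near one of `x`, `y` and far from the other, so the two midpoints separate `x` from `y`. -/
theorem noUnhit_of {N i W : ℕ} (hi : i < 2) (hW : W < X.n) (hWt : X.NoFar W)
    (hball : ∀ u < X.n, X.Near i W u → ∀ v < X.n, X.Near (1 - i) W v → X.NoSep i u (1 - i) v) :
    X.NoUnhit N i := by
  intro x hx y hy _ _ h1 h2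
  have hq := X.q_pos
  -- The case in which `x` is close to `W` in mode `i` and `y` in mode `1 - i`; the other case
  -- exchanges `x` and `y`.
  have core : ∀ x < X.n, ∀ y < X.n, 4 * X.q ≤ X.d i x y → 4 * X.q ≤ X.d (1 - i) x y →
      X.d i W x < 2 * X.q → X.d (1 - i) W y < 2 * X.q → False := by
    intro x hx y hy h1 h2 h3 h4
    obtain ⟨u, hu, hu1, hu2⟩ := X.midpoint hi hW hx h3
    obtain ⟨v, hv, hv1, hv2⟩ := X.midpoint (i := 1 - i) (by omega) hW hy h4
    refine (hball u hu hu1 v hv hv1).2 x hx y hy ?_ ?_ ?_ ?_ <;> simp only [Near, Far]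
    · exact hu2.le
    · have := X.d_tri (1 - i) x v y
      have := X.d_comm (1 - i) x v
      omega
    · have := X.d_tri i x u y
      have := X.d_comm i x u
      omega
    · exact hv2.le
  have hx' := hWt x hx i hi
  have hy' := hWt y hy i hi
  have t1 := X.d_tri i x W y
  have t2 := X.d_comm i x W
  have t3 := X.d_tri (1 - i) x W y
  have t4 := X.d_comm (1 - i) x W
  by_cases h3 : X.d i W x < 2 * X.q
  · exact core x hx y hy h1 h2 h3 (by omega)
  · exact core y hy x hx (by rwa [X.d_comm]) (by rwa [X.d_comm]) (by omega) (by omega)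

end Inst

notation "ρtwo" => 43
notation "ρk" => 44
notation "ρw" => 45
notation "ρb" => 46
notation "ρh" => 47
notation "ρc1" => 48
notation "ρg" => 49
notation "ρN" => 51
notation "ρH" => 52
notation "ρr" => 53

/-- The array `hit` is correct for the first `N` and the first `a ^ 2` samples. -/
structure HitOK (X : Inst E) (N : ℕ) (A : ℕ → ℕ) : Prop where
  S : ∀ i < 2, ∀ v < X.n, A (2 * v + i) ≠ 0 ↔ X.Hit i N v
  R : ∀ i < 2, ∀ v < X.n, A (2 * X.n + (2 * v + i)) ≠ 0 ↔ X.Hit i (X.a ^ 2) v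

/-! ### The search from a sample -/

/-- Search along the ball about the vertex `reg ρw - 1`. -/
def starBall : Cmd :=
  .asg ρt (.var ρw - 1) ;; test ;; .asg ρK (.var ρJ) ;; .asg ρcap (.var ρr) ;; collect ;;
  .for' ρh ρcnt (
    .ld ρs αball (2 * .var ρh + .var ρJ) ;; .asg ρI (.var ρJ) ;; bfs ;;
    findv ρb ρy (.ld ρd0 αdist (2 * .var ρy + .var ρJ) ;; .ld ρd1 αfar (.var ρy))
      (.and (.le (.var ρd0) (.var ρq)) (.var ρd1)) ;;
    testIf ρb)

/-- One vertex `ρw` per sample and mode is enough: it need not be the vertex `x` of a far pair, only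
be near the sample in one mode and unhit in the other. -/
def star : Cmd :=
  .ld ρs αsmp (.var ρk) ;; .asg ρI (.var ρM) ;; bfs ;;
  .for' ρy ρn (.ld ρd0 αdist (2 * .var ρy + .var ρM) ;;
    .st αfar (.var ρy) (.le (.var ρ3q) (.var ρd0))) ;;
  findv ρw ρy (.ld ρd0 αdist (2 * .var ρy + .var ρM) ;; .ld ρd1 αhit (2 * .var ρy + .var ρJ))
    (.and (.le (.var ρd0) (.var ρq)) (.eq (.var ρd1) 0)) ;;
  .ite (.var ρw) starBall .skip

/-- That `W` is unhit enters only through `Good`, which makes the list of its ball complete. -/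
theorem starBall_spec (hc : Ctx X h) {i s W N : ℕ} (hi : i < 2) (hM : h.reg ρM = i)
    (hJ : h.reg ρJ = 1 - i) (hW : W < X.n) (hw : h.reg ρw = W + 1) (hr : 2 * h.reg ρr + 2 < E.B)
    (hfar : ∀ v < X.n, h.arr αfar v ≠ 0 ↔ X.Far i s v) (hWs : X.Near i s W)
    (hWN : ¬ X.Hit (1 - i) N W) :
    wp E starBall (Srch X (X.Good N (h.reg ρr) → X.NoStar N i s)
      (130 * X.m + 170 * X.m * h.reg ρr) h) h := by
  have hB := X.hundred_lt
  have hn8 := X.n8_le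
  have hβ := X.β_lt
  have hn := X.n_pos
  have hnm := X.n_le_m
  simp only [starBall, wp_seq, wp_asg]
  refine ⟨by simp [hw]; omega, ?_⟩
  simp only [Exp.ev_sub, Exp.ev_var, Exp.ev_ofNat, hw, Nat.add_sub_cancel]
  refine (test_spec (hc.set rfl) (by simpa using hW)).call ?_
  rintro h₁ hf ⟨h1, hS₁⟩
  have hc₁ := (hc.set rfl).frame hf rfl
  simp only [HState.set_reg, if_true] at h1 hS₁
  have hJ₁ : h₁.reg ρJ = 1 - i := by rw [hf.reg _ rfl]; simp [hJ]
  have hr₁ : h₁.reg ρr = h.reg ρr := by rw [hf.reg _ rfl]; simp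
  have hfar₁ : h₁.arr αfar = h.arr αfar := by rw [hf.arr _ rfl]; simp
  refine ⟨by simp, by simp, ?_⟩
  refine (collect_spec (i := 1 - i) (u := W) ((hc₁.set rfl).set rfl) (by omega) (by simp [hJ₁])
    (by simp [hr₁]; omega) (by simpa using h1 (1 - i) (by omega))).call ?_
  rintro h₂ hf₂ ⟨-, h2, h3, h4, h5⟩
  have hc₂ := ((hc₁.set rfl).set rfl).frame hf₂ rfl
  have hJ₂ : h₂.reg ρJ = 1 - i := by rw [hf₂.reg _ rfl]; simp [hJ₁]
  have hfar₂ : h₂.arr αfar = h.arr αfar := by rw [hf₂.arr _ rfl]; simp [hfar₁]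
  simp [hr₁] at h3 h4 h5
  have hS₂ : Srch X (X.NoFar W) (100 * X.m + 1 + 2 + 10 * X.m) h h₂ := by
    refine (((((Srch.of_eq (t := 0) (F := True) (h := h) (h' := h) rfl rfl rfl (by omega)
      trivial).set (r := ρt) (by decide) (by decide) (by decide)).trans hS₁).set (by decide)
      (by decide) (by decide)).set (by decide) (by decide) (by decide)).trans
      (Srch.of_frame (F := True) (t := 10 * X.m) hf₂ rfl rfl rfl (by simp; omega) trivial)
      |>.mono (fun hF => hF.1.2) (by omega)
  refine wp_for_srch (X := X) (J := fun _ _ => True) (F := fun t => ∃ b, ((b = 0 ∧ ∀ v < X.n,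
      ¬ (X.d (1 - i) (h₂.arr αball (2 * t + (1 - i))) v ≤ X.q ∧ X.Far i s v)) ∨
        ∃ v < X.n, b = v + 1 ∧ (X.d (1 - i) (h₂.arr αball (2 * t + (1 - i))) v ≤ X.q ∧
          X.Far i s v)) ∧ (b ≠ 0 → X.NoFar (b - 1)))
    (t := 160 * X.m) (by decide) rfl rfl (by decide) (by omega) trivial ?_ ?_
  · intro t ht h₃ hf₃ h6 h7 _
    have hc₃ := hc₂.frame hf₃ rfl
    have hJ₃ : h₃.reg ρJ = 1 - i := by rw [hf₃.reg _ rfl, hJ₂]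
    have hball₃ : h₃.arr αball = h₂.arr αball := hf₃.arr _ rfl
    have hfar₃ : h₃.arr αfar = h.arr αfar := by rw [hf₃.arr _ rfl, hfar₂]
    simp only [wp_seq, wp_ld, wp_asg]
    simp [h6, hJ₃, hball₃]
    repeat refine ⟨by omega, ?_⟩
    refine (bfs_spec X (i := 1 - i) (by omega) (h2 t ht) (((hc₃.tick.set rfl).set rfl)) (by simp)
      (by simp)).call ?_
    rintro h₄ hf₄ ⟨h8, -, h9⟩
    have hc₄ := ((hc₃.tick.set rfl).set rfl).frame hf₄ rfl
    have hJ₄ : h₄.reg ρJ = 1 - i := by rw [hf₄.reg _ rfl]; simp [hJ₃]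
    have hfar₄ : h₄.arr αfar = h.arr αfar := by rw [hf₄.arr _ rfl]; simp [hfar₃]
    refine (findv_spec hc₄ (P := fun v => X.d (1 - i) (h₂.arr αball (2 * t + (1 - i))) v ≤ X.q ∧
      X.Far i s v) 2 (by decide) (by decide)
      (by decide) (by decide) (by decide) rfl rfl rfl ?_).call ?_
    · rintro k hk h₅ hf₅ h10
      have hc₅ := hc₄.frame hf₅ rfl
      have hJ₅ : h₅.reg ρJ = 1 - i := by rw [hf₅.reg _ rfl, hJ₄]
      have e0 : h₅.D (1 - i) k = X.d (1 - i) (h₂.arr αball (2 * t + (1 - i))) k := by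
        rw [HState.D, hf₅.arr _ rfl]; exact h8 k hk
      have e1 : h₅.arr αfar k = h.arr αfar k := by rw [hf₅.arr _ rfl, hfar₄]
      simp only [wp_seq, wp_ld]
      have e2 := hfar k hk
      simp [h10, hJ₅, e0, e1, hc₅.rq]
      repeat refine ⟨by omega, ?_⟩
      exact fun _ => e2
    · rintro h₅ hf₅ ⟨h10, h11⟩
      have hc₅ := hc₄.frame hf₅ rfl
      have lB : h₅.reg ρb ≤ X.n := by rcases h10 with ⟨h, -⟩ | ⟨x, hx, h, -⟩ <;> omega
      refine (testIf_spec hc₅ lB).call fun h₆ hf₆ hS₆ => ?_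
      have hS₅ : Srch X True (42 * X.m + 7 * X.n + 5) h₃.tick h₅ := by
        refine ((((Srch.of_eq (t := 0) (F := True) (h := h₃.tick) (h' := h₃.tick) rfl rfl rfl
          (by omega) trivial).set (by decide) (by decide) (by decide)).set (by decide)
          (by decide) (by decide)).trans
          (Srch.of_frame (F := True) (t := 40 * X.m) hf₄ rfl rfl rfl h9 trivial)).trans
          (Srch.of_frame (F := True) (t := 7 * X.n + 3) hf₅ rfl rfl rfl h11 trivial)
          |>.mono (fun _ => trivial) (by omega)
      have hle : 42 * X.m + 7 * X.n + 5 + (100 * X.m + 2) ≤ 160 * X.m := by clear h10; omega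
      exact (hS₅.trans hS₆).mono (fun hF => ⟨h₅.reg ρb, by simpa using h10, hF.2⟩) hle
  · intro h₃ hf₃ _ hS₃
    have hle : (160 * X.m + 2) * h₂.reg ρcnt ≤ 170 * X.m * h.reg ρr :=
      Nat.mul_le_mul (by omega) h3
    refine (hS₂.trans hS₃).mono (fun hF hgood => ?_) (by omega)
    refine Inst.noStar_of hi hW hWs hF.1 fun z hz hWz => ?_
    obtain ⟨t, ht, rfl⟩ := h4 (hgood (1 - i) (by omega) W hW hWN) z hz hWz
    exact hF.2 t ht

theorem star_spec (hc : Ctx X h) {i k N : ℕ} (hi : i < 2) (hM : h.reg ρM = i)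
    (hJ : h.reg ρJ = 1 - i) (hk : h.reg ρk = k) (hka : k < X.a ^ 3) (hr : 2 * h.reg ρr + 2 < E.B)
    (hhit : HitOK X N (h.arr αhit)) :
    wp E star (Srch X (X.Good N (h.reg ρr) → X.NoStar N i (X.smp k))
      (200 * X.m + 170 * X.m * h.reg ρr) h) h := by
  have hB := X.hundred_lt
  have hn8 := X.n8_le
  have hβ := X.β_lt
  have hn := X.n_pos
  have hnm := X.n_le_m
  have hs := X.smp_lt k
  have ha3 := X.pow_a_le (k := 3) (by omega)
  simp only [star, wp_seq, wp_asg, wp_ld]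
  simp [hk, hc.smp k hka, hM]
  refine ⟨by omega, ?_⟩
  refine (bfs_spec X (i := i) (s := X.smp k) hi hs ((hc.set rfl).set rfl) (by simp)
    (by simp)).call ?_
  rintro h₁ hf ⟨h1, -, h2⟩
  have hc₁ := ((hc.set rfl).set rfl).frame hf rfl
  have hM₁ : h₁.reg ρM = i := by rw [hf.reg _ rfl]; simp [hM]
  have hJ₁ : h₁.reg ρJ = 1 - i := by rw [hf.reg _ rfl]; simp [hJ]
  have hr₁ : h₁.reg ρr = h.reg ρr := by rw [hf.reg _ rfl]; simp
  have hhit₁ : h₁.arr αhit = h.arr αhit := by rw [hf.arr _ rfl]; simp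
  have hS₁ : Srch X True (40 * X.m + 2) h h₁ :=
    (((Srch.of_eq (t := 0) (F := True) rfl rfl rfl (by omega) trivial).set (by decide) (by decide)
      (by decide)).set (by decide) (by decide) (by decide)).trans
      (Srch.of_frame (F := True) hf rfl rfl rfl h2 trivial) |>.mono (fun _ => trivial) (by omega)
  refine wp_for (fun v h₂ => (∀ x < v, h₂.arr αfar x ≠ 0 ↔ X.Far i (X.smp k) x) ∧
    h₂.time ≤ h₁.time + 1 + 4 * v) (by decide) rfl rfl (by omega) (by rw [hc₁.rn]; omega)
    (by simp) ?_ ?_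
  · rintro v hv h₂ hf₂ h3 h4 ⟨h5, h6⟩
    have hc₂ := hc₁.frame hf₂ rfl
    rw [hc₁.rn] at hv
    have hM₂ : h₂.reg ρM = i := by rw [hf₂.reg _ rfl, hM₁]
    have e0 : h₂.D i v = X.d i (X.smp k) v := by rw [HState.D, hf₂.arr _ rfl]; exact h1 v hv
    simp only [wp_seq, wp_ld, wp_st]
    simp [h3, hM₂, e0, hc₂.r3q]
    repeat refine ⟨by omega, ?_⟩
    refine ⟨fun x hx => ?_, by omega⟩
    rcases Nat.lt_succ_iff_lt_or_eq.1 (Nat.lt_succ_of_le hx) with h7 | rfl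
    · simpa [h7.ne] using h5 x h7
    · simp [Inst.Far]
  rintro h₂ hf₂ ⟨h3, h4⟩
  have hc₂ := (hc₁.frame hf₂ rfl).tick
  rw [hc₁.rn] at h3 h4
  have hM₂ : h₂.tick.reg ρM = i := by rw [HState.tick_reg, hf₂.reg _ rfl, hM₁]
  have hJ₂ : h₂.tick.reg ρJ = 1 - i := by rw [HState.tick_reg, hf₂.reg _ rfl]; simp [hJ₁]
  have hr₂ : h₂.tick.reg ρr = h.reg ρr := by rw [HState.tick_reg, hf₂.reg _ rfl]; simp [hr₁]
  have hhit₂ : h₂.tick.arr αhit = h.arr αhit := by rw [HState.tick_arr, hf₂.arr _ rfl, hhit₁]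
  have hdist₂ : h₂.tick.arr αdist = h₁.arr αdist := by rw [HState.tick_arr, hf₂.arr _ rfl]
  have hS₂ := hS₁.trans ((Srch.of_frame (F := True) (t := 1 + 4 * X.n) hf₂ rfl rfl rfl
    (by omega) trivial).tick)
  refine (findv_spec hc₂ (P := fun v => X.Near i (X.smp k) v ∧ ¬ X.Hit (1 - i) N v) 2 (by decide)
    (by decide) (by decide) (by decide) (by decide) rfl rfl rfl ?_).call ?_
  · rintro v hv h₃ hf₃ h5
    have hc₃ := hc₂.frame hf₃ rfl
    have hM₃ : h₃.reg ρM = i := by rw [hf₃.reg _ rfl, hM₂]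
    have hJ₃ : h₃.reg ρJ = 1 - i := by rw [hf₃.reg _ rfl, hJ₂]
    have e0 : h₃.D i v = X.d i (X.smp k) v := by
      rw [HState.D, hf₃.arr _ rfl, hdist₂]; exact h1 v hv
    have e1 : h₃.arr αhit (2 * v + (1 - i)) = h.arr αhit (2 * v + (1 - i)) := by
      rw [hf₃.arr _ rfl, hhit₂]
    have e2 := hhit.S (1 - i) (by omega) v hv
    simp only [wp_seq, wp_ld]
    simp [h5, hM₃, hJ₃, e0, e1, hc₃.rq]
    repeat refine ⟨by omega, ?_⟩
    rw [← e2, not_not]; rfl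
  rintro h₃ hf₃ ⟨h5, h6⟩
  have hc₃ := hc₂.frame hf₃ rfl
  have hM₃ : h₃.reg ρM = i := by rw [hf₃.reg _ rfl, hM₂]
  have hJ₃ : h₃.reg ρJ = 1 - i := by rw [hf₃.reg _ rfl, hJ₂]
  have hr₃ : h₃.reg ρr = h.reg ρr := by rw [hf₃.reg _ rfl, hr₂]
  have hfar₃ : h₃.arr αfar = h₂.arr αfar := by rw [hf₃.arr _ rfl]; rfl
  have hS₃ := (hS₂.trans (Srch.of_frame (F := True) (t := 7 * X.n + 3) hf₃ rfl rfl rfl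
    (by clear h5; omega) trivial)).tick
  refine ⟨fun h7 => ?_, fun h7 => ?_⟩
  · rcases h5 with ⟨h5, -⟩ | ⟨W, hW, h5, h8, h9⟩
    · exact absurd h5 h7
    refine (starBall_spec (N := N) (s := X.smp k) hc₃.tick hi hM₃ hJ₃ hW h5
      (by simp [hr₃]; omega) (by rw [HState.tick_arr, hfar₃]; exact h3) h8 h9).mono fun h₄ hS₄ => ?_
    rw [HState.tick_reg, hr₃] at hS₄
    exact (hS₃.trans hS₄).mono (fun hF => hF.2) (by omega)
  · simp only [Cmd.skip, wp_asg]
    refine ⟨by simp; omega, (hS₃.set (by decide) (by decide) (by decide)).mono (fun _ _ => ?_)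
      (by clear h5; omega)⟩
    rcases h5 with ⟨-, h5⟩ | ⟨W, hW, h5, -⟩
    · intro x hx y _ h8 _ h9 _
      exact h5 x hx ⟨h8, h9⟩
    · omega

end WordRAM

namespace WordRAM

variable {E : Env} {X : Inst E} {h : HState} {Q : HState → Prop}

/-! ### The search from a vertex that is not hit -/

/-- The caps of the two lists are the sizes that an unhit ball may have: `a ^ 2 * l` in mode `ρM`,
where the first `a ^ 2` samples count, and `reg ρr` in mode `ρJ`, where all `N` samples count. -/
def unhitBall : Cmd :=
  .asg ρt (.var ρw - 1) ;; test ;;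
  .asg ρK (.var ρM) ;; .asg ρcap (.var ρa2l) ;; collect ;; .asg ρc1 (.var ρcnt) ;;
  .asg ρK (.var ρJ) ;; .asg ρcap (.var ρr) ;; collect ;;
  .for' ρh ρc1 (.for' ρg ρcnt (
    .ld ρpa αball (2 * .var ρh + .var ρM) ;; .ld ρpb αball (2 * .var ρg + .var ρJ) ;; pairCheck))

def unhit : Cmd :=
  findv ρw ρy
    (.ld ρd0 αhit (2 * .var ρy + .var ρJ) ;; .ld ρd1 αhit (.var ρ2n + (2 * .var ρy + .var ρM)))
    (.and (.eq (.var ρd0) 0) (.eq (.var ρd1) 0)) ;;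
  .ite (.var ρw) unhitBall .skip

theorem Inst.a2l_lt (X : Inst E) : 2 * (X.a ^ 2 * X.l) + 2 < E.B := by
  have h1 := X.pow_β_lt (k := 1) (by omega)
  have h2 := X.pow_a_le (k := 2) (by omega)
  have h3 : 8 * X.a ^ 2 * (X.l + 1) ≤ X.β * (X.l + 1) := Nat.mul_le_mul_right _ h2
  have h4 := Nat.one_le_pow 2 X.a X.a_pos
  rw [pow_one] at h1
  nlinarith

/-- Both balls are kept in the array `αball`, one at the even and one at the odd places, so the
second list does not destroy the first. Every pair of members then takes a bounded number of
breadth-first searches. -/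
theorem unhitBall_spec (hc : Ctx X h) {i W N : ℕ} (hi : i < 2) (hM : h.reg ρM = i)
    (hJ : h.reg ρJ = 1 - i) (hW : W < X.n) (hw : h.reg ρw = W + 1) (hr : 2 * h.reg ρr + 2 < E.B)
    (hWN : ¬ X.Hit (1 - i) N W) (hWR : ¬ X.Hit i (X.a ^ 2) W) :
    wp E unhitBall (Srch X (X.Good N (h.reg ρr) → X.Good (X.a ^ 2) (X.a ^ 2 * X.l) →
      X.NoUnhit N i) (140 * X.m + (325 * X.m * h.reg ρr + 5) * (X.a ^ 2 * X.l)) h) h := by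
  have hB := X.hundred_lt
  have hn8 := X.n8_le
  have hβ := X.β_lt
  have hn := X.n_pos
  have hnm := X.n_le_m
  have ha2l := X.a2l_lt
  simp only [unhitBall, wp_seq, wp_asg]
  refine ⟨by simp [hw]; omega, ?_⟩
  simp only [Exp.ev_sub, Exp.ev_var, Exp.ev_ofNat, hw, Nat.add_sub_cancel]
  refine (test_spec (hc.set rfl) (by simpa using hW)).call ?_
  rintro h₁ hf ⟨h1, hS₁⟩
  have hc₁ := (hc.set rfl).frame hf rfl
  simp only [HState.set_reg, if_true] at h1 hS₁
  have hM₁ : h₁.reg ρM = i := by rw [hf.reg _ rfl]; simp [hM]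
  have hJ₁ : h₁.reg ρJ = 1 - i := by rw [hf.reg _ rfl]; simp [hJ]
  have hr₁ : h₁.reg ρr = h.reg ρr := by rw [hf.reg _ rfl]; simp
  refine ⟨by simp, by simp, ?_⟩
  refine (collect_spec (i := i) (u := W) ((hc₁.set rfl).set rfl) (by omega) (by simp [hM₁])
    (by simp [hc₁.ra2l]; omega) (by simpa using h1 i (by omega))).call ?_
  rintro h₂ hf₂ ⟨-, h2, h3, h4, h5⟩
  have hc₂ := ((hc₁.set rfl).set rfl).frame hf₂ rfl
  have hM₂ : h₂.reg ρM = i := by rw [hf₂.reg _ rfl]; simp [hM₁]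
  have hJ₂ : h₂.reg ρJ = 1 - i := by rw [hf₂.reg _ rfl]; simp [hJ₁]
  have hr₂ : h₂.reg ρr = h.reg ρr := by rw [hf₂.reg _ rfl]; simp [hr₁]
  have hD₂ : ∀ j < 2, ∀ v < X.n, h₂.D j v = X.d j W v := by
    intro j hj v hv; rw [HState.D, hf₂.arr _ rfl]; exact h1 j hj v hv
  simp [hc₁.ra2l] at h3 h4 h5
  have hS₂ : Srch X (X.NoFar W) (100 * X.m + 1 + 2 + 10 * X.m) h h₂ := by
    refine (((((Srch.of_eq (t := 0) (F := True) (h := h) (h' := h) rfl rfl rfl (by omega)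
      trivial).set (r := ρt) (by decide) (by decide) (by decide)).trans hS₁).set (by decide)
      (by decide) (by decide)).set (by decide) (by decide) (by decide)).trans
      (Srch.of_frame (F := True) (t := 10 * X.m) hf₂ rfl rfl rfl (by simp; omega) trivial)
      |>.mono (fun hF => hF.1.2) (by omega)
  refine ⟨by simp, by simp, by simp, ?_⟩
  refine (collect_spec (i := 1 - i) (u := W) (((hc₂.set rfl).set rfl).set rfl) (by omega)
    (by simp [hJ₂]) (by simp [hr₂]; omega) (by simpa using hD₂ (1 - i) (by omega))).call ?_
  rintro h₃ hf₃ ⟨h6, h7, h8, h9, h10⟩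
  have hc₃ := (((hc₂.set rfl).set rfl).set rfl).frame hf₃ rfl
  have hM₃ : h₃.reg ρM = i := by rw [hf₃.reg _ rfl]; simp [hM₂]
  have hJ₃ : h₃.reg ρJ = 1 - i := by rw [hf₃.reg _ rfl]; simp [hJ₂]
  have hk₃ : h₃.reg ρc1 = h₂.reg ρcnt := by rw [hf₃.reg _ rfl]; simp
  simp [hr₂] at h6 h8 h9 h10
  rw [show 1 - (1 - i) = i by omega] at h6
  have hS₃ : Srch X (X.NoFar W) (130 * X.m) h h₃ :=
    (((hS₂.set (by decide) (by decide) (by decide)).set (by decide) (by decide) (by decide)).set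
      (by decide) (by decide) (by decide)).trans
      (Srch.of_frame (F := True) (t := 10 * X.m) hf₃ rfl rfl rfl (by simp; omega) trivial)
      |>.mono (fun hF => hF.1) (by omega)
  refine wp_for_srch (X := X) (J := fun _ _ => True) (F := fun s => ∀ t < h₃.reg ρcnt,
      X.NoSep i (h₃.arr αball (2 * s + i)) (1 - i) (h₃.arr αball (2 * t + (1 - i))))
    (t := (325 * X.m) * h.reg ρr + 3) (by decide) rfl rfl (by decide) (by omega) trivial ?_ ?_
  · intro s hs h₄ hf₄ h11 h12 _
    have hc₄ := hc₃.frame hf₄ rfl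
    have hM₄ : h₄.reg ρM = i := by rw [hf₄.reg _ rfl, hM₃]
    have hJ₄ : h₄.reg ρJ = 1 - i := by rw [hf₄.reg _ rfl, hJ₃]
    have hcnt₄ : h₄.reg ρcnt = h₃.reg ρcnt := hf₄.reg _ rfl
    have hball₄ : h₄.arr αball = h₃.arr αball := hf₄.arr _ rfl
    refine wp_for_srch (X := X) (J := fun _ _ => True) (F := fun t =>
      X.NoSep i (h₃.arr αball (2 * s + i)) (1 - i) (h₃.arr αball (2 * t + (1 - i))))
      (t := 320 * X.m + 2) (by decide) rfl rfl (by decide) (by simp; omega) trivial ?_ ?_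
    · intro t ht h₅ hf₅ h13 h14 _
      have hc₅ := hc₄.tick.frame hf₅ rfl
      have hM₅ : h₅.reg ρM = i := by rw [hf₅.reg _ rfl]; exact hM₄
      have hJ₅ : h₅.reg ρJ = 1 - i := by rw [hf₅.reg _ rfl]; exact hJ₄
      have hs₅ : h₅.reg ρh = s := by rw [hf₅.reg _ rfl]; exact h11
      have hball₅ : h₅.arr αball = h₃.arr αball := by rw [hf₅.arr _ rfl]; exact hball₄
      simp only [HState.tick_reg] at ht
      simp only [wp_seq, wp_ld]
      simp [hs₅, h13, hM₅, hJ₅, hball₅]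
      repeat refine ⟨by omega, ?_⟩
      refine (pairCheck_spec ((hc₅.tick.set rfl).set rfl) hi (by simp [hM₅]) (by simp [hJ₅])
        (by simp [h6]; exact h2 s (by omega)) (by simp; exact h7 t (by omega))).mono ?_
      intro h₆ hS₆
      simp only [HState.set_reg, if_true] at hS₆
      exact ((((Srch.of_eq (t := 0) (F := True) (h := h₅.tick) (h' := h₅.tick) rfl rfl rfl
        (by omega) trivial).set (by decide) (by decide) (by decide)).set (by decide)
        (by decide) (by decide)).trans hS₆).mono (fun hF => by simpa using hF.2) (by omega)
    · intro h₅ hf₅ _ hS₅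
      simp only [HState.tick_reg, hcnt₄] at hS₅
      refine ⟨hS₅.mono (fun hF => hF) ?_, trivial⟩
      have : (320 * X.m + 2 + 2) * h₃.reg ρcnt ≤ 325 * X.m * h.reg ρr :=
        Nat.mul_le_mul (by omega) h8
      omega
  · intro h₄ hf₄ _ hS₄
    have hle : (325 * X.m * h.reg ρr + 3 + 2) * h₃.reg ρc1 ≤
        (325 * X.m * h.reg ρr + 5) * (X.a ^ 2 * X.l) := Nat.mul_le_mul (by omega) (by omega)
    refine (hS₃.trans hS₄).mono (fun hF hgood hgood' => ?_) (by omega)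
    refine Inst.noUnhit_of hi hW hF.1 fun u hu hWu v hv hWv => ?_
    obtain ⟨s, hs, rfl⟩ := h4 (hgood' i hi W hW hWR) u hu hWu
    obtain ⟨t, ht, rfl⟩ := h9 (hgood (1 - i) (by omega) W hW hWN) v hv hWv
    rw [← h6]
    exact hF.2 s (by omega) t ht

theorem unhit_spec (hc : Ctx X h) {i N : ℕ} (hi : i < 2) (hM : h.reg ρM = i)
    (hJ : h.reg ρJ = 1 - i) (hr : 2 * h.reg ρr + 2 < E.B) (hhit : HitOK X N (h.arr αhit)) :
    wp E unhit (Srch X (X.Good N (h.reg ρr) → X.Good (X.a ^ 2) (X.a ^ 2 * X.l) →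
      X.NoUnhit N i) (160 * X.m + (325 * X.m * h.reg ρr + 5) * (X.a ^ 2 * X.l)) h) h := by
  have hB := X.hundred_lt
  have hn8 := X.n8_le
  have hβ := X.β_lt
  have hn := X.n_pos
  have hnm := X.n_le_m
  rw [unhit, wp_seq]
  refine (findv_spec hc (P := fun v => ¬ X.Hit (1 - i) N v ∧ ¬ X.Hit i (X.a ^ 2) v) 2 (by decide)
    (by decide) (by decide) (by decide) (by decide) rfl rfl rfl ?_).call ?_
  · rintro v hv h₃ hf₃ h5
    have hc₃ := hc.frame hf₃ rfl
    have hM₃ : h₃.reg ρM = i := by rw [hf₃.reg _ rfl, hM]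
    have hJ₃ : h₃.reg ρJ = 1 - i := by rw [hf₃.reg _ rfl, hJ]
    have hhit₃ : h₃.arr αhit = h.arr αhit := hf₃.arr _ rfl
    have e2 := hhit.S (1 - i) (by omega) v hv
    have e3 := hhit.R i hi v hv
    simp only [wp_seq, wp_ld]
    simp [h5, hM₃, hJ₃, hhit₃, hc₃.r2n]
    repeat refine ⟨by omega, ?_⟩
    rw [← e2, ← e3, not_not, not_not]
  rintro h₃ hf₃ ⟨h5, h6⟩
  have hc₃ := hc.frame hf₃ rfl
  have hM₃ : h₃.reg ρM = i := by rw [hf₃.reg _ rfl, hM]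
  have hJ₃ : h₃.reg ρJ = 1 - i := by rw [hf₃.reg _ rfl, hJ]
  have hr₃ : h₃.reg ρr = h.reg ρr := hf₃.reg _ rfl
  have hS₃ := ((Srch.of_frame (X := X) (F := True) (t := 7 * X.n + 3) hf₃ rfl rfl rfl
    (by clear h5; omega) trivial)).tick
  simp only [wp_ite, Exp.ok_var, Exp.ev_var, true_and]
  refine ⟨fun h7 => ?_, fun h7 => ?_⟩
  · rcases h5 with ⟨h5, -⟩ | ⟨W, hW, h5, h8, h9⟩
    · exact absurd h5 h7
    refine (unhitBall_spec (N := N) hc₃.tick hi hM₃ hJ₃ hW h5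
      (by simp [hr₃]; omega) h8 h9).mono fun h₄ hS₄ => ?_
    rw [HState.tick_reg, hr₃] at hS₄
    exact (hS₃.trans hS₄).mono (fun hF => hF.2) (by omega)
  · simp only [Cmd.skip, wp_asg]
    refine ⟨by simp; omega, (hS₃.set (by decide) (by decide) (by decide)).mono (fun _ _ _ => ?_)
      (by clear h5; omega)⟩
    rcases h5 with ⟨-, h5⟩ | ⟨W, hW, h5, -⟩
    · intro x hx y _ h8 h9 _ _
      exact h5 x hx ⟨h8, h9⟩
    · omega

/-- The searches that use the samples and the vertices that are not hit. -/
def search : Cmd :=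
  .asg ρtwo 2 ;;
  .for' ρM ρtwo (.asg ρJ (1 - .var ρM) ;; .for' ρk ρa2 star ;; unhit)

/-- Two kinds of searches of about the same cost: `a ^ 2` samples with a ball of at most `r`
vertices each, and `a ^ 2 * l` times `r` pairs from the balls about one unhit vertex. -/
theorem search_spec (hc : Ctx X h) {N : ℕ} (hr : 2 * h.reg ρr + 2 < E.B)
    (hhit : HitOK X N (h.arr αhit)) :
    wp E search (Srch X (X.Good N (h.reg ρr) → X.Good (X.a ^ 2) (X.a ^ 2 * X.l) →
      ∀ i < 2, (∀ k < X.a ^ 2, X.NoStar N i (X.smp k)) ∧ X.NoUnhit N i)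
      (1500 * (X.m * X.a ^ 2 * (h.reg ρr + 1) * (X.l + 1))) h) h := by
  have hB := X.hundred_lt
  have hβ := X.β_lt
  have hn := X.n_pos
  have hnm := X.n_le_m
  have ha2 := X.pow_a_le (k := 2) (by omega)
  have ha3 := X.pow_a_le (k := 3) (by omega)
  have ha23 : X.a ^ 2 ≤ X.a ^ 3 := Nat.pow_le_pow_right X.a_pos (by omega)
  rw [search, wp_seq, wp_asg]
  refine ⟨by simp; omega, ?_⟩
  refine wp_for_srch (X := X) (J := fun _ _ => True) (F := fun i => X.Good N (h.reg ρr) →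
      X.Good (X.a ^ 2) (X.a ^ 2 * X.l) → (∀ k < X.a ^ 2, X.NoStar N i (X.smp k)) ∧ X.NoUnhit N i)
    (t := 163 * X.m + (325 * X.m * h.reg ρr + 5) * (X.a ^ 2 * X.l) +
      (200 * X.m + 170 * X.m * h.reg ρr + 2) * X.a ^ 2)
    (by decide) rfl rfl (by decide) (by simp; omega) trivial ?_ ?_
  · intro i hi h₁ hf h1 h2 _
    have hi : i < 2 := by simpa using hi
    have hc₁ := (hc.set rfl).frame hf rfl
    have hr₁ : h₁.reg ρr = h.reg ρr := by rw [hf.reg _ rfl]; simp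
    have hhit₁ : h₁.arr αhit = h.arr αhit := by rw [hf.arr _ rfl]; simp
    simp only [wp_seq, wp_asg]
    simp only [Exp.ok_sub, Exp.ok_ofNat, Exp.ok_var, Exp.ev_var, Exp.ev_ofNat, Exp.ev_sub,
      HState.tick_reg, h1]
    refine ⟨by simp; omega, ?_⟩
    have hc₂ := hc₁.tick.set (r := ρJ) (x := 1 - i) rfl
    refine wp_for_srch (X := X) (J := fun _ _ => True) (F := fun k => X.Good N (h.reg ρr) →
      X.NoStar N i (X.smp k)) (t := 200 * X.m + 170 * X.m * h.reg ρr)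
      (by decide) rfl rfl (by decide) (by rw [hc₂.ra2]; omega) trivial ?_ ?_
    · intro k hk h₂ hf₂ h3 h4 _
      rw [hc₂.ra2] at hk
      have hc₃ := hc₂.frame hf₂ rfl
      have hM₂ : h₂.reg ρM = i := by rw [hf₂.reg _ rfl]; simp [h1]
      have hJ₂ : h₂.reg ρJ = 1 - i := by rw [hf₂.reg _ rfl]; simp
      have hr₂ : h₂.reg ρr = h.reg ρr := by rw [hf₂.reg _ rfl]; simp [hr₁]
      have hhit₂ : h₂.arr αhit = h.arr αhit := by rw [hf₂.arr _ rfl]; simp [hhit₁]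
      refine (star_spec (N := N) hc₃.tick hi hM₂ hJ₂ h3 (by omega) (by simp [hr₂]; omega)
        (by simpa [hhit₂] using hhit)).mono fun h₃ hS₃ => ⟨?_, trivial⟩
      simpa only [HState.tick_reg, hr₂] using hS₃
    · intro h₂ hf₂ _ hS₂
      rw [hc₂.ra2] at hS₂
      have hc₃ := hc₂.frame hf₂ rfl
      have hM₂ : h₂.reg ρM = i := by rw [hf₂.reg _ rfl]; simp [h1]
      have hJ₂ : h₂.reg ρJ = 1 - i := by rw [hf₂.reg _ rfl]; simp
      have hr₂ : h₂.reg ρr = h.reg ρr := by rw [hf₂.reg _ rfl]; simp [hr₁]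
      have hhit₂ : h₂.arr αhit = h.arr αhit := by rw [hf₂.arr _ rfl]; simp [hhit₁]
      refine (unhit_spec (N := N) hc₃.tick hi hM₂ hJ₂ (by simp [hr₂]; omega)
        (by simpa [hhit₂] using hhit)).mono fun h₃ hS₃ => ⟨?_, trivial⟩
      simp only [HState.tick_reg, hr₂] at hS₃
      exact ((((Srch.of_eq (t := 0) (F := True) (h := h₁.tick) (h' := h₁.tick) rfl rfl rfl
        (by omega) trivial).set (by decide) (by decide) (by decide)).trans hS₂).trans hS₃).mono
        (fun hF g1 g2 => ⟨fun k hk => hF.1.2 k hk g1, hF.2 g1 g2⟩) (by omega)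
  · intro h₁ hf _ hS₁
    refine (((Srch.of_eq (t := 0) (F := True) (h := h) (h' := h) rfl rfl rfl
        (by omega) trivial).set (by decide) (by decide) (by decide)).trans hS₁).mono
        (fun hF g1 g2 i hi => hF.2 i (by simpa using hi) g1 g2) ?_
    have h1 := Nat.one_le_pow 2 X.a X.a_pos
    simp only [HState.set_reg, if_true, Exp.ev_ofNat]
    generalize X.a ^ 2 = A at *
    generalize h.reg ρr = r at *
    have hm : 1 ≤ X.m := by omega
    generalize X.m = m at *
    generalize X.l = l at *
    have e1 : m ≤ m * A := Nat.le_mul_of_pos_right _ h1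
    have e2 : A ≤ m * A := Nat.le_mul_of_pos_left _ hm
    have e3 : A * l ≤ m * A * l := Nat.mul_le_mul_right _ e2
    have e4 : m * A * (r + 1) * (l + 1) = m * A * r * l + m * A * r + m * A * l + m * A := by ring
    have e5 : (325 * m * r + 5) * (A * l) = 325 * (m * A * r * l) + 5 * (A * l) := by ring
    have e6 : (200 * m + 170 * m * r + 2) * A = 200 * (m * A) + 170 * (m * A * r) + 2 * A := by ring
    rw [e4, e5, e6]
    omega

end WordRAM

namespace WordRAM

variable {E : Env} {X : Inst E} {h : HState} {Q : HState → Prop}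

/-! ### Distances from the sample -/

notation "αcode0" => 6
notation "αcode1" => 7

notation "ρnum" => 54
notation "ρoff" => 55
notation "ρsi" => 56
notation "ρrow" => 57

/-- For the first `reg ρnum` samples, compute which vertices are hit, and the matrices that code
which vertices are near and far. -/
def sampleRow : Cmd :=
  .ld ρd0 αdist (2 * .var ρy) ;; .ld ρd1 αdist (2 * .var ρy + 1) ;;
  .st αcode0 (.var ρrow + .var ρy)
    (.le (.var ρd0) (.var ρq) + .var ρβ * .le (.var ρ3q) (.var ρd0)) ;;
  .st αcode1 (.var ρrow + .var ρy)
    (.le (.var ρd1) (.var ρq) + .var ρβ2 * .le (.var ρ3q) (.var ρd1)) ;;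
  .ite (.le (.var ρd0) (.var ρq)) (.st αhit (.var ρoff + 2 * .var ρy) 1) .skip ;;
  .ite (.le (.var ρd1) (.var ρq)) (.st αhit (.var ρoff + (2 * .var ρy + 1)) 1) .skip

/-- The offset `ρoff` selects one of two tables in `αhit`: from `0` on for the first `N` samples,
from `2 * n` on for the first `a ^ 2`. -/
def sample : Cmd :=
  .for' ρy ρ2n (.st αhit (.var ρoff + .var ρy) 0) ;;
  .for' ρsi ρnum (
    .ld ρt αsmp (.var ρsi) ;; .asg ρrow (.var ρsi * .var ρn) ;; bfs2 ;;
    .for' ρy ρn sampleRow)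

namespace Inst

open Classical in
/-- Near is coded by `1`, far by `β ^ (i + 1)`. -/
noncomputable def code (X : Inst E) (i s v : ℕ) : ℕ :=
  (if X.Near i (X.smp s) v then 1 else 0) + X.β ^ (i + 1) * (if X.Far i (X.smp s) v then 1 else 0)

theorem hit_succ {i N v : ℕ} : X.Hit i (N + 1) v ↔ X.Hit i N v ∨ X.Near i (X.smp N) v := by
  constructor
  · rintro ⟨k, hk, h1⟩
    rcases Nat.lt_succ_iff_lt_or_eq.1 hk with h2 | rfl
    · exact Or.inl ⟨k, h2, h1⟩
    · exact Or.inr h1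
  · rintro (⟨k, hk, h1⟩ | h1)
    · exact ⟨k, by omega, h1⟩
    · exact ⟨N, by omega, h1⟩

end Inst

/-- The results for the first `N` samples. -/
structure SampleInv (X : Inst E) (off N : ℕ) (h h' : HState) : Prop where
  hit : ∀ i < 2, ∀ v < X.n, h'.arr αhit (off + (2 * v + i)) ≠ 0 ↔ X.Hit i N v
  other : ∀ x, (x < off ∨ off + 2 * X.n ≤ x) → h'.arr αhit x = h.arr αhit x
  code0 : ∀ s < N, ∀ v < X.n, h'.arr αcode0 (s * X.n + v) = X.code 0 s v
  code1 : ∀ s < N, ∀ v < X.n, h'.arr αcode1 (s * X.n + v) = X.code 1 s v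

theorem row_inj {n s s' v v' : ℕ} (hv : v < n) (hv' : v' < n) :
    s * n + v = s' * n + v' ↔ s = s' ∧ v = v' := by
  constructor
  · intro h
    have h1 : (s * n + v) / n = s := by
      rw [Nat.mul_comm, Nat.mul_add_div (by omega), Nat.div_eq_of_lt hv, Nat.add_zero]
    have h2 : (s' * n + v') / n = s' := by
      rw [Nat.mul_comm, Nat.mul_add_div (by omega), Nat.div_eq_of_lt hv', Nat.add_zero]
    have h3 : s = s' := by rw [← h1, h, h2]
    subst h3
    exact ⟨rfl, by omega⟩
  · rintro ⟨rfl, rfl⟩; rfl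

open Classical in
theorem sampleRow_spec (hc : Ctx X h) {k y off row : ℕ} (hy : h.reg ρy = y) (hyn : y < X.n)
    (hrow : h.reg ρrow = row) (hrowB : row + X.n < E.B) (hoff : h.reg ρoff = off)
    (hoff' : off ≤ 2 * X.n) (e0 : h.arr αdist (2 * y) = X.d 0 (X.smp k) y)
    (e1 : h.arr αdist (2 * y + 1) = X.d 1 (X.smp k) y) :
    wp E sampleRow (fun h' =>
      (∀ x, h'.arr αhit x = if X.Near 0 (X.smp k) y ∧ x = off + 2 * y then 1 else
        if X.Near 1 (X.smp k) y ∧ x = off + (2 * y + 1) then 1 else h.arr αhit x) ∧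
      (∀ x, h'.arr αcode0 x = if x = row + y then X.code 0 k y else h.arr αcode0 x) ∧
      (∀ x, h'.arr αcode1 x = if x = row + y then X.code 1 k y else h.arr αcode1 x) ∧
      h'.time ≤ h.time + 9) h := by
  have hB := X.hundred_lt
  have hn8 := X.n8_le
  have hβ := X.β_lt
  have hβ2 := X.β2_lt
  have h8 := X.β_ge
  have hq := X.q_pos
  have hββ : X.β ≤ X.β ^ 2 := by nlinarith
  have b0 : X.β * (if 3 * X.q ≤ X.d 0 (X.smp k) y then 1 else 0) ≤ X.β := by
    split_ifs <;> simp
  have b1 : X.β ^ 2 * (if 3 * X.q ≤ X.d 1 (X.smp k) y then 1 else 0) ≤ X.β ^ 2 := by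
    split_ifs <;> simp
  have c0 : (if X.d 0 (X.smp k) y ≤ X.q then 1 else 0) +
      X.β * (if 3 * X.q ≤ X.d 0 (X.smp k) y then 1 else 0) = X.code 0 k y := by
    simp only [Inst.code, Inst.Near, Inst.Far, zero_add, pow_one]; split_ifs <;> simp [*]
  have c1 : (if X.d 1 (X.smp k) y ≤ X.q then 1 else 0) +
      X.β ^ 2 * (if 3 * X.q ≤ X.d 1 (X.smp k) y then 1 else 0) = X.code 1 k y := by
    simp only [Inst.code, Inst.Near, Inst.Far, Nat.reduceAdd]; split_ifs <;> simp [*]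
  have d0 : X.code 0 k y ≤ X.β := by rw [← c0]; split_ifs <;> omega
  have d1 : X.code 1 k y ≤ X.β ^ 2 := by
    rw [← c1]; split_ifs <;> omega
  have n0 : X.d 0 (X.smp k) y ≤ X.q ↔ X.Near 0 (X.smp k) y := Iff.rfl
  have n1 : X.d 1 (X.smp k) y ≤ X.q ↔ X.Near 1 (X.smp k) y := Iff.rfl
  simp only [sampleRow, wp_seq, wp_ld, wp_st, wp_ite, Cmd.skip, wp_asg]
  simp [-mul_ite, -HState.D_eq, hy, e0, e1, hc.rq, hc.r3q, hc.rβ, hc.rβ2, hrow, hoff, c0, c1]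
  generalize X.code 0 k y = C0 at *
  generalize X.code 1 k y = C1 at *
  repeat refine ⟨by omega, ?_⟩
  refine ⟨fun p0 => ?_, fun p0 => ⟨by omega, ?_⟩⟩
  · repeat refine ⟨by omega, ?_⟩
    have m0 := n0.1 p0
    refine ⟨fun p1 => ?_, fun p1 => ⟨by omega, fun x => ?_⟩⟩
    · repeat refine ⟨by omega, ?_⟩
      have m1 := n1.1 p1
      intro x
      by_cases hx : x = off + (2 * y + 1)
      · simp [m0, m1, hx]
      · simp [m0, hx]
    · have m1 : ¬ X.Near 1 (X.smp k) y := fun hh => by have := n1.2 hh; omega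
      simp [m0, m1]
  · have m0 : ¬ X.Near 0 (X.smp k) y := fun hh => by have := n0.2 hh; omega
    refine ⟨fun p1 => ?_, fun p1 => ⟨by omega, fun x => ?_⟩⟩
    · repeat refine ⟨by omega, ?_⟩
      have m1 := n1.1 p1
      intro x
      simp [m0, m1]
    · have m1 : ¬ X.Near 1 (X.smp k) y := fun hh => by have := n1.2 hh; omega
      simp [m0, m1]

theorem sample_spec (hc : Ctx X h) {N off : ℕ} (hN : h.reg ρnum = N) (hN' : N ≤ X.a ^ 3)
    (hoff : h.reg ρoff = off) (hoff' : off ≤ 2 * X.n) :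
    wp E sample (fun h' => SampleInv X off N h h' ∧ h'.time ≤ h.time + 120 * X.m * (N + 1)) h := by
  have hB := X.hundred_lt
  have hn8 := X.n8_le
  have hβ := X.β_lt
  have hβ2 := X.β2_lt
  have hn := X.n_pos
  have hnm := X.n_le_m
  have ha3 := X.pow_a_le (k := 3) (by omega)
  have h8 := X.β_ge
  have hββ : X.β * X.β = X.β ^ 2 := by ring
  rw [sample, wp_seq]
  refine wp_for (fun k h₁ => (∀ x, off ≤ x → x < off + k → h₁.arr αhit x = 0) ∧
    (∀ x, (x < off ∨ off + 2 * X.n ≤ x) → h₁.arr αhit x = h.arr αhit x) ∧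
    h₁.time ≤ h.time + 1 + 3 * k) (by decide) rfl rfl (by omega) (by rw [hc.r2n]; omega) ?_ ?_ ?_
  · simp; omega
  · rintro k hk h₁ hf h1 h2 ⟨h3, h4, h5⟩
    rw [hc.r2n] at hk
    have ho : h₁.reg ρoff = off := (hf.reg _ rfl).trans hoff
    simp [h1, ho]
    repeat refine ⟨by omega, ?_⟩
    refine ⟨fun x hx1 hx2 hx3 => h3 x hx1 (by omega), fun x hx => ?_, by omega⟩
    rw [if_neg (by omega)]
    exact h4 x hx
  rintro h₁ hf ⟨h3, h4, h5⟩
  rw [hc.r2n] at h3 h5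
  have hc₁ := (hc.frame hf rfl).tick
  have hN₁ : h₁.tick.reg ρnum = N := (hf.reg _ rfl).trans hN
  have hoff₁ : h₁.tick.reg ρoff = off := (hf.reg _ rfl).trans hoff
  refine wp_for (fun k h₂ => SampleInv X off k h h₂ ∧ h₂.time ≤ h₁.time + 2 + 110 * X.m * k)
    (by decide) rfl rfl (by omega) (by omega) ?_ ?_ ?_
  · refine ⟨⟨fun i hi v hv => ?_, fun x hx => h4 x hx, by simp, by simp⟩, by simp⟩
    simp only [HState.set_arr, HState.tick_arr]
    rw [h3 _ (by omega) (by omega)]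
    simp [Inst.Hit]
  · rintro k hk h₂ hf₂ h6 h7 ⟨hI, h8⟩
    rw [hN₁] at hk
    have hc₂ := (hc₁.frame hf₂ rfl).tick
    have hoff₂ : h₂.reg ρoff = off := (hf₂.reg _ rfl).trans hoff₁
    have hkn : k * X.n ≤ X.β * X.n := Nat.mul_le_mul_right _ (by omega)
    have hkn' : X.β * X.n + X.n < E.B := by nlinarith
    have hs₂ := hc₂.smp k (by omega)
    have hsn := X.smp_lt k
    simp [h6, hc₂.rn] at hs₂ ⊢
    repeat refine ⟨by omega, ?_⟩
    rw [hs₂]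
    refine (bfs2_spec ((hc₂.set rfl).set rfl) (by simpa using hsn)).call ?_
    rintro h₃ hf₃ ⟨h9, h10⟩
    simp at h9 h10
    have hc₃ := ((hc₂.set rfl).set rfl).frame hf₃ rfl
    have hrow₃ : h₃.reg ρrow = k * X.n := by rw [hf₃.reg _ rfl]; simp
    have hoff₃ : h₃.reg ρoff = off := by rw [hf₃.reg _ rfl]; simp [hoff₂]
    have hhit₃ : h₃.arr αhit = h₂.arr αhit := by rw [hf₃.arr _ rfl]; simp
    have h0₃ : h₃.arr αcode0 = h₂.arr αcode0 := by rw [hf₃.arr _ rfl]; simp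
    have h1₃ : h₃.arr αcode1 = h₂.arr αcode1 := by rw [hf₃.arr _ rfl]; simp
    refine wp_for (fun y h₄ => (∀ i < 2, ∀ v < X.n, h₄.arr αhit (off + (2 * v + i)) ≠ 0 ↔
        X.Hit i k v ∨ (v < y ∧ X.Near i (X.smp k) v)) ∧
      (∀ x, (x < off ∨ off + 2 * X.n ≤ x) → h₄.arr αhit x = h.arr αhit x) ∧
      (∀ s < k + 1, ∀ v < X.n, (s = k → v < y) → h₄.arr αcode0 (s * X.n + v) = X.code 0 s v) ∧
      (∀ s < k + 1, ∀ v < X.n, (s = k → v < y) → h₄.arr αcode1 (s * X.n + v) = X.code 1 s v) ∧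
      h₄.time ≤ h₃.time + 1 + 11 * y) (by decide) rfl rfl (by omega) (by rw [hc₃.rn]; omega)
      ?_ ?_ ?_
    · refine ⟨fun i hi v hv => ?_, fun x hx => ?_, fun s hs v hv hsv => ?_,
        fun s hs v hv hsv => ?_, by simp⟩
      · simpa [hhit₃] using hI.hit i hi v hv
      · simpa [hhit₃] using hI.other x hx
      · have hsk : s ≠ k := fun hsk => by simpa using hsv hsk
        simpa [h0₃] using hI.code0 s (by omega) v hv
      · have hsk : s ≠ k := fun hsk => by simpa using hsv hsk
        simpa [h1₃] using hI.code1 s (by omega) v hv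
    · rintro y hy h₄ hf₄ h11 h12 ⟨a1, a2, a3, a4, a5⟩
      rw [hc₃.rn] at hy
      have hc₄ := hc₃.frame hf₄ rfl
      have hrow₄ : h₄.reg ρrow = k * X.n := (hf₄.reg _ rfl).trans hrow₃
      have hoff₄ : h₄.reg ρoff = off := (hf₄.reg _ rfl).trans hoff₃
      have e0 : h₄.D 0 y = X.d 0 (X.smp k) y := by
        rw [HState.D, hf₄.arr _ rfl]; exact h9 0 (by omega) y hy
      have e1 : h₄.D 1 y = X.d 1 (X.smp k) y := by
        rw [HState.D, hf₄.arr _ rfl]; exact h9 1 (by omega) y hy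
      have e0' : h₄.arr αdist (2 * y) = X.d 0 (X.smp k) y := e0
      have hck : ∀ s < k + 1, ∀ v < X.n, (s = k → v < y + 1) → ¬ (s * X.n + v = k * X.n + y) →
          (s = k → v < y) := by
        intro s hs v hv h1 h2 h3
        subst h3
        have := h1 rfl
        omega
      refine (sampleRow_spec (k := k) hc₄.tick h11 hy hrow₄ (by omega) hoff₄ hoff' e0' e1).mono ?_
      rintro h₅ ⟨g1, g2, g3, g4⟩
      simp only [HState.tick_arr, HState.tick_time] at g1 g2 g3 g4
      refine ⟨fun i hi v hv => ?_, fun x hx => ?_, fun s hs v hv hsv => ?_,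
        fun s hs v hv hsv => ?_, by simp; omega⟩
      · have g5 := a1 i hi v hv
        simp only [HState.set_arr]
        rw [g1]
        obtain rfl | rfl : i = 0 ∨ i = 1 := by omega
        · rw [if_neg (show ¬ (X.Near 1 (X.smp k) y ∧ off + (2 * v + 0) = off + (2 * y + 1)) by
            omega)]
          by_cases hvy : v = y
          · subst hvy
            by_cases hP : X.Near 0 (X.smp k) v
            · simp [hP]
            · rw [if_neg (by tauto), g5]; simp [hP]
          · rw [if_neg (by omega), g5, show v < y + 1 ↔ v < y by omega]
        · rw [if_neg (show ¬ (X.Near 0 (X.smp k) y ∧ off + (2 * v + 1) = off + (2 * y)) by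
            omega)]
          by_cases hvy : v = y
          · subst hvy
            by_cases hP : X.Near 1 (X.smp k) v
            · simp [hP]
            · rw [if_neg (by tauto), g5]; simp [hP]
          · rw [if_neg (by omega), g5, show v < y + 1 ↔ v < y by omega]
      · simp only [HState.set_arr]
        rw [g1, if_neg (by omega), if_neg (by omega)]
        exact a2 x hx
      · simp only [HState.set_arr]
        rw [g2]
        split_ifs with g6
        · obtain ⟨rfl, rfl⟩ := (row_inj hv hy).1 g6; rfl
        · exact a3 s hs v hv (hck s hs v hv hsv g6)
      · simp only [HState.set_arr]
        rw [g3]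
        split_ifs with g6
        · obtain ⟨rfl, rfl⟩ := (row_inj hv hy).1 g6; rfl
        · exact a4 s hs v hv (hck s hs v hv hsv g6)
    · rintro h₄ hf₄ ⟨a1, a2, a3, a4, a5⟩
      rw [hc₃.rn] at a1 a3 a4 a5
      refine ⟨⟨fun i hi v hv => ?_, a2, fun s hs v hv => a3 s hs v hv fun _ => hv,
        fun s hs v hv => a4 s hs v hv fun _ => hv⟩, ?_⟩
      · have := a1 i hi v hv
        simp only [HState.set_arr, HState.tick_arr]
        rw [this, Inst.hit_succ]
        simp [hv]
      · simp only [HState.tick_time, Nat.mul_add, Nat.mul_one]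
        omega
  · rintro h₂ hf₂ ⟨hI, h8⟩
    rw [hN₁] at hI h8
    refine ⟨⟨hI.hit, hI.other, hI.code0, hI.code1⟩, ?_⟩
    simp only [HState.tick_time]
    have : 120 * X.m * (N + 1) = 110 * X.m * N + 10 * X.m * N + 120 * X.m := by ring
    omega

end WordRAM

namespace WordRAM

/-! ### Simulation of a program for a smaller word size, with bounded time -/

/-- The simulation produces a run, the hypothesis on the multiplication program another one;
determinism identifies them. -/
theorem Run.unique {w : ℕ} {tape : ℕ → Bool} {p : Prog} {s s₁ s₂ : State w} {t₁ t₂ : ℕ}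
    (h1 : Run tape p s t₁ s₁) (h2 : Run tape p s t₂ s₂) : t₁ = t₂ ∧ s₁ = s₂ := by
  induction h1 generalizing t₂ s₂ with
  | const | op | load | store | coin => cases h2; exact ⟨rfl, rfl⟩
  | seq _ _ ih1 ih2 =>
    cases h2 with
    | seq a b =>
      obtain ⟨rfl, rfl⟩ := ih1 a
      obtain ⟨rfl, rfl⟩ := ih2 b
      exact ⟨rfl, rfl⟩
  | branch_true h0 _ ih =>
    cases h2 with
    | branch_true _ a => obtain ⟨rfl, rfl⟩ := ih a; exact ⟨rfl, rfl⟩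
    | branch_false h3 _ => exact absurd h3 h0
  | branch_false h0 _ ih =>
    cases h2 with
    | branch_true h3 _ => exact absurd h0 h3
    | branch_false _ a => obtain ⟨rfl, rfl⟩ := ih a; exact ⟨rfl, rfl⟩
  | loop_true h0 _ _ ih1 ih2 =>
    cases h2 with
    | loop_true _ a b =>
      obtain ⟨rfl, rfl⟩ := ih1 a
      obtain ⟨rfl, rfl⟩ := ih2 b
      exact ⟨rfl, rfl⟩
    | loop_false h3 => exact absurd h3 h0
  | loop_false h0 =>
    cases h2 with
    | loop_true h3 _ _ => exact absurd h0 h3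
    | loop_false _ => exact ⟨rfl, rfl⟩

/-- A bound for the registers and constants of a program. -/
def Prog.top : Prog → ℕ
  | .const r k => r + k + 1
  | .op _ r a b => r + a + b + 1
  | .load r a => r + a + 1
  | .store a r => r + a + 1
  | .coin r => r + 1
  | .seq p q => p.top + q.top
  | .branch r p q => r + 1 + p.top + q.top
  | .loop r p => r + 1 + p.top

/-- The size of a program. -/
def Prog.size : Prog → ℕ
  | .seq p q => p.size + q.size
  | .branch _ p q => p.size + q.size + 1
  | .loop _ p => p.size + 2
  | _ => 1

notation "αmem" => 15
notation "ρfu" => 58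
notation "ρmo" => 59

/-- Simulation with words modulo `reg ρZ`, random bits `0`, memory in the array `αmem` from
`reg ρmo` on, and at most `reg ρfu` repetitions of loops. -/
def Prog.sim : Prog → Cmd
  | .const r k => .asg (64 + r) (.lit k % .var ρZ)
  | .op o r a b => .asg (64 + r) (.raw o (.var (64 + a)) (.var (64 + b)) % .var ρZ)
  | .load r a => .ld (64 + r) αmem (.var ρmo + .var (64 + a))
  | .store a r => .st αmem (.var ρmo + .var (64 + a)) (.var (64 + r))
  | .coin r => .asg (64 + r) 0
  | .seq p q => p.sim ;; q.sim
  | .branch r p q => .ite (.var (64 + r)) p.sim q.sim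
  | .loop r p => .whl (.and (.var (64 + r)) (.var ρfu)) (.asg ρfu (.var ρfu - 1) ;; p.sim)

theorem Prog.sim_W (p : Prog) {r : ℕ} (hr : r < 64) (hr' : r ≠ ρfu) : p.sim.W r = false := by
  induction p with
  | seq _ _ h1 h2 => simp [sim, Cmd.W, h1, h2]
  | branch _ _ _ h1 h2 => simp [sim, Cmd.W, h1, h2]
  | loop _ _ h1 => simp [sim, Cmd.W, h1, hr']
  | store => rfl
  | _ => simp [sim, Cmd.W]; omega

theorem Prog.sim_WA (p : Prog) {a : ℕ} (ha : a ≠ αmem) : p.sim.WA a = false := by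
  induction p with
  | seq _ _ h1 h2 => simp [sim, Cmd.WA, h1, h2]
  | branch _ _ _ h1 h2 => simp [sim, Cmd.WA, h1, h2]
  | loop _ _ h1 => simp [sim, Cmd.WA, h1]
  | store => simp [sim, Cmd.WA, ha]
  | _ => rfl

/-- Sums, differences, products and left shifts may be reduced modulo `2 ^ v` at the end because `2
^ v` divides `2 ^ w`. The other operations give results below `2 ^ v` anyway. -/
theorem Op.word_mod {v w : ℕ} (hv : 0 < v) (hvw : v ≤ w) (o : Op) (x y : BitVec v) :
    o.word w x.toNat y.toNat % 2 ^ v = (o.eval x y).toNat := by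
  have hx := x.isLt
  have hy := y.isLt
  have hd : 2 ^ v ∣ 2 ^ w := Nat.pow_dvd_pow 2 hvw
  have hle : 2 ^ v ≤ 2 ^ w := Nat.pow_le_pow_right (by omega) hvw
  have e1 : x.toNat % 2 ^ w = x.toNat := Nat.mod_eq_of_lt (by omega)
  have e2 : y.toNat % 2 ^ w = y.toNat := Nat.mod_eq_of_lt (by omega)
  have h1 : 1 < 2 ^ v := Nat.one_lt_two_pow (by omega)
  unfold Op.word
  cases o <;> simp only [Op.eval]
  · simp [e1, e2, Nat.mod_mod_of_dvd _ hd]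
  · simp only [BitVec.toNat_sub, BitVec.toNat_ofNat, e1, e2, Nat.mod_mod_of_dvd _ hd]
    obtain ⟨c, hc⟩ := hd
    have hc0 : 0 < c := Nat.pos_of_ne_zero (by rintro rfl; simp at hc)
    obtain ⟨c, rfl⟩ : ∃ c', c = c' + 1 := ⟨c - 1, by omega⟩
    -- The two ways to avoid a negative difference differ by a multiple of `2 ^ v`.
    rw [show 2 ^ w - y.toNat + x.toNat = (2 ^ v - y.toNat + x.toNat) + 2 ^ v * c by
      rw [hc, Nat.mul_add]; omega]
    exact Nat.add_mul_mod_self_left _ _ _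
  · simp [e1, e2, Nat.mod_mod_of_dvd _ hd]
  · simp only [BitVec.toNat_udiv, BitVec.toNat_ofNat, e1, e2]
    exact Nat.mod_eq_of_lt ((Nat.div_le_self _ _).trans_lt hx)
  · simp only [BitVec.toNat_umod, BitVec.toNat_ofNat, e1, e2]
    exact Nat.mod_eq_of_lt ((Nat.mod_le _ _).trans_lt hx)
  · simp only [BitVec.toNat_and, BitVec.toNat_ofNat, e1, e2]
    exact Nat.mod_eq_of_lt (Nat.and_lt_two_pow _ hy)
  · simp only [BitVec.toNat_or, BitVec.toNat_ofNat, e1, e2]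
    exact Nat.mod_eq_of_lt (Nat.or_lt_two_pow hx hy)
  · simp only [BitVec.toNat_xor, BitVec.toNat_ofNat, e1, e2]
    exact Nat.mod_eq_of_lt (Nat.xor_lt_two_pow hx hy)
  · simp [e1, e2, Nat.mod_mod_of_dvd _ hd]
  · simp only [BitVec.ushiftRight_eq', BitVec.toNat_ushiftRight, BitVec.toNat_ofNat, e1, e2]
    exact Nat.mod_eq_of_lt (lt_of_le_of_lt (by rw [Nat.shiftRight_eq_div_pow]; exact Nat.div_le_self _ _) hx)
  · rw [toNat_boole _ (by omega), toNat_boole _ hv]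
    simp only [BitVec.lt_def, BitVec.toNat_ofNat, e1, e2]
    split_ifs <;> simp [Nat.mod_eq_of_lt h1]
  · rw [toNat_boole _ (by omega), toNat_boole _ hv]
    simp only [← BitVec.toNat_inj, BitVec.toNat_ofNat, e1, e2]
    split_ifs <;> simp [Nat.mod_eq_of_lt h1]

/-- The state `h` represents the machine state `s` with word size `v`. -/
structure Sim (v b off : ℕ) (s : State v) (h : HState) : Prop where
  reg : ∀ r < b, h.reg (64 + r) = (s.reg r).toNat
  mem : ∀ x < 2 ^ v, h.arr αmem (off + x) = (s.mem (BitVec.ofNat v x)).toNat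

/-- What the simulation needs. -/
structure SimEnv (E : Env) (v b off : ℕ) (h : HState) : Prop where
  pos : 0 < v
  le : v ≤ E.w
  top : b ≤ E.B
  fits : off + 2 ^ v ≤ E.B
  Z : h.reg ρZ = 2 ^ v
  mo : h.reg ρmo = off

/-- The array `αmem` is unchanged except in the part from `off` to `off + 2 ^ v`. -/
def MemEq (v off : ℕ) (h h' : HState) : Prop :=
  ∀ x, (x < off ∨ off + 2 ^ v ≤ x) → h'.arr αmem x = h.arr αmem x

/-- The simulation of `p` either shows that `p` halts, or uses up the fuel. -/
structure SimRes (v b off : ℕ) (p : Prog) (s : State v) (h h' : HState) (s' : State v) :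
    Prop where
  sim : Sim v b off s' h'
  mem : MemEq v off h h'
  fuel : h'.reg ρfu ≤ h.reg ρfu
  time : h'.time ≤ h.time + p.size * (1 + (h.reg ρfu - h'.reg ρfu))
  res : (∃ t, Run (fun _ => false) p s t s' ∧ h.reg ρfu ≤ h'.reg ρfu + t) ∨
    (h'.reg ρfu = 0 ∧ ∀ t s'', Run (fun _ => false) p s t s'' → h.reg ρfu ≤ t)

section

variable {E : Env} {v b off : ℕ} {s : State v} {h h' : HState}

theorem SimEnv.frame (H : SimEnv E v b off h) {p : Prog} (hf : Frame p.sim h h') :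
    SimEnv E v b off h' :=
  ⟨H.pos, H.le, H.top, H.fits, by rw [hf.reg _ (p.sim_W (by decide) (by decide)), H.Z],
    by rw [hf.reg _ (p.sim_W (by decide) (by decide)), H.mo]⟩

theorem Sim.setReg (H : Sim v b off s h) {r : ℕ} {x : BitVec v} {y : ℕ} (hy : y = x.toNat) :
    Sim v b off (s.setReg r x) (h.set (64 + r) y) := by
  refine ⟨fun r' hr' => ?_, H.mem⟩
  simp only [HState.set_reg, State.setReg, Function.update_apply]
  by_cases hh : r' = r
  · simp [hh, hy]
  · simp [hh, H.reg r' hr']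

theorem SimRes.of_step {p : Prog} {s' : State v} {r y : ℕ}
    (hp : p.size = 1) (hs : Sim v b off s' (h.set (64 + r) y))
    (hr : Run (fun _ => false) p s 1 s') : SimRes v b off p s h (h.set (64 + r) y) s' := by
  have h1 : (h.set (64 + r) y).reg ρfu = h.reg ρfu := by simp; omega
  refine ⟨hs, fun x _ => rfl, h1.le, ?_, Or.inl ⟨1, hr, by omega⟩⟩
  rw [hp]; simp

/-- Only loops use fuel, one unit per pass, so a simulation takes at most `size` times one more than
the fuel used. Once the fuel is gone, loops are left early and the simulated state means nothing;
but then a true run must take at least as many steps as there was fuel, and this is all that is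
claimed. -/
theorem Prog.sim_spec (p : Prog) : ∀ (s : State v) (h : HState), p.top ≤ b → SimEnv E v b off h →
    Sim v b off s h → wp E p.sim (fun h' => ∃ s', SimRes v b off p s h h' s') h := by
  induction p with
  | const r k =>
    intro s h hb H hs
    simp only [Prog.top] at hb
    simp only [Prog.sim, wp_asg, Exp.ok_mod, Exp.ok_lit, Exp.ok_var, Exp.ev_mod, Exp.ev_lit,
      Exp.ev_var, and_true]
    have := H.top
    exact ⟨by omega, _, .of_step rfl (hs.setReg (by simp [H.Z])) (.const _ _ _)⟩
  | op o r x y =>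
    intro s h hb H hs
    simp only [Prog.top] at hb
    simp only [Prog.sim, wp_asg, Exp.ok_mod, Exp.ok_raw, Exp.ok_var, Exp.ev_mod, Exp.ev_raw,
      Exp.ev_var, true_and]
    refine ⟨_, .of_step rfl (hs.setReg ?_) (.op _ _ _ _ _)⟩
    rw [H.Z, hs.reg x (by omega), hs.reg y (by omega)]
    exact Op.word_mod H.pos H.le o _ _
  | load r x =>
    intro s h hb H hs
    simp only [Prog.top] at hb
    have h1 := (s.reg x).isLt
    have h2 := H.fits
    simp only [Prog.sim, wp_ld, Exp.ok_add, Exp.ok_var, Exp.ev_add, Exp.ev_var, true_and, H.mo,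
      hs.reg x (by omega)]
    refine ⟨by omega, by omega, by omega, _, .of_step rfl (hs.setReg ?_) (.load _ _ _)⟩
    rw [hs.mem _ h1]; simp
  | store x r =>
    intro s h hb H hs
    simp only [Prog.top] at hb
    have h1 := (s.reg x).isLt
    have h2 := H.fits
    simp only [Prog.sim, wp_st, Exp.ok_add, Exp.ok_var, Exp.ev_add, Exp.ev_var, true_and, H.mo,
      hs.reg x (by omega), hs.reg r (by omega)]
    refine ⟨by omega, by omega, by omega, s.setMem (s.reg x) (s.reg r), ⟨hs.reg, fun y hy => ?_⟩, fun y hy => ?_, le_rfl,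
      by simp [Prog.size], Or.inl ⟨1, .store _ _ _, by simp⟩⟩
    · simp only [HState.put_arr, State.setMem, Function.update_apply, true_and]
      have h3 : BitVec.ofNat v y = s.reg x ↔ off + y = off + (s.reg x).toNat := by
        rw [← BitVec.toNat_inj, BitVec.toNat_ofNat, Nat.mod_eq_of_lt hy]; omega
      simp only [h3]
      split_ifs
      · rfl
      · exact hs.mem y hy
    · simp only [HState.put_arr, true_and]
      rw [if_neg (by omega)]
  | coin r =>
    intro s h hb H hs
    have h2 := H.fits
    simp only [Prog.sim, wp_asg, Exp.ok_ofNat, Exp.ev_ofNat]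
    have h3 : 0 < 2 ^ v := by positivity
    refine ⟨by omega, { s.setReg r 0 with drawn := s.drawn + 1 },
      .of_step rfl ⟨(hs.setReg (x := 0) (by simp)).reg, hs.mem⟩ (.coin _ _)⟩
  | seq p q ihp ihq =>
    intro s h hb H hs
    simp only [Prog.top] at hb
    simp only [Prog.sim, wp_seq]
    refine (ihp s h (by omega) H hs).call ?_
    rintro h₁ hf₁ ⟨s₁, R₁⟩
    refine (ihq s₁ h₁ (by omega) (H.frame hf₁) R₁.sim).call ?_
    rintro h₂ hf₂ ⟨s₂, R₂⟩
    have f1 := R₁.fuel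
    have f2 := R₂.fuel
    refine ⟨s₂, R₂.sim, fun x hx => (R₂.mem x hx).trans (R₁.mem x hx), f2.trans f1, ?_, ?_⟩
    · have t1 := R₁.time
      have t2 := R₂.time
      simp only [Prog.size]
      have e1 : p.size * (1 + (h.reg ρfu - h₁.reg ρfu)) ≤
        p.size * (1 + (h.reg ρfu - h₂.reg ρfu)) := Nat.mul_le_mul_left _ (by omega)
      have e2 : q.size * (1 + (h₁.reg ρfu - h₂.reg ρfu)) ≤
        q.size * (1 + (h.reg ρfu - h₂.reg ρfu)) := Nat.mul_le_mul_left _ (by omega)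
      rw [Nat.add_mul]
      omega
    · rcases R₁.res with ⟨t1, r1, u1⟩ | ⟨z1, u1⟩
      · rcases R₂.res with ⟨t2, r2, u2⟩ | ⟨z2, u2⟩
        · exact Or.inl ⟨_, .seq r1 r2, by omega⟩
        · refine Or.inr ⟨z2, fun t s'' r => ?_⟩
          cases r with
          | seq a c =>
            obtain ⟨rfl, rfl⟩ := a.unique r1
            have := u2 _ _ c
            omega
      · refine Or.inr ⟨by omega, fun t s'' r => ?_⟩
        cases r with
        | seq a c => have := u1 _ _ a; omega
  | branch r p q ihp ihq =>
    intro s h hb H hs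
    simp only [Prog.top] at hb
    have e0 := hs.reg r (by omega)
    simp only [Prog.sim, wp_ite, Exp.ok_var, true_and, Exp.ev_var]
    have Ht : SimEnv E v b off h.tick := ⟨H.pos, H.le, H.top, H.fits, H.Z, H.mo⟩
    have hst : Sim v b off s h.tick := ⟨hs.reg, hs.mem⟩
    refine ⟨fun h0 => ?_, fun h0 => ?_⟩
    · have h0' : s.reg r ≠ 0 := fun hh => h0 (by rw [e0, hh]; simp)
      refine (ihp s h.tick (by omega) Ht hst).mono ?_
      rintro h₁ ⟨s₁, R₁⟩
      refine ⟨s₁, R₁.sim, R₁.mem, R₁.fuel, ?_, ?_⟩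
      · have t1 := R₁.time
        simp only [Prog.size, HState.tick_time, HState.tick_reg, Nat.add_mul] at t1 ⊢
        omega
      · rcases R₁.res with ⟨t1, r1, u1⟩ | ⟨z1, u1⟩
        · exact Or.inl ⟨_, .branch_true h0' r1, by simp at u1; omega⟩
        · refine Or.inr ⟨z1, fun t s'' rr => ?_⟩
          cases rr with
          | branch_true _ a => have := u1 _ _ a; simp at this; omega
          | branch_false hz _ => exact absurd hz h0'
    · have h0' : s.reg r = 0 := BitVec.eq_of_toNat_eq (by simpa [e0] using h0)
      refine (ihq s h.tick (by omega) Ht hst).mono ?_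
      rintro h₁ ⟨s₁, R₁⟩
      refine ⟨s₁, R₁.sim, R₁.mem, R₁.fuel, ?_, ?_⟩
      · have t1 := R₁.time
        simp only [Prog.size, HState.tick_time, HState.tick_reg, Nat.add_mul] at t1 ⊢
        omega
      · rcases R₁.res with ⟨t1, r1, u1⟩ | ⟨z1, u1⟩
        · exact Or.inl ⟨_, .branch_false h0' r1, by simp at u1; omega⟩
        · refine Or.inr ⟨z1, fun t s'' rr => ?_⟩
          cases rr with
          | branch_true hz _ => exact absurd h0' hz
          | branch_false _ a => have := u1 _ _ a; simp at this; omega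
  | loop r p ih =>
    intro s h hb H hs
    simp only [Prog.top] at hb
    have hB0 : 1 < E.B := by
      have := H.fits; have := Nat.one_lt_two_pow (n := v) H.pos.ne'; omega
    generalize hF : h.reg ρfu = F
    induction F using Nat.strong_induction_on generalizing s h with
    | _ F IH =>
    have e0 := hs.reg r (by omega)
    rw [Prog.sim, wp_whl]
    simp only [Exp.ok_and, Exp.ok_var, Exp.ev_and, Exp.ev_var, true_and]
    have Ht : SimEnv E v b off h.tick := ⟨H.pos, H.le, H.top, H.fits, H.Z, H.mo⟩
    have hst : Sim v b off s h.tick := ⟨hs.reg, hs.mem⟩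
    refine ⟨by omega, fun h0 => ?_, fun h0 => ?_⟩
    · have h0 : h.reg (64 + r) ≠ 0 ∧ h.reg ρfu ≠ 0 := by by_contra hh; simp [hh] at h0
      have h0' : s.reg r ≠ 0 := fun hh => h0.1 (by rw [e0, hh]; simp)
      have h02 := h0.2
      obtain ⟨f, rfl⟩ : ∃ f, F = f + 1 := ⟨F - 1, by omega⟩
      simp only [wp_seq, wp_asg, Exp.ok_sub, Exp.ok_var, Exp.ok_ofNat, Exp.ev_sub, Exp.ev_var,
        Exp.ev_ofNat, HState.tick_reg, hF]
      refine ⟨⟨trivial, by omega, by omega⟩, ?_⟩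
      have H1 : SimEnv E v b off (h.tick.set ρfu (f + 1 - 1)) :=
        ⟨H.pos, H.le, H.top, H.fits, by simp [H.Z], by simp [H.mo]⟩
      have hs1 : Sim v b off s (h.tick.set ρfu (f + 1 - 1)) :=
        ⟨fun r' hr' => by
          simp only [HState.set_reg]; rw [if_neg (by omega)]; exact hs.reg r' hr', hs.mem⟩
      refine (ih s _ (by omega) H1 hs1).call ?_
      rintro h₁ hf₁ ⟨s₁, R₁⟩
      have f1 := R₁.fuel
      have t1 := R₁.time
      simp only [HState.set_reg, if_true, HState.set_time, HState.tick_time,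
        Nat.add_sub_cancel] at f1 t1
      refine (IH (h₁.reg ρfu) (by omega) s₁ h₁ (H1.frame hf₁) R₁.sim rfl).mono ?_
      rintro h₂ ⟨s₂, R₂⟩
      have f2 := R₂.fuel
      have t2 := R₂.time
      refine ⟨s₂, R₂.sim, fun x hx => (R₂.mem x hx).trans (R₁.mem x hx), by omega, ?_, ?_⟩
      · simp only [Prog.size] at t2 ⊢
        obtain ⟨x, hx⟩ : ∃ x, f = h₁.reg ρfu + x := ⟨f - h₁.reg ρfu, by omega⟩
        -- The fuel used is split into one unit for this pass, `x` for its body and `y` for the rest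
        -- of the loop.
        obtain ⟨y, hy⟩ : ∃ y, h₁.reg ρfu = h₂.reg ρfu + y := ⟨h₁.reg ρfu - h₂.reg ρfu, by omega⟩
        rw [show f - h₁.reg ρfu = x by omega] at t1
        rw [show h₁.reg ρfu - h₂.reg ρfu = y by omega] at t2
        rw [show h.reg ρfu - h₂.reg ρfu = x + y + 1 by omega]
        have e1 : (p.size + 2) * (1 + (x + y + 1)) =
          p.size * (1 + x) + (p.size + 2) * (1 + y) + 2 * x + 2 := by ring
        omega
      · rw [hF]
        rcases R₁.res with ⟨t1, r1, u1⟩ | ⟨z1, u1⟩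
        · simp only [HState.set_reg, if_true, Nat.add_sub_cancel] at u1
          rcases R₂.res with ⟨t2, r2, u2⟩ | ⟨z2, u2⟩
          · exact Or.inl ⟨_, .loop_true h0' r1 r2, by omega⟩
          · refine Or.inr ⟨z2, fun t s'' rr => ?_⟩
            cases rr with
            | loop_true _ a c =>
              obtain ⟨rfl, rfl⟩ := a.unique r1
              have := u2 _ _ c
              omega
            | loop_false hz => exact absurd hz h0'
        · refine Or.inr ⟨by omega, fun t s'' rr => ?_⟩
          cases rr with
          | loop_true _ a c =>
            have := u1 _ _ a
            simp only [HState.set_reg, if_true, Nat.add_sub_cancel] at this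
            omega
          | loop_false hz => exact absurd hz h0'
    · refine ⟨s, hst, fun _ _ => rfl, le_rfl, by simp [Prog.size], ?_⟩
      by_cases hr : s.reg r = 0
      · exact Or.inl ⟨_, .loop_false hr, by simp⟩
      · refine Or.inr ⟨?_, fun t s'' rr => ?_⟩
        · by_contra hh
          have : h.reg (64 + r) ≠ 0 := by
            rw [e0]; intro hz; exact hr (BitVec.eq_of_toNat_eq (by simpa using hz))
          simp_all
        · have : h.reg ρfu = 0 := by
            by_contra hh
            have : h.reg (64 + r) ≠ 0 := by
              rw [e0]; intro hz; exact hr (BitVec.eq_of_toNat_eq (by simpa using hz))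
            simp_all
          omega

end

end WordRAM

namespace WordRAM

/-! ### Matrices that code distances -/

theorem flatten_ofFn_matrix {N : ℕ} (hN : 0 < N) (A : Matrix (Fin N) (Fin N) ℕ) :
    (List.ofFn fun i => List.ofFn fun j => A i j).flatten =
      List.ofFn fun x : Fin (N * N) => A ⟨x / N, Nat.div_lt_of_lt_mul x.2⟩ ⟨x % N, Nat.mod_lt _ hN⟩ := by
  rw [List.ofFn_mul]
  congr 1
  refine congrArg List.ofFn (funext fun i => congrArg List.ofFn (funext fun j => ?_))
  have h1 : (↑i * N + ↑j) / N = (i : ℕ) := by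
    rw [Nat.mul_comm, Nat.mul_add_div hN, Nat.div_eq_of_lt j.2, Nat.add_zero]
  have h2 : (↑i * N + ↑j) % N = (j : ℕ) := by
    rw [Nat.mul_comm, Nat.mul_add_mod, Nat.mod_eq_of_lt j.2]
  simp [h1, h2]

/-- The matrix with entries `f i j`. -/
def natMatrix (N : ℕ) (f : ℕ → ℕ → ℕ) : Matrix (Fin N) (Fin N) ℕ := fun i j => f i j

theorem encodeMatrices_length {N : ℕ} (A B : Matrix (Fin N) (Fin N) ℕ) (hN : 0 < N) :
    (encodeMatrices A B).length = 1 + 2 * N ^ 2 := by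
  rw [encodeMatrices, flatten_ofFn_matrix hN, flatten_ofFn_matrix hN]
  simp; ring

theorem encodeMatrices_getD {N : ℕ} {f g : ℕ → ℕ → ℕ} (hN : 0 < N) (y : ℕ) :
    (encodeMatrices (natMatrix N f) (natMatrix N g)).getD y 0 =
      if y = 0 then N else if y < 1 + N ^ 2 then f ((y - 1) / N) ((y - 1) % N) else
        if y < 1 + 2 * N ^ 2 then g ((y - 1 - N ^ 2) / N) ((y - 1 - N ^ 2) % N) else 0 := by
  rw [encodeMatrices, flatten_ofFn_matrix hN, flatten_ofFn_matrix hN]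
  rcases y with _ | y
  · simp
  · have hNN : N * N = N ^ 2 := by ring
    simp only [List.getD_cons_succ, Nat.add_sub_cancel, Nat.add_one_ne_zero, if_false]
    split_ifs with h1 h2
    · rw [List.getD_append _ _ _ _ (by simp [hNN]; omega), List.getD_eq_getElem _ _ (by simp [hNN]; omega)]
      simp [natMatrix]
    · rw [List.getD_append_right _ _ _ _ (by simp [hNN]; omega),
        List.getD_eq_getElem _ _ (by simp [hNN]; omega)]
      simp [hNN, natMatrix]
    · rw [List.getD_eq_default _ _ (by simp [hNN]; omega)]

namespace Inst

variable {E : Env} (X : Inst E)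

/-- The program `P` multiplies the matrices that occur, in time less than `T`. -/
def Multiplies (P : Prog) (T : ℕ → ℕ) : Prop :=
  ∀ N, 0 < N → N ≤ X.a ^ 3 → ∀ f g : ℕ → ℕ → ℕ, (∀ i j, f i j ≤ X.β) → (∀ i j, g i j ≤ X.β ^ 2) →
    ∃ t s, Run (fun _ => false) P (State.init (X.κ * (3 + 6 * X.e))
      (encodeMatrices (natMatrix N f) (natMatrix N g))) t s ∧ t < T N ∧
      ∀ i < N, ∀ j < N, (s.mem (BitVec.ofNat _ (1 + 2 * N ^ 2 + N * i + j))).toNat =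
        ∑ v ∈ Finset.range N, f i v * g v j

theorem Z_eq : 2 ^ (X.κ * (3 + 6 * X.e)) = X.Z := by
  have h1 : X.β = 2 ^ (3 + 6 * X.e) := by
    rw [β, a, ← pow_mul, pow_add]; norm_num; ring
  rw [Z, h1, ← pow_mul, Nat.mul_comm]

/-- In `κ = K + 4`, the `K` meets the demand of the program on the word size, since the input length
plus `2` is at most `β`. The `4` makes room for the entries of the product, at most `N * β * β ^ 2 <
β ^ 4`. -/
theorem multiplies_of {P : Prog} {K : ℕ} {T : ℕ → ℕ}
    (hP : ∀ (N w : ℕ) (A B : Matrix (Fin N) (Fin N) ℕ), 0 < N →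
      WordSizeOK K w (encodeMatrices A B) → (∀ i j, (A * B) i j < 2 ^ w) →
      ∀ tape : ℕ → Bool, ∃ (t : ℕ) (s : State w),
        Run tape P (State.init w (encodeMatrices A B)) t s ∧ t < T N ∧
        ∀ i j : Fin N,
          s.mem (BitVec.ofNat w (1 + 2 * N ^ 2 + N * i + j)) = BitVec.ofNat w ((A * B) i j))
    (hκ : X.κ = K + 4) : X.Multiplies P T := by
  intro N hN hNa f g hf hg
  have h8 := X.β_ge
  have hNβ : 8 * N ≤ X.β := (Nat.mul_le_mul_left 8 hNa).trans (X.pow_a_le (k := 3) (by omega))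
  have hN2 : 8 * N ^ 2 ≤ X.β := by
    refine (Nat.mul_le_mul_left 8 ((Nat.pow_le_pow_left hNa 2).trans ?_)).trans
      (X.pow_a_le (k := 6) (by omega))
    rw [← pow_mul]
  have hZ4 : X.β ^ 4 ≤ X.Z := by rw [Z, hκ]; exact Nat.pow_le_pow_right (by omega) (by omega)
  have hβ24 : X.β ^ 2 < X.β ^ 4 := Nat.pow_lt_pow_right (by omega) (by omega)
  have hβ12 : X.β ≤ X.β ^ 2 := by nlinarith
  have hprod : ∀ i j, ∑ v ∈ Finset.range N, f i v * g v j < X.Z := by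
    intro i j
    have h1 : ∑ v ∈ Finset.range N, f i v * g v j ≤ N * (X.β * X.β ^ 2) := by
      refine (Finset.sum_le_card_nsmul _ _ _ fun v _ => Nat.mul_le_mul (hf i v) (hg v j)).trans ?_
      simp
    have h2 : N * (X.β * X.β ^ 2) < X.β * (X.β * X.β ^ 2) :=
      Nat.mul_lt_mul_of_pos_right (by omega) (by positivity)
    have h3 : X.β * (X.β * X.β ^ 2) = X.β ^ 4 := by ring
    omega
  have hmul : ∀ i j : Fin N, (natMatrix N f * natMatrix N g) i j
      = ∑ v ∈ Finset.range N, f i v * g v j := by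
    intro i j
    rw [Matrix.mul_apply, Finset.sum_range]; rfl
  have hws : WordSizeOK K (X.κ * (3 + 6 * X.e)) (encodeMatrices (natMatrix N f) (natMatrix N g)) := by
    constructor
    · rw [X.Z_eq]
      intro x hx
      obtain ⟨y, hy, rfl⟩ := List.mem_iff_getElem.1 hx
      rw [← List.getD_eq_getElem _ 0 hy, encodeMatrices_getD hN]
      have := hf ((y - 1) / N) ((y - 1) % N)
      have := hg ((y - 1 - N ^ 2) / N) ((y - 1 - N ^ 2) % N)
      split_ifs <;> omega
    · rw [X.Z_eq, encodeMatrices_length _ _ hN]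
      calc (1 + 2 * N ^ 2 + 2) ^ K ≤ X.β ^ K := Nat.pow_le_pow_left (by omega) _
        _ ≤ X.Z := by rw [Z, hκ]; exact Nat.pow_le_pow_right (by omega) (by omega)
  obtain ⟨t, s, h1, h2, h3⟩ := hP N (X.κ * (3 + 6 * X.e)) (natMatrix N f) (natMatrix N g) hN
    hws (fun i j => by rw [hmul, X.Z_eq]; exact hprod i j) fun _ => false
  refine ⟨t, s, h1, h2, fun i hi j hj => ?_⟩
  have h4 := h3 ⟨i, hi⟩ ⟨j, hj⟩
  rw [hmul] at h4
  rw [h4, BitVec.toNat_ofNat, X.Z_eq, Nat.mod_eq_of_lt (hprod i j)]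

/-- The number of vertices with both properties. -/
noncomputable def count (P Q : ℕ → Prop) (n : ℕ) : ℕ := by
  classical exact ((Finset.range n).filter fun v => P v ∧ Q v).card

theorem count_le (P Q : ℕ → Prop) (n : ℕ) : count P Q n ≤ n := by
  classical
  have := Finset.card_filter_le (Finset.range n) fun v => P v ∧ Q v
  unfold count
  simpa using this

theorem count_pos {P Q : ℕ → Prop} {n : ℕ} : 0 < count P Q n ↔ ∃ v < n, P v ∧ Q v := by
  classical
  unfold count
  rw [Finset.card_pos]
  constructor
  · rintro ⟨v, hv⟩; simp at hv; exact ⟨v, hv⟩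
  · rintro ⟨v, hv⟩; exact ⟨v, by simpa using hv⟩

/-- Far has weight `β` in mode 0 and `β ^ 2` in mode 1, so the four combinations have the weights
`1`, `β`, `β ^ 2`, `β ^ 3`. -/
theorem sum_code (s s' : ℕ) : ∑ v ∈ Finset.range X.n, X.code 0 s v * X.code 1 s' v =
    count (X.Near 0 (X.smp s)) (X.Near 1 (X.smp s')) X.n + X.β * (
      count (X.Far 0 (X.smp s)) (X.Near 1 (X.smp s')) X.n + X.β * (
        count (X.Near 0 (X.smp s)) (X.Far 1 (X.smp s')) X.n + X.β *
          count (X.Far 0 (X.smp s)) (X.Far 1 (X.smp s')) X.n)) := by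
  classical
  unfold count
  simp only [Finset.card_filter, Finset.mul_sum, ← Finset.sum_add_distrib]
  refine Finset.sum_congr rfl fun v _ => ?_
  simp only [code]
  by_cases h1 : X.Near 0 (X.smp s) v <;> by_cases h2 : X.Far 0 (X.smp s) v <;>
    by_cases h3 : X.Near 1 (X.smp s') v <;> by_cases h4 : X.Far 1 (X.smp s') v <;>
    simp only [h1, h2, h3, h4, if_true, if_false, and_self, and_true, and_false] <;> ring

/-- The test that the program makes with an entry of the product of the matrices. -/
theorem noSep_of_digits {s s' c : ℕ}
    (hc : c = ∑ v ∈ Finset.range X.n, X.code 0 s v * X.code 1 s' v) :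
    ((c % X.β ≠ 0 ∧ c / X.β / X.β / X.β ≠ 0) ∨
      (c / X.β % X.β ≠ 0 ∧ c / X.β / X.β % X.β ≠ 0)) ↔ ¬ X.NoSep 0 (X.smp s) 1 (X.smp s') := by
  have h8 := X.β_ge
  have hn := X.n8_le
  have hn0 := X.n_pos
  rw [X.sum_code] at hc
  have b1 := count_le (X.Near 0 (X.smp s)) (X.Near 1 (X.smp s')) X.n
  have b2 := count_le (X.Far 0 (X.smp s)) (X.Near 1 (X.smp s')) X.n
  have b3 := count_le (X.Near 0 (X.smp s)) (X.Far 1 (X.smp s')) X.n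
  have b4 := count_le (X.Far 0 (X.smp s)) (X.Far 1 (X.smp s')) X.n
  have p1 := count_pos (P := X.Near 0 (X.smp s)) (Q := X.Near 1 (X.smp s')) (n := X.n)
  have p2 := count_pos (P := X.Far 0 (X.smp s)) (Q := X.Near 1 (X.smp s')) (n := X.n)
  have p3 := count_pos (P := X.Near 0 (X.smp s)) (Q := X.Far 1 (X.smp s')) (n := X.n)
  have p4 := count_pos (P := X.Far 0 (X.smp s)) (Q := X.Far 1 (X.smp s')) (n := X.n)
  generalize count (X.Near 0 (X.smp s)) (X.Near 1 (X.smp s')) X.n = c1 at *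
  generalize count (X.Far 0 (X.smp s)) (X.Near 1 (X.smp s')) X.n = c2 at *
  generalize count (X.Near 0 (X.smp s)) (X.Far 1 (X.smp s')) X.n = c3 at *
  generalize count (X.Far 0 (X.smp s)) (X.Far 1 (X.smp s')) X.n = c4 at *
  -- The counts are at most `n < β`, so there are no carries and they are the digits in base `β`.
  have dm : ∀ x y, x < X.β → (x + X.β * y) % X.β = x ∧ (x + X.β * y) / X.β = y := fun x y hx =>
    ⟨by rw [Nat.add_mul_mod_self_left, Nat.mod_eq_of_lt hx],
      by rw [Nat.add_mul_div_left _ _ (by omega), Nat.div_eq_of_lt hx, Nat.zero_add]⟩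
  obtain ⟨d1, d2⟩ := dm c1 (c2 + X.β * (c3 + X.β * c4)) (by omega)
  obtain ⟨d3, d4⟩ := dm c2 (c3 + X.β * c4) (by omega)
  obtain ⟨d5, d6⟩ := dm c3 c4 (by omega)
  rw [hc, d1, d2, d3, d4, d5, d6]
  simp only [← Nat.pos_iff_ne_zero]
  rw [p1, p2, p3, p4]
  unfold NoSep
  constructor
  · rintro (⟨⟨x, hx, x1, x2⟩, ⟨y, hy, y1, y2⟩⟩ | ⟨⟨y, hy, y1, y2⟩, ⟨x, hx, x1, x2⟩⟩) ⟨g1, g2⟩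
    · exact g1 x hx y hy x1 x2 y1 y2
    · exact g2 x hx y hy x1 x2 y1 y2
  · intro hno
    by_contra hh
    push Not at hh
    refine hno ⟨fun x hx y hy x1 x2 y1 y2 => ?_, fun x hx y hy x1 x2 y1 y2 => ?_⟩
    · exact hh.1 ⟨x, hx, x1, x2⟩ y hy y1 y2
    · exact hh.2 ⟨y, hy, y1, y2⟩ x hx x1 x2

end Inst

end WordRAM

namespace WordRAM

/-! ### The product of the matrices, block by block -/

notation "αacc" => 8

notation "ρbi" => 44
notation "ρNN" => 41
notation "ρcall" => 60
notation "ρok" => 61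

/-- The entries of the factors at the position `reg ρy`. -/
def entry : Cmd :=
  .asg ρx (.var ρy / .var ρN) ;; .asg ρdx (.var ρy % .var ρN) ;;
  .asg ρu (.var ρbi * .var ρN + .var ρdx) ;; .asg ρv (.var ρbi * .var ρN + .var ρx) ;;
  .ite (.lt (.var ρu) (.var ρn)) (.ld ρd0 αcode0 (.var ρx * .var ρn + .var ρu)) (.asg ρd0 0) ;;
  .ite (.lt (.var ρv) (.var ρn)) (.ld ρd1 αcode1 (.var ρdx * .var ρn + .var ρv)) (.asg ρd1 0)

/-- Write the factors of the block product with index `reg ρbi` to the array `αmem`. -/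
def fill : Cmd :=
  .for' ρy ρNN (
    entry ;;
    .st αmem (.var ρmo + (1 + .var ρy)) (.var ρd0) ;;
    .st αmem (.var ρmo + (1 + .var ρNN + .var ρy)) (.var ρd1))

/-- Set the simulated registers to `0`. -/
def zeroRegs : ℕ → Cmd
  | 0 => .skip
  | b + 1 => zeroRegs b ;; .asg (64 + b) 0

theorem zeroRegs_W (b : ℕ) {r : ℕ} (hr : r < 63) : (zeroRegs b).W r = false := by
  induction b with
  | zero => simp [zeroRegs, Cmd.skip, Cmd.W]; omega
  | succ b ih => simp [zeroRegs, Cmd.W, ih]; omega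

theorem zeroRegs_WA (b a : ℕ) : (zeroRegs b).WA a = false := by
  induction b with
  | zero => rfl
  | succ b ih => simp [zeroRegs, Cmd.WA, ih]

/-- One block of the product. -/
def mulBlock (P : Prog) : Cmd :=
  .asg ρmo (.var ρcall * .var ρZ) ;; .asg ρcall (.var ρcall + 1) ;;
  .st αmem (.var ρmo) (.var ρN) ;; fill ;; zeroRegs P.top ;; .asg ρfu (.var ρfuel) ;; P.sim ;;
  .ite (.var ρfu) .skip (.asg ρok 0) ;;
  .for' ρy ρNN (
    .ld ρd0 αmem (.var ρmo + (1 + 2 * .var ρNN + .var ρy)) ;; .ld ρd1 αacc (.var ρy) ;;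
    .st αacc (.var ρy) (.var ρd0 + .var ρd1))

theorem mulBlock_W (P : Prog) {r : ℕ} (hr : r < 63) (h1 : ρmo ≠ r) (h2 : ρcall ≠ r)
    (h3 : ρy ≠ r) (h4 : ρx ≠ r) (h5 : ρdx ≠ r) (h6 : ρu ≠ r) (h7 : ρv ≠ r) (h8 : ρd0 ≠ r)
    (h9 : ρd1 ≠ r) (h10 : ρfu ≠ r) (h11 : ρok ≠ r) : (mulBlock P).W r = false := by
  simp [mulBlock, fill, entry, Cmd.for', Cmd.skip, Cmd.W, zeroRegs_W _ hr,
    P.sim_W (show r < 64 by omega) h10.symm, h1.symm, h2.symm, h3.symm, h4.symm, h5.symm, h6.symm,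
    h7.symm, h8.symm, h9.symm, h10.symm, h11.symm]
  omega

theorem mulBlock_WA (P : Prog) {a : ℕ} (h1 : αmem ≠ a) (h2 : αacc ≠ a) :
    (mulBlock P).WA a = false := by
  simp [mulBlock, fill, entry, Cmd.for', Cmd.skip, Cmd.WA, zeroRegs_WA, P.sim_WA h1.symm, h1.symm, h2.symm]

variable {E : Env} {X : Inst E} {h h' : HState}

theorem zeroRegs_spec (hB : 0 < E.B) (b : ℕ) : wp E (zeroRegs b) (fun h' =>
    (∀ r < b, h'.reg (64 + r) = 0) ∧ h'.time = h.time + b + 1) h := by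
  induction b with
  | zero => simp [zeroRegs, Cmd.skip, hB]
  | succ b ih =>
    rw [zeroRegs, wp_seq]
    refine ih.mono fun h₁ hh => ?_
    simp
    refine ⟨hB, fun r hr => ?_, by omega⟩
    by_cases hrb : r = b
    · simp [hrb]
    · exact fun _ => hh.1 r (by omega)

namespace Inst

/-- The factors of the product with index `k`. -/
noncomputable def blockA (X : Inst E) (N k r c : ℕ) : ℕ :=
  if k * N + c < X.n then X.code 0 r (k * N + c) else 0
noncomputable def blockB (X : Inst E) (N k r c : ℕ) : ℕ :=
  if k * N + r < X.n then X.code 1 c (k * N + r) else 0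

theorem code_le (X : Inst E) (i s v : ℕ) : X.code i s v ≤ X.β ^ (i + 1) := by
  have h1 := X.q_pos
  have h2 : 1 ≤ X.β ^ (i + 1) := Nat.one_le_pow _ _ (by have := X.β_ge; omega)
  unfold code Near Far
  split_ifs <;> omega

theorem blockA_le (X : Inst E) (N k r c : ℕ) : X.blockA N k r c ≤ X.β := by
  unfold blockA
  split_ifs
  · simpa using X.code_le 0 r (k * N + c)
  · omega

theorem blockB_le (X : Inst E) (N k r c : ℕ) : X.blockB N k r c ≤ X.β ^ 2 := by
  unfold blockB
  split_ifs
  · exact X.code_le 1 c (k * N + r)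
  · omega

/-- The vertices are cut into `K` strips of length `N`; the part of the last strips beyond `n` is
filled with zeros. -/
theorem sum_blocks (X : Inst E) (N s s' K : ℕ) (hK : X.n ≤ K * N) :
    ∑ k ∈ Finset.range K, ∑ v ∈ Finset.range N, X.blockA N k s v * X.blockB N k v s' =
      ∑ v ∈ Finset.range X.n, X.code 0 s v * X.code 1 s' v := by
  have key : ∀ K, ∑ k ∈ Finset.range K, ∑ v ∈ Finset.range N, X.blockA N k s v * X.blockB N k v s' =
      ∑ v ∈ Finset.range (K * N), if v < X.n then X.code 0 s v * X.code 1 s' v else 0 := by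
    intro K
    induction K with
    | zero => simp
    | succ K ih =>
      rw [Finset.sum_range_succ, ih, Nat.succ_mul, Finset.sum_range_add]
      congr 1
      refine Finset.sum_congr rfl fun v _ => ?_
      unfold blockA blockB
      split_ifs <;> simp
  rw [key, ← Finset.sum_filter]
  refine Finset.sum_congr ?_ fun _ _ => rfl
  ext v
  simp only [Finset.mem_filter, Finset.mem_range]
  omega

end Inst

/-- What the multiplication of the matrices needs. -/
structure MulPre (X : Inst E) (N : ℕ) (h : HState) : Prop where
  ctx : Ctx X h
  pos : 0 < N
  le : N ≤ X.a ^ 3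
  rN : h.reg ρN = N
  rNN : h.reg ρNN = N ^ 2
  code0 : ∀ s < N, ∀ v < X.n, h.arr αcode0 (s * X.n + v) = X.code 0 s v
  code1 : ∀ s < N, ∀ v < X.n, h.arr αcode1 (s * X.n + v) = X.code 1 s v

theorem Inst.sq_le (X : Inst E) {N : ℕ} (hN : N ≤ X.a ^ 3) : 8 * N ^ 2 ≤ X.β := by
  refine (Nat.mul_le_mul_left 8 ((Nat.pow_le_pow_left hN 2).trans ?_)).trans
    (X.pow_a_le (k := 6) (by omega))
  rw [← pow_mul]

theorem Inst.β_le_Z (X : Inst E) (hκ : 0 < X.κ) : X.β ≤ X.Z := by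
  have := X.β_ge
  calc X.β = X.β ^ 1 := (pow_one _).symm
    _ ≤ X.β ^ X.κ := Nat.pow_le_pow_right (by omega) hκ

theorem entry_spec {N k y : ℕ} (H : MulPre X N h) (hk : h.reg ρbi = k)
    (hkN : k * N + N < E.B) (hy : h.reg ρy = y) (hyN : y < N ^ 2) :
    wp E entry (fun h' => h'.reg ρd0 = X.blockA N k (y / N) (y % N) ∧
      h'.reg ρd1 = X.blockB N k (y / N) (y % N) ∧ h'.time ≤ h.time + 8) h := by
  have hB1 := X.hundred_lt
  have hn8 := X.n8_le
  have hβ := X.β_lt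
  have hβ2 := X.β2_lt
  have h8 := X.β_ge
  have hN2 := X.sq_le H.le
  have hNpos := H.pos
  have hr : y / N < N := Nat.div_lt_of_lt_mul (by rwa [pow_two] at hyN)
  have hcl : y % N < N := Nat.mod_lt _ hNpos
  have hNβ : N ≤ X.β := by nlinarith
  have m1 : y / N * X.n ≤ X.β * X.n := Nat.mul_le_mul_right _ (by omega)
  have m2 : y % N * X.n ≤ X.β * X.n := Nat.mul_le_mul_right _ (by omega)
  have m3 : X.β * X.n + X.n < E.B := by nlinarith
  have e0 := H.code0 _ hr
  have e1 := H.code1 _ hcl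
  unfold Inst.blockA Inst.blockB entry
  simp only [wp_seq, wp_asg, wp_ite, wp_ld]
  simp [H.rN, H.ctx.rn, hk, hy]
  generalize y / N = r at *
  generalize y % N = c at *
  by_cases c0 : k * N + c < X.n <;> by_cases c1 : k * N + r < X.n <;>
    simp [c0, c1, not_lt.1, e0, e1] <;> omega

theorem fill_spec {N k off : ℕ} (H : MulPre X N h) (hκ : 0 < X.κ) (hk : h.reg ρbi = k)
    (hkN : k * N + N < E.B) (hoff : h.reg ρmo = off) (hB : off + X.Z ≤ E.B) :
    wp E fill (fun h' =>
      (∀ y < N ^ 2, h'.arr αmem (off + (1 + y)) = X.blockA N k (y / N) (y % N) ∧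
        h'.arr αmem (off + (1 + N ^ 2 + y)) = X.blockB N k (y / N) (y % N)) ∧
      (∀ x, (x ≤ off ∨ off + 1 + 2 * N ^ 2 ≤ x) → h'.arr αmem x = h.arr αmem x) ∧
      h'.time ≤ h.time + 15 * N ^ 2 + 2) h := by
  have hB1 := X.hundred_lt
  have hn8 := X.n8_le
  have hβ := X.β_lt
  have hβ2 := X.β2_lt
  have h8 := X.β_ge
  have hN2 := X.sq_le H.le
  have hZ := X.β_le_Z hκ
  have hNpos := H.pos
  refine wp_for (fun z h₁ =>
      (∀ y < z, h₁.arr αmem (off + (1 + y)) = X.blockA N k (y / N) (y % N) ∧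
        h₁.arr αmem (off + (1 + N ^ 2 + y)) = X.blockB N k (y / N) (y % N)) ∧
      (∀ x, (x ≤ off ∨ off + 1 + 2 * N ^ 2 ≤ x) → h₁.arr αmem x = h.arr αmem x) ∧
      h₁.time ≤ h.time + 15 * z + 1) (by decide) rfl rfl (by omega) (by rw [H.rNN]; omega)
      (by simp) ?_ ?_
  · rintro y hy h₁ hf h1 h2 ⟨h3, h4, h5⟩
    rw [H.rNN] at hy h2
    have hc₁ := H.ctx.frame hf rfl
    have hN₁ : h₁.reg ρN = N := (hf.reg _ rfl).trans H.rN
    have hk₁ : h₁.reg ρbi = k := (hf.reg _ rfl).trans hk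
    have hoff₁ : h₁.reg ρmo = off := (hf.reg _ rfl).trans hoff
    have fin : ∀ h₂ : HState, h₂.arr = Function.update h₁.arr αmem
        (Function.update (Function.update (h₁.arr αmem) (off + (1 + y)) (X.blockA N k (y / N) (y % N)))
          (off + (1 + N ^ 2 + y)) (X.blockB N k (y / N) (y % N))) → h₂.time ≤ h₁.time + 14 →
        (∀ y' < y + 1, h₂.arr αmem (off + (1 + y')) = X.blockA N k (y' / N) (y' % N) ∧
          h₂.arr αmem (off + (1 + N ^ 2 + y')) = X.blockB N k (y' / N) (y' % N)) ∧
        (∀ x, (x ≤ off ∨ off + 1 + 2 * N ^ 2 ≤ x) → h₂.arr αmem x = h.arr αmem x) ∧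
        h₂.time + 1 ≤ h.time + 15 * (y + 1) + 1 := by
      intro h₂ g1 g2
      simp only [g1, Function.update_self]
      refine ⟨fun y' hy' => ?_, fun x hx => ?_, by omega⟩
      · simp only [Function.update_apply]
        by_cases hyy : y' = y
        · subst hyy
          rw [if_neg (by omega)]; simp
        · obtain ⟨g3, g4⟩ := h3 y' (by omega)
          rw [if_neg (by omega), if_neg (by omega), if_neg (by omega), if_neg (by omega)]
          exact ⟨g3, g4⟩
      · rw [Function.update_of_ne (by omega), Function.update_of_ne (by omega)]
        exact h4 x hx
    rw [wp_seq]
    refine (entry_spec (k := k) ⟨hc₁.tick, H.pos, H.le, hN₁, h2, ?_, ?_⟩ hk₁ hkN h1 hy).call ?_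
    · intro s hs v hv; rw [HState.tick_arr, hf.arr _ rfl]; exact H.code0 _ hs v hv
    · intro s hs v hv; rw [HState.tick_arr, hf.arr _ rfl]; exact H.code1 _ hs v hv
    rintro h₂ hf₂ ⟨g1, g2, g3⟩
    have g4 : h₂.reg ρmo = off := (hf₂.reg _ rfl).trans hoff₁
    have g5 : h₂.reg ρNN = N ^ 2 := (hf₂.reg _ rfl).trans h2
    have g6 : h₂.reg ρy = y := (hf₂.reg _ rfl).trans h1
    have g7 : h₂.arr = h₁.arr := funext fun a => hf₂.arr _ rfl
    simp only [wp_seq, wp_st, Exp.ok_add, Exp.ok_var, Exp.ok_ofNat, Exp.ev_add, Exp.ev_var,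
      Exp.ev_ofNat, HState.put_reg, g1, g2, g4, g5, g6, true_and, HState.set_arr,
      HState.set_time]
    repeat refine ⟨by omega, ?_⟩
    refine fin _ ?_ (by simp at g3 ⊢; omega)
    simp [HState.put, g7]
  · rintro h₁ hf ⟨h3, h4, h5⟩
    rw [H.rNN] at h3 h5
    exact ⟨h3, h4, by simp; omega⟩

end WordRAM

namespace WordRAM

variable {E : Env} {X : Inst E} {h h' : HState}

/-- The effect of one block of the product. -/
structure BlockRes (X : Inst E) (P : Prog) (T : ℕ → ℕ) (N k c : ℕ) (h h' : HState) : Prop where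
  call : h'.reg ρcall = c + 1
  fresh : ∀ x, (c + 1) * X.Z ≤ x → h'.arr αmem x = 0
  ok : h'.reg ρok = h.reg ρok ∨ h'.reg ρok = 0
  ok_eq : T N ≤ X.fuel → h'.reg ρok = h.reg ρok
  acc : h'.reg ρok ≠ 0 → ∀ y < N ^ 2, h'.arr αacc y = h.arr αacc y +
    ∑ v ∈ Finset.range N, X.blockA N k (y / N) v * X.blockB N k v (y % N)
  acc_le : ∀ y < N ^ 2, h'.arr αacc y ≤ h.arr αacc y + X.Z
  time : h'.time ≤ h.time + (P.size * (1 + X.fuel) + P.top + 20 * N ^ 2 + 20)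

/-- A simulated program expects memory that is zero behind its input. Instead of being cleared, the
memory is used only once: the run with number `c` works on the `Z` cells from `c * Z` on. -/
theorem mulBlock_spec (hE : E.Valid) {P : Prog} {T : ℕ → ℕ} {N k c : ℕ} (hP : X.Multiplies P T)
    (htop : P.top ≤ E.B) (H : MulPre X N h) (hκ : 4 ≤ X.κ) (hk : h.reg ρbi = k)
    (hkN : k * N + N < E.B) (hc : h.reg ρcall = c) (hcB : (c + 1) * X.Z + X.Z ≤ E.B)
    (hfresh : ∀ x, c * X.Z ≤ x → h.arr αmem x = 0)
    (hacc : ∀ y < N ^ 2, h.arr αacc y + X.Z < E.B) :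
    wp E (mulBlock P) (BlockRes X P T N k c h) h := by
  have hB1 := X.hundred_lt
  have hβ := X.β_lt
  have hN2 := X.sq_le H.le
  have hZ := X.β_le_Z (by omega)
  have hNpos := H.pos
  have h8 := X.β_ge
  have hcZ : (c + 1) * X.Z = c * X.Z + X.Z := by ring
  have hc1 : c ≤ c * X.Z := Nat.le_mul_of_pos_right _ (by omega)
  have hrZ := H.ctx.rZ
  simp only [mulBlock, wp_seq, wp_asg, wp_st]
  simp [hc, H.ctx.rZ, H.rN]
  repeat refine ⟨by omega, ?_⟩
  have H1 : MulPre X N (((h.set ρmo (c * X.Z)).set ρcall (c + 1)).put αmem (c * X.Z) N) :=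
    ⟨((H.ctx.set rfl).set rfl).put rfl, H.pos, H.le, by simp [H.rN], by simp [H.rNN],
      by simpa using H.code0, by simpa using H.code1⟩
  refine (fill_spec (k := k) (off := c * X.Z) H1 (by omega) (by simp [hk]) hkN (by simp) (by omega)).call ?_
  rintro h₁ hf₁ ⟨f1, f2, f3⟩
  have hc₁ := H1.ctx.frame hf₁ rfl
  refine (zeroRegs_spec (h := h₁) (by omega) P.top).call ?_
  rintro h₂ hf₂ ⟨z1, z2⟩
  have r₂ : ∀ r, r < 63 → h₂.reg r = h₁.reg r := fun r hr => hf₂.reg _ (zeroRegs_W _ hr)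
  have a₂ : h₂.arr = h₁.arr := funext fun a => hf₂.arr _ (zeroRegs_WA _ _)
  have e1 : h₁.reg ρfuel = X.fuel := hc₁.rfuel
  have e2 : h₁.reg ρmo = c * X.Z := by rw [hf₁.reg _ rfl]; simp
  have e3 : h₁.reg ρcall = c + 1 := by rw [hf₁.reg _ rfl]; simp
  have e4 : h₁.reg ρok = h.reg ρok := by rw [hf₁.reg _ rfl]; simp
  have e5 : h₁.reg ρNN = N ^ 2 := by rw [hf₁.reg _ rfl]; simp [H.rNN]
  have e6 : h₁.arr αacc = h.arr αacc := by
    rw [hf₁.arr _ rfl, HState.put_arr_of_ne _ _ _ _ _ (by decide)]; rfl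
  have m1 : ∀ x < 2 ^ (X.κ * (3 + 6 * X.e)), h₁.arr αmem (c * X.Z + x) =
      (encodeMatrices (natMatrix N (X.blockA N k)) (natMatrix N (X.blockB N k))).getD x 0 := by
    intro x hx
    rw [encodeMatrices_getD hNpos]
    split_ifs with g1 g2 g3
    · subst g1
      rw [f2 _ (by omega)]; simp
    · have := (f1 (x - 1) (by omega)).1
      rwa [show c * X.Z + (1 + (x - 1)) = c * X.Z + x by omega] at this
    · have := (f1 (x - 1 - N ^ 2) (by omega)).2
      rwa [show c * X.Z + (1 + N ^ 2 + (x - 1 - N ^ 2)) = c * X.Z + x by omega] at this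
    · rw [f2 _ (by omega)]
      simp
      rw [if_neg (by omega)]
      exact hfresh _ (by omega)
  have m1' : ∀ x, (c + 1) * X.Z ≤ x → h₁.arr αmem x = 0 := by
    intro x hx
    rw [f2 _ (by omega)]
    simp
    rw [if_neg (by omega)]
    exact hfresh _ (by omega)
  have hdig : ∀ x, (encodeMatrices (natMatrix N (X.blockA N k)) (natMatrix N (X.blockB N k))).getD
      x 0 < 2 ^ (X.κ * (3 + 6 * X.e)) := by
    intro x
    have := X.blockA_le N k ((x - 1) / N) ((x - 1) % N)
    have := X.blockB_le N k ((x - 1 - N ^ 2) / N) ((x - 1 - N ^ 2) % N)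
    have h2 : X.β ^ 2 < X.Z := Nat.pow_lt_pow_right (by omega) (by omega)
    have h1 : X.β < X.β ^ 2 := by nlinarith
    have := Nat.le_self_pow (n := 2) (by omega) N
    rw [encodeMatrices_getD hNpos, X.Z_eq]
    split_ifs <;> omega
  have hsim : Sim (X.κ * (3 + 6 * X.e)) P.top (c * X.Z) (State.init _
      (encodeMatrices (natMatrix N (X.blockA N k)) (natMatrix N (X.blockB N k))))
      (h₂.set ρfu X.fuel) := by
    refine ⟨fun r hr => ?_, fun x hx => ?_⟩
    · simp [State.init, z1 r hr]; omega
    · simp only [HState.set_arr, a₂, m1 x hx, State.init, BitVec.toNat_ofNat, Nat.mod_eq_of_lt hx]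
      exact (Nat.mod_eq_of_lt (hdig x)).symm
  have hse : SimEnv E (X.κ * (3 + 6 * X.e)) P.top (c * X.Z) (h₂.set ρfu X.fuel) := by
    refine ⟨by positivity, ?_, htop, by rw [X.Z_eq]; omega, ?_, ?_⟩
    · have h1 := X.pow_β_lt' (k := X.κ) (by omega)
      have h2 := hE.fits
      exact ((Nat.pow_lt_pow_iff_right (by decide)).1 (show 2 ^ (X.κ * (3 + 6 * X.e)) < 2 ^ E.w by
        rw [X.Z_eq, Inst.Z]; omega)).le
    · rw [X.Z_eq]; simp [r₂, hc₁.rZ]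
    · simp [r₂, e2]
  rw [r₂ _ (by decide), e1]
  refine (P.sim_spec _ _ le_rfl hse hsim).call ?_
  rintro h₃ hf₃ ⟨s', R⟩
  have r₃ : ∀ r, r < 63 → r ≠ ρfu → h₃.reg r = h₁.reg r := fun r hr hr' => by
    rw [hf₃.reg _ (P.sim_W (by omega) hr')]; simp [hr', r₂ r hr]
  have a₃ : ∀ a, a ≠ αmem → h₃.arr a = h₁.arr a := fun a ha => by
    rw [hf₃.arr _ (P.sim_WA ha)]; simp [a₂]
  have hc₃ : Ctx X h₃ := hc₁.congr (fun r hr => r₃ r (by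
    simp only [ctxReg, Bool.or_eq_true, Bool.and_eq_true, decide_eq_true_eq] at hr
    omega) (by rintro rfl; cases hr)) fun a ha => a₃ a (by rintro rfl; cases ha)
  have R1 := R.fuel
  have R2 := R.time
  simp only [HState.set_reg, if_true, HState.set_time] at R1 R2
  have R3 : P.size * (1 + (X.fuel - h₃.reg ρfu)) ≤ P.size * (1 + X.fuel) :=
    Nat.mul_le_mul_left _ (by omega)
  have hrun := hP N H.pos H.le _ _ (fun i j => X.blockA_le N k i j) fun i j => X.blockB_le N k i j
  obtain ⟨t, s, run1, run2, run3⟩ := hrun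
  -- Fuel that is left proves that the program has halted, and so in the state with the product.
  have done : h₃.reg ρfu ≠ 0 → s' = s := by
    intro h0
    rcases R.res with ⟨t1, q1, q2⟩ | ⟨q1, -⟩
    · exact (q1.unique run1).2
    · exact absurd q1 h0
  -- Using up the fuel proves that the multiplication takes at least that long.
  have notdone : h₃.reg ρfu = 0 → X.fuel < T N := by
    intro h0
    rcases R.res with ⟨t1, q1, q2⟩ | ⟨-, q2⟩
    · obtain ⟨rfl, -⟩ := q1.unique run1
      simp at q2; omega
    · have := q2 _ _ run1
      simp at this; omega
  have last : ∀ h₄ : HState, h₄.arr = h₃.arr → (∀ r < 61, h₄.reg r = h₃.reg r) →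
      (h₄.reg ρok = h.reg ρok ∨ h₄.reg ρok = 0) → (T N ≤ X.fuel → h₄.reg ρok = h.reg ρok) →
      (h₄.reg ρok ≠ 0 → s' = s) → h₄.time ≤ h₃.time + 2 →
      wp E (.for' ρy ρNN (
        .ld ρd0 αmem (.var ρmo + (1 + 2 * .var ρNN + .var ρy)) ;; .ld ρd1 αacc (.var ρy) ;;
        .st αacc (.var ρy) (.var ρd0 + .var ρd1))) (BlockRes X P T N k c h) h₄ := by
    intro h₄ g1 g2 g3 g4 g5 g6
    have i1 : h₄.reg ρNN = N ^ 2 := by rw [g2 _ (by decide), r₃ _ (by decide) (by decide), e5]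
    have i2 : h₄.reg ρmo = c * X.Z := by rw [g2 _ (by decide), r₃ _ (by decide) (by decide), e2]
    have i3 : h₄.reg ρcall = c + 1 := by rw [g2 _ (by decide), r₃ _ (by decide) (by decide), e3]
    have i4 : h₄.arr αacc = h.arr αacc := by rw [g1, a₃ _ (by decide), e6]
    have i5 : ∀ y, h₄.arr αmem y = h₃.arr αmem y := fun y => by rw [g1]
    -- Simulated cells are words modulo `Z`. The first bound thus holds even for an unfinished
    -- product, and the accumulators cannot overflow.
    have i6 : ∀ y < N ^ 2, h₄.arr αmem (c * X.Z + (1 + 2 * N ^ 2 + y)) < X.Z ∧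
        (h₄.reg ρok ≠ 0 → h₄.arr αmem (c * X.Z + (1 + 2 * N ^ 2 + y)) =
          ∑ v ∈ Finset.range N, X.blockA N k (y / N) v * X.blockB N k v (y % N)) := by
      intro y hy
      rw [i5, R.sim.mem _ (by rw [X.Z_eq]; omega)]
      refine ⟨by rw [← X.Z_eq]; exact BitVec.isLt _, fun h0 => ?_⟩
      rw [g5 h0, ← run3 (y / N) (Nat.div_lt_of_lt_mul (by rwa [pow_two] at hy)) (y % N)
        (Nat.mod_lt _ hNpos), show 1 + 2 * N ^ 2 + N * (y / N) + y % N = 1 + 2 * N ^ 2 + y by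
          have := Nat.div_add_mod y N; omega]
    refine wp_for (fun z h₅ => (∀ y < N ^ 2, h₅.arr αacc y = h.arr αacc y +
      if y < z then h₄.arr αmem (c * X.Z + (1 + 2 * N ^ 2 + y)) else 0) ∧
      h₅.time ≤ h₄.time + 1 + 5 * z) (by decide) rfl rfl (by omega) (by omega) ?_ ?_ ?_
    · simp [i4]
    · rintro y hy h₅ hf₅ j1 j2 ⟨j3, j4⟩
      rw [i1] at hy j2
      have j5 : h₅.reg ρmo = c * X.Z := (hf₅.reg _ rfl).trans i2
      have j6 : h₅.arr αmem = h₄.arr αmem := hf₅.arr _ rfl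
      have j7 := j3 y hy
      have j8 := (i6 y hy).1
      have j9 := hacc y hy
      simp at j7
      simp only [wp_seq, wp_ld, wp_st]
      simp [j1, j2, j5, j6, j7]
      repeat refine ⟨by omega, ?_⟩
      refine ⟨fun y' hy' => ?_, by omega⟩
      by_cases hyy : y' = y
      · subst hyy; simp; omega
      · rw [if_neg hyy, j3 y' hy']
        simp only [show y' < y ↔ y' ≤ y by omega]
    · rintro h₅ hf₅ ⟨j3, j4⟩
      rw [i1] at j3 j4
      have k1 : h₅.reg ρok = h₄.reg ρok := hf₅.reg _ rfl
      have k2 : h₅.arr αmem = h₄.arr αmem := hf₅.arr _ rfl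
      refine ⟨(hf₅.reg _ rfl).trans i3, fun x hx => ?_, by rw [HState.tick_reg, k1]; exact g3,
        fun hT => by rw [HState.tick_reg, k1]; exact g4 hT, fun h0 y hy => ?_, fun y hy => ?_, ?_⟩
      · rw [HState.tick_arr, k2, i5, R.mem x (Or.inr (by rw [X.Z_eq]; omega)), HState.set_arr, a₂]
        exact m1' x hx
      · rw [HState.tick_reg, k1] at h0
        rw [HState.tick_arr, j3 y hy, if_pos hy, (i6 y hy).2 h0]
      · rw [HState.tick_arr, j3 y hy, if_pos hy]
        have := (i6 y hy).1
        omega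
      · simp at f3 z2 ⊢
        omega
  simp only [Cmd.skip, wp_asg]
  have q4 : h₃.reg ρok = h.reg ρok := by rw [r₃ _ (by decide) (by decide), e4]
  refine ⟨fun h0 => ?_, fun h0 => ?_⟩
  · simp
    refine ⟨by omega, last _ rfl (fun r hr => ?_) ?_ ?_ ?_ ?_⟩
    · simp; omega
    · simp [q4]
    · simp [q4]
    · exact fun _ => done h0
    · simp
  · refine ⟨by omega, last _ rfl (fun r hr => ?_) ?_ ?_ ?_ ?_⟩
    · simp; omega
    · simp
    · intro hT; have := notdone h0; omega
    · simp
    · simp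

end WordRAM

/-! ### All pairs of samples by matrix products -/

namespace WordRAM

variable {E : Env} {X : Inst E} {h h' : HState}

notation "ρnb" => 48

/-- Find a pair of samples that separates two vertices, and search from it. -/
def scan : Cmd :=
  .ld ρpa αsmp 0 ;; .ld ρpb αsmp 0 ;;
  .for' ρy ρNN (
    .ld ρx αacc (.var ρy) ;; .asg ρd0 (.var ρx / .var ρβ) ;; .asg ρd1 (.var ρd0 / .var ρβ) ;;
    -- Remainders and quotients give the digits, and the sum of two truth values serves as a
    -- disjunction.
    .ite (.and (.var ρx % .var ρβ) (.var ρd1 / .var ρβ) +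
        .and (.var ρd0 % .var ρβ) (.var ρd1 % .var ρβ))
      (.ld ρpa αsmp (.var ρy / .var ρN) ;; .ld ρpb αsmp (.var ρy % .var ρN)) .skip) ;;
  .asg ρM 0 ;; .asg ρJ 1 ;; pairCheck

/-- Search from all pairs of samples with the help of the product of the matrices. -/
def pairs (P : Prog) : Cmd :=
  .asg ρNN (.var ρN * .var ρN) ;; .asg ρnb (.var ρa * .var ρH) ;; .asg ρok 1 ;;
  .for' ρy ρNN (.st αacc (.var ρy) 0) ;;
  .for' ρbi ρnb (mulBlock P) ;;
  scan

/-- The entry `c` of the product shows that two vertices are separated. -/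
def Inst.Flag (X : Inst E) (c : ℕ) : Prop :=
  (c % X.β ≠ 0 ∧ c / X.β / X.β / X.β ≠ 0) ∨ (c / X.β % X.β ≠ 0 ∧ c / X.β / X.β % X.β ≠ 0)

/-- Only one pair is searched: the last flagged one, or the sample `0` twice if there is none. If
any pair is flagged, the searched pair is a flagged one, from which `pairCheck` cannot fail; so
failure means that no pair of samples separates two vertices. -/
theorem scan_spec {N : ℕ} (hc : Ctx X h) (hN : 0 < N) (hNa : N ≤ X.a ^ 3) (hrN : h.reg ρN = N)
    (hrNN : h.reg ρNN = N ^ 2) :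
    wp E scan (Srch X ((∀ y < N ^ 2, h.arr αacc y =
        ∑ v ∈ Finset.range X.n, X.code 0 (y / N) v * X.code 1 (y % N) v) →
      ∀ s < N, ∀ s' < N, X.NoSep 0 (X.smp s) 1 (X.smp s')) (340 * X.m + 10 * N ^ 2) h) h := by
  have hB := X.hundred_lt
  have hn := X.n_pos
  have hnm := X.n_le_m
  have hβ := X.β_lt
  have h8 := X.β_ge
  have ha3 := X.pow_a_le (k := 3) (by omega)
  have hN2 := X.sq_le hNa
  have hs0 := hc.smp 0 (by omega)
  simp only [scan, wp_seq, wp_ld]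
  simp [hs0]
  refine ⟨by omega, ?_⟩
  refine wp_for (fun k h₁ => h₁.reg ρpa < X.n ∧ h₁.reg ρpb < X.n ∧
      (∀ y < k, X.Flag (h.arr αacc y) → ∃ y' < N ^ 2, X.Flag (h.arr αacc y') ∧
        h₁.reg ρpa = X.smp (y' / N) ∧ h₁.reg ρpb = X.smp (y' % N)) ∧
      h₁.time ≤ h.time + 3 + 9 * k) (by decide) rfl rfl (by omega) (by simp; omega) ?_ ?_ ?_
  · simp [X.smp_lt]
  · rintro y hy h₁ hf h1 h2 ⟨h3, h4, h5, h6⟩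
    simp [hrNN] at hy h2
    have hc₁ := ((hc.set rfl).set rfl).frame hf rfl
    have hN₁ : h₁.reg ρN = N := by rw [hf.reg _ rfl]; simp [hrN]
    have hacc₁ : h₁.arr αacc y = h.arr αacc y := by rw [hf.arr _ rfl]; simp
    have hr : y / N < N := Nat.div_lt_of_lt_mul (by rwa [pow_two] at hy)
    have hcl : y % N < N := Nat.mod_lt _ hN
    have e1 := hc₁.smp (y / N) (by omega)
    have e2 := hc₁.smp (y % N) (by omega)
    have p1 := X.smp_lt (y / N)
    have p2 := X.smp_lt (y % N)
    simp only [wp_seq, wp_ld, wp_ite, Cmd.skip, wp_asg]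
    simp [-Nat.div_eq_zero_iff, h1, hacc₁, hc₁.rβ, hN₁, e1, e2]
    generalize hg : h.arr αacc y = g at *
    refine ⟨by omega, ⟨by omega, by split_ifs <;> omega⟩, fun hF => ?_, fun hF hF' => ?_⟩
    · have hF : X.Flag g := by unfold Inst.Flag; tauto
      refine ⟨by omega, by omega, p1, p2, fun y' hy' _ => ⟨y, hy, by rwa [hg], rfl, rfl⟩,
        by omega⟩
    · have hF : ¬ X.Flag g := by unfold Inst.Flag; tauto
      refine ⟨by omega, h3, h4, fun y' hy' h7 => ?_, by omega⟩
      rcases Nat.lt_or_eq_of_le hy' with h8 | rfl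
      · exact h5 y' h8 h7
      · rw [hg] at h7; exact absurd h7 hF
  · rintro h₁ hf ⟨h3, h4, h5, h6⟩
    simp [hrNN] at h5 h6
    have hc₁ := ((hc.set rfl).set rfl).frame hf rfl
    have hS₁ : Srch X True (3 + 9 * N ^ 2 + 1) h h₁.tick := by
      refine Srch.tick (Srch.of_eq ?_ ?_ ?_ (by omega) trivial) <;> rw [hf.reg _ rfl] <;> simp
    refine ⟨by omega, by omega, ?_⟩
    refine (pairCheck_spec (i := 0) ((hc₁.tick.set rfl).set rfl) (by omega) (by simp) (by simp)
      (by simpa using h3) (by simpa using h4)).mono fun h₂ hS₂ => ?_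
    simp at hS₂
    refine (((hS₁.set (by decide) (by decide) (by decide)).set (by decide) (by decide)
      (by decide)).trans hS₂).mono (fun hF hacc s hs s' hs' => ?_) (by omega)
    by_contra hno
    have e1 : (s * N + s') / N = s := by
      rw [Nat.mul_comm, Nat.mul_add_div hN, Nat.div_eq_of_lt hs', Nat.add_zero]
    have e2 : (s * N + s') % N = s' := by
      rw [Nat.mul_comm, Nat.mul_add_mod, Nat.mod_eq_of_lt hs']
    have hy : s * N + s' < N ^ 2 := by nlinarith
    have hfl : X.Flag (h.arr αacc (s * N + s')) := by
      refine (X.noSep_of_digits (s := s) (s' := s') ?_).2 hno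
      rw [hacc _ hy, e1, e2]
    obtain ⟨y', hy', g1, g2, g3⟩ := h5 _ hy hfl
    have := (X.noSep_of_digits (hacc y' hy')).1 g1
    rw [g2, g3] at hF
    exact this hF.2

theorem mulBlock_ctx (P : Prog) {r : ℕ} (hr : ctxReg r = true) : (mulBlock P).W r = false := by
  simp only [ctxReg, Bool.or_eq_true, Bool.and_eq_true, decide_eq_true_eq] at hr
  refine mulBlock_W P (by omega) ?_ ?_ ?_ ?_ ?_ ?_ ?_ ?_ ?_ ?_ ?_ <;> omega

/-- The effect of `pairs`. -/
structure PairsRes (X : Inst E) (P : Prog) (T : ℕ → ℕ) (N K c : ℕ) (h h' : HState) : Prop where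
  call : h'.reg ρcall = c + K
  fresh : ∀ x, (c + K) * X.Z ≤ x → h'.arr αmem x = 0
  ok : h'.reg ρok ≤ 1
  ok_eq : T N ≤ X.fuel → h'.reg ρok = 1
  srch : Srch X (h'.reg ρok = 1 → ∀ s < N, ∀ s' < N, X.NoSep 0 (X.smp s) 1 (X.smp s'))
    (K * (P.size * (1 + X.fuel) + P.top + 20 * N ^ 2 + 22) + 20 * N ^ 2 + 360 * X.m) h h'

/-- The `K` block products are summed in `αacc`. Each adds at most `Z` to an entry, and `K < β`, so
the sums stay below `β * Z` whether or not the products are finished. -/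
theorem pairs_spec (hE : E.Valid) {P : Prog} {T : ℕ → ℕ} {N K c : ℕ} (hP : X.Multiplies P T)
    (htop : P.top ≤ E.B) (hc : Ctx X h) (hκ : 4 ≤ X.κ) (hN : 0 < N) (hNa : N ≤ X.a ^ 3)
    (hrN : h.reg ρN = N) (hK : X.a * h.reg ρH = K) (hKa : K ≤ X.a ^ 4) (hcov : X.n ≤ K * N)
    (hcode0 : ∀ s < N, ∀ v < X.n, h.arr αcode0 (s * X.n + v) = X.code 0 s v)
    (hcode1 : ∀ s < N, ∀ v < X.n, h.arr αcode1 (s * X.n + v) = X.code 1 s v)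
    (hcall : h.reg ρcall = c) (hcB : (c + K + 1) * X.Z ≤ E.B)
    (hfresh : ∀ x, c * X.Z ≤ x → h.arr αmem x = 0) :
    wp E (pairs P) (PairsRes X P T N K c h) h := by
  have hB := X.hundred_lt
  have hn := X.n_pos
  have hnm := X.n_le_m
  have hβ := X.β_lt
  have hβ2 := X.β2_lt
  have h8 := X.β_ge
  have ha3 := X.pow_a_le (k := 3) (by omega)
  have ha4 := X.pow_a_le (k := 4) (by omega)
  have hN2 := X.sq_le hNa
  have hNN : N * N = N ^ 2 := by ring
  have hZβ : X.β * X.Z < E.B := by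
    have := X.pow_β_lt' (k := X.κ + 1) (by omega)
    rwa [pow_succ', ← Inst.Z] at this
  have hKZ : K * X.Z + X.Z < E.B := by
    refine lt_of_le_of_lt ?_ hZβ
    have : (K + 1) * X.Z ≤ X.β * X.Z := Nat.mul_le_mul_right _ (by omega)
    linarith
  have hKN : K * N + N < E.B := by
    refine lt_of_le_of_lt ?_ hβ2
    have : (K + 1) * N ≤ X.β * X.β := Nat.mul_le_mul (by omega) (by omega)
    nlinarith
  simp only [pairs, wp_seq, wp_asg]
  simp [hrN, hc.ra, hK, hNN]
  repeat refine ⟨by omega, ?_⟩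
  refine wp_for (fun k h₁ => (∀ y < k, h₁.arr αacc y = 0) ∧ h₁.time ≤ h.time + 4 + 3 * k)
    (by decide) rfl rfl (by omega) (by simp; omega) (by simp) ?_ ?_
  · rintro y hy h₁ hf h1 h2 ⟨h3, h4⟩
    simp at hy
    simp [h1]
    repeat refine ⟨by omega, ?_⟩
    exact ⟨fun y' hy' hne => h3 y' (by omega), by omega⟩
  rintro h₁ hf ⟨h3, h4⟩
  simp at h3 h4
  have hc₁ := ((((hc.set rfl).set rfl).set rfl).frame hf rfl).tick
  have hN₁ : h₁.tick.reg ρN = N := by rw [HState.tick_reg, hf.reg _ rfl]; simp [hrN]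
  have hNN₁ : h₁.tick.reg ρNN = N ^ 2 := by rw [HState.tick_reg, hf.reg _ rfl]; simp
  have hnb₁ : h₁.tick.reg ρnb = K := by rw [HState.tick_reg, hf.reg _ rfl]; simp
  have hok₁ : h₁.tick.reg ρok = 1 := by rw [HState.tick_reg, hf.reg _ rfl]; simp
  have hcall₁ : h₁.tick.reg ρcall = c := by rw [HState.tick_reg, hf.reg _ rfl]; simp [hcall]
  have c0₁ : h₁.tick.arr αcode0 = h.arr αcode0 := by rw [HState.tick_arr, hf.arr _ rfl]; simp
  have c1₁ : h₁.tick.arr αcode1 = h.arr αcode1 := by rw [HState.tick_arr, hf.arr _ rfl]; simp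
  have mem₁ : h₁.tick.arr αmem = h.arr αmem := by rw [HState.tick_arr, hf.arr _ rfl]; simp
  have hS₁ : Srch X True (5 + 3 * N ^ 2) h h₁.tick := by
    refine Srch.of_eq ?_ ?_ ?_ (by simp; omega) trivial <;> rw [HState.tick_reg, hf.reg _ rfl] <;>
      simp
  set L := P.size * (1 + X.fuel) + P.top + 20 * N ^ 2 + 22 with hL
  have fr : ∀ h₂, Frame (Cmd.for' ρbi ρnb (mulBlock P)) h₁.tick h₂ →
      Ctx X h₂ ∧ h₂.reg ρN = N ∧ h₂.reg ρNN = N ^ 2 ∧ h₂.arr αcode0 = h.arr αcode0 ∧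
        h₂.arr αcode1 = h.arr αcode1 := by
    intro h₂ hf₂
    refine ⟨hc₁.congr (fun r hr => hf₂.reg r ?_) (fun a ha => hf₂.arr a ?_), ?_, ?_, ?_, ?_⟩
    · have : r ≠ ρbi := by rintro rfl; cases hr
      simp [Cmd.for', Cmd.W, mulBlock_ctx P hr, this]
    · have h1 : αmem ≠ a := by rintro rfl; cases ha
      have h2 : αacc ≠ a := by rintro rfl; cases ha
      simp [Cmd.for', Cmd.WA, mulBlock_WA P h1 h2]
    · rw [hf₂.reg _ (by simp [Cmd.for', Cmd.W, mulBlock_W]), hN₁]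
    · rw [hf₂.reg _ (by simp [Cmd.for', Cmd.W, mulBlock_W]), hNN₁]
    · rw [hf₂.arr _ (by simp [Cmd.for', Cmd.WA, mulBlock_WA]), c0₁]
    · rw [hf₂.arr _ (by simp [Cmd.for', Cmd.WA, mulBlock_WA]), c1₁]
  refine wp_for (fun k h₂ => h₂.reg ρcall = c + k ∧
      (∀ x, (c + k) * X.Z ≤ x → h₂.arr αmem x = 0) ∧ h₂.reg ρok ≤ 1 ∧
      (T N ≤ X.fuel → h₂.reg ρok = 1) ∧
      (h₂.reg ρok = 1 → ∀ y < N ^ 2, h₂.arr αacc y = ∑ k' ∈ Finset.range k,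
        ∑ v ∈ Finset.range N, X.blockA N k' (y / N) v * X.blockB N k' v (y % N)) ∧
      (∀ y < N ^ 2, h₂.arr αacc y ≤ k * X.Z) ∧ h₂.time ≤ h₁.tick.time + 1 + L * k)
    (by decide) (mulBlock_W P (by decide) (by decide) (by decide) (by decide) (by decide)
      (by decide) (by decide) (by decide) (by decide) (by decide) (by decide) (by decide))
    (mulBlock_W P (by decide) (by decide) (by decide) (by decide) (by decide)
      (by decide) (by decide) (by decide) (by decide) (by decide) (by decide) (by decide))
    (by omega) (by rw [hnb₁]; have := X.Z; omega) ?_ ?_ ?_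
  · simp [hcall₁, hok₁]
    simp at hcall₁ hok₁ mem₁
    exact ⟨by simpa [mem₁] using hfresh, h3⟩
  · rintro k hk h₂ hf₂ h5 h6 ⟨g1, g2, g3, g4, g5, g6, g7⟩
    rw [hnb₁] at hk
    obtain ⟨i1, i2, i3, i4, i5⟩ := fr h₂ hf₂
    have hkZ : k * X.Z + X.Z ≤ K * X.Z := by
      rw [← Nat.succ_mul]; exact Nat.mul_le_mul_right _ hk
    refine (mulBlock_spec (k := k) (c := c + k) hE hP htop ⟨i1.tick, hN, hNa, i2, i3,
      by simpa [i4] using hcode0, by simpa [i5] using hcode1⟩ hκ h5 ?_ g1 ?_ g2 ?_).mono ?_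
    · have : k * N ≤ K * N := Nat.mul_le_mul_right _ hk.le
      omega
    · refine le_trans ?_ hcB
      have : (c + k + 2) * X.Z ≤ (c + K + 1) * X.Z := Nat.mul_le_mul_right _ (by omega)
      linarith
    · intro y hy
      have := g6 y hy
      simp
      omega
    rintro h₃ R
    have r1 := R.ok
    have r2 := R.ok_eq
    have r3 := R.acc
    have r4 := R.acc_le
    have r5 := R.time
    simp only [HState.tick_reg, HState.tick_arr, HState.tick_time] at r1 r2 r3 r4 r5
    refine ⟨by simp [R.call]; omega, fun x hx => R.fresh x (by simpa [Nat.add_assoc] using hx),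
      ?_, fun hT => ?_, fun h0 y hy => ?_, fun y hy => ?_, ?_⟩
    · simp; omega
    · simp [r2 hT, g4 hT]
    · simp at h0 ⊢
      rw [Finset.sum_range_succ, r3 (by omega) y hy, g5 (by omega) y hy]
    · have := r4 y hy
      have := g6 y hy
      simp [Nat.succ_mul]
      omega
    · simp [Nat.mul_succ] at g7 ⊢
      omega
  rintro h₂ hf₂ ⟨g1, g2, g3, g4, g5, g6, g7⟩
  rw [hnb₁] at g1 g2 g5 g6 g7
  obtain ⟨i1, i2, i3, i4, i5⟩ := fr h₂ hf₂
  refine (scan_spec (h := h₂.tick) i1.tick hN hNa i2 i3).call ?_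
  rintro h₃ hf₃ hS₃
  have hS₂ : Srch X True (2 + L * K) h₁.tick h₂.tick := by
    refine Srch.of_eq ?_ ?_ ?_ (by simp at g7 ⊢; omega) trivial <;> rw [HState.tick_reg] <;>
      exact hf₂.reg _ (by simp [Cmd.for', Cmd.W, mulBlock_W])
  have q1 : h₃.reg ρok = h₂.reg ρok := hf₃.reg _ rfl
  refine ⟨(hf₃.reg _ rfl).trans g1, fun x hx => ?_, by rw [q1]; exact g3,
    fun hT => by rw [q1]; exact g4 hT, ((hS₁.trans hS₂).trans hS₃).mono (fun hF h0 => ?_) ?_⟩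
  · rw [hf₃.arr _ rfl]; exact g2 x hx
  · refine hF.2 fun y hy => ?_
    rw [HState.tick_arr, g5 (by omega) y hy]
    exact X.sum_blocks N _ _ K hcov
  · rw [Nat.mul_comm K, ← hL]
    omega

end WordRAM

/-! ### The size of the sample, and the whole algorithm -/

namespace WordRAM

variable {E : Env} {X : Inst E} {h h' : HState}

theorem pairs_W (P : Prog) {r : ℕ} (hr : ctxReg r = true ∨ r = ρN ∨ r = ρH) :
    (pairs P).W r = false := by
  have h1 : (mulBlock P).W r = false := by
    rcases hr with hr | rfl | rfl
    · exact mulBlock_ctx P hr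
    all_goals simp [mulBlock_W]
  have h2 : r < 20 ∨ r = ρN ∨ r = ρH := by
    rcases hr with hr | hr
    · simp only [ctxReg, Bool.or_eq_true, Bool.and_eq_true, decide_eq_true_eq] at hr
      omega
    · exact Or.inr hr
  simp only [pairs, Cmd.for', Cmd.W, h1]
  rcases h2 with h2 | rfl | rfl
  · have h3 : ctxReg r = true := by
      rcases hr with hr | rfl | rfl
      · exact hr
      all_goals omega
    clear h1 hr
    interval_cases r <;> first | rfl | cases h3
  all_goals rfl

theorem pairs_WA (P : Prog) {a : ℕ} (ha : ctxArr a = true ∨ a = αhit) :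
    (pairs P).WA a = false := by
  simp only [ctxArr, Bool.or_eq_true, beq_iff_eq] at ha
  have h1 : (mulBlock P).WA a = false := mulBlock_WA P (by omega) (by omega)
  simp only [pairs, Cmd.for', Cmd.WA, h1]
  rcases ha with ((rfl | rfl) | rfl) | rfl <;> rfl

/-- Sample, and multiply matrices for smaller and smaller samples until this is fast enough. -/
def mainLoop (P : Prog) : Cmd :=
  .whl (.eq (.var ρok) 0) (
    .asg ρnum (.var ρN) ;; .asg ρoff 0 ;; sample ;; pairs P ;;
    .ite (.var ρok) .skip (.asg ρN (.var ρN / 2) ;; .asg ρH (2 * .var ρH)))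

/-- The table for the first `a ^ 2` samples is computed once, that for the first `N` in each pass.
The last pass fixes `H`, hence the cap `a * H * l` for balls that miss the first `N` samples. -/
def algorithm (P : Prog) : Cmd :=
  .asg ρnum (.var ρa2) ;; .asg ρoff (.var ρ2n) ;; sample ;;
  .asg ρN (.var ρa3) ;; .asg ρH 1 ;; .asg ρcall 0 ;; .asg ρok 0 ;; mainLoop P ;;
  .asg ρr (.var ρa * .var ρH * .var ρl) ;; search

/-- The state before the pass `j` of the main loop. -/
structure PassInv (X : Inst E) (T : ℕ → ℕ) (j : ℕ) (h : HState) : Prop where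
  ctx : Ctx X h
  le : j ≤ 3 * X.e
  rN : h.reg ρN = 2 ^ (3 * X.e - j)
  rH : h.reg ρH = 2 ^ j
  hitR : ∀ i < 2, ∀ v < X.n, h.arr αhit (2 * X.n + (2 * v + i)) ≠ 0 ↔ X.Hit i (X.a ^ 2) v
  -- Unless this is the first pass, products of twice the present size were too slow.
  fail : j = 0 ∨ X.fuel < T (2 ^ (3 * X.e - j + 1))

theorem Inst.pow_mul_pow (X : Inst E) {j : ℕ} (hj : j ≤ 3 * X.e) :
    2 ^ (3 * X.e - j) * 2 ^ j = X.a ^ 3 := by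
  rw [← pow_add, Nat.sub_add_cancel hj, Inst.a, ← pow_mul, Nat.mul_comm]

/-- The time for one pass. -/
def passTime (P : Prog) (F : ℕ) : ℕ := 2 * P.size * F + P.top + 1400

/-- The `a * H` products with fuel of order `m * a ^ 2` each give `m * a ^ 3 * H`. Handling the `N ^
2` entries of all blocks costs no more, as `a * H * N ^ 2 = a ^ 4 * N ≤ 16 * n * N`. -/
theorem Inst.pass_le (X : Inst E) (P : Prog) {F j N H : ℕ} (hF : X.fuel ≤ F * (X.m * X.a ^ 2))
    (hF0 : 0 < F) (hH : H = 2 ^ j) (hN : N * H = X.a ^ 3) :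
    120 * X.m * (N + 1) + (X.a * H * (P.size * (1 + X.fuel) + P.top + 20 * N ^ 2 + 22) + 20 * N ^ 2
      + 360 * X.m) + 20 ≤ passTime P F * (X.m * X.a ^ 3 * 2 ^ j) := by
  have hH1 : 1 ≤ H := by rw [hH]; exact Nat.one_le_two_pow
  have ha := X.a_pos
  have hn := X.n_pos
  have hm : 1 ≤ X.m := by have := X.n_le_m; omega
  have hNa : N ≤ X.a ^ 3 := by rw [← hN]; exact Nat.le_mul_of_pos_right _ hH1
  rw [← hH]
  set U := X.m * X.a ^ 3 * H with hU
  have ha3 : 1 ≤ X.a ^ 3 := Nat.one_le_pow _ _ ha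
  have u1 : X.m * X.a ^ 3 ≤ U := Nat.le_mul_of_pos_right _ hH1
  have u2 : X.m ≤ U := (Nat.le_mul_of_pos_right _ ha3).trans u1
  have u3 : X.m * N ≤ U := (Nat.mul_le_mul_left _ hNa).trans u1
  have e1 : X.a * H * N ^ 2 = X.a ^ 4 * N := by
    calc X.a * H * N ^ 2 = X.a * (N * H) * N := by ring
      _ = X.a ^ 4 * N := by rw [hN]; ring
  have u4 : X.a * H * N ^ 2 ≤ 16 * U := by
    rw [e1]
    calc X.a ^ 4 * N ≤ 16 * X.n * N := Nat.mul_le_mul_right _ X.le_n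
      _ ≤ 16 * X.m * N := Nat.mul_le_mul_right _ (Nat.mul_le_mul_left _ X.n_le_m)
      _ = 16 * (X.m * N) := by ring
      _ ≤ 16 * U := Nat.mul_le_mul_left _ u3
  have u5 : N ^ 2 ≤ 16 * U := le_trans (Nat.le_mul_of_pos_left _ (by positivity)) u4
  have e2 : X.a * H * (X.m * X.a ^ 2) = U := by rw [hU]; ring
  have u6 : X.a * H ≤ U := by
    rw [← e2]; exact Nat.le_mul_of_pos_right _ (Nat.mul_pos hm (by positivity))
  have u7 : X.a * H * (1 + X.fuel) ≤ 2 * F * U := by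
    have h1 : 1 ≤ X.m * X.a ^ 2 := Nat.mul_pos hm (by positivity)
    have h2 : 1 + X.fuel ≤ 2 * F * (X.m * X.a ^ 2) := by nlinarith
    calc X.a * H * (1 + X.fuel) ≤ X.a * H * (2 * F * (X.m * X.a ^ 2)) := Nat.mul_le_mul_left _ h2
      _ = 2 * F * (X.a * H * (X.m * X.a ^ 2)) := by ring
      _ = _ := by rw [e2]
  have u8 : X.a * H * (P.size * (1 + X.fuel)) ≤ 2 * P.size * F * U := by
    calc X.a * H * (P.size * (1 + X.fuel)) = P.size * (X.a * H * (1 + X.fuel)) := by ring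
      _ ≤ P.size * (2 * F * U) := Nat.mul_le_mul_left _ u7
      _ = _ := by ring
  have u9 : X.a * H * P.top ≤ P.top * U := by
    rw [Nat.mul_comm]; exact Nat.mul_le_mul_left _ u6
  unfold passTime
  have e3 : 120 * X.m * (N + 1) = 120 * (X.m * N) + 120 * X.m := by ring
  have e4 : X.a * H * (P.size * (1 + X.fuel) + P.top + 20 * N ^ 2 + 22) =
    X.a * H * (P.size * (1 + X.fuel)) + X.a * H * P.top + 20 * (X.a * H * N ^ 2) +
      22 * (X.a * H) := by ring
  have e5 : (2 * P.size * F + P.top + 1400) * U = 2 * P.size * F * U + P.top * U + 1400 * U := by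
    ring
  rw [e3, e4, e5]
  omega

/-- The bound for a pass grows with `j`, so all earlier passes are charged at the price of the
current one. Before pass `j` there were `a * (2 ^ j - 1)` products, which tells how much of the
memory for simulations is used. The loop ends at `N = 1` at the latest, by `hT1`. -/
theorem mainLoop_spec (hE : E.Valid) {P : Prog} {T : ℕ → ℕ} {F : ℕ} (hP : X.Multiplies P T)
    (htop : P.top ≤ E.B) (hκ : 4 ≤ X.κ) (hF : X.fuel ≤ F * (X.m * X.a ^ 2)) (hF0 : 0 < F)
    (hT1 : T 1 ≤ X.fuel) (h₀ : HState) : ∀ d j h, d + j = 3 * X.e → PassInv X T j h →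
      h.reg ρok = 0 → h.reg ρcall + X.a = X.a * 2 ^ j →
      (∀ x, h.reg ρcall * X.Z ≤ x → h.arr αmem x = 0) →
      Srch X True (j * (passTime P F * (X.m * X.a ^ 3 * 2 ^ j))) h₀ h →
      wp E (mainLoop P) (fun h' => ∃ j, PassInv X T j h' ∧ HitOK X (h'.reg ρN) (h'.arr αhit) ∧
        Srch X (∀ s < h'.reg ρN, ∀ s' < h'.reg ρN, X.NoSep 0 (X.smp s) 1 (X.smp s'))
          ((j + 1) * (passTime P F * (X.m * X.a ^ 3 * 2 ^ j))) h₀ h') h := by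
  have hB := X.hundred_lt
  have hn := X.n_pos
  have hn8 := X.n8_le
  have hβ := X.β_lt
  have h8 := X.β_ge
  have ha := X.a_pos
  have ha3 := X.pow_a_le (k := 3) (by omega)
  have ha4 := X.pow_a_le (k := 4) (by omega)
  have hZβ : X.β * X.Z < E.B := by
    have := X.pow_β_lt' (k := X.κ + 1) (by omega)
    rwa [pow_succ', ← Inst.Z] at this
  intro d
  induction d using Nat.strong_induction_on with
  | _ d ih =>
  intro j h hd I hok hcall hfresh hS
  have hNH := X.pow_mul_pow I.le
  set N := 2 ^ (3 * X.e - j) with hN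
  set H := 2 ^ j with hH
  have rN₀ : h.reg ρN = N := I.rN
  have rH₀ : h.reg ρH = H := I.rH
  have hN0 : 0 < N := by positivity
  have hH0 : 0 < H := by positivity
  have hNa : N ≤ X.a ^ 3 := by rw [← hNH]; exact Nat.le_mul_of_pos_right _ hH0
  have hHa : H ≤ X.a ^ 3 := by rw [← hNH]; exact Nat.le_mul_of_pos_left _ hN0
  have hKa : X.a * H ≤ X.a ^ 4 := by rw [pow_succ']; exact Nat.mul_le_mul_left _ hHa
  have hpass := X.pass_le P hF hF0 hH hNH
  rw [← hH] at hpass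
  have hdbl : X.a * 2 ^ (j + 1) = 2 * (X.a * H) := by rw [hH]; ring
  rw [mainLoop, wp_whl]
  refine ⟨by simp; omega, fun _ => ?_, fun h0 => by simp [hok] at h0⟩
  simp only [wp_seq, wp_asg]
  simp [rN₀]
  refine ⟨by omega, ?_⟩
  have hc₀ := (I.ctx.tick.set (r := ρnum) (x := N) rfl).set (r := ρoff) (x := 0) rfl
  refine (sample_spec hc₀ (N := N) (off := 0) (by simp) hNa (by simp) (by omega)).call ?_
  rintro h₁ hf₁ ⟨S, t₁⟩
  have hc₁ := hc₀.frame hf₁ rfl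
  have rN₁ : h₁.reg ρN = N := by rw [hf₁.reg _ rfl]; simp [rN₀]
  have rH₁ : h₁.reg ρH = H := by rw [hf₁.reg _ rfl]; simp [rH₀]
  have call₁ : h₁.reg ρcall = h.reg ρcall := by rw [hf₁.reg _ rfl]; simp
  have mem₁ : h₁.arr αmem = h.arr αmem := by rw [hf₁.arr _ rfl]; simp
  have hit₁ : HitOK X N (h₁.arr αhit) := by
    refine ⟨fun i hi v hv => by simpa using S.hit i hi v hv, fun i hi v hv => ?_⟩
    rw [S.other _ (Or.inr (by omega))]
    simpa using I.hitR i hi v hv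
  have hS₁ : Srch X True (j * (passTime P F * (X.m * X.a ^ 3 * H)) + (3 + 120 * X.m * (N + 1)))
      h₀ h₁ := by
    refine (hS.trans (G := True) (s := 3 + 120 * X.m * (N + 1)) (Srch.of_eq ?_ ?_ ?_
      (by simp at t₁; omega) trivial)).mono (fun _ => trivial) le_rfl <;>
      rw [hf₁.reg _ rfl] <;> simp
  refine (pairs_spec (K := X.a * H) (c := h.reg ρcall) hE hP htop hc₁ hκ hN0 hNa rN₁ (by rw [rH₁])
    hKa ?_ S.code0 S.code1 call₁ ?_ (by rw [mem₁]; exact hfresh)).call ?_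
  · refine X.n_le.trans (le_of_eq ?_)
    rw [Nat.mul_assoc, Nat.mul_comm H, hNH]; ring
  · refine le_trans ?_ hZβ.le
    refine Nat.mul_le_mul_right _ ?_
    omega
  rintro h₂ hf₂ R
  have fr : ∀ r, ctxReg r = true ∨ r = ρN ∨ r = ρH → h₂.reg r = h₁.reg r := fun r hr =>
    hf₂.reg r (pairs_W P hr)
  have hc₂ : Ctx X h₂ := hc₁.congr (fun r hr => fr r (Or.inl hr)) fun a ha =>
    hf₂.arr a (pairs_WA P (Or.inl ha))
  have rN₂ : h₂.reg ρN = N := (fr _ (by simp)).trans rN₁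
  have rH₂ : h₂.reg ρH = H := (fr _ (by simp)).trans rH₁
  have hit₂ : HitOK X N (h₂.arr αhit) := by
    rw [hf₂.arr _ (pairs_WA P (Or.inr rfl))]; exact hit₁
  have hS₂ := hS₁.trans R.srch
  have hok₂ := R.ok
  simp only [Cmd.skip]
  refine ⟨fun h0 => ?_, fun h0 => ?_⟩
  · simp only [wp_asg]
    refine ⟨by simp; omega, ?_⟩
    rw [wp_whl]
    refine ⟨by simp; omega, fun h1 => by simp at h1; exact absurd h1 h0, fun _ => ?_⟩
    refine ⟨j, ⟨((hc₂.tick).set rfl).tick, I.le, by simp [rN₂, hN], by simp [rH₂, hH], ?_, I.fail⟩, ?_, ?_⟩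
    · simpa using hit₂.R
    · simpa [rN₂] using hit₂
    · refine (((hS₂.tick).set (by decide) (by decide) (by decide)).tick).mono (fun hF => ?_) ?_
      · simpa [rN₂] using hF.2 (by omega)
      · rw [← hH, Nat.add_one_mul j]; omega
  · simp [rN₂, rH₂]
    refine ⟨by omega, by omega, ?_⟩
    -- For `j = 3 * e` the matrices are `1 × 1` and the fuel would have sufficed.
    have hj : j < 3 * X.e := by
      by_contra hj
      have : N = 1 := by rw [hN, show 3 * X.e - j = 0 by omega]; rfl
      rw [this] at R
      have := R.ok_eq hT1
      omega
    have hN2 : N / 2 = 2 ^ (3 * X.e - (j + 1)) := by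
      rw [hN, show 3 * X.e - j = (3 * X.e - (j + 1)) + 1 by omega, pow_succ]; simp
    have hH2 : 2 * H = 2 ^ (j + 1) := by rw [hH]; ring
    refine ih (d - 1) (by omega) (j + 1) _ (by omega)
      ⟨((hc₂.tick).set rfl).set rfl, hj, by simpa using hN2, by simpa using hH2, ?_, Or.inr ?_⟩
      (by simp [h0]) ?_ ?_ ?_
    · simpa using hit₂.R
    · rw [show 3 * X.e - (j + 1) + 1 = 3 * X.e - j by omega, ← hN]
      by_contra hle
      have := R.ok_eq (not_lt.1 hle)
      omega
    · simp [R.call]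
      rw [hdbl]
      omega
    · simpa [R.call] using R.fresh
    · have hUU : passTime P F * (X.m * X.a ^ 3 * 2 ^ (j + 1)) =
          2 * (passTime P F * (X.m * X.a ^ 3 * H)) := by rw [← hH2]; ring
      refine (((hS₂.tick).set (by decide) (by decide) (by decide)).set (by decide) (by decide)
        (by decide)).mono (fun _ => trivial) ?_
      rw [hUU, Nat.add_one_mul j]
      have : j * (2 * (passTime P F * (X.m * X.a ^ 3 * H))) =
        2 * (j * (passTime P F * (X.m * X.a ^ 3 * H))) := by ring
      omega

/-- There is no pair of vertices that is far in both modes. -/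
def Inst.NoPair (X : Inst E) : Prop :=
  ∀ x < X.n, ∀ y < X.n, ¬ (4 * X.q ≤ X.d 0 x y ∧ 4 * X.q ≤ X.d 1 x y)

/-- A vertex near `x` is far from `y` in that mode. If `x` is hit in both modes, the two samples
separate `x` from `y`. If it is not hit in mode `1 - i`, it is either near one of the first `a ^ 2`
samples in mode `i` or unhit there too. -/
theorem Inst.noPair_of {N : ℕ}
    (h1 : ∀ s < N, ∀ s' < N, X.NoSep 0 (X.smp s) 1 (X.smp s'))
    (h2 : ∀ i < 2, (∀ k < X.a ^ 2, X.NoStar N i (X.smp k)) ∧ X.NoUnhit N i) : X.NoPair := by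
  rintro x hx y hy ⟨f0, f1⟩
  have far : ∀ i < 2, 4 * X.q ≤ X.d i x y := by
    intro i hi
    obtain rfl | rfl : i = 0 ∨ i = 1 := by omega
    · exact f0
    · exact f1
  have far' : ∀ i < 2, ∀ s, X.Near i s x → X.Far i s y := by
    intro i hi s hs
    have := far i hi
    have := X.d_tri i x s y
    have := X.d_comm i x s
    unfold Inst.Near at hs
    unfold Inst.Far
    omega
  have hit : ∀ i < 2, X.Hit (1 - i) N x := by
    intro i hi
    by_contra hno
    by_cases hR : X.Hit i (X.a ^ 2) x
    · obtain ⟨k, hk, hkx⟩ := hR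
      exact (h2 i hi).1 k hk x hx y hy hkx (far' i hi _ hkx) hno (far (1 - i) (by omega))
    · exact (h2 i hi).2 x hx y hy hno hR (far i hi) (far (1 - i) (by omega))
  obtain ⟨s, hs, hsx⟩ := hit 1 (by omega)
  obtain ⟨s', hs', hsx'⟩ := hit 0 (by omega)
  exact (h1 s hs s' hs').1 x hx y hy hsx hsx' (far' 0 (by omega) _ hsx) (far' 1 (by omega) _ hsx')

theorem algorithm_spec (hE : E.Valid) {P : Prog} {T : ℕ → ℕ} {F : ℕ} (hP : X.Multiplies P T)
    (htop : P.top ≤ E.B) (hκ : 4 ≤ X.κ) (hF : X.fuel ≤ F * (X.m * X.a ^ 2)) (hF0 : 0 < F)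
    (hT1 : T 1 ≤ X.fuel) (hc : Ctx X h) (hfresh : ∀ x, h.arr αmem x = 0) :
    wp E (algorithm P) (fun h' => ∃ j ≤ 3 * X.e, (j = 0 ∨ X.fuel < T (2 ^ (3 * X.e - j + 1))) ∧
      Srch X (X.Good (2 ^ (3 * X.e - j)) (X.a * 2 ^ j * X.l) → X.Good (X.a ^ 2) (X.a ^ 2 * X.l) →
        X.NoPair) ((passTime P F + 2000) * (X.m * X.a ^ 3 * 2 ^ j) * (3 * X.e + 1) *
          (X.l + 1) ^ 2) h h') h := by
  have hB := X.hundred_lt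
  have hn := X.n_pos
  have hnm := X.n_le_m
  have hn8 := X.n8_le
  have hβ := X.β_lt
  have h8 := X.β_ge
  have ha := X.a_pos
  have ha3 := X.pow_a_le (k := 3) (by omega)
  have ha4 := X.pow_a_le (k := 4) (by omega)
  have ha23 : X.a ^ 2 ≤ X.a ^ 3 := Nat.pow_le_pow_right X.a_pos (by omega)
  simp only [algorithm, wp_seq, wp_asg]
  simp [hc.ra2, hc.r2n]
  refine (sample_spec ((hc.set rfl).set rfl) (N := X.a ^ 2) (off := 2 * X.n) (by simp) ha23
    (by simp) (by omega)).call ?_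
  rintro h₁ hf₁ ⟨S, t₁⟩
  have hc₁ := ((hc.set (r := ρnum) rfl).set (r := ρoff) rfl).frame hf₁ rfl
  have mem₁ : h₁.arr αmem = h.arr αmem := by rw [hf₁.arr _ rfl]; simp
  repeat refine ⟨by omega, ?_⟩
  rw [hc₁.ra3]
  have hS₁ : Srch X True (2 + 120 * X.m * (X.a ^ 2 + 1)) h h₁ := by
    refine Srch.of_eq ?_ ?_ ?_ (by simp at t₁; omega) trivial <;> rw [hf₁.reg _ rfl] <;> simp
  have hS₂ := (((hS₁.set (r := ρN) (x := X.a ^ 3) (by decide) (by decide) (by decide)).set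
    (r := ρH) (x := 1) (by decide) (by decide) (by decide)).set (r := ρcall) (x := 0) (by decide)
    (by decide) (by decide)).set (r := ρok) (x := 0) (by decide) (by decide) (by decide)
  refine (mainLoop_spec hE hP htop hκ hF hF0 hT1 _ (3 * X.e) 0 _ (by omega)
    ⟨(((hc₁.set rfl).set rfl).set rfl).set rfl, by omega, ?_, by simp, ?_, Or.inl rfl⟩
    (by simp) (by simp) (by simp [mem₁, hfresh])
    (Srch.of_eq rfl rfl rfl (by simp) trivial)).mono ?_
  · simp [Inst.a, ← pow_mul, Nat.mul_comm]
  · simpa using S.hit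
  rintro h₃ ⟨j, I, hhit, hS₃⟩
  have hNH := X.pow_mul_pow I.le
  have hH0 : 0 < 2 ^ j := by positivity
  have hHa : 2 ^ j ≤ X.a ^ 3 := by rw [← hNH]; exact Nat.le_mul_of_pos_left _ (by positivity)
  have hKa : X.a * 2 ^ j ≤ X.a ^ 4 := by rw [pow_succ']; exact Nat.mul_le_mul_left _ hHa
  have hl := X.pow_β_lt (k := 1) (by omega)
  have hr : 2 * (X.a * 2 ^ j * X.l) + 2 < E.B := by
    have h1 : X.a * 2 ^ j * (X.l + 1) ≤ X.a ^ 4 * (X.l + 1) := Nat.mul_le_mul_right _ hKa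
    have h2 : 8 * X.a ^ 4 * (X.l + 1) ≤ X.β * (X.l + 1) := Nat.mul_le_mul_right _ ha4
    have h3 : 1 ≤ X.a * 2 ^ j := Nat.mul_pos ha hH0
    rw [pow_one] at hl
    nlinarith
  simp [I.ctx.ra, I.ctx.rl, I.rH]
  refine ⟨⟨by omega, by omega⟩, ?_⟩
  refine (search_spec (N := h₃.reg ρN) (I.ctx.set rfl) (by simpa using hr) hhit).mono ?_
  intro h₄ hS₄
  simp only [HState.set_reg, if_true] at hS₄
  refine ⟨j, I.le, I.fail, ((((hS₂.trans hS₃).set (by decide) (by decide) (by decide)).trans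
    hS₄)).mono (fun hF g1 g2 => ?_) ?_⟩
  · rw [I.rN] at hF
    exact Inst.noPair_of hF.1.2 (hF.2 g1 g2)
  · set H := 2 ^ j
    set U := X.m * X.a ^ 3 * H with hU
    have hm : 1 ≤ X.m := by omega
    have u1 : X.m * X.a ^ 2 ≤ U := by
      rw [hU, Nat.mul_assoc]
      exact Nat.mul_le_mul_left _ (ha23.trans (Nat.le_mul_of_pos_right _ hH0))
    have u2 : X.m ≤ U := (Nat.le_mul_of_pos_right _ (by positivity)).trans u1
    have u3 : X.m * X.a ^ 2 * (X.a * H * X.l + 1) ≤ U * (X.l + 1) := by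
      have e1 : U = X.m * X.a ^ 2 * (X.a * H) := by rw [hU]; ring
      rw [e1, Nat.mul_assoc (X.m * X.a ^ 2)]
      refine Nat.mul_le_mul_left _ ?_
      have : 1 ≤ X.a * H := Nat.mul_pos ha hH0
      nlinarith
    have hj := I.le
    have v1 : 1 ≤ (3 * X.e + 1) * (X.l + 1) ^ 2 := Nat.mul_pos (by omega) (by positivity)
    have v2 : j + 1 ≤ (3 * X.e + 1) * (X.l + 1) ^ 2 :=
      (Nat.succ_le_succ hj).trans (Nat.le_mul_of_pos_right _ (by positivity))
    have v3 : (X.l + 1) * (X.l + 1) ≤ (3 * X.e + 1) * (X.l + 1) ^ 2 := by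
      rw [← pow_two]; exact Nat.le_mul_of_pos_left _ (by omega)
    set V := (3 * X.e + 1) * (X.l + 1) ^ 2 with hV
    have w1 : U ≤ U * V := Nat.le_mul_of_pos_right _ v1
    have w2 : (j + 1) * (passTime P F * U) ≤ passTime P F * (U * V) := by
      calc (j + 1) * (passTime P F * U) ≤ V * (passTime P F * U) := Nat.mul_le_mul_right _ v2
        _ = _ := by ring
    have w3 : X.m * X.a ^ 2 * (X.a * H * X.l + 1) * (X.l + 1) ≤ U * V := by
      refine (Nat.mul_le_mul_right _ u3).trans ?_
      rw [Nat.mul_assoc]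
      exact Nat.mul_le_mul_left _ v3
    have e2 : (passTime P F + 2000) * U * (3 * X.e + 1) * (X.l + 1) ^ 2 =
      passTime P F * (U * V) + 2000 * (U * V) := by rw [hV]; ring
    rw [e2]
    have e3 : 120 * X.m * (X.a ^ 2 + 1) = 120 * (X.m * X.a ^ 2) + 120 * X.m := by ring
    rw [e3]
    clear hc hc₁ hS₁ hS₂ hS₃ hS₄ I S hP
    omega

end WordRAM

namespace WordRAM

variable {E : Env} {X : Inst E} {h h' : HState}

/-! ### Initialization -/

notation "ρm1" => 46
notation "ρm2" => 47
notation "ρlo" => 48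
notation "ρe4" => 50

/-- The number with the `b` binary digits of the tape from place `o` on. -/
def bitsVal (tape : ℕ → Bool) (o : ℕ) : ℕ → ℕ
  | 0 => 0
  | b + 1 => 2 * bitsVal tape o b + if tape (o + b) then 1 else 0

theorem bitsVal_lt (tape : ℕ → Bool) (o b : ℕ) : bitsVal tape o b < 2 ^ b := by
  induction b with
  | zero => simp [bitsVal]
  | succ b ih => rw [bitsVal, pow_succ]; split_ifs <;> omega

def powLoop : Cmd :=
  .asg ρa 1 ;; .asg ρa4 1 ;; .asg ρe4 0 ;;
  .whl (.lt (.var ρa4) (.var ρn)) (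
    .asg ρa (2 * .var ρa) ;; .asg ρa4 (16 * .var ρa4) ;; .asg ρe4 (.var ρe4 + 4))

theorem powLoop_spec {n e : ℕ} (hn : h.reg ρn = n) (he : Nat.clog 16 n = e) (hB : 16 ^ e < E.B)
    (hB' : 100 < E.B) (heB : 4 * e + 4 < E.B) :
    wp E powLoop (fun h' => h'.reg ρa = 2 ^ e ∧ h'.reg ρa4 = 16 ^ e ∧ h'.reg ρe4 = 4 * e ∧
      h'.time ≤ h.time + 4 + 4 * e) h := by
  have key : ∀ d j h₁, d + j = e → h₁.reg ρn = n → h₁.reg ρa = 2 ^ j → h₁.reg ρa4 = 16 ^ j →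
      h₁.reg ρe4 = 4 * j → h₁.time ≤ h.time + 3 + 4 * j →
      wp E (.whl (.lt (.var ρa4) (.var ρn)) (
        .asg ρa (2 * .var ρa) ;; .asg ρa4 (16 * .var ρa4) ;; .asg ρe4 (.var ρe4 + 4)))
        (fun h' => h'.reg ρa = 2 ^ e ∧ h'.reg ρa4 = 16 ^ e ∧ h'.reg ρe4 = 4 * e ∧
          h'.time ≤ h.time + 4 + 4 * e) h₁ := by
    intro d
    induction d with
    | zero =>
      intro j h₁ hj h1 h2 h3 h4 h5
      obtain rfl : j = e := by omega
      have hle : n ≤ 16 ^ j := (Nat.clog_le_iff_le_pow (by omega)).1 he.le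
      rw [wp_whl_lt]
      simp [h1, h2, h3, h4]
      omega
    | succ d ih =>
      intro j h₁ hj h1 h2 h3 h4 h5
      have hlt : 16 ^ j < n := by
        by_contra hle
        have := (Nat.clog_le_iff_le_pow (b := 16) (by omega)).2 (not_lt.1 hle)
        omega
      have h16 : 16 * 16 ^ j < E.B := by
        rw [← pow_succ']
        exact (Nat.pow_le_pow_right (by omega) (by omega)).trans_lt hB
      have h2j : 2 ^ j ≤ 16 ^ j := Nat.pow_le_pow_left (by omega) j
      rw [wp_whl_lt]
      refine ⟨by simp, fun _ => ?_, fun hle => by simp [h1, h3] at hle; omega⟩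
      simp only [wp_seq, wp_asg]
      simp [h2, h3, h4]
      repeat refine ⟨by omega, ?_⟩
      exact ih (j + 1) _ (by omega) (by simp [h1]) (by simp [pow_succ']) (by simp [pow_succ'])
        (by simp; ring) (by simp; omega)
  simp only [powLoop, wp_seq, wp_asg]
  simp
  repeat refine ⟨by omega, ?_⟩
  exact key e 0 _ (by omega) (by simp [hn]) (by simp) (by simp) (by simp) (by simp)

/-- Cell `3` holds the positive part of `D`. Capping `q` at `n` keeps all numbers small. -/
def readNumbers : Cmd :=
  .inp ρn 0 ;; .inp ρm1 1 ;; .inp ρm2 2 ;; .inp ρq 3 ;; .asg ρq (.var ρq / 4) ;;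
  .ite (.lt (.var ρn) (.var ρq)) (.asg ρq (.var ρn)) .skip

def numbers (κ c F : ℕ) : Cmd :=
  .asg ρ3q (3 * .var ρq) ;; .asg ρ2q (2 * .var ρq) ;; .asg ρ2n (2 * .var ρn) ;;
  .asg ρinf (4 * .var ρn) ;; powLoop ;;
  .asg ρa2 (.var ρa * .var ρa) ;; .asg ρa3 (.var ρa * .var ρa2) ;;
  .asg ρβ (8 * .var ρa3 * .var ρa3) ;; .asg ρβ2 (.var ρβ * .var ρβ) ;;
  -- With this `l`, `2 ^ (-l)` is the power `-(c + 3)` of `16 ^ e`, which is at least `n`.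
  .asg ρl (.lit (c + 3) * .var ρe4) ;; .asg ρa2l (.var ρa2 * .var ρl) ;;
  -- One product may take as long as `a ^ 2` breadth-first searches, up to the factor `F`.
  .asg ρfuel (.lit F * ((.var ρm1 + .var ρm2) * .var ρa2)) ;;
  .asg ρZ 1 ;; .asg ρt (.lit κ) ;; .for' ρv ρt (.asg ρZ (.var ρZ * .var ρβ))

/-- The instance `X` belongs to the input. -/
structure Inst.Reads (X : Inst E) (c F : ℕ) : Prop where
  inp0 : E.inp 0 = X.n
  q_eq : X.q = min (E.inp 3 / 4) X.n
  m_eq : X.m = E.inp 1 + E.inp 2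
  five_le : 5 ≤ E.len
  lo0 : X.lo 0 = 5
  hi0 : X.hi 0 = 5 + 2 * E.inp 1
  lo1 : X.lo 1 = 5 + 2 * E.inp 1
  hi1 : X.hi 1 = 5 + 2 * E.inp 1 + 2 * E.inp 2
  e_eq : X.e = Nat.clog 16 X.n
  l_eq : X.l = (c + 3) * (4 * X.e)
  fuel_eq : X.fuel = F * (X.m * X.a ^ 2)
  F_pos : 0 < F
  smp_eq : ∀ k, X.smp k = bitsVal E.tape (4 * X.e * k) (4 * X.e) % X.n
  F_lt : F < E.B
  c_lt : c + 3 < E.B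
  κ_lt : X.κ < E.B

theorem Inst.e4_le (X : Inst E) : 4 * X.e ≤ X.a ^ 4 := by
  have : 4 * X.e < 2 ^ (4 * X.e) := Nat.lt_two_pow_self
  rw [Inst.a, ← pow_mul, Nat.mul_comm X.e 4]
  omega

/-- The registers have the values that they keep. -/
def HasNumbers (X : Inst E) (h' : HState) : Prop :=
  ∀ h'' : HState, (∀ r, ctxReg r = true → h''.reg r = h'.reg r) →
    (∀ i < 2, ∀ v < X.n, h''.arr αhead (2 * v + i) = lastCell E.inp (X.lo i) v (X.hi i)) →
    (∀ i < 2, ∀ p, X.lo i ≤ p → p < X.hi i →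
      h''.arr αnext p = lastCell E.inp (X.lo i) (E.inp p) p) →
    (∀ k < X.a ^ 3, h''.arr αsmp k = X.smp k) → Ctx X h''

theorem readNumbers_spec {c F : ℕ} (hX : X.Reads c F) :
    wp E readNumbers (fun h' => h'.reg ρn = X.n ∧ h'.reg ρq = X.q ∧ h'.reg ρm1 = E.inp 1 ∧
      h'.reg ρm2 = E.inp 2 ∧ h'.time = h.time + 7) h := by
  have hB := X.hundred_lt
  have hfive := hX.five_le
  have hq := hX.q_eq
  simp only [readNumbers, wp_seq, wp_inp, wp_asg, wp_ite, Cmd.skip]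
  simp [-Nat.div_eq_zero_iff, hX.inp0]
  repeat refine ⟨by omega, ?_⟩
  omega

theorem numbers_spec {c F : ℕ} (hX : X.Reads c F) (r1 : h.reg ρn = X.n) (r2 : h.reg ρq = X.q)
    (r3 : h.reg ρm1 = E.inp 1) (r4 : h.reg ρm2 = E.inp 2) :
    wp E (numbers X.κ c F) (fun h' =>
      HasNumbers X h' ∧ h'.reg ρn = X.n ∧ h'.reg ρa3 = X.a ^ 3 ∧ h'.reg ρe4 = 4 * X.e ∧
      h'.reg ρm1 = E.inp 1 ∧ h'.reg ρm2 = E.inp 2 ∧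
      h'.time ≤ h.time + 40 + 4 * X.e + 3 * X.κ) h := by
  have hB := X.hundred_lt
  have hlen := X.len_lt
  have hn := X.n_pos
  have hn8 := X.n8_le
  have hβ := X.β_lt
  have hβ2 := X.β2_lt
  have h8 := X.β_ge
  have ha := X.a_pos
  have ha1 := X.pow_a_le (k := 1) (by omega)
  have ha2 := X.pow_a_le (k := 2) (by omega)
  have ha3 := X.pow_a_le (k := 3) (by omega)
  have ha4 := X.pow_a_le (k := 4) (by omega)
  have he4 := X.e4_le
  have hqn := X.q_le
  have h16 : 16 ^ X.e = X.a ^ 4 := by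
    rw [Inst.a, ← pow_mul, Nat.mul_comm, pow_mul]; norm_num
  have hβe : X.β = 8 * X.a ^ 3 * X.a ^ 3 := by rw [Inst.β]; ring
  have hm := hX.m_eq
  have hhi := X.hi_le 1 (by omega)
  rw [hX.hi1] at hhi
  have hq := hX.q_eq
  have hfive := hX.five_le
  have hF := hX.F_lt
  have hF0 := hX.F_pos
  have hc := hX.c_lt
  have hκ := hX.κ_lt
  have hfl := X.fuel_lt
  have hfe := hX.fuel_eq
  have hma : X.m * X.a ^ 2 ≤ X.fuel := by rw [hfe]; exact Nat.le_mul_of_pos_left _ hF0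
  have hl : X.a ^ 2 * X.l < E.B := by have := X.a2l_lt; omega
  have hl' : X.l ≤ X.a ^ 2 * X.l := Nat.le_mul_of_pos_left _ (by positivity)
  simp only [numbers, wp_seq, wp_asg]
  simp [r1, r2]
  repeat refine ⟨by omega, ?_⟩
  refine (powLoop_spec (n := X.n) (e := X.e) (by simp [r1]) hX.e_eq.symm (by omega) hB
    (by omega)).call ?_
  rintro h₂ hf ⟨p1, p2, p3, p4⟩
  have s1 : h₂.reg ρn = X.n := by rw [hf.reg _ rfl]; simp [r1]
  have s2 : h₂.reg ρq = X.q := by rw [hf.reg _ rfl]; simp [r2]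
  have s3 : h₂.reg ρm1 = E.inp 1 := by rw [hf.reg _ rfl]; simp [r3]
  have s4 : h₂.reg ρm2 = E.inp 2 := by rw [hf.reg _ rfl]; simp [r4]
  have s5 : h₂.reg ρ3q = 3 * X.q := by rw [hf.reg _ rfl]; simp
  have s6 : h₂.reg ρ2q = 2 * X.q := by rw [hf.reg _ rfl]; simp
  have s7 : h₂.reg ρ2n = 2 * X.n := by rw [hf.reg _ rfl]; simp
  have s8 : h₂.reg ρinf = 4 * X.n := by rw [hf.reg _ rfl]; simp
  simp at p4
  have q2 : X.a * X.a = X.a ^ 2 := by ring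
  have q3 : X.a * X.a ^ 2 = X.a ^ 3 := by ring
  have q4 : X.β * X.β = X.β ^ 2 := by ring
  have q5 := hX.l_eq
  have p1' : h₂.reg ρa = X.a := p1
  simp [p1', p3, s3, s4, q2, q3, ← hβe, q4, ← q5, ← hm, ← hfe]
  have q6 : X.a ^ 2 * X.l < E.B := hl
  have q7 : 8 * X.a ^ 3 < E.B := by omega
  repeat refine ⟨by omega, ?_⟩
  refine wp_for (fun k h₃ => h₃.reg ρZ = X.β ^ k ∧ h₃.time ≤ h.time + 38 + 4 * X.e + 2 * k + k)
    (by decide) rfl rfl (by omega) (by simp; omega) ?_ ?_ ?_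
  · simp; omega
  · rintro k hk h₃ hf₃ g1 g2 ⟨g3, g4⟩
    simp at hk
    have t1 : h₃.reg ρβ = X.β := by rw [hf₃.reg _ rfl]; simp
    have t2 : X.β ^ k * X.β < E.B := by
      rw [← pow_succ]; exact X.pow_β_lt' (by omega)
    rw [wp_asg]
    simp [g3, t1, pow_succ]
    omega
  · rintro h₃ hf₃ ⟨g3, g4⟩
    simp at g3 g4
    refine ⟨fun h'' hr hh hnx hs => ?_, ?_, ?_, ?_, ?_, ?_, ?_⟩
    · constructor <;> first
        | assumption
        | (rw [hr _ rfl, HState.tick_reg, hf₃.reg _ rfl]; simp; done)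
        | (rw [hr _ rfl, HState.tick_reg, hf₃.reg _ rfl]; simp; assumption)
        | (rw [hr _ rfl, HState.tick_reg]; exact g3)
        | (rw [hr _ rfl, HState.tick_reg, hf₃.reg _ rfl]; simp [p2, h16])
    all_goals first
      | (rw [HState.tick_reg, hf₃.reg _ rfl]; simp; done)
      | (rw [HState.tick_reg, hf₃.reg _ rfl]; simp; assumption)
      | (simp; omega)

/-- Build the adjacency lists of the mode `reg ρI`. -/
def link : Cmd :=
  .for' ρv ρcnt (
    .asg ρp (.var ρlo + .var ρv) ;; .inp ρx (.var ρp) ;;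
    .ld ρt αhead (2 * .var ρx + .var ρI) ;;
    .st αnext (.var ρp) (.var ρt) ;;
    .st αhead (2 * .var ρx + .var ρI) (.var ρp))

theorem lastCell_of_le {inp : ℕ → ℕ} {lo v c : ℕ} (hc : c ≤ lo) : lastCell inp lo v c = 0 := by
  induction c with
  | zero => rfl
  | succ c ih => rw [lastCell, if_neg (by omega), ih (by omega)]

/-- Cells are put in front of the lists in increasing order, so the head is always the last cell
seen and the link of a cell is the last earlier cell with the same vertex. -/
theorem link_spec {i : ℕ} (hi : i < 2) (hI : h.reg ρI = i) (hlo : h.reg ρlo = X.lo i)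
    (hcnt : h.reg ρcnt = X.hi i - X.lo i) (h0 : ∀ v < X.n, h.arr αhead (2 * v + i) = 0) :
    wp E link (fun h' =>
      (∀ v < X.n, h'.arr αhead (2 * v + i) = lastCell E.inp (X.lo i) v (X.hi i)) ∧
      (∀ x, x % 2 ≠ i → h'.arr αhead x = h.arr αhead x) ∧
      (∀ p, X.lo i ≤ p → p < X.hi i → h'.arr αnext p = lastCell E.inp (X.lo i) (E.inp p) p) ∧
      (∀ p, (p < X.lo i ∨ X.hi i ≤ p) → h'.arr αnext p = h.arr αnext p) ∧
      h'.time ≤ h.time + 2 + 14 * X.m) h := by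
  have hB := X.hundred_lt
  have hlen := X.len_lt
  have hn := X.n_pos
  have hn8 := X.n8_le
  have hβ := X.β_lt
  have hlohi := X.lo_le i
  have hle := X.hi_le i hi
  have hcm := X.cells i hi
  refine wp_for (fun k h₁ =>
      (∀ v < X.n, h₁.arr αhead (2 * v + i) = lastCell E.inp (X.lo i) v (X.lo i + k)) ∧
      (∀ x, x % 2 ≠ i → h₁.arr αhead x = h.arr αhead x) ∧
      (∀ p, X.lo i ≤ p → p < X.lo i + k →
        h₁.arr αnext p = lastCell E.inp (X.lo i) (E.inp p) p) ∧
      (∀ p, (p < X.lo i ∨ X.hi i ≤ p) → h₁.arr αnext p = h.arr αnext p) ∧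
      h₁.time ≤ h.time + 1 + 7 * k) (by decide) rfl rfl (by omega) (by omega) ?_ ?_ ?_
  · refine ⟨fun v hv => ?_, fun _ _ => rfl, fun p h1 h2 => by omega, fun _ _ => rfl, by simp⟩
    rw [lastCell_of_le (by omega)]
    exact h0 v hv
  · rintro k hk h₁ hf h1 h2 ⟨a1, a2, a3, a4, a5⟩
    rw [hcnt] at hk
    have s1 : h₁.reg ρI = i := (hf.reg _ rfl).trans hI
    have s2 : h₁.reg ρlo = X.lo i := (hf.reg _ rfl).trans hlo
    have hx := X.cell_lt i hi (X.lo i + k) (by omega) (by omega)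
    have hh := a1 _ hx
    simp only [wp_seq, wp_asg, wp_inp, wp_ld, wp_st]
    simp [h1, s1, s2, hh]
    repeat refine ⟨by omega, ?_⟩
    refine ⟨fun v hv => ?_, fun x hx' => ?_, fun p h3 h4 => ?_, fun p hp => ?_, by omega⟩
    · rw [← Nat.add_assoc, lastCell]
      by_cases hv' : v = E.inp (X.lo i + k)
      · rw [if_pos (by omega), if_pos ⟨by omega, hv'.symm⟩]
      · rw [if_neg (by omega), if_neg (fun hh => hv' hh.2.symm)]
        exact a1 v hv
    · rw [if_neg (by omega)]
      exact a2 x hx'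
    · by_cases hp : p = X.lo i + k
      · rw [if_pos hp, hp]
      · rw [if_neg hp]
        exact a3 p h3 (by omega)
    · rw [if_neg (by omega)]
      exact a4 p hp
  · rintro h₁ hf ⟨a1, a2, a3, a4, a5⟩
    rw [hcnt] at a1 a3 a5
    rw [Nat.add_sub_cancel' hlohi] at a1 a3
    refine ⟨a1, a2, a3, a4, ?_⟩
    simp
    omega

/-- Draw the sample. -/
def drawSample : Cmd :=
  .for' ρsi ρa3 (
    .asg ρx 0 ;;
    .for' ρv ρe4 (.coin ρdx ;; .asg ρx (2 * .var ρx + .var ρdx)) ;;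
    .st αsmp (.var ρsi) (.var ρx % .var ρn))

theorem drawSample_spec {c F : ℕ} (hX : X.Reads c F) (hn : h.reg ρn = X.n)
    (ha3 : h.reg ρa3 = X.a ^ 3) (he4 : h.reg ρe4 = 4 * X.e) (hd : h.drawn = 0) :
    wp E drawSample (fun h' => (∀ k < X.a ^ 3, h'.arr αsmp k = X.smp k) ∧
      h'.time ≤ h.time + 2 + (20 * X.e + 6) * X.a ^ 3) h := by
  have hB := X.hundred_lt
  have hn0 := X.n_pos
  have hn8 := X.n8_le
  have hβ := X.β_lt
  have h8 := X.β_ge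
  have ha3' := X.pow_a_le (k := 3) (by omega)
  have ha4 := X.pow_a_le (k := 4) (by omega)
  have he := X.e4_le
  have hpow : X.a ^ 4 = 2 ^ (4 * X.e) := by rw [Inst.a, ← pow_mul, Nat.mul_comm]
  refine wp_for (fun k h₁ => (∀ s < k, h₁.arr αsmp s = X.smp s) ∧ h₁.drawn = 4 * X.e * k ∧
    h₁.time ≤ h.time + 1 + (20 * X.e + 6) * k) (by decide) rfl rfl (by omega) (by omega) ?_ ?_ ?_
  · simp [hd]
  · rintro k hk h₁ hf h1 h2 ⟨a1, a2, a3⟩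
    rw [ha3] at hk
    have s1 : h₁.reg ρn = X.n := (hf.reg _ rfl).trans hn
    have s2 : h₁.reg ρe4 = 4 * X.e := (hf.reg _ rfl).trans he4
    simp only [wp_seq, wp_asg]
    simp
    refine ⟨by omega, ?_⟩
    refine wp_for (fun j h₂ => h₂.reg ρx = bitsVal E.tape (4 * X.e * k) j ∧
      h₂.drawn = 4 * X.e * k + j ∧ h₂.time ≤ h₁.time + 3 + 5 * j) (by decide) rfl rfl (by omega)
      (by simp [s2]; omega) ?_ ?_ ?_
    · simp [a2, bitsVal]
    · rintro j hj h₂ hf₂ b1 b2 ⟨b3, b4, b5⟩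
      simp [s2] at hj
      have hlt := bitsVal_lt E.tape (4 * X.e * k) j
      have hle : 2 ^ (j + 1) ≤ 2 ^ (4 * X.e) := Nat.pow_le_pow_right (by omega) (by omega)
      rw [pow_succ] at hle
      simp only [wp_seq, wp_asg, wp_coin]
      simp [b3, b4, bitsVal]
      split_ifs <;> omega
    · rintro h₂ hf₂ ⟨b3, b4, b5⟩
      simp [s2] at b3 b4 b5
      have t1 : h₂.reg ρsi = k := by rw [hf₂.reg _ rfl]; simp [h1]
      have t2 : h₂.reg ρn = X.n := by rw [hf₂.reg _ rfl]; simp [s1]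
      have t3 : h₂.arr αsmp = h₁.arr αsmp := by rw [hf₂.arr _ rfl]; simp
      simp [t1, t2, b3, b4, t3]
      refine ⟨by omega, fun s hs => ?_, by ring, ?_⟩
      · by_cases hsk : s = k
        · rw [if_pos hsk, hsk, hX.smp_eq]
        · rw [if_neg hsk]; exact a1 s (by omega)
      · rw [Nat.mul_succ]; omega
  · rintro h₁ hf ⟨a1, a2, a3⟩
    rw [ha3] at a1 a3
    exact ⟨a1, by simp; omega⟩

def prepare (κ c F : ℕ) : Cmd :=
  readNumbers ;; numbers κ c F ;;
  .asg ρI 0 ;; .asg ρlo 5 ;; .asg ρcnt (2 * .var ρm1) ;; link ;;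
  .asg ρI 1 ;; .asg ρlo (.var ρlo + .var ρcnt) ;; .asg ρcnt (2 * .var ρm2) ;; link ;;
  drawSample

theorem prepare_spec {c F : ℕ} (hX : X.Reads c F) (h0 : ∀ a x, h.arr a x = 0)
    (hd : h.drawn = 0) : wp E (prepare X.κ c F) (fun h' => Ctx X h' ∧
      (∀ x, h'.arr αmem x = 0) ∧ h'.reg ρfound = h.reg ρfound ∧
      h'.time ≤ h.time + (100 + 3 * X.κ) * (X.m * X.a ^ 3 * (3 * X.e + 1))) h := by
  have hB := X.hundred_lt
  have hlen := X.len_lt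
  have hn := X.n_pos
  have hnm := X.n_le_m
  have hm := hX.m_eq
  have hhi0 := X.hi_le 0 (by omega)
  have hhi1 := X.hi_le 1 (by omega)
  have l0 := hX.lo0
  have l1 := hX.lo1
  have i0 := hX.hi0
  have i1 := hX.hi1
  rw [prepare, wp_seq]
  refine (readNumbers_spec hX).call ?_
  rintro h₁ hf₁ ⟨p1, p2, p3, p4, p5⟩
  rw [wp_seq]
  refine (numbers_spec hX p1 p2 p3 p4).call ?_
  rintro h₂ hf₂ ⟨q1, q2, q3, q4, q5, q6, q7⟩
  have arr₂ : ∀ a x, h₂.arr a x = 0 := fun a x => by rw [hf₂.arr _ rfl, hf₁.arr _ rfl, h0]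
  have d₂ : h₂.drawn = 0 := by rw [hf₂.drawn rfl, hf₁.drawn rfl, hd]
  have f₂ : h₂.reg ρfound = h.reg ρfound := by rw [hf₂.reg _ rfl, hf₁.reg _ rfl]
  simp only [wp_seq, wp_asg]
  simp [q5]
  repeat refine ⟨by omega, ?_⟩
  refine (link_spec (i := 0) (X := X) (by omega) (by simp) (by simp [l0])
    (by simp; omega) (by simp [arr₂])).call ?_
  rintro h₃ hf₃ ⟨a1, a2, a3, a4, a5⟩
  have s1 : h₃.reg ρlo = 5 := by rw [hf₃.reg _ rfl]; simp
  have s2 : h₃.reg ρcnt = 2 * E.inp 1 := by rw [hf₃.reg _ rfl]; simp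
  have s3 : h₃.reg ρm2 = E.inp 2 := by rw [hf₃.reg _ rfl]; simp [q6]
  simp [s1, s2, s3]
  repeat refine ⟨by omega, ?_⟩
  refine (link_spec (i := 1) (X := X) (by omega) (by simp) (by simp [l1])
    (by simp; omega) (fun v hv => ?_)).call ?_
  · simp
    rw [a2 _ (by omega)]
    simp [arr₂]
  rintro h₄ hf₄ ⟨b1, b2, b3, b4, b5⟩
  have g : ∀ r, ctxReg r = true ∨ r = ρe4 ∨ r = ρfound → h₄.reg r = h₂.reg r := by
    intro r hr
    have hr' : r < 20 ∨ r = ρe4 := by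
      simp only [ctxReg, Bool.or_eq_true, Bool.and_eq_true, decide_eq_true_eq] at hr
      omega
    have w1 : link.W r = false := by
      rcases hr' with hr' | rfl
      · clear hr; interval_cases r <;> rfl
      · rfl
    rw [hf₄.reg _ w1]
    simp [show r ≠ ρI by omega, show r ≠ ρlo by omega, show r ≠ ρcnt by omega]
    rw [hf₃.reg _ w1]
    simp [show r ≠ ρI by omega, show r ≠ ρlo by omega, show r ≠ ρcnt by omega]
  have d₄ : h₄.drawn = 0 := by
    rw [hf₄.drawn rfl]; simp; rw [hf₃.drawn rfl]; simp [d₂]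
  have m₄ : ∀ x, h₄.arr αmem x = 0 := fun x => by
    rw [hf₄.arr _ rfl]; simp; rw [hf₃.arr _ rfl]; simp [arr₂]
  refine (drawSample_spec hX ((g _ (by decide)).trans q2) ((g _ (by decide)).trans q3)
    ((g _ (by decide)).trans q4) d₄).call ?_
  rintro h₅ hf₅ ⟨c1, c2⟩
  have g5 : ∀ r, ctxReg r = true ∨ r = ρfound → h₅.reg r = h₂.reg r := by
    intro r hr
    rw [← g r (by tauto)]
    have hr' : r < 20 := by
      simp only [ctxReg, Bool.or_eq_true, Bool.and_eq_true, decide_eq_true_eq] at hr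
      omega
    refine hf₅.reg _ ?_
    clear hr
    interval_cases r <;> rfl
  refine ⟨q1 h₅ (fun r hr => g5 r (Or.inl hr)) ?_ ?_ c1, fun x => ?_, ?_, ?_⟩
  · intro i hi v hv
    rw [hf₅.arr _ rfl]
    obtain rfl | rfl : i = 0 ∨ i = 1 := by omega
    · rw [b2 _ (by omega)]
      simpa using a1 v hv
    · exact b1 v hv
  · intro i hi p h1 h2
    rw [hf₅.arr _ rfl]
    obtain rfl | rfl : i = 0 ∨ i = 1 := by omega
    · rw [b4 _ (by omega)]
      simpa using a3 p h1 h2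
    · exact b3 p h1 h2
  · rw [hf₅.arr _ rfl, m₄]
  · rw [g5 _ (Or.inr rfl), f₂]
  · simp at a5 b5
    have e1 : 1 ≤ X.a ^ 3 := Nat.one_le_pow _ _ X.a_pos
    have e2 : X.a ^ 3 * (3 * X.e + 1) ≤ X.m * X.a ^ 3 * (3 * X.e + 1) :=
      Nat.mul_le_mul_right _ (Nat.le_mul_of_pos_left _ (by omega))
    have e3 : X.m ≤ X.m * X.a ^ 3 * (3 * X.e + 1) :=
      (Nat.le_mul_of_pos_right _ e1).trans (Nat.le_mul_of_pos_right _ (by omega))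
    have e4 : X.e ≤ X.e * X.a ^ 3 := Nat.le_mul_of_pos_right _ e1
    set U := X.m * X.a ^ 3 * (3 * X.e + 1)
    have e5 : X.κ ≤ X.κ * U := Nat.le_mul_of_pos_right _ (by omega)
    have e6 : X.a ^ 3 * (3 * X.e + 1) = 3 * (X.e * X.a ^ 3) + X.a ^ 3 := by ring
    have e7 : (20 * X.e + 6) * X.a ^ 3 = 20 * (X.e * X.a ^ 3) + 6 * X.a ^ 3 := by ring
    have e8 : (100 + 3 * X.κ) * U = 100 * U + 3 * (X.κ * U) := by ring
    omega

end WordRAM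

namespace WordRAM

/-! ### Probability -/

instance : IsProbabilityMeasure coinMeasure := by unfold coinMeasure; infer_instance

theorem coin_box (y : ℕ → Bool) (L : ℕ) :
    coinMeasure {tape | ∀ i < L, tape i = y i} = 2⁻¹ ^ L := by
  have h1 : {tape : ℕ → Bool | ∀ i < L, tape i = y i} =
      Set.pi (Finset.range L : Set ℕ) fun i => {y i} := by
    ext tape; simp [Set.mem_pi]
  rw [h1, coinMeasure, Measure.infinitePi_pi _ (fun _ _ => measurableSet_singleton _)]
  simp

theorem bitsVal_inj {t t' : ℕ → Bool} {o b : ℕ} (h : bitsVal t o b = bitsVal t' o b) :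
    ∀ i < b, t (o + i) = t' (o + i) := by
  induction b with
  | zero => simp
  | succ b ih =>
    rw [bitsVal, bitsVal] at h
    intro i hi
    have h1 : bitsVal t o b = bitsVal t' o b := by split_ifs at h <;> omega
    rcases Nat.lt_succ_iff_lt_or_eq.1 hi with h2 | rfl
    · exact ih h1 i h2
    · cases h3 : t (o + i) <;> cases h4 : t' (o + i) <;> simp [h3, h4] at h ⊢ <;> omega

/-- Prescribing `N` blocks of `b` digits prescribes the first `b * N` bits. If the event is not
empty, it lies in the box about any of its points. -/
theorem coin_blocks_le (b N : ℕ) (x : ℕ → ℕ) :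
    coinMeasure {tape | ∀ k < N, bitsVal tape (b * k) b = x k} ≤ 2⁻¹ ^ (b * N) := by
  rcases Set.eq_empty_or_nonempty {tape | ∀ k < N, bitsVal tape (b * k) b = x k} with h | ⟨y, hy⟩
  · rw [h]; simp
  · rw [← coin_box y]
    refine measure_mono fun tape ht i hi => ?_
    have hb : 0 < b := Nat.pos_of_ne_zero (by rintro rfl; simp at hi)
    have hk : i / b < N := Nat.div_lt_of_lt_mul hi
    have h1 := bitsVal_inj ((ht _ hk).trans (hy _ hk).symm) (i % b) (Nat.mod_lt _ hb)
    rwa [Nat.div_add_mod] at h1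

/-- The union over the possible sequences of `N` values from `S`. -/
theorem coin_mem_le (b N : ℕ) (S : Finset ℕ) :
    coinMeasure {tape | ∀ k < N, bitsVal tape (b * k) b ∈ S} ≤
      (S.card : ENNReal) ^ N * 2⁻¹ ^ (b * N) := by
  classical
  have h1 : {tape : ℕ → Bool | ∀ k < N, bitsVal tape (b * k) b ∈ S} ⊆
      ⋃ x ∈ Fintype.piFinset fun _ : Fin N => S,
        {tape | ∀ k < N, bitsVal tape (b * k) b = if hk : k < N then x ⟨k, hk⟩ else 0} := by
    intro tape ht
    simp only [Set.mem_iUnion, Fintype.mem_piFinset, Set.mem_ofPred_eq]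
    exact ⟨fun k => bitsVal tape (b * k) b, fun k => ht k k.2, fun k hk => by simp [hk]⟩
  refine (measure_mono h1).trans ((measure_biUnion_finset_le _ _).trans ?_)
  refine (Finset.sum_le_card_nsmul _ _ _ fun x _ => coin_blocks_le b N _).trans ?_
  simp [Fintype.card_piFinset]

/-- The sample `k`. -/
def sampleAt (n e : ℕ) (tape : ℕ → Bool) (k : ℕ) : ℕ := bitsVal tape (4 * e * k) (4 * e) % n

/-- A block of bits with value in `T`, hence below `n`, is its own remainder modulo `n`. So a sample
hits `T` with probability at least `T.card / 2 ^ (4 * e)`, and the rest is `1 - x ≤ exp (-x)`. -/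
theorem coin_miss_le {n e N l : ℕ} (hne : n ≤ 2 ^ (4 * e)) {T : Finset ℕ}
    (hT : T ⊆ Finset.range n) (hN : 2 ^ (4 * e) * l ≤ N * T.card) :
    coinMeasure {tape | ∀ k < N, sampleAt n e tape k ∉ T} ≤ ENNReal.ofReal (Real.exp (-l)) := by
  classical
  set b := 4 * e
  have hTb : T ⊆ Finset.range (2 ^ b) := hT.trans (by simpa using hne)
  have hc : T.card ≤ 2 ^ b := by simpa using Finset.card_le_card hTb
  have h1 : {tape : ℕ → Bool | ∀ k < N, sampleAt n e tape k ∉ T} ⊆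
      {tape | ∀ k < N, bitsVal tape (b * k) b ∈ Finset.range (2 ^ b) \ T} := by
    intro tape ht k hk
    refine Finset.mem_sdiff.2 ⟨by simpa using bitsVal_lt tape _ b, fun hh => ht k hk ?_⟩
    rw [sampleAt, Nat.mod_eq_of_lt (by simpa using hT hh)]
    exact hh
  refine (measure_mono h1).trans ((coin_mem_le b N _).trans ?_)
  rw [Finset.card_sdiff_of_subset hTb, Finset.card_range, pow_mul (2⁻¹ : ENNReal) b N, ← mul_pow]
  have hpos : (0 : ℝ) < 2 ^ b := by positivity
  have h2 : ((2 ^ b - T.card : ℕ) : ENNReal) * 2⁻¹ ^ b =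
      ENNReal.ofReal (1 - T.card / 2 ^ b) := by
    rw [← ENNReal.ofReal_natCast, ← ENNReal.ofReal_ofNat, ← ENNReal.ofReal_inv_of_pos (by norm_num),
      ← ENNReal.ofReal_pow (by norm_num), ← ENNReal.ofReal_mul (by positivity)]
    congr 1
    rw [Nat.cast_sub hc]
    have h0 : (2 : ℝ) ^ b * (2⁻¹) ^ b = 1 := by rw [← mul_pow]; norm_num
    push_cast
    rw [sub_mul, h0, inv_pow, div_eq_mul_inv]
  have h3 : (0 : ℝ) ≤ 1 - T.card / 2 ^ b := by
    rw [sub_nonneg, div_le_one hpos]; exact_mod_cast hc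
  rw [h2, ← ENNReal.ofReal_pow h3]
  refine ENNReal.ofReal_le_ofReal ?_
  calc (1 - T.card / 2 ^ b : ℝ) ^ N ≤ Real.exp (-(T.card / 2 ^ b)) ^ N :=
        pow_le_pow_left₀ h3 (Real.one_sub_le_exp_neg _) N
    _ = Real.exp (-(N * T.card / 2 ^ b)) := by rw [← Real.exp_nat_mul]; congr 1; ring
    _ ≤ Real.exp (-l) := by
        refine Real.exp_le_exp.2 (neg_le_neg ?_)
        rw [le_div_iff₀ hpos, mul_comm]
        exact_mod_cast hN

theorem exp_neg_le_pow (k : ℕ) : Real.exp (-k) ≤ (1 / 2) ^ k := by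
  have h1 : Real.exp (-1) ≤ 1 / 2 := by
    rw [Real.exp_neg, one_div]
    exact inv_anti₀ (by norm_num) (by linarith [Real.add_one_le_exp 1])
  calc Real.exp (-k) = Real.exp (-1) ^ k := by rw [← Real.exp_nat_mul]; congr 1; ring
    _ ≤ _ := pow_le_pow_left₀ (Real.exp_pos _).le h1 k

/-- The events that all of the samples miss one of the large sets. -/
theorem coin_bad_le {n e c l : ℕ} (hn : 0 < n) (he : e = Nat.clog 16 n) (hl : l = (c + 3) * (4 * e))
    (he0 : 0 < e) (T : ℕ → ℕ → Finset ℕ) (hT : ∀ i v, T i v ⊆ Finset.range n)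
    (A : Finset (ℕ × ℕ)) (hA : A.card ≤ 3 * e + 2) (hAN : ∀ p ∈ A, 2 ^ (4 * e) * l ≤ p.1 * p.2) :
    coinMeasure {tape | ∃ p ∈ A, ∃ i < 2, ∃ v < n, p.2 < (T i v).card ∧
      ∀ k < p.1, sampleAt n e tape k ∉ T i v} ≤ ENNReal.ofReal ((n : ℝ) ^ (-(c : ℝ))) := by
  classical
  have hne : n ≤ 16 ^ e := by rw [he]; exact Nat.le_pow_clog (by omega) n
  have h16 : 2 ^ (4 * e) = 16 ^ e := by rw [pow_mul]; norm_num
  have h1 : {tape : ℕ → Bool | ∃ p ∈ A, ∃ i < 2, ∃ v < n, p.2 < (T i v).card ∧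
      ∀ k < p.1, sampleAt n e tape k ∉ T i v} ⊆
      ⋃ x ∈ (A ×ˢ (Finset.range 2 ×ˢ Finset.range n)).filter
        (fun x => x.1.2 < (T x.2.1 x.2.2).card),
        {tape | ∀ k < x.1.1, sampleAt n e tape k ∉ T x.2.1 x.2.2} := by
    rintro tape ⟨p, hp, i, hi, v, hv, h1, h2⟩
    simp only [Set.mem_iUnion]
    exact ⟨(p, i, v), by simp [hp, hi, hv, h1], h2⟩
  refine (measure_mono h1).trans ((measure_biUnion_finset_le _ _).trans ?_)
  refine (Finset.sum_le_card_nsmul _ _ (ENNReal.ofReal (Real.exp (-l))) fun x hx => ?_).trans ?_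
  · simp only [Finset.mem_filter, Finset.mem_product] at hx
    refine coin_miss_le (by rwa [h16]) (hT _ _) ?_
    exact (hAN _ hx.1.1).trans (Nat.mul_le_mul_left _ hx.2.le)
  · rw [nsmul_eq_mul, ← ENNReal.ofReal_natCast, ← ENNReal.ofReal_mul (by positivity)]
    refine ENNReal.ofReal_le_ofReal ?_
    set M := ((A ×ˢ (Finset.range 2 ×ˢ Finset.range n)).filter
        (fun x => x.1.2 < (T x.2.1 x.2.2).card)).card
    -- There are at most `16 ^ (2 * e)` events, each of probability at most `16 ^ (-e * (c + 3))`: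
    -- this leaves one power of `16 ^ e` to spare.
    have hM : M ≤ 16 ^ e * 16 ^ e := by
      refine (Finset.card_filter_le _ _).trans ?_
      simp only [Finset.card_product, Finset.card_range]
      have h2 : 6 * e + 4 ≤ 16 ^ e := by
        clear * - he0
        induction e, he0 using Nat.le_induction with
        | base => norm_num
        | succ e he ih => rw [pow_succ]; omega
      calc A.card * (2 * n) ≤ (3 * e + 2) * (2 * 16 ^ e) :=
            Nat.mul_le_mul hA (Nat.mul_le_mul_left _ hne)
        _ = (6 * e + 4) * 16 ^ e := by ring
        _ ≤ _ := Nat.mul_le_mul_right _ h2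
    have hp : (0 : ℝ) < 16 ^ e := by positivity
    have h3 : Real.exp (-l) ≤ ((16 : ℝ) ^ e)⁻¹ ^ (c + 3) := by
      refine (exp_neg_le_pow l).trans (le_of_eq ?_)
      rw [hl, Nat.mul_comm, pow_mul, pow_mul, ← inv_pow]
      norm_num
    have hM' : (M : ℝ) ≤ 16 ^ e * 16 ^ e := by exact_mod_cast hM
    calc (M : ℝ) * Real.exp (-l) ≤ 16 ^ e * 16 ^ e * ((16 : ℝ) ^ e)⁻¹ ^ (c + 3) :=
          mul_le_mul hM' h3 (Real.exp_pos _).le (by positivity)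
      _ = ((16 : ℝ) ^ e)⁻¹ ^ (c + 1) := by
          have : (16 : ℝ) ^ e ≠ 0 := hp.ne'
          rw [pow_add, pow_add]; field_simp
      _ ≤ ((16 : ℝ) ^ e)⁻¹ ^ c := by
          refine pow_le_pow_of_le_one (by positivity) ?_ (by omega)
          exact inv_le_one_of_one_le₀ (one_le_pow₀ (by norm_num))
      _ ≤ ((n : ℝ))⁻¹ ^ c := by
          refine pow_le_pow_left₀ (by positivity) (inv_anti₀ (by exact_mod_cast hn) ?_) c
          exact_mod_cast hne
      _ = (n : ℝ) ^ (-(c : ℝ)) := by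
          rw [Real.rpow_neg (by positivity), Real.rpow_natCast, inv_pow]

end WordRAM

namespace WordRAM

/-! ### Distances -/

section Dist

variable {n : ℕ} (H : SimpleGraph (Fin n)) (u v x : Fin n)

/-- The distance, or `4 * n` for points that are not connected. -/
noncomputable def truncDist : ℕ := (min (H.edist u v) ((4 * n : ℕ) : ℕ∞)).toNat

theorem coe_truncDist : (truncDist H u v : ℕ∞) = min (H.edist u v) ((4 * n : ℕ) : ℕ∞) := by
  rw [truncDist, ENat.natCast_toNat]
  exact ne_top_of_le_ne_top (ENat.natCast_ne_top _) (min_le_right _ _)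

theorem le_truncDist_iff {k : ℕ} (hk : k ≤ 4 * n) : k ≤ truncDist H u v ↔ (k : ℕ∞) ≤ H.edist u v := by
  rw [← Nat.cast_le (α := ℕ∞), coe_truncDist, le_min_iff, and_iff_left (by exact_mod_cast hk)]

theorem truncDist_le : truncDist H u v ≤ 4 * n := by
  rw [← Nat.cast_le (α := ℕ∞), coe_truncDist]
  exact min_le_right _ _

theorem truncDist_self : truncDist H u u = 0 := by simp [truncDist]

theorem truncDist_comm : truncDist H u v = truncDist H v u := by
  rw [truncDist, SimpleGraph.edist_comm, truncDist]

theorem truncDist_triangle : truncDist H u x ≤ truncDist H u v + truncDist H v x := by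
  rw [← Nat.cast_le (α := ℕ∞), Nat.cast_add, coe_truncDist, coe_truncDist, coe_truncDist]
  have h1 := H.edist_triangle (u := u) (v := v) (w := x)
  rcases le_total (H.edist u v) ((4 * n : ℕ) : ℕ∞) with h2 | h2
  · rcases le_total (H.edist v x) ((4 * n : ℕ) : ℕ∞) with h3 | h3
    · rw [min_eq_left h2, min_eq_left h3]
      exact (min_le_left _ _).trans h1
    · rw [min_eq_right h3]
      exact (min_le_right _ _).trans le_add_self
  · rw [min_eq_right h2]
    exact (min_le_right _ _).trans le_self_add

theorem edist_eq_of_truncDist_lt (h : truncDist H u v < 4 * n) :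
    H.edist u v = truncDist H u v := by
  have h1 := coe_truncDist H u v
  rw [h1]
  refine (min_eq_left (le_of_lt ?_)).symm
  by_contra h2
  rw [min_eq_right (not_lt.1 h2)] at h1
  have : truncDist H u v = 4 * n := by exact_mod_cast h1
  omega

/-- Vertices at finite distance are joined by a shortest path, and a path has fewer than `n` edges.
-/
theorem truncDist_lt (h : truncDist H u v ≠ 4 * n) : truncDist H u v < n := by
  have h1 := edist_eq_of_truncDist_lt H u v (lt_of_le_of_ne (truncDist_le H u v) h)
  have hr : H.Reachable u v := SimpleGraph.reachable_of_edist_ne_top (by rw [h1]; simp)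
  obtain ⟨p, hp, hl⟩ := hr.exists_path_of_dist
  have h2 := hp.length_lt
  have h3 := hr.coe_dist_eq_edist
  rw [h1] at h3
  have h4 : H.dist u v = truncDist H u v := by exact_mod_cast h3
  rw [Fintype.card_fin] at h2
  omega

theorem eq_of_truncDist_eq_zero (h : truncDist H u v = 0) : u = v := by
  have hn : 0 < n := u.pos
  have h1 := edist_eq_of_truncDist_lt H u v (by omega)
  rw [h] at h1
  exact SimpleGraph.edist_eq_zero_iff.1 h1

theorem truncDist_le_one (h : H.Adj u v) : truncDist H u v ≤ 1 := by
  rw [← Nat.cast_le (α := ℕ∞), coe_truncDist]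
  exact (min_le_left _ _).trans (SimpleGraph.edist_eq_one_iff_adj.2 h).le

/-- The penultimate vertex of a shortest walk. -/
theorem exists_adj_of_truncDist_eq {k : ℕ} (h : truncDist H u v = k + 1) (hk : k + 1 ≠ 4 * n) :
    ∃ x, H.Adj x v ∧ truncDist H u x = k := by
  have hle := truncDist_le H u v
  have h1 := edist_eq_of_truncDist_lt H u v (by omega)
  obtain ⟨p, hp⟩ := SimpleGraph.exists_walk_of_edist_eq_coe (h1.trans (by rw [h]))
  have hnil : ¬ p.Nil := fun hh => by
    have := SimpleGraph.Walk.length_eq_zero_iff.2 hh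
    omega
  refine ⟨p.penultimate, p.adj_penultimate hnil, ?_⟩
  have h2 : H.edist u p.penultimate ≤ k := by
    refine (SimpleGraph.edist_le p.dropLast).trans (le_of_eq ?_)
    simp [SimpleGraph.Walk.dropLast, SimpleGraph.Walk.take_length, hp]
  have h3 : truncDist H u p.penultimate ≤ k := by
    rw [← Nat.cast_le (α := ℕ∞), coe_truncDist]
    exact (min_le_left _ _).trans h2
  have h4 := truncDist_triangle H u p.penultimate v
  have h5 := truncDist_le_one H _ _ (p.adj_penultimate hnil)
  omega

end Dist

/-! ### The input -/

section Input

variable {n : ℕ} (L : Fin 2 → List (Fin n × Fin n)) (D : ℤ)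

/-- The content of an input cell. -/
def inputCell (p : ℕ) : ℕ := (encodeInstance L D).getD p 0

theorem encodeInstance_length :
    (encodeInstance L D).length = 5 + 2 * (L 0).length + 2 * (L 1).length := by
  simp [encodeInstance, List.length_flatMap]
  omega

theorem getD_flatMap_pair (l : List (Fin n × Fin n)) {t : ℕ} (ht : t < l.length) :
    (l.flatMap fun e => [(e.1 : ℕ), (e.2 : ℕ)]).getD (2 * t) 0 = l[t].1 ∧
      (l.flatMap fun e => [(e.1 : ℕ), (e.2 : ℕ)]).getD (2 * t + 1) 0 = l[t].2 := by
  induction l generalizing t with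
  | nil => simp at ht
  | cons a l ih =>
    rcases t with _ | t
    · simp
    · have := ih (t := t) (by simpa using ht)
      rw [show 2 * (t + 1) = 2 * t + 1 + 1 by ring]
      simpa using this

/-- The mode with number `i`. -/
def modeOf (i : ℕ) : Fin 2 := if i = 0 then 0 else 1

/-- The first cell of the edges of mode `i`. -/
def edgeLo (i : ℕ) : ℕ := if i = 0 then 5 else 5 + 2 * (L 0).length

/-- The end of the cells of the edges of mode `i`. -/
def edgeHi (i : ℕ) : ℕ := edgeLo L i + 2 * (L (modeOf i)).length

theorem inputCell_edge (i : ℕ) {t : ℕ} (ht : t < (L (modeOf i)).length) :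
    inputCell L D (edgeLo L i + 2 * t) = (L (modeOf i))[t].1 ∧
      inputCell L D (edgeLo L i + 2 * t + 1) = (L (modeOf i))[t].2 := by
  have key : ∀ s, (hs : s < (L 0 ++ L 1).length) → inputCell L D (5 + 2 * s) = (L 0 ++ L 1)[s].1 ∧
      inputCell L D (5 + 2 * s + 1) = (L 0 ++ L 1)[s].2 := by
    intro s hs
    have h1 := getD_flatMap_pair (L 0 ++ L 1) hs
    rw [inputCell, inputCell, encodeInstance, List.getD_append_right _ _ _ _ (by simp),
      List.getD_append_right _ _ _ _ (by simp; omega)]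
    simpa [show 5 + 2 * s + 1 - 5 = 2 * s + 1 by omega] using h1
  by_cases hi : i = 0
  · subst hi
    have ht' : t < (L 0).length := ht
    have := key t (by simp; omega)
    rw [List.getElem_append_left ht'] at this
    exact this
  · simp only [modeOf, hi, if_false] at ht
    have := key ((L 0).length + t) (by simp; omega)
    rw [List.getElem_append_right (by omega)] at this
    simp only [edgeLo, modeOf, hi, if_false]
    simpa [Nat.mul_add, ← Nat.add_assoc] using this

variable {L} {G : MultimodeGraph 2 (Fin n)}

theorem adj_of_cell (hL : ∀ i, IsEdgeList (L i) (G i)) {i p : ℕ} (h1 : edgeLo L i ≤ p)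
    (h2 : p < edgeHi L i) : ∃ x y : Fin n, inputCell L D p = x ∧ inputCell L D (partner p) = y ∧
      (G (modeOf i)).Adj x y := by
  have hodd : edgeLo L i % 2 = 1 := by unfold edgeLo; split_ifs <;> omega
  rw [edgeHi] at h2
  obtain ⟨t, hp⟩ : ∃ t, p = edgeLo L i + 2 * t ∨ p = edgeLo L i + 2 * t + 1 :=
    ⟨(p - edgeLo L i) / 2, by omega⟩
  have ht : t < (L (modeOf i)).length := by omega
  obtain ⟨c1, c2⟩ := inputCell_edge L D i ht
  have hadj : (G (modeOf i)).Adj (L (modeOf i))[t].1 (L (modeOf i))[t].2 :=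
    ((hL _).2 _ _).2 (List.mem_map.2 ⟨_, List.getElem_mem ht, rfl⟩)
  rcases hp with rfl | rfl
  · have hpt : partner (edgeLo L i + 2 * t) = edgeLo L i + 2 * t + 1 := by unfold partner; omega
    exact ⟨_, _, c1, by rw [hpt, c2], hadj⟩
  · have hpt : partner (edgeLo L i + 2 * t + 1) = edgeLo L i + 2 * t := by unfold partner; omega
    exact ⟨_, _, c2, by rw [hpt, c1], hadj.symm⟩

theorem cell_of_adj (hL : ∀ i, IsEdgeList (L i) (G i)) {i : ℕ} {x y : Fin n}
    (h : (G (modeOf i)).Adj x y) : ∃ p, edgeLo L i ≤ p ∧ p < edgeHi L i ∧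
      inputCell L D p = x ∧ inputCell L D (partner p) = y := by
  have hodd : edgeLo L i % 2 = 1 := by unfold edgeLo; split_ifs <;> omega
  obtain ⟨e, he, hxy⟩ := List.mem_map.1 (((hL _).2 x y).1 h)
  obtain ⟨t, ht, rfl⟩ := List.mem_iff_getElem.1 he
  obtain ⟨c1, c2⟩ := inputCell_edge L D i ht
  have hp1 : partner (edgeLo L i + 2 * t) = edgeLo L i + 2 * t + 1 := by unfold partner; omega
  have hp2 : partner (edgeLo L i + 2 * t + 1) = edgeLo L i + 2 * t := by unfold partner; omega
  rcases Sym2.eq_iff.1 hxy with ⟨h1, h2⟩ | ⟨h1, h2⟩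
  · exact ⟨edgeLo L i + 2 * t, by omega, by unfold edgeHi; omega, by rw [c1, h1],
      by rw [hp1, c2, h2]⟩
  · exact ⟨edgeLo L i + 2 * t + 1, by omega, by unfold edgeHi; omega, by rw [c2, h2],
      by rw [hp2, c1, h1]⟩

theorem numEdges_eq (hL : ∀ i, IsEdgeList (L i) (G i)) :
    G.numEdges = (L 0).length + (L 1).length := by
  have key : ∀ i, (G i).edgeSet.ncard = (L i).length := by
    intro i
    classical
    have h1 : (G i).edgeSet = (((L i).map fun e => s(e.1, e.2)).toFinset : Set _) := by
      ext z
      induction z with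
      | _ u v => simpa using (hL i).2 u v
    rw [h1, Set.ncard_coe_finset, List.toFinset_card_of_nodup (hL i).1, List.length_map]
  rw [MultimodeGraph.numEdges, Fin.sum_univ_two, key, key]

end Input

end WordRAM

namespace WordRAM

/-! ### The instance of a graph -/

/-- The exponent of the bound for the numbers. -/
def boundExp (κ c F top : ℕ) : ℕ := 8 * κ + c + F + top + 50

/-- For a fixed program every number that occurs is polynomially bounded in `n` and `m`, both at
most `M`, the length of the input plus `2`. Since `M ≥ 7`, constants are absorbed by further powers
of `M`. -/
theorem bounds_of_le {M n m e κ c F top : ℕ} (hM : 7 ≤ M) (hn : n ≤ M) (hm : m ≤ M)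
    (ha : 16 ^ e ≤ 16 * n) : (8 * (2 ^ e) ^ 6) ^ (κ + 3) * ((c + 3) * (4 * e) + 1) <
      M ^ boundExp κ c F top ∧ F * (m * (2 ^ e) ^ 2) + 1 < M ^ boundExp κ c F top ∧
      M + 100 < M ^ boundExp κ c F top ∧ F < M ^ boundExp κ c F top ∧
      c + 3 < M ^ boundExp κ c F top ∧ κ < M ^ boundExp κ c F top ∧
      top ≤ M ^ boundExp κ c F top := by
  have hM1 : 1 ≤ M := by omega
  have lt : ∀ x y, x ≤ y → x < M ^ y := fun x y hxy =>
    (Nat.lt_pow_self (by omega : 1 < M)).trans_le (Nat.pow_le_pow_right hM1 hxy)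
  have mono : ∀ x, x ≤ boundExp κ c F top → M ^ x ≤ M ^ boundExp κ c F top := fun x hx =>
    Nat.pow_le_pow_right hM1 hx
  have h16 : 16 ≤ M ^ 2 := by nlinarith
  have ha4 : (2 ^ e) ^ 4 ≤ M ^ 3 := by
    have : (2 ^ e) ^ 4 = 16 ^ e := by rw [← pow_mul, Nat.mul_comm, pow_mul]; norm_num
    rw [this, pow_succ]
    exact ha.trans (Nat.mul_le_mul h16 hn)
  have ha1 : 1 ≤ 2 ^ e := Nat.one_le_two_pow
  have ha6 : 8 * (2 ^ e) ^ 6 ≤ M ^ 8 := by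
    calc 8 * (2 ^ e) ^ 6 ≤ M ^ 2 * (2 ^ e) ^ 8 :=
          Nat.mul_le_mul (by omega) (Nat.pow_le_pow_right ha1 (by omega))
      _ = M ^ 2 * ((2 ^ e) ^ 4) ^ 2 := by ring
      _ ≤ M ^ 2 * (M ^ 3) ^ 2 := Nat.mul_le_mul_left _ (Nat.pow_le_pow_left ha4 2)
      _ = M ^ 8 := by ring
  have hl : (c + 3) * (4 * e) + 1 ≤ M ^ (c + 7) := by
    have h1 : 4 * e < (2 ^ e) ^ 4 := by
      rw [← pow_mul, Nat.mul_comm]; exact Nat.lt_two_pow_self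
    calc (c + 3) * (4 * e) + 1 ≤ M ^ (c + 3) * (4 * e) + M ^ (c + 3) * 1 :=
          Nat.add_le_add (Nat.mul_le_mul_right _ (lt _ _ le_rfl).le)
            (by rw [Nat.mul_one]; exact Nat.one_le_pow _ _ hM1)
      _ = M ^ (c + 3) * (4 * e + 1) := by ring
      _ ≤ M ^ (c + 3) * M ^ 3 := Nat.mul_le_mul_left _ (by omega)
      _ ≤ M ^ (c + 7) := by rw [← pow_add]; exact Nat.pow_le_pow_right hM1 (by omega)
  refine ⟨?_, ?_, ?_, lt _ _ ?_, lt _ _ ?_, lt _ _ ?_, (lt _ _ ?_).le⟩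
  · calc (8 * (2 ^ e) ^ 6) ^ (κ + 3) * ((c + 3) * (4 * e) + 1) ≤ (M ^ 8) ^ (κ + 3) * M ^ (c + 7) :=
          Nat.mul_le_mul (Nat.pow_le_pow_left ha6 _) hl
      _ = M ^ (8 * (κ + 3) + (c + 7)) := by rw [← pow_mul, ← pow_add]
      _ < _ := Nat.pow_lt_pow_right (by omega) (by unfold boundExp; omega)
  · have h2 : (2 ^ e) ^ 2 ≤ M ^ 3 := (Nat.pow_le_pow_right ha1 (by omega)).trans ha4
    calc F * (m * (2 ^ e) ^ 2) + 1 ≤ M ^ F * (M * M ^ 3) + M ^ F * (M * M ^ 3) := by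
          refine Nat.add_le_add (Nat.mul_le_mul (lt _ _ le_rfl).le (Nat.mul_le_mul hm h2)) ?_
          exact Nat.mul_pos (by positivity) (by positivity)
      _ = 2 * M ^ (F + 4) := by ring
      _ ≤ M * M ^ (F + 4) := Nat.mul_le_mul_right _ (by omega)
      _ = M ^ (F + 5) := by ring
      _ < _ := Nat.pow_lt_pow_right (by omega) (by unfold boundExp; omega)
  · have h3 : M + 100 < M ^ 3 := by nlinarith [Nat.mul_le_mul hM hM]
    exact h3.trans_le (mono _ (by unfold boundExp; omega))
  all_goals unfold boundExp; omega

/-- The extra factor `M ^ 3 ≥ 343` pays for the sixteen arrays and the input. -/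
theorem valid_of_le {M κ c F top len w : ℕ} (hM : 7 ≤ M) (hlen : len + 2 = M)
    (hw : M ^ (boundExp κ c F top + 3) ≤ 2 ^ w) :
    len + 16 * M ^ boundExp κ c F top + 16 ≤ 2 ^ w := by
  refine le_trans ?_ hw
  have h1 : M ≤ M ^ boundExp κ c F top := by
    calc M = M ^ 1 := (pow_one M).symm
      _ ≤ _ := Nat.pow_le_pow_right (by omega) (by unfold boundExp; omega)
  have h2 : 343 ≤ M ^ 3 := by
    calc 343 = 7 ^ 3 := by norm_num
      _ ≤ M ^ 3 := Nat.pow_le_pow_left hM 3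
  rw [pow_add]
  have := Nat.mul_le_mul_left (M ^ boundExp κ c F top) h2
  omega

theorem two_pow_four (e : ℕ) : (2 ^ e) ^ 4 = 16 ^ e := by
  rw [← pow_mul, Nat.mul_comm, pow_mul]; norm_num

theorem pow_clog_le {n : ℕ} (hn : 0 < n) : 16 ^ Nat.clog 16 n ≤ 16 * n := by
  by_cases h1 : n = 1
  · subst h1; simp
  · have h2 : 1 < n := by omega
    have h3 := Nat.pow_pred_clog_lt_self (b := 16) (by omega) h2
    have h4 : 0 < Nat.clog 16 n := Nat.clog_pos (by omega) h2
    obtain ⟨k, hk⟩ : ∃ k, Nat.clog 16 n = k + 1 := ⟨Nat.clog 16 n - 1, by omega⟩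
    rw [hk] at h3 ⊢
    rw [pow_succ]
    simp at h3
    omega

/-- What the algorithm gets to see. -/
def solverEnv {n : ℕ} (L : Fin 2 → List (Fin n × Fin n)) (D : ℤ) (w N : ℕ) (tape : ℕ → Bool) :
    Env := ⟨w, ((encodeInstance L D).length + 2) ^ N, (encodeInstance L D).length, inputCell L D, tape⟩

/-- A vertex for every number. -/
def retract {n : ℕ} (hn : 0 < n) (u : ℕ) : Fin n := ⟨u % n, Nat.mod_lt _ hn⟩

theorem retract_coe {n : ℕ} (hn : 0 < n) (u : Fin n) : retract hn u = u :=
  Fin.ext (Nat.mod_eq_of_lt u.2)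

theorem retract_inj {n : ℕ} (hn : 0 < n) {u v : ℕ} (hu : u < n) (hv : v < n)
    (h : retract hn u = retract hn v) : u = v := by
  have := congrArg Fin.val h
  simpa [retract, Nat.mod_eq_of_lt hu, Nat.mod_eq_of_lt hv] using this

/-- The ball of radius `q` about `v` in the mode `i`. -/
noncomputable def graphBall {n : ℕ} (G : MultimodeGraph 2 (Fin n)) (hn : 0 < n) (q i v : ℕ) :
    Finset ℕ :=
  (Finset.range n).filter fun u => truncDist (G (modeOf i)) (retract hn v) (retract hn u) ≤ q

section

variable {n : ℕ} {G : MultimodeGraph 2 (Fin n)} {L : Fin 2 → List (Fin n × Fin n)} {D : ℤ}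

theorem inputCell_small (D : ℤ) (L : Fin 2 → List (Fin n × Fin n)) : inputCell L D 0 = n ∧
    inputCell L D 1 = (L 0).length ∧ inputCell L D 2 = (L 1).length ∧
    inputCell L D 3 = D.toNat := by
  simp [inputCell, encodeInstance]

/-- The instance for the algorithm. -/
noncomputable def graphInst (hn : 0 < n) (hm : n ≤ G.numEdges) (hL : ∀ i, IsEdgeList (L i) (G i))
    (hD : 4 ≤ D.toNat) (κ c F top w : ℕ) (tape : ℕ → Bool) :
    Inst (solverEnv L D w (boundExp κ c F top) tape) :=
  have hlen : (encodeInstance L D).length = 5 + 2 * (L 0).length + 2 * (L 1).length :=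
    encodeInstance_length L D
  have hE : G.numEdges = (L 0).length + (L 1).length := numEdges_eq hL
  have hb := bounds_of_le (M := (encodeInstance L D).length + 2) (n := n) (m := G.numEdges)
    (e := Nat.clog 16 n) (κ := κ) (c := c) (F := F) (top := top) (by omega) (by omega) (by omega)
    (pow_clog_le hn)
  { n := n
    m := G.numEdges
    q := min (D.toNat / 4) n
    e := Nat.clog 16 n
    l := (c + 3) * (4 * Nat.clog 16 n)
    κ := κ
    fuel := F * (G.numEdges * (2 ^ Nat.clog 16 n) ^ 2)
    smp := sampleAt n (Nat.clog 16 n) tape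
    lo := edgeLo L
    hi := edgeHi L
    d := fun i u v => truncDist (G (modeOf i)) (retract hn u) (retract hn v)
    q_pos := by omega
    q_le := min_le_right _ _
    n_le_m := hm
    lo_odd := fun i => by unfold edgeLo; split_ifs <;> omega
    hi_odd := fun i => by unfold edgeHi edgeLo; split_ifs <;> omega
    lo_pos := fun i => by unfold edgeLo; split_ifs <;> omega
    lo_le := fun i => by unfold edgeHi; omega
    hi_le := fun i _ => by
      change edgeHi L i ≤ (encodeInstance L D).length
      unfold edgeHi edgeLo modeOf; split_ifs <;> omega
    cells := fun i _ => by unfold edgeHi modeOf; split_ifs <;> omega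
    cell_lt := fun i _ p h1 h2 => by
      obtain ⟨x, y, hx, -, -⟩ := adj_of_cell D hL h1 h2
      exact lt_of_eq_of_lt hx x.2
    d_self := fun i u => truncDist_self _ _
    d_comm := fun i u v => truncDist_comm _ _ _
    d_tri := fun i u v x => truncDist_triangle _ _ _ _
    d_le := fun i u v => truncDist_le _ _ _
    d_lt := fun i u v => truncDist_lt _ _ _
    d_zero := fun i u hu v hv h => retract_inj hn hu hv (eq_of_truncDist_eq_zero _ _ _ h)
    d_adj := fun i _ p h1 h2 => by
      obtain ⟨x, y, hx, hy, hxy⟩ := adj_of_cell D hL h1 h2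
      change truncDist _ (retract hn (inputCell L D p)) (retract hn (inputCell L D (partner p))) ≤ 1
      rw [hx, hy, retract_coe, retract_coe]
      exact truncDist_le_one _ _ _ hxy
    d_pred := fun i _ u hu v hv k h hk => by
      obtain ⟨x, hxv, hx⟩ := exists_adj_of_truncDist_eq _ _ _ h hk
      obtain ⟨p, h1, h2, h3, h4⟩ := cell_of_adj D hL hxv
      refine ⟨p, h1, h2, h4.trans (Nat.mod_eq_of_lt hv), ?_⟩
      change truncDist _ _ (retract hn (inputCell L D p)) = k
      rw [h3, retract_coe]
      exact hx
    n_le_a := by rw [two_pow_four]; exact Nat.le_pow_clog (by omega) n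
    a_le_n := by rw [two_pow_four]; exact pow_clog_le hn
    smp_lt := fun k => Nat.mod_lt _ hn
    len_lt := by
      have := hb.2.2.1
      change (encodeInstance L D).length + 100 < ((encodeInstance L D).length + 2) ^ _
      omega
    fuel_lt := hb.2.1
    bound := hb.1 }

theorem graphInst_reads (hn : 0 < n) (hm : n ≤ G.numEdges) (hL : ∀ i, IsEdgeList (L i) (G i))
    (hD : 4 ≤ D.toNat) {κ c F top w : ℕ} (hF : 0 < F) (tape : ℕ → Bool) :
    (graphInst hn hm hL hD κ c F top w tape).Reads c F := by
  have hlen : (encodeInstance L D).length = 5 + 2 * (L 0).length + 2 * (L 1).length :=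
    encodeInstance_length L D
  have hE : G.numEdges = (L 0).length + (L 1).length := numEdges_eq hL
  have hb := bounds_of_le (M := (encodeInstance L D).length + 2) (n := n) (m := G.numEdges)
    (e := Nat.clog 16 n) (κ := κ) (c := c) (F := F) (top := top) (by omega) (by omega) (by omega)
    (pow_clog_le hn)
  obtain ⟨i0, i1, i2, i3⟩ := inputCell_small D L
  exact
    { inp0 := i0
      q_eq := congrArg (fun x => min (x / 4) n) i3.symm
      m_eq := hE.trans (congrArg₂ _ i1.symm i2.symm)
      five_le := by change 5 ≤ (encodeInstance L D).length; omega
      lo0 := rfl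
      hi0 := congrArg (fun x => 5 + 2 * x) i1.symm
      lo1 := congrArg (fun x => 5 + 2 * x) i1.symm
      hi1 := congrArg₂ (fun x y => 5 + 2 * x + 2 * y) i1.symm i2.symm
      e_eq := rfl
      l_eq := rfl
      fuel_eq := rfl
      F_pos := hF
      smp_eq := fun k => rfl
      F_lt := hb.2.2.2.1
      c_lt := hb.2.2.2.2.1
      κ_lt := hb.2.2.2.2.2.1 }

end

end WordRAM

namespace WordRAM

/-! ### The program -/

/-- The state at the start. -/
def HState.zero : HState := ⟨fun _ => 0, fun _ _ => 0, 0, 0⟩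

/-- Compute the length of the input. -/
def lengthProg : Prog :=
  .seq (.const 1 1) (.seq (.load 1 1) (.seq (.const 3 2) (.seq (.load 3 3) (.seq (.op .add 1 1 3)
    (.seq (.op .add 1 1 1) (.seq (.const 3 5) (.op .add 0 1 3)))))))

/-- Registers `12`, `14`, `16` of the machine are the variables `ρfound`, `ρoutA`, `ρoutB`, numbered
`5`, `6`, `7`. -/
def outputProg : Prog :=
  .seq (.op .and 0 12 12) (.seq (.op .and 1 14 14) (.op .and 2 16 16))

def Cmd.toProg (c : Cmd) : Prog := .seq lengthProg (.seq c.comp outputProg)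

variable {E : Env} {X : Inst E}

theorem lengthProg_run {n : ℕ} {L : Fin 2 → List (Fin n × Fin n)} {D : ℤ} (hE : E.Valid)
    (hl : E.len = (encodeInstance L D).length) (hi : E.inp = inputCell L D)
    (hin : ∀ x ∈ encodeInstance L D, x < 2 ^ E.w) :
    ∃ s, Run E.tape lengthProg (State.init E.w (encodeInstance L D)) 8 s ∧
      Rel E HState.zero s := by
  obtain ⟨i0, i1, i2, i3⟩ := inputCell_small D L
  have hlen := encodeInstance_length L D
  have hfit := hE.fits
  refine ⟨_, .seq (.const _ _ _) (.seq (.load _ _ _) (.seq (.const _ _ _) (.seq (.load _ _ _)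
    (.seq (.op _ _ _ _ _) (.seq (.op _ _ _ _ _) (.seq (.const _ _ _) (.op _ _ _ _ _))))))), ?_⟩
  have m1 : (encodeInstance L D).getD (BitVec.ofNat E.w 1).toNat 0 = (L 0).length := by
    rw [BitVec.toNat_ofNat, Nat.mod_eq_of_lt (by omega)]; exact i1
  have m2 : (encodeInstance L D).getD (BitVec.ofNat E.w 2).toNat 0 = (L 1).length := by
    rw [BitVec.toNat_ofNat, Nat.mod_eq_of_lt (by omega)]; exact i2
  refine ⟨?_, fun r => ?_, fun p hp => ?_, fun a ha x hx => ?_, rfl⟩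
  · simp only [State.setReg, State.init, Function.update_apply, Op.eval]
    simp only [if_true, OfNat.ofNat_ne_one, OfNat.one_ne_ofNat, if_false, m1, m2]
    rw [← BitVec.ofNat_add, ← BitVec.ofNat_add, ← BitVec.ofNat_add, BitVec.toNat_ofNat,
      Nat.mod_eq_of_lt (by omega)]
    omega
  · simp [State.setReg, State.init, HState.zero]
  · change (BitVec.ofNat _ ((encodeInstance L D).getD (BitVec.ofNat _ p).toNat 0)).toNat = _
    rw [BitVec.toNat_ofNat p, Nat.mod_eq_of_lt (by omega), BitVec.toNat_ofNat, Nat.mod_eq_of_lt, hi]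
    · rfl
    · rw [List.getD_eq_getElem _ _ (by omega)]
      exact hin _ (List.getElem_mem _)
  · change (BitVec.ofNat _ ((encodeInstance L D).getD
      (BitVec.ofNat _ (E.len + 16 * x + a)).toNat 0)).toNat = 0
    rw [BitVec.toNat_ofNat (_ + a), Nat.mod_eq_of_lt (by omega), List.getD_eq_default _ _ (by omega)]
    simp

theorem toProg_run {n : ℕ} {L : Fin 2 → List (Fin n × Fin n)} {D : ℤ} (hE : E.Valid)
    (hl : E.len = (encodeInstance L D).length) (hi : E.inp = inputCell L D)
    (hin : ∀ x ∈ encodeInstance L D, x < 2 ^ E.w) {c : Cmd} {Q : HState → Prop}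
    (H : wp E c Q HState.zero) :
    ∃ t s, Run E.tape c.toProg (State.init E.w (encodeInstance L D)) t s ∧ ∃ h', Q h' ∧
      s.reg 0 = BitVec.ofNat E.w (h'.reg ρfound) ∧ s.reg 1 = BitVec.ofNat E.w (h'.reg ρoutA) ∧
      s.reg 2 = BitVec.ofNat E.w (h'.reg ρoutB) ∧ t ≤ 11 + c.cost * h'.time := by
  obtain ⟨s₁, r₁, hs₁⟩ := lengthProg_run hE hl hi hin
  obtain ⟨h', hr, hQ⟩ := wp_iff.1 H
  obtain ⟨t₂, s₂, r₂, hs₂, ht⟩ := hr.comp hE c.cost s₁ le_rfl hs₁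
  have e : ∀ r, s₂.reg (2 * r + 2) = BitVec.ofNat E.w (h'.reg r) := fun r => by
    rw [← hs₂.reg r, BitVec.ofNat_toNat, BitVec.setWidth_eq]
  refine ⟨_, _, .seq r₁ (.seq r₂ (.seq (.op _ _ _ _ _) (.seq (.op _ _ _ _ _) (.op _ _ _ _ _)))),
    h', hQ, ?_, ?_, ?_, ?_⟩
  · simpa [State.setReg, Function.update_apply, Op.eval] using e 5
  · simpa [State.setReg, Function.update_apply, Op.eval] using e 6
  · simpa [State.setReg, Function.update_apply, Op.eval] using e 7
  · change t₂ + c.cost * 0 ≤ _ at ht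
    omega

/-- If the positive part of `D` is zero, the vertex `0` taken twice is an answer. -/
def solver (P : Prog) (κ c F : ℕ) : Cmd :=
  .inp ρt 3 ;; .ite (.var ρt) (prepare κ c F ;; algorithm P) (.asg ρfound 1)

/-- The bound for the time with `j` repetitions. -/
def Inst.timeBound (X : Inst E) (P : Prog) (F j : ℕ) : ℕ :=
  (passTime P F + 2102 + 3 * X.κ) * (X.m * X.a ^ 3 * 2 ^ j) * (3 * X.e + 1) * (X.l + 1) ^ 2

/-- The properties of the final state. -/
def Inst.Solved (X : Inst E) (P : Prog) (T : ℕ → ℕ) (F : ℕ) (h' : HState) : Prop :=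
  ∃ j ≤ 3 * X.e, (j = 0 ∨ X.fuel < T (2 ^ (3 * X.e - j + 1))) ∧ Snd X h' ∧
    (h'.reg ρfound = 0 → X.Good (2 ^ (3 * X.e - j)) (X.a * 2 ^ j * X.l) →
      X.Good (X.a ^ 2) (X.a ^ 2 * X.l) → X.NoPair) ∧
    h'.time ≤ X.timeBound P F j

theorem solver_spec (hE : E.Valid) {P : Prog} {T : ℕ → ℕ} {c F : ℕ} (hP : X.Multiplies P T)
    (htop : P.top ≤ E.B) (hκ : 4 ≤ X.κ) (hX : X.Reads c F) (hT1 : T 1 ≤ F) (h3 : E.inp 3 ≠ 0) :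
    wp E (solver P X.κ c F) (X.Solved P T F) HState.zero := by
  have hB := X.hundred_lt
  have hfive := hX.five_le
  have hm : 0 < X.m := X.n_pos.trans_le X.n_le_m
  have ha := X.a_pos
  have hfuel := hX.fuel_eq
  simp only [solver, wp_seq, wp_inp, wp_ite, wp_asg]
  simp [h3]
  repeat refine ⟨by omega, ?_⟩
  refine (prepare_spec hX (by simp [HState.zero]) (by simp [HState.zero])).call ?_
  rintro h₁ hf₁ ⟨hc, hmem, hfound, ht⟩
  simp [HState.zero] at hfound ht
  refine (algorithm_spec hE hP htop hκ hfuel.le hX.F_pos ?_ hc hmem).call ?_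
  · rw [hfuel]
    exact hT1.trans (Nat.le_mul_of_pos_right _ (by positivity))
  rintro h₂ - ⟨j, hj, hfail, hS⟩
  refine ⟨j, hj, hfail, hS.snd ⟨by omega, fun h => by omega, fun h => by omega, fun h => by omega⟩,
    fun h0 => (hS.fin h0).2, hS.time.trans ?_⟩
  have hH : 1 ≤ 2 ^ j := Nat.one_le_two_pow
  set V := (3 * X.e + 1) * (X.l + 1) ^ 2 with hV
  have e1 : X.timeBound P F j = (passTime P F + 2000) * (X.m * X.a ^ 3 * 2 ^ j) * (3 * X.e + 1) *
      (X.l + 1) ^ 2 + (102 + 3 * X.κ) * (X.m * X.a ^ 3 * 2 ^ j * V) := by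
    rw [Inst.timeBound, hV]; ring
  have e2 : X.m * X.a ^ 3 * (3 * X.e + 1) ≤ X.m * X.a ^ 3 * 2 ^ j * V :=
    Nat.mul_le_mul (Nat.le_mul_of_pos_right _ hH) (Nat.le_mul_of_pos_right _ (by positivity))
  have e3 : 1 ≤ X.m * X.a ^ 3 * 2 ^ j * V := Nat.mul_pos (by positivity) (by positivity)
  have e4 := Nat.mul_le_mul_left (100 + 3 * X.κ) e2
  have e5 : (102 + 3 * X.κ) * (X.m * X.a ^ 3 * 2 ^ j * V) =
    (100 + 3 * X.κ) * (X.m * X.a ^ 3 * 2 ^ j * V) + 2 * (X.m * X.a ^ 3 * 2 ^ j * V) := by ring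
  rw [e1]
  omega

theorem solver_spec_zero (hlen : 3 < E.len) (hB3 : 3 < E.B) {P : Prog} {κ c F : ℕ}
    (h3 : E.inp 3 = 0) :
    wp E (solver P κ c F) (fun h' => h'.reg ρfound = 1 ∧ h'.reg ρoutA = 0 ∧ h'.reg ρoutB = 0 ∧
      h'.time = 3) HState.zero := by
  simp only [solver, wp_seq, wp_inp, wp_ite, wp_asg]
  simp [h3, HState.zero]
  omega

end WordRAM

namespace WordRAM

/-! ### Correctness -/

section

variable {n : ℕ} {G : MultimodeGraph 2 (Fin n)} {L : Fin 2 → List (Fin n × Fin n)} {D : ℤ}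

theorem edist_eq_top_of_truncDist_eq {H : SimpleGraph (Fin n)} {u v : Fin n}
    (h : truncDist H u v = 4 * n) : H.edist u v = ⊤ := by
  by_contra hne
  have hn : 0 < n := u.pos
  have hr := SimpleGraph.reachable_of_edist_ne_top hne
  obtain ⟨p, hp, hl⟩ := hr.exists_path_of_dist
  have h2 := hp.length_lt
  rw [Fintype.card_fin] at h2
  have h3 : truncDist H u v ≤ H.dist u v := by
    rw [← Nat.cast_le (α := ℕ∞), coe_truncDist, hr.coe_dist_eq_edist]
    exact min_le_left _ _
  omega

theorem le_dist_iff {k : ℕ∞} {u v : Fin n} :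
    k ≤ G.dist u v ↔ k ≤ (G 0).edist u v ∧ k ≤ (G 1).edist u v := by
  rw [MultimodeGraph.dist, le_iInf_iff, Fin.forall_fin_two]

theorem coe_le_of_le {x : ℕ∞} {k : ℕ} {y : ℝ} (h : (k : ℕ∞) ≤ x) (hy : y ≤ k) :
    (y : EReal) ≤ ((x : ENNReal) : EReal) := by
  have h1 : ((k : ENNReal) : EReal) ≤ ((x : ENNReal) : EReal) := by
    rw [EReal.coe_ennreal_le_coe_ennreal_iff]
    exact_mod_cast ENat.toENNReal_le.2 h
  refine le_trans ?_ h1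
  have h2 : ((k : ENNReal) : EReal) = ((k : ℝ) : EReal) := by
    rw [← ENNReal.ofReal_natCast, EReal.coe_ennreal_ofReal, max_eq_left (by positivity)]
  rw [h2]
  exact EReal.coe_le_coe_iff.2 hy

theorem coe_lt_of_le {x : ℕ∞} {k : ℕ} {y : ℝ} (h : x ≤ (k : ℕ∞)) (hy : (k : ℝ) < y) :
    ((x : ENNReal) : EReal) < (y : EReal) := by
  have h1 : ((x : ENNReal) : EReal) ≤ ((k : ENNReal) : EReal) := by
    rw [EReal.coe_ennreal_le_coe_ennreal_iff]
    exact_mod_cast ENat.toENNReal_le.2 h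
  refine h1.trans_lt ?_
  have h2 : ((k : ENNReal) : EReal) = ((k : ℝ) : EReal) := by
    rw [← ENNReal.ofReal_natCast, EReal.coe_ennreal_ofReal, max_eq_left (by positivity)]
  rw [h2]
  exact EReal.coe_lt_coe_iff.2 hy

/-- If `D / 4` exceeds `n`, then `q = n`, and a truncated distance of at least `2 * n` can only be
the mark of infinity. -/
theorem half_le_dist (h4 : (4 : ℤ) ∣ D) {q : ℕ} (hq : q = min (D.toNat / 4) n) {u v : Fin n}
    (h : ∀ i < 2, 2 * q ≤ truncDist (G (modeOf i)) u v) :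
    (((D : ℝ) / 2 : ℝ) : EReal) ≤ ((G.dist u v : ENNReal) : EReal) := by
  have hn : 0 < n := u.pos
  obtain ⟨z, rfl⟩ := h4
  have key : ((2 * (z.toNat) : ℕ) : ℕ∞) ≤ G.dist u v := by
    have each : ∀ i < 2, ((2 * (z.toNat) : ℕ) : ℕ∞) ≤ (G (modeOf i)).edist u v := by
      intro i hi
      have h1 := h i hi
      by_cases hc : z.toNat ≤ n
      · exact (le_truncDist_iff _ _ _ (by omega)).1 (by omega)
      · have h2 : truncDist (G (modeOf i)) u v = 4 * n := by
          by_contra hne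
          have := truncDist_lt _ _ _ hne
          omega
        rw [edist_eq_top_of_truncDist_eq h2]
        exact le_top
    exact le_dist_iff.2 ⟨each 0 (by omega), each 1 (by omega)⟩
  refine coe_le_of_le key ?_
  have h3 : (z : ℝ) ≤ (z.toNat : ℝ) := by exact_mod_cast Int.self_le_toNat z
  push_cast
  linarith

/-- A truncated distance below `4 * q ≤ 4 * n` is the true one, so the diameter is at most `4 * q -
1 < D`. -/
theorem diam_lt {q : ℕ} (hD : 4 ≤ D.toNat) (hn : 0 < n) (hq : q = min (D.toNat / 4) n)
    (h : ∀ u v : Fin n, ¬ (4 * q ≤ truncDist (G 0) u v ∧ 4 * q ≤ truncDist (G 1) u v)) :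
    ((G.diam : ENNReal) : EReal) < ((D : ℝ) : EReal) := by
  have key : G.diam ≤ ((4 * q - 1 : ℕ) : ℕ∞) := by
    refine iSup_le fun u => iSup_le fun v => ?_
    have each : ∀ i, truncDist (G i) u v < 4 * q → G.dist u v ≤ ((4 * q - 1 : ℕ) : ℕ∞) := by
      intro i hi
      refine (iInf_le _ i).trans ?_
      rw [edist_eq_of_truncDist_lt _ _ _ (by omega)]
      exact_mod_cast (by omega : truncDist (G i) u v ≤ 4 * q - 1)
    by_cases h0 : truncDist (G 0) u v < 4 * q
    · exact each 0 h0
    · exact each 1 (by have := h u v; omega)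
  refine coe_lt_of_le key ?_
  have h1 : ((4 * q - 1 : ℕ) : ℤ) < D := by omega
  exact_mod_cast h1

/-- The events that the sample is bad. -/
def badSizes (e l : ℕ) : Finset (ℕ × ℕ) :=
  insert ((2 ^ e) ^ 2, (2 ^ e) ^ 2 * l)
    ((Finset.range (3 * e + 1)).image fun j => (2 ^ (3 * e - j), 2 ^ e * 2 ^ j * l))

theorem badSizes_card (e l : ℕ) : (badSizes e l).card ≤ 3 * e + 2 := by
  refine (Finset.card_insert_le _ _).trans ?_
  have := Finset.card_image_le (s := Finset.range (3 * e + 1))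
    (f := fun j => (2 ^ (3 * e - j), 2 ^ e * 2 ^ j * l))
  rw [Finset.card_range] at this
  omega

/-- In every case the sample size times the ball size is `a ^ 4 * l`. All values of `j` are included
because the final one may depend on the random bits. -/
theorem badSizes_mul {e l : ℕ} {p : ℕ × ℕ} (hp : p ∈ badSizes e l) :
    2 ^ (4 * e) * l ≤ p.1 * p.2 := by
  simp only [badSizes, Finset.mem_insert, Finset.mem_image, Finset.mem_range] at hp
  refine le_of_eq ?_
  rcases hp with rfl | ⟨j, hj, rfl⟩
  · simp only
    rw [← Nat.mul_assoc, ← pow_mul, ← pow_add]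
    congr 2; ring
  · simp only
    rw [← Nat.mul_assoc, ← pow_add, ← pow_add]
    congr 2; omega

theorem graphInst_good (hn : 0 < n) (hm : n ≤ G.numEdges) (hL : ∀ i, IsEdgeList (L i) (G i))
    (hD : 4 ≤ D.toNat) {κ c F top w : ℕ} {tape : ℕ → Bool} {p : ℕ × ℕ}
    (h : ¬ ∃ i < 2, ∃ v < n, p.2 < (graphBall G hn (min (D.toNat / 4) n) i v).card ∧
      ∀ k < p.1, sampleAt n (Nat.clog 16 n) tape k ∉ graphBall G hn (min (D.toNat / 4) n) i v) :
    (graphInst hn hm hL hD κ c F top w tape).Good p.1 p.2 := by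
  intro i hi v hv hno
  by_contra hlt
  refine h ⟨i, hi, v, hv, not_le.1 hlt, fun k hk hmem => hno ⟨k, hk, ?_⟩⟩
  have := (Finset.mem_filter.1 hmem).2
  rw [truncDist_comm] at this
  exact this

theorem correctAnswer_of (hn : 0 < n) (hm : n ≤ G.numEdges) (hL : ∀ i, IsEdgeList (L i) (G i))
    (hD : 4 ≤ D.toNat) (h4 : (4 : ℤ) ∣ D) {κ c F top w : ℕ} {tape : ℕ → Bool} {P : Prog}
    {T : ℕ → ℕ} {h' : HState} {s : State w}
    (hS : (graphInst hn hm hL hD κ c F top w tape).Solved P T F h')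
    (hgood : ∀ p ∈ badSizes (Nat.clog 16 n) ((c + 3) * (4 * Nat.clog 16 n)),
      (graphInst hn hm hL hD κ c F top w tape).Good p.1 p.2)
    (e0 : s.reg 0 = BitVec.ofNat w (h'.reg ρfound)) (e1 : s.reg 1 = BitVec.ofNat w (h'.reg ρoutA))
    (e2 : s.reg 2 = BitVec.ofNat w (h'.reg ρoutB)) : CorrectAnswer G D s := by
  obtain ⟨j, hj, -, hsnd, hfin, -⟩ := hS
  have hle := hsnd.le_one
  by_cases hf : h'.reg ρfound = 1
  · left
    rw [hf] at e0
    have hA := hsnd.A_lt hf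
    have hB := hsnd.B_lt hf
    refine ⟨e0, ⟨_, hA⟩, ⟨_, hB⟩, e1, e2, half_le_dist h4 rfl fun i hi => ?_⟩
    have := hsnd.far hf i hi
    have r1 : retract hn (h'.reg ρoutA) = ⟨_, hA⟩ := Fin.ext (Nat.mod_eq_of_lt hA)
    have r2 : retract hn (h'.reg ρoutB) = ⟨_, hB⟩ := Fin.ext (Nat.mod_eq_of_lt hB)
    rw [← r1, ← r2]
    exact this
  · right
    have hf0 : h'.reg ρfound = 0 := by omega
    rw [hf0] at e0
    refine ⟨e0, diam_lt hD hn rfl fun u v huv => ?_⟩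
    have hno := hfin hf0
      (hgood (2 ^ (3 * Nat.clog 16 n - j),
        2 ^ Nat.clog 16 n * 2 ^ j * ((c + 3) * (4 * Nat.clog 16 n))) ?_)
      (hgood ((2 ^ Nat.clog 16 n) ^ 2,
        (2 ^ Nat.clog 16 n) ^ 2 * ((c + 3) * (4 * Nat.clog 16 n))) ?_)
    · refine hno u u.2 v v.2 ?_
      rw [← retract_coe hn u, ← retract_coe hn v] at huv
      exact huv
    · refine Finset.mem_insert_of_mem (Finset.mem_image.2 ⟨j, ?_, rfl⟩)
      have hj' : j ≤ 3 * Nat.clog 16 n := hj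
      exact Finset.mem_range.2 (by omega)
    · exact Finset.mem_insert_self _ _

end

end WordRAM

/-! ### The program on the word RAM -/

namespace WordRAM

/-- Subadditivity takes the place of the measure of a complement, so neither set has to be
measurable. -/
theorem le_coinMeasure_of {S S' : Set (ℕ → Bool)} {x : ℝ} (hS : coinMeasure S' ≤ ENNReal.ofReal x)
    (h : ∀ tape, tape ∉ S' → tape ∈ S) (hx : 0 ≤ x) :
    ENNReal.ofReal (1 - x) ≤ coinMeasure S := by
  rw [ENNReal.ofReal_sub _ hx, ENNReal.ofReal_one, tsub_le_iff_right]
  calc (1 : ENNReal) = coinMeasure Set.univ := measure_univ.symm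
    _ ≤ coinMeasure (S ∪ S') := measure_mono fun tape _ => by
        by_cases h1 : tape ∈ S'
        · exact Or.inr h1
        · exact Or.inl (h tape h1)
    _ ≤ coinMeasure S + coinMeasure S' := measure_union_le _ _
    _ ≤ _ := by gcongr

/-- The factor in the bound for the time of the whole program. -/
def solverFactor (P : Prog) (κ c F : ℕ) : ℕ :=
  11 + (solver P κ c F).cost * (3 + (passTime P F + 2102 + 3 * κ) * (3 * (4 * c + 13) ^ 2))

theorem solver_exists {P : Prog} {K : ℕ} {T : ℕ → ℕ}
    (hP : ∀ (N w : ℕ) (A B : Matrix (Fin N) (Fin N) ℕ), 0 < N →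
      WordSizeOK K w (encodeMatrices A B) → (∀ i j, (A * B) i j < 2 ^ w) →
      ∀ tape : ℕ → Bool, ∃ (t : ℕ) (s : State w),
        Run tape P (State.init w (encodeMatrices A B)) t s ∧ t < T N ∧
        ∀ i j : Fin N,
          s.mem (BitVec.ofNat w (1 + 2 * N ^ 2 + N * i + j)) = BitVec.ofNat w ((A * B) i j))
    (c : ℕ) :
    ∃ (Q : Prog) (K' C : ℕ), ∀ (n w : ℕ) (G : MultimodeGraph 2 (Fin n))
      (L : Fin 2 → List (Fin n × Fin n)) (D : ℤ),
      0 < n → n ≤ G.numEdges → (4 : ℤ) ∣ D → (∀ i, IsEdgeList (L i) (G i)) →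
      WordSizeOK K' w (encodeInstance L D) →
      (∀ tape : ℕ → Bool, ∃ (t : ℕ) (s : State w),
        Run tape Q (State.init w (encodeInstance L D)) t s ∧ ∃ j ≤ 3 * Nat.clog 16 n,
          (j = 0 ∨ G.numEdges * (2 ^ Nat.clog 16 n) ^ 2 < T (2 ^ (3 * Nat.clog 16 n - j + 1))) ∧
          t ≤ C * (G.numEdges * (2 ^ Nat.clog 16 n) ^ 3 * 2 ^ j * (Nat.clog 16 n + 1) ^ 3)) ∧
      ENNReal.ofReal (1 - (n : ℝ) ^ (-(c : ℝ))) ≤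
        coinMeasure {tape | ∃ (t : ℕ) (s : State w),
          Run tape Q (State.init w (encodeInstance L D)) t s ∧ CorrectAnswer G D s} := by
  set κ := K + 4 with hκ
  -- This ensures that `1 × 1` products finish within the fuel.
  set F := T 1 + 1 with hF
  refine ⟨(solver P κ c F).toProg, boundExp κ c F P.top + 3, solverFactor P κ c F,
    fun n w G L D hn hm h4 hL hw => ?_⟩
  have hlen : (encodeInstance L D).length = 5 + 2 * (L 0).length + 2 * (L 1).length :=
    encodeInstance_length L D
  have hE : G.numEdges = (L 0).length + (L 1).length := numEdges_eq hL
  set e := Nat.clog 16 n with he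
  have hb := bounds_of_le (M := (encodeInstance L D).length + 2) (n := n) (m := G.numEdges)
    (e := e) (κ := κ) (c := c) (F := F) (top := P.top) (by omega) (by omega) (by omega)
    (pow_clog_le hn)
  have hval : ∀ tape, (solverEnv L D w (boundExp κ c F P.top) tape).Valid := fun tape =>
    ⟨by have := hb.2.2.1; change 1 < ((encodeInstance L D).length + 2) ^ _; omega,
      valid_of_le (by omega) rfl hw.2⟩
  have hm0 : 0 < G.numEdges := by omega
  by_cases hD : 4 ≤ D.toNat
  · have main : ∀ tape, ∃ (t : ℕ) (s : State w),
        Run tape (solver P κ c F).toProg (State.init w (encodeInstance L D)) t s ∧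
        ∃ h', (graphInst hn hm hL hD κ c F P.top w tape).Solved P T F h' ∧
          s.reg 0 = BitVec.ofNat w (h'.reg ρfound) ∧ s.reg 1 = BitVec.ofNat w (h'.reg ρoutA) ∧
          s.reg 2 = BitVec.ofNat w (h'.reg ρoutB) ∧
          t ≤ 11 + (solver P κ c F).cost * h'.time := by
      intro tape
      have h3 : (solverEnv L D w (boundExp κ c F P.top) tape).inp 3 ≠ 0 := by
        change inputCell L D 3 ≠ 0
        rw [(inputCell_small D L).2.2.2]; omega
      exact toProg_run (hval tape) rfl rfl hw.1 (solver_spec (hval tape)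
        ((graphInst hn hm hL hD κ c F P.top w tape).multiplies_of hP rfl) hb.2.2.2.2.2.2
        (by change 4 ≤ κ; omega) (graphInst_reads hn hm hL hD (by omega) tape) (by omega) h3)
    refine ⟨fun tape => ?_, ?_⟩
    · obtain ⟨t, s, hr, h', hS, -, -, -, ht⟩ := main tape
      obtain ⟨j, hj, hfail, -, -, htime⟩ := hS
      refine ⟨t, s, hr, j, hj, hfail.imp_right fun hlt => ?_, ?_⟩
      · refine lt_of_le_of_lt ?_ hlt
        exact Nat.le_mul_of_pos_left _ (by omega)
      · set U := G.numEdges * (2 ^ e) ^ 3 * 2 ^ j with hU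
        have h1 : h'.time ≤ (passTime P F + 2102 + 3 * κ) * U * (3 * e + 1) *
          ((c + 3) * (4 * e) + 1) ^ 2 := htime
        have h2 : (c + 3) * (4 * e) + 1 ≤ (4 * c + 13) * (e + 1) := by
          ring_nf; omega
        have h3 : 0 < U * (e + 1) ^ 3 := by positivity
        have h4 : h'.time ≤ (passTime P F + 2102 + 3 * κ) * (3 * (4 * c + 13) ^ 2) *
            (U * (e + 1) ^ 3) := by
          refine h1.trans ?_
          calc (passTime P F + 2102 + 3 * κ) * U * (3 * e + 1) * ((c + 3) * (4 * e) + 1) ^ 2 ≤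
              (passTime P F + 2102 + 3 * κ) * U * (3 * (e + 1)) * ((4 * c + 13) * (e + 1)) ^ 2 := by
                refine Nat.mul_le_mul (Nat.mul_le_mul_left _ (by omega)) (Nat.pow_le_pow_left h2 2)
            _ = _ := by ring
        have h5 := Nat.mul_le_mul_left (solver P κ c F).cost h4
        have h6 : solverFactor P κ c F * (U * (e + 1) ^ 3) = 11 * (U * (e + 1) ^ 3) +
          (solver P κ c F).cost * (3 * (U * (e + 1) ^ 3)) + (solver P κ c F).cost *
            ((passTime P F + 2102 + 3 * κ) * (3 * (4 * c + 13) ^ 2) * (U * (e + 1) ^ 3)) := by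
          unfold solverFactor; ring
        rw [h6]
        omega
    -- For `e = 0` there is just one vertex, and the required probability `1 - 1 ^ (-c)` is zero.
    · by_cases he0 : e = 0
      · have hn1 : n = 1 := by
          have : n ≤ 16 ^ e := Nat.le_pow_clog (by omega) n
          rw [he0] at this
          omega
        subst hn1
        simp
      · refine le_coinMeasure_of (coin_bad_le (c := c) (l := (c + 3) * (4 * e)) hn he rfl
          (Nat.pos_of_ne_zero he0) (graphBall G hn (min (D.toNat / 4) n))
          (fun i v => Finset.filter_subset _ _) (badSizes e ((c + 3) * (4 * e)))
          (badSizes_card _ _) (fun p hp => badSizes_mul hp)) (fun tape ht => ?_) (by positivity)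
        obtain ⟨t, s, hr, h', hS, e0, e1, e2, -⟩ := main tape
        refine ⟨t, s, hr, correctAnswer_of hn hm hL hD h4 hS (fun p hp => ?_) e0 e1 e2⟩
        refine graphInst_good hn hm hL hD fun hbad => ht ?_
        exact ⟨p, hp, hbad⟩
  -- A multiple of `4` below `4` is at most `0`; here every outcome of the random bits gives a
  -- correct answer.
  · have hD0 : D.toNat = 0 := by omega
    have hDle : D ≤ 0 := by omega
    have main : ∀ tape, ∃ (t : ℕ) (s : State w),
        Run tape (solver P κ c F).toProg (State.init w (encodeInstance L D)) t s ∧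
        ∃ h' : HState, (h'.reg ρfound = 1 ∧ h'.reg ρoutA = 0 ∧ h'.reg ρoutB = 0 ∧ h'.time = 3) ∧
          s.reg 0 = BitVec.ofNat w (h'.reg ρfound) ∧ s.reg 1 = BitVec.ofNat w (h'.reg ρoutA) ∧
          s.reg 2 = BitVec.ofNat w (h'.reg ρoutB) ∧
          t ≤ 11 + (solver P κ c F).cost * h'.time := by
      intro tape
      have h3 : (solverEnv L D w (boundExp κ c F P.top) tape).inp 3 = 0 := by
        change inputCell L D 3 = 0
        rw [(inputCell_small D L).2.2.2, hD0]
      exact toProg_run (hval tape) rfl rfl hw.1 (solver_spec_zero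
        (by change 3 < (encodeInstance L D).length; omega)
        (by have := hb.2.2.1; change 3 < ((encodeInstance L D).length + 2) ^ _; omega) h3)
    refine ⟨fun tape => ?_, ?_⟩
    · obtain ⟨t, s, hr, h', ⟨-, -, -, h3⟩, -, -, -, ht⟩ := main tape
      refine ⟨t, s, hr, 0, Nat.zero_le _, Or.inl rfl, ht.trans ?_⟩
      have h4 : 0 < G.numEdges * (2 ^ e) ^ 3 * 2 ^ 0 * (e + 1) ^ 3 := by positivity
      refine le_trans ?_ (Nat.le_mul_of_pos_right _ h4)
      rw [h3]
      unfold solverFactor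
      exact Nat.add_le_add_left (Nat.mul_le_mul_left _ (Nat.le_add_right _ _)) _
    · refine le_coinMeasure_of (S' := ∅) (by simp) (fun tape _ => ?_) (by positivity)
      obtain ⟨t, s, hr, h', ⟨g0, g1, g2, -⟩, e0, e1, e2, -⟩ := main tape
      refine ⟨t, s, hr, Or.inl ⟨by rw [e0, g0]; rfl, ⟨0, hn⟩, ⟨0, hn⟩, by rw [e1, g1], by rw [e2, g2],
        ?_⟩⟩
      refine coe_le_of_le (k := 0) (by simp) ?_
      have : (D : ℝ) ≤ 0 := by exact_mod_cast hDle
      simp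
      linarith

end WordRAM

namespace WordRAM

/-! ### Running time -/

theorem fourthRoot_bounds {n e : ℕ} (hn : 0 < n) (he : e = Nat.clog 16 n) :
    ((2 : ℝ) ^ e) ^ 3 ≤ 8 * (n : ℝ) ^ (3 / 4 : ℝ) ∧ ((2 : ℝ) ^ e) ^ 6 ≤ 64 * (n : ℝ) ^ (3 / 2 : ℝ) ∧
      √(n : ℝ) ≤ ((2 : ℝ) ^ e) ^ 2 ∧ (e : ℝ) + 1 ≤ 2 * (1 + Real.log n) := by
  have h1 : (n : ℝ) ≤ ((2 : ℝ) ^ e) ^ 4 := by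
    have : n ≤ (2 ^ e) ^ 4 := by rw [two_pow_four, he]; exact Nat.le_pow_clog (by omega) n
    exact_mod_cast this
  have h2 : ((2 : ℝ) ^ e) ^ 4 ≤ 16 * n := by
    have : (2 ^ e) ^ 4 ≤ 16 * n := by rw [two_pow_four, he]; exact pow_clog_le hn
    exact_mod_cast this
  have h16 : (16 : ℝ) = 2 ^ (4 : ℝ) := by norm_num
  have ha : (0 : ℝ) < 2 ^ e := by positivity
  set a : ℝ := 2 ^ e with haa
  have hpow : ∀ x : ℝ, (a ^ 4) ^ x = a ^ (4 * x) := fun x => by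
    rw [← Real.rpow_natCast, ← Real.rpow_mul ha.le]; norm_num
  refine ⟨?_, ?_, ?_, ?_⟩
  · calc a ^ 3 = (a ^ 4) ^ (3 / 4 : ℝ) := by rw [hpow, ← Real.rpow_natCast]; norm_num
      _ ≤ (16 * (n : ℝ)) ^ (3 / 4 : ℝ) := Real.rpow_le_rpow (by positivity) h2 (by norm_num)
      _ = 8 * (n : ℝ) ^ (3 / 4 : ℝ) := by
        rw [Real.mul_rpow (by norm_num) (by positivity), h16, ← Real.rpow_mul (by norm_num)]
        norm_num
  · calc a ^ 6 = (a ^ 4) ^ (3 / 2 : ℝ) := by rw [hpow, ← Real.rpow_natCast]; norm_num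
      _ ≤ (16 * (n : ℝ)) ^ (3 / 2 : ℝ) := Real.rpow_le_rpow (by positivity) h2 (by norm_num)
      _ = 64 * (n : ℝ) ^ (3 / 2 : ℝ) := by
        rw [Real.mul_rpow (by norm_num) (by positivity), h16, ← Real.rpow_mul (by norm_num)]
        norm_num
  · refine Real.sqrt_le_iff.2 ⟨by positivity, h1.trans (le_of_eq (by ring))⟩
  · have hlog : Real.log (a ^ 4) ≤ Real.log (16 * n) := Real.log_le_log (by positivity) h2
    have hn' : (n : ℝ) ≠ 0 := by positivity
    rw [Real.log_mul (by norm_num) hn', haa, ← pow_mul, Real.log_pow,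
      show (16 : ℝ) = 2 ^ 4 by norm_num, Real.log_pow] at hlog
    have hl2 := Real.log_two_gt_d9
    have hln : 0 ≤ Real.log n := Real.log_nonneg (by exact_mod_cast hn)
    push_cast at hlog
    nlinarith

/-- If the products of size `M = 2 * N` were too slow, `m * a ^ 2` is at most about `M ^ τ`, so `M`
is at least about `(m * √n) ^ (1 / τ)`. As `M * 2 ^ j = 2 * a ^ 3`, this bounds `2 ^ j`, and `a ^ 6`
is of order `n ^ (3 / 2)`. The first pass, `j = 0`, gives the summand `n ^ (3 / 4)`. -/
theorem matMulBound_le {τ : ℝ} (hτ : 1 ≤ τ) (k : ℕ) {C₁ : ℝ} (hC : 0 ≤ C₁) :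
    ∃ C₂ : ℝ, 0 ≤ C₂ ∧ ∀ n m j : ℕ, 0 < n → n ≤ m → j ≤ 3 * Nat.clog 16 n →
      (j = 0 ∨ m * (2 ^ Nat.clog 16 n) ^ 2 < ⌈C₁ * (((2 ^ (3 * Nat.clog 16 n - j + 1) : ℕ) : ℝ) ^ τ *
        (1 + Real.log ((2 ^ (3 * Nat.clog 16 n - j + 1) : ℕ) : ℝ)) ^ k)⌉₊ + 1) →
      ((m * (2 ^ Nat.clog 16 n) ^ 3 * 2 ^ j * (Nat.clog 16 n + 1) ^ 3 : ℕ) : ℝ) ≤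
        C₂ * (m * ((n : ℝ) ^ (3 / 4 : ℝ) + (n : ℝ) ^ (3 / 2 : ℝ) / (m * √(n : ℝ)) ^ (1 / τ)) *
          (1 + Real.log n) ^ (k + 3)) := by
  -- The factor `6 ^ k` comes from `1 + log M ≤ 6 * ℓ`, the `2` from rounding up and adding one.
  set C₃ : ℝ := C₁ * 6 ^ k + 2 with hC₃
  have hC₃1 : 1 ≤ C₃ := by
    have : 0 ≤ C₁ * 6 ^ k := by positivity
    linarith
  refine ⟨1024 * C₃, by positivity, fun n m j hn hnm hj hfail => ?_⟩
  obtain ⟨b1, b2, b3, b4⟩ := fourthRoot_bounds hn rfl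
  set e := Nat.clog 16 n
  have hln : 0 ≤ Real.log n := Real.log_nonneg (by exact_mod_cast hn)
  set ℓ := 1 + Real.log n with hℓ
  have hℓ1 : 1 ≤ ℓ := by linarith
  have hℓk : 1 ≤ ℓ ^ k := one_le_pow₀ hℓ1
  have he3 : ((e : ℝ) + 1) ^ 3 ≤ 8 * ℓ ^ 3 := by
    calc ((e : ℝ) + 1) ^ 3 ≤ (2 * ℓ) ^ 3 := pow_le_pow_left₀ (by positivity) b4 3
      _ = _ := by ring
  have hn0 : (0 : ℝ) < n := by exact_mod_cast hn
  have hm0 : (0 : ℝ) < m := by exact_mod_cast hn.trans_le hnm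
  have hms : (0 : ℝ) < m * √(n : ℝ) := by positivity
  set A := (n : ℝ) ^ (3 / 4 : ℝ) with hA
  set S := (m * √(n : ℝ)) ^ (1 / τ) with hS
  have hS0 : 0 < S := Real.rpow_pos_of_pos hms _
  have hA0 : 0 ≤ A := by positivity
  have hB0 : 0 ≤ (n : ℝ) ^ (3 / 2 : ℝ) := by positivity
  have hBS : 0 ≤ (n : ℝ) ^ (3 / 2 : ℝ) / S := by positivity
  push_cast
  rw [pow_add]
  rcases hfail with rfl | hfail
  · calc (m : ℝ) * (2 ^ e) ^ 3 * 2 ^ 0 * ((e : ℝ) + 1) ^ 3 ≤ m * (8 * A) * 1 * (8 * ℓ ^ 3) := by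
          gcongr; norm_num
      _ = 64 * (m * A * (1 * ℓ ^ 3)) := by ring
      _ ≤ 1024 * C₃ * (m * (A + (n : ℝ) ^ (3 / 2 : ℝ) / S) * (ℓ ^ k * ℓ ^ 3)) := by
          gcongr
          · linarith
          · linarith
  · set M : ℕ := 2 ^ (3 * e - j + 1) with hM
    have hMj : (M : ℝ) * 2 ^ j = 2 * (2 ^ e) ^ 3 := by
      have : M * 2 ^ j = 2 * (2 ^ e) ^ 3 := by
        rw [hM, ← pow_mul, ← pow_add, ← pow_succ']
        congr 1; omega
      exact_mod_cast this
    have hM1 : (1 : ℝ) ≤ M := by exact_mod_cast (Nat.one_le_two_pow : 1 ≤ M)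
    have hMτ : 1 ≤ (M : ℝ) ^ τ := Real.one_le_rpow hM1 (by linarith)
    have hlogM0 : 0 ≤ Real.log M := Real.log_nonneg hM1
    have hlogM : 1 + Real.log M ≤ 6 * ℓ := by
      have h1 : Real.log M = ((3 * e - j + 1 : ℕ) : ℝ) * Real.log 2 := by
        rw [hM]; push_cast; rw [Real.log_pow]; push_cast; ring
      have h2 : ((3 * e - j + 1 : ℕ) : ℝ) ≤ 3 * e + 1 := by exact_mod_cast (by omega)
      have h3 := Real.log_two_lt_d9
      have h4 := Real.log_two_gt_d9
      have h5 : Real.log M ≤ 3 * e + 1 := by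
        rw [h1]; nlinarith [Nat.cast_nonneg (α := ℝ) (3 * e - j + 1)]
      linarith
    have h1 : (m : ℝ) * (2 ^ e) ^ 2 ≤ C₃ * ((M : ℝ) ^ τ * ℓ ^ k) := by
      have h2 : (m : ℝ) * (2 ^ e) ^ 2 ≤ ⌈C₁ * ((M : ℝ) ^ τ * (1 + Real.log M) ^ k)⌉₊ + 1 := by
        exact_mod_cast hfail.le
      have h3 := (Nat.ceil_lt_add_one
        (show 0 ≤ C₁ * ((M : ℝ) ^ τ * (1 + Real.log M) ^ k) by positivity)).le
      have h4 : (1 + Real.log M) ^ k ≤ 6 ^ k * ℓ ^ k := by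
        rw [← mul_pow]; exact pow_le_pow_left₀ (by linarith) hlogM k
      have h5 : C₁ * ((M : ℝ) ^ τ * (1 + Real.log M) ^ k) ≤ C₁ * ((M : ℝ) ^ τ * (6 ^ k * ℓ ^ k)) := by
        gcongr
      have h6 : 1 ≤ (M : ℝ) ^ τ * ℓ ^ k := one_le_mul_of_one_le_of_one_le hMτ hℓk
      have h7 : C₃ * ((M : ℝ) ^ τ * ℓ ^ k) = C₁ * ((M : ℝ) ^ τ * (6 ^ k * ℓ ^ k)) +
        2 * ((M : ℝ) ^ τ * ℓ ^ k) := by rw [hC₃]; ring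
      linarith
    have h2 : S ≤ C₃ * M * ℓ ^ k := by
      have h3 : (m : ℝ) * √(n : ℝ) ≤ (C₃ * M * ℓ ^ k) ^ τ := by
        calc (m : ℝ) * √(n : ℝ) ≤ m * (2 ^ e) ^ 2 := by gcongr
          _ ≤ C₃ * ((M : ℝ) ^ τ * ℓ ^ k) := h1
          -- The factors `C₃` and `ℓ ^ k` are at least `1` and `τ ≥ 1`, so they may be moved into
          -- the power; this makes the root easy to take.
          _ ≤ C₃ ^ τ * ((M : ℝ) ^ τ * (ℓ ^ k) ^ τ) := by
            gcongr
            · exact Real.self_le_rpow_of_one_le hC₃1 hτ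
            · exact Real.self_le_rpow_of_one_le hℓk hτ
          _ = _ := by
            rw [Real.mul_rpow (by positivity) (by positivity), Real.mul_rpow (by positivity)
              (by positivity)]
            ring
      calc S ≤ ((C₃ * M * ℓ ^ k) ^ τ) ^ (1 / τ) :=
            Real.rpow_le_rpow hms.le h3 (by positivity)
        _ = _ := by
            rw [← Real.rpow_mul (by positivity), mul_one_div_cancel (by linarith), Real.rpow_one]
    have h3 : 2 ^ j ≤ 2 * C₃ * (2 ^ e) ^ 3 * ℓ ^ k / S := by
      rw [le_div_iff₀ hS0]
      calc 2 ^ j * S ≤ 2 ^ j * (C₃ * M * ℓ ^ k) := by gcongr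
        _ = C₃ * ℓ ^ k * (M * 2 ^ j) := by ring
        _ = _ := by rw [hMj]; ring
    calc (m : ℝ) * (2 ^ e) ^ 3 * 2 ^ j * ((e : ℝ) + 1) ^ 3 ≤
          m * (2 ^ e) ^ 3 * (2 * C₃ * (2 ^ e) ^ 3 * ℓ ^ k / S) * (8 * ℓ ^ 3) := by gcongr
      _ = 16 * C₃ * (m * ((2 ^ e) ^ 6 / S) * (ℓ ^ k * ℓ ^ 3)) := by ring
      _ ≤ 16 * C₃ * (m * (64 * (n : ℝ) ^ (3 / 2 : ℝ) / S) * (ℓ ^ k * ℓ ^ 3)) := by gcongr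
      _ = 1024 * C₃ * (m * (0 + (n : ℝ) ^ (3 / 2 : ℝ) / S) * (ℓ ^ k * ℓ ^ 3)) := by ring
      _ ≤ _ := by gcongr

/-- The exponent `τ` occurs in the analysis only; the program finds its sample size by trial. Three
logarithms are added by the algorithm: one for the number of passes and two for `l`. -/
theorem diameterGap_of_matMul {τ : ℝ} (hτ : 1 ≤ τ) {k : ℕ}
    (h : MatMulInTime fun N => (N : ℝ) ^ τ * (1 + Real.log N) ^ k) :
    DiameterGapInTime fun n m =>
      m * ((n : ℝ) ^ (3 / 4 : ℝ) + (n : ℝ) ^ (3 / 2 : ℝ) / (m * √(n : ℝ)) ^ (1 / τ)) *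
        (1 + Real.log n) ^ (k + 3) := by
  obtain ⟨P, K, C, hP⟩ := h
  obtain ⟨C₂, hC₂, hbound⟩ := matMulBound_le hτ k (abs_nonneg C)
  intro c
  obtain ⟨Q, K', C', hQ⟩ := solver_exists (P := P) (K := K)
    -- The bound is made a natural number, and strict by adding one.
    (T := fun N => ⌈|C| * ((N : ℝ) ^ τ * (1 + Real.log N) ^ k)⌉₊ + 1) (by
      intro N w A B hN hw hAB tape
      obtain ⟨t, s, h1, h2, h3⟩ := hP N w A B hN hw hAB tape
      refine ⟨t, s, h1, ?_, h3⟩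
      have hN1 : (1 : ℝ) ≤ N := by exact_mod_cast hN
      have h0 : 0 ≤ (N : ℝ) ^ τ * (1 + Real.log N) ^ k := by
        have := Real.log_nonneg hN1
        positivity
      have h4 : (t : ℝ) ≤ ⌈|C| * ((N : ℝ) ^ τ * (1 + Real.log N) ^ k)⌉₊ :=
        (h2.trans (mul_le_mul_of_nonneg_right (le_abs_self C) h0)).trans (Nat.le_ceil _)
      have h5 : t ≤ ⌈|C| * ((N : ℝ) ^ τ * (1 + Real.log N) ^ k)⌉₊ := by exact_mod_cast h4
      exact Nat.lt_succ_of_le h5) c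
  refine ⟨Q, K', C' * C₂, fun n w G L D hn hm h4 hL hw => ?_⟩
  obtain ⟨h1, h2⟩ := hQ n w G L D hn hm h4 hL hw
  refine ⟨fun tape => ?_, h2⟩
  obtain ⟨t, s, hr, j, hj, hfail, ht⟩ := h1 tape
  refine ⟨t, s, hr, ?_⟩
  have h3 : (t : ℝ) ≤ C' * ((G.numEdges * (2 ^ Nat.clog 16 n) ^ 3 * 2 ^ j *
    (Nat.clog 16 n + 1) ^ 3 : ℕ) : ℝ) := by exact_mod_cast ht
  refine h3.trans ?_
  exact (mul_le_mul_of_nonneg_left (hbound n _ j hn hm hj hfail) (Nat.cast_nonneg _)).trans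
    (mul_assoc _ _ _).ge

end WordRAM

/-! ### Comparison of the bounds -/

theorem MultimodeGraph.numEdges_le {n : ℕ} (G : MultimodeGraph 2 (Fin n)) : G.numEdges ≤ n ^ 2 := by
  classical
  have key : ∀ i, (G i).edgeSet.ncard ≤ n.choose 2 := by
    intro i
    have h := (G i).card_edgeFinset_le_card_choose_two
    rw [Fintype.card_fin] at h
    rwa [← SimpleGraph.coe_edgeFinset, Set.ncard_coe_finset]
  have h1 : n.choose 2 * 2 ≤ n ^ 2 := by
    rw [Nat.choose_two_right, pow_two]
    exact (Nat.div_mul_le_self _ _).trans (Nat.mul_le_mul_left _ (Nat.sub_le _ _))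
  rw [MultimodeGraph.numEdges, Fin.sum_univ_two]
  have := key 0
  have := key 1
  omega

theorem DiameterGapInTime.mono {T T' : ℕ → ℕ → ℝ} (h : DiameterGapInTime T) {C : ℝ}
    (h0 : ∀ n m : ℕ, 0 < n → n ≤ m → 0 ≤ T n m)
    (hT : ∀ n m : ℕ, 0 < n → n ≤ m → m ≤ n ^ 2 → T n m ≤ C * T' n m) : DiameterGapInTime T' := by
  intro c
  obtain ⟨P, K, C', hP⟩ := h c
  refine ⟨P, K, |C'| * C, fun n w G L D hn hm h4 hL hw => ?_⟩
  obtain ⟨h1, h2⟩ := hP n w G L D hn hm h4 hL hw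
  refine ⟨fun tape => ?_, h2⟩
  obtain ⟨t, s, hr, ht⟩ := h1 tape
  refine ⟨t, s, hr, ht.trans ?_⟩
  calc C' * T n G.numEdges ≤ |C'| * T n G.numEdges :=
        mul_le_mul_of_nonneg_right (le_abs_self _) (h0 n _ hn hm)
    _ ≤ |C'| * (C * T' n G.numEdges) :=
        mul_le_mul_of_nonneg_left (hT n _ hn hm G.numEdges_le) (abs_nonneg _)
    _ = |C'| * C * T' n G.numEdges := (mul_assoc _ _ _).symm

/-- `sInf` is `0` for an empty set of reals and for one that is not bounded below. A positive
exponent excludes both, so there are admissible `τ` arbitrarily close to it. -/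
theorem exists_matMulInTime_lt (h : 0 < matMulExponent) {δ : ℝ} (hδ : 0 < δ) :
    ∃ τ, matMulExponent ≤ τ ∧ τ < matMulExponent + δ ∧
      MatMulInTime fun N => (N : ℝ) ^ τ * (1 + Real.log N) ^ 0 := by
  have hne : {τ : ℝ | MatMulInTime fun N => (N : ℝ) ^ τ}.Nonempty := by
    by_contra hemp
    rw [Set.not_nonempty_iff_eq_empty] at hemp
    rw [matMulExponent, hemp, Real.sInf_empty] at h
    exact lt_irrefl _ h
  have hbdd : BddBelow {τ : ℝ | MatMulInTime fun N => (N : ℝ) ^ τ} := by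
    by_contra hb
    rw [matMulExponent, Real.sInf_of_not_bddBelow hb] at h
    exact lt_irrefl _ h
  obtain ⟨τ, hτ, hlt⟩ := exists_lt_of_csInf_lt hne
    (show sInf {τ : ℝ | MatMulInTime fun N => (N : ℝ) ^ τ} < matMulExponent + δ by
      rw [← matMulExponent]; linarith)
  exact ⟨τ, csInf_le hbdd hτ, hlt, by simpa using hτ⟩

theorem one_add_log_pow_le (k : ℕ) {η : ℝ} (hη : 0 < η) :
    ∃ C : ℝ, 0 ≤ C ∧ ∀ n : ℕ, 0 < n → (1 + Real.log n) ^ k ≤ C * (n : ℝ) ^ η := by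
  set θ := η / (k + 1) with hθ
  have hθ0 : 0 < θ := by positivity
  refine ⟨(1 + 1 / θ) ^ k, by positivity, fun n hn => ?_⟩
  have hn1 : (1 : ℝ) ≤ n := by exact_mod_cast hn
  have h1 : Real.log n ≤ (n : ℝ) ^ θ / θ := Real.log_le_rpow_div (by positivity) hθ0
  have h2 : 1 ≤ (n : ℝ) ^ θ := Real.one_le_rpow hn1 hθ0.le
  have h3 : 1 + Real.log n ≤ (1 + 1 / θ) * (n : ℝ) ^ θ := by
    have : (1 + 1 / θ) * (n : ℝ) ^ θ = (n : ℝ) ^ θ + (n : ℝ) ^ θ / θ := by ring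
    linarith
  have h4 : 0 ≤ 1 + Real.log n := by linarith [Real.log_nonneg hn1]
  calc (1 + Real.log n) ^ k ≤ ((1 + 1 / θ) * (n : ℝ) ^ θ) ^ k := pow_le_pow_left₀ h4 h3 k
    _ = (1 + 1 / θ) ^ k * (n : ℝ) ^ (θ * k) := by
        rw [mul_pow, ← Real.rpow_natCast ((n : ℝ) ^ θ), ← Real.rpow_mul (by positivity)]
    _ ≤ (1 + 1 / θ) ^ k * (n : ℝ) ^ η := by
        gcongr
        rw [hθ, div_mul_eq_mul_div, div_le_iff₀ (by positivity)]
        nlinarith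

/-- Since `m ≥ n`, `m * √n` is at least `n ^ (3 / 2)`. -/
theorem matMulTerm_le {n m : ℕ} (hn : 0 < n) (hnm : n ≤ m) {τ : ℝ} (hτ : 0 < τ) :
    (n : ℝ) ^ (3 / 2 : ℝ) / (m * √(n : ℝ)) ^ (1 / τ) ≤ (n : ℝ) ^ (3 / 2 - 3 / 2 * (1 / τ) : ℝ) := by
  have hn0 : (0 : ℝ) < n := by exact_mod_cast hn
  have hm : (n : ℝ) ≤ m := by exact_mod_cast hnm
  have h1 : (n : ℝ) ^ (3 / 2 : ℝ) ≤ m * √(n : ℝ) := by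
    have : (n : ℝ) ^ (3 / 2 : ℝ) = n * √(n : ℝ) := by
      rw [Real.sqrt_eq_rpow, show (3 / 2 : ℝ) = 1 + 1 / 2 by norm_num, Real.rpow_add hn0,
        Real.rpow_one]
    rw [this]; gcongr
  rw [Real.rpow_sub hn0, Real.rpow_mul hn0.le]
  gcongr

theorem gapTime_nonneg (τ : ℝ) (k : ℕ) {n m : ℕ} (hn : 0 < n) :
    0 ≤ m * ((n : ℝ) ^ (3 / 4 : ℝ) + (n : ℝ) ^ (3 / 2 : ℝ) / (m * √(n : ℝ)) ^ (1 / τ)) *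
      (1 + Real.log n) ^ k := by
  have : 0 ≤ Real.log n := Real.log_nonneg (by exact_mod_cast hn)
  positivity

/-- One of the two summands of the bound is large. -/
theorem rpow_le_gapTerms {n m : ℕ} (hn : 0 < n) (hnm : n ≤ m) {ω : ℝ} (hω : 2 < ω) :
    (n : ℝ) ^ (3 / 4 : ℝ) ≤ (n : ℝ) ^ (3 / 2 : ℝ) / (m * √(n : ℝ)) ^ (1 / ω) +
      ((m : ℝ) / n) ^ (1 / (ω - 2)) := by
  have hn0 : (0 : ℝ) < n := by exact_mod_cast hn
  have hm0 : (0 : ℝ) < m := by exact_mod_cast hn.trans_le hnm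
  have hω2 : 0 < ω - 2 := by linarith
  have hS : 0 < (m * √(n : ℝ)) ^ (1 / ω) := by positivity
  rcases le_total ((n : ℝ) ^ (3 / 4 : ℝ)) (((m : ℝ) / n) ^ (1 / (ω - 2))) with h | h
  · exact h.trans (le_add_of_nonneg_left (by positivity))
  · refine le_add_of_le_of_nonneg ?_ (by positivity)
    -- If the second summand is below `n ^ (3 / 4)`, the graph is so sparse that `m * √n ≤ n ^ (3 /
    -- 4 * ω)`. Then the first summand is at least `n ^ (3 / 2 - 3 / 4)`.
    have h1 : (m : ℝ) / n ≤ (n : ℝ) ^ (3 / 4 * (ω - 2) : ℝ) := by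
      have := Real.rpow_le_rpow (by positivity) h hω2.le
      rwa [← Real.rpow_mul (by positivity), one_div_mul_cancel hω2.ne', Real.rpow_one,
        ← Real.rpow_mul hn0.le] at this
    have h2 : m * √(n : ℝ) ≤ (n : ℝ) ^ (3 / 4 * ω : ℝ) := by
      rw [div_le_iff₀ hn0] at h1
      calc m * √(n : ℝ) ≤ (n : ℝ) ^ (3 / 4 * (ω - 2) : ℝ) * n * √(n : ℝ) := by gcongr
        _ = (n : ℝ) ^ (3 / 4 * (ω - 2) : ℝ) * (n : ℝ) ^ (1 : ℝ) * (n : ℝ) ^ (1 / 2 : ℝ) := by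
            rw [Real.rpow_one, Real.sqrt_eq_rpow]
        _ = _ := by rw [← Real.rpow_add hn0, ← Real.rpow_add hn0]; congr 1; ring
    have h3 : (m * √(n : ℝ)) ^ (1 / ω) ≤ (n : ℝ) ^ (3 / 4 : ℝ) := by
      calc (m * √(n : ℝ)) ^ (1 / ω) ≤ ((n : ℝ) ^ (3 / 4 * ω : ℝ)) ^ (1 / ω) :=
            Real.rpow_le_rpow (by positivity) h2 (by positivity)
        _ = _ := by
            rw [← Real.rpow_mul hn0.le, mul_assoc, mul_one_div_cancel (by linarith), mul_one]
    rw [le_div_iff₀ hS]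
    calc (n : ℝ) ^ (3 / 4 : ℝ) * (m * √(n : ℝ)) ^ (1 / ω) ≤
          (n : ℝ) ^ (3 / 4 : ℝ) * (n : ℝ) ^ (3 / 4 : ℝ) := by gcongr
      _ = _ := by rw [← Real.rpow_add hn0]; norm_num

/-- A slightly larger exponent costs little. -/
theorem matMulTerm_le_mul {n m : ℕ} (hn : 0 < n) (hnm : n ≤ m) (hmn : m ≤ n ^ 2) {ω τ δ : ℝ}
    (hω : 2 ≤ ω) (hωτ : ω ≤ τ) (hτ : τ ≤ ω + δ) :
    (n : ℝ) ^ (3 / 2 : ℝ) / (m * √(n : ℝ)) ^ (1 / τ) ≤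
      (n : ℝ) ^ (3 / 2 : ℝ) / (m * √(n : ℝ)) ^ (1 / ω) * (n : ℝ) ^ δ := by
  have hn1 : (1 : ℝ) ≤ n := by exact_mod_cast hn
  have hn0 : (0 : ℝ) < n := by linarith
  have hm0 : (0 : ℝ) < m := by exact_mod_cast hn.trans_le hnm
  have hb0 : 0 < m * √(n : ℝ) := by positivity
  have hsq : √(n : ℝ) ≤ n := by
    rw [Real.sqrt_le_iff]; exact ⟨hn0.le, by nlinarith⟩
  have hm2 : (m : ℝ) ≤ (n : ℝ) ^ 2 := by exact_mod_cast hmn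
  have h1 : m * √(n : ℝ) ≤ (n : ℝ) ^ (3 : ℝ) := by
    calc m * √(n : ℝ) ≤ (n : ℝ) ^ 2 * n := by gcongr
      _ = (n : ℝ) ^ (3 : ℕ) := by ring
      _ = _ := by rw [← Real.rpow_natCast]; norm_num
  have hexp : 0 ≤ 1 / ω - 1 / τ := by
    rw [sub_nonneg]; exact one_div_le_one_div_of_le (by linarith) hωτ
  -- Since `m * √n ≤ n ^ 3`, the change of exponent costs at most this power of `n`, and `ω * τ ≥ 4`
  -- outweighs the factor `3`.
  have hexp' : 3 * (1 / ω - 1 / τ) ≤ δ := by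
    have : 1 / ω - 1 / τ = (τ - ω) / (ω * τ) := by
      rw [div_sub_div _ _ (by linarith) (by linarith)]; ring
    rw [this, mul_div_assoc', div_le_iff₀ (by nlinarith)]
    have h4 : 4 ≤ ω * τ := by nlinarith
    calc 3 * (τ - ω) ≤ (ω * τ) * (τ - ω) :=
          mul_le_mul_of_nonneg_right (by linarith) (sub_nonneg.2 hωτ)
      _ ≤ (ω * τ) * δ := mul_le_mul_of_nonneg_left (by linarith) (by linarith)
      _ = _ := mul_comm _ _
  have h2 : (m * √(n : ℝ)) ^ (1 / ω - 1 / τ) ≤ (n : ℝ) ^ δ := by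
    calc (m * √(n : ℝ)) ^ (1 / ω - 1 / τ) ≤ ((n : ℝ) ^ (3 : ℝ)) ^ (1 / ω - 1 / τ) :=
          Real.rpow_le_rpow hb0.le h1 hexp
      _ = (n : ℝ) ^ (3 * (1 / ω - 1 / τ)) := (Real.rpow_mul hn0.le _ _).symm
      _ ≤ _ := Real.rpow_le_rpow_of_exponent_le hn1 hexp'
  rw [Real.rpow_sub hb0, div_le_iff₀ (by positivity)] at h2
  rw [div_le_iff₀ (by positivity)]
  have hS : 0 < (m * √(n : ℝ)) ^ (1 / ω) := by positivity
  calc (n : ℝ) ^ (3 / 2 : ℝ) = (n : ℝ) ^ (3 / 2 : ℝ) / (m * √(n : ℝ)) ^ (1 / ω) *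
        (m * √(n : ℝ)) ^ (1 / ω) := by field_simp
    _ ≤ (n : ℝ) ^ (3 / 2 : ℝ) / (m * √(n : ℝ)) ^ (1 / ω) *
        ((n : ℝ) ^ δ * (m * √(n : ℝ)) ^ (1 / τ)) := by gcongr
    _ = _ := by ring

theorem diameterGap_two (h2 : matMulExponent = 2) {ε : ℝ} (hε : 0 < ε) :
    DiameterGapInTime fun n m => m * (n : ℝ) ^ (3 / 4 : ℝ) * (n : ℝ) ^ ε := by
  -- One half of `ε` pays for the exponent `τ` above `ω`, the other for the logarithms.
  obtain ⟨τ, h1, hτ, hM⟩ := exists_matMulInTime_lt (by linarith) (half_pos hε)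
  rw [h2] at h1 hτ
  obtain ⟨C, hC, hlog⟩ := one_add_log_pow_le 3 (half_pos hε)
  refine (WordRAM.diameterGap_of_matMul (by linarith) hM).mono (C := 2 * C)
    (fun n m hn _ => gapTime_nonneg τ _ hn) fun n m hn hnm _ => ?_
  have hn1 : (1 : ℝ) ≤ n := by exact_mod_cast hn
  have hn0 : (0 : ℝ) < n := by linarith
  have e1 : (n : ℝ) ^ (3 / 2 : ℝ) / (m * √(n : ℝ)) ^ (1 / τ) ≤
      (n : ℝ) ^ (3 / 4 : ℝ) * (n : ℝ) ^ (ε / 2) := by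
    refine (matMulTerm_le hn hnm (by linarith)).trans ?_
    rw [← Real.rpow_add hn0]
    refine Real.rpow_le_rpow_of_exponent_le hn1 ?_
    -- From `τ < 2 + ε / 2`. The exponent `3 / 2 - 3 / 2 * (1 / τ)` thus exceeds `3 / 4` by at most
    -- `3 * ε / 8`.
    have : 1 / 2 - ε / 4 ≤ 1 / τ := by
      rw [le_div_iff₀ (by linarith)]
      by_cases hh : 0 ≤ 1 / 2 - ε / 4
      · nlinarith
      · nlinarith
    linarith
  have e2 : (n : ℝ) ^ (3 / 4 : ℝ) ≤ (n : ℝ) ^ (3 / 4 : ℝ) * (n : ℝ) ^ (ε / 2) :=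
    le_mul_of_one_le_right (by positivity) (Real.one_le_rpow hn1 (by linarith))
  have e3 : (n : ℝ) ^ ε = (n : ℝ) ^ (ε / 2) * (n : ℝ) ^ (ε / 2) := by
    rw [← Real.rpow_add hn0, add_halves]
  have hl := Real.log_natCast_nonneg n
  calc m * ((n : ℝ) ^ (3 / 4 : ℝ) + (n : ℝ) ^ (3 / 2 : ℝ) / (m * √(n : ℝ)) ^ (1 / τ)) *
        (1 + Real.log n) ^ (0 + 3) ≤
        m * (2 * ((n : ℝ) ^ (3 / 4 : ℝ) * (n : ℝ) ^ (ε / 2))) * (C * (n : ℝ) ^ (ε / 2)) := by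
        gcongr
        · linarith
        · exact hlog n hn
    _ = 2 * C * (m * (n : ℝ) ^ (3 / 4 : ℝ) * (n : ℝ) ^ ε) := by rw [e3]; ring

theorem diameterGap_two_log (h2 : matMulExponent = 2) {k : ℕ}
    (h : MatMulInTime fun N => (N : ℝ) ^ matMulExponent * (1 + Real.log N) ^ k) :
    DiameterGapInTime fun n m => m * (n : ℝ) ^ (3 / 4 : ℝ) * (1 + Real.log n) ^ (k + 3) := by
  refine (WordRAM.diameterGap_of_matMul (by linarith) h).mono (C := 2)
    (fun n m hn _ => gapTime_nonneg _ _ hn) fun n m hn hnm _ => ?_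
  have e1 := matMulTerm_le hn hnm (τ := matMulExponent) (by linarith)
  rw [h2] at e1 ⊢
  norm_num at e1
  have hl := Real.log_natCast_nonneg n
  calc m * ((n : ℝ) ^ (3 / 4 : ℝ) + (n : ℝ) ^ (3 / 2 : ℝ) / (m * √(n : ℝ)) ^ (1 / 2 : ℝ)) *
        (1 + Real.log n) ^ (k + 3) ≤
        m * (2 * (n : ℝ) ^ (3 / 4 : ℝ)) * (1 + Real.log n) ^ (k + 3) := by
        gcongr
        norm_num
        linarith
    _ = _ := by ring

theorem diameterGap_gt (h2 : 2 < matMulExponent) {ε : ℝ} (hε : 0 < ε) :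
    DiameterGapInTime fun n m =>
      m * ((n : ℝ) ^ (3 / 2 : ℝ) / (m * √(n : ℝ)) ^ (1 / matMulExponent) +
        ((m : ℝ) / n) ^ (1 / (matMulExponent - 2))) * (n : ℝ) ^ ε := by
  obtain ⟨τ, h1, hτ, hM⟩ := exists_matMulInTime_lt (by linarith) (half_pos hε)
  obtain ⟨C, hC, hlog⟩ := one_add_log_pow_le 3 (half_pos hε)
  refine (WordRAM.diameterGap_of_matMul (by linarith) hM).mono (C := 2 * C)
    (fun n m hn _ => gapTime_nonneg τ _ hn) fun n m hn hnm hmn => ?_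
  have hn1 : (1 : ℝ) ≤ n := by exact_mod_cast hn
  have hn0 : (0 : ℝ) < n := by linarith
  have e1 := matMulTerm_le_mul hn hnm hmn h2.le h1 hτ.le
  have e2 := rpow_le_gapTerms hn hnm h2
  have e3 : (n : ℝ) ^ ε = (n : ℝ) ^ (ε / 2) * (n : ℝ) ^ (ε / 2) := by
    rw [← Real.rpow_add hn0, add_halves]
  have e4 : 1 ≤ (n : ℝ) ^ (ε / 2) := Real.one_le_rpow hn1 (by linarith)
  have hl := Real.log_natCast_nonneg n
  have e5 : 0 ≤ ((m : ℝ) / n) ^ (1 / (matMulExponent - 2)) := by positivity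
  set A := (n : ℝ) ^ (3 / 2 : ℝ) / (m * √(n : ℝ)) ^ (1 / matMulExponent)
  set B := ((m : ℝ) / n) ^ (1 / (matMulExponent - 2))
  have e6 : 0 ≤ A := by positivity
  calc m * ((n : ℝ) ^ (3 / 4 : ℝ) + (n : ℝ) ^ (3 / 2 : ℝ) / (m * √(n : ℝ)) ^ (1 / τ)) *
        (1 + Real.log n) ^ (0 + 3) ≤
        m * (2 * ((A + B) * (n : ℝ) ^ (ε / 2))) * (C * (n : ℝ) ^ (ε / 2)) := by
        gcongr
        · nlinarith
        · exact hlog n hn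
    _ = 2 * C * (m * (A + B) * (n : ℝ) ^ ε) := by rw [e3]; ring

theorem diameterGap_gt_log (h2 : 2 < matMulExponent) {k : ℕ}
    (h : MatMulInTime fun N => (N : ℝ) ^ matMulExponent * (1 + Real.log N) ^ k) :
    DiameterGapInTime fun n m =>
      m * ((n : ℝ) ^ (3 / 2 : ℝ) / (m * √(n : ℝ)) ^ (1 / matMulExponent) +
        ((m : ℝ) / n) ^ (1 / (matMulExponent - 2))) * (1 + Real.log n) ^ (k + 3) := by
  refine (WordRAM.diameterGap_of_matMul (by linarith) h).mono (C := 2)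
    (fun n m hn _ => gapTime_nonneg _ _ hn) fun n m hn hnm _ => ?_
  have e2 := rpow_le_gapTerms hn hnm h2
  have hl := Real.log_natCast_nonneg n
  have e5 : 0 ≤ ((m : ℝ) / n) ^ (1 / (matMulExponent - 2)) := by positivity
  set A := (n : ℝ) ^ (3 / 2 : ℝ) / (m * √(n : ℝ)) ^ (1 / matMulExponent)
  set B := ((m : ℝ) / n) ^ (1 / (matMulExponent - 2))
  calc m * ((n : ℝ) ^ (3 / 4 : ℝ) + A) * (1 + Real.log n) ^ (k + 3) ≤
        m * (2 * (A + B)) * (1 + Real.log n) ^ (k + 3) := by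
        gcongr
        linarith
    _ = _ := by ring

theorem mainTheorem1 :
    (matMulExponent = 2 →
      (∀ ε : ℝ, 0 < ε →
        DiameterGapInTime fun n m => m * (n : ℝ) ^ (3 / 4 : ℝ) * (n : ℝ) ^ ε) ∧
      ((∃ k : ℕ, MatMulInTime fun N => (N : ℝ) ^ matMulExponent * (1 + Real.log N) ^ k) →
        ∃ k : ℕ, DiameterGapInTime fun n m =>
          m * (n : ℝ) ^ (3 / 4 : ℝ) * (1 + Real.log n) ^ k)) ∧
    (2 < matMulExponent →
      (∀ ε : ℝ, 0 < ε →
        DiameterGapInTime fun n m =>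
          m * ((n : ℝ) ^ (3 / 2 : ℝ) / (m * √(n : ℝ)) ^ (1 / matMulExponent) +
            ((m : ℝ) / n) ^ (1 / (matMulExponent - 2))) * (n : ℝ) ^ ε) ∧
      ((∃ k : ℕ, MatMulInTime fun N => (N : ℝ) ^ matMulExponent * (1 + Real.log N) ^ k) →
        ∃ k : ℕ, DiameterGapInTime fun n m =>
          m * ((n : ℝ) ^ (3 / 2 : ℝ) / (m * √(n : ℝ)) ^ (1 / matMulExponent) +
            ((m : ℝ) / n) ^ (1 / (matMulExponent - 2))) * (1 + Real.log n) ^ k)) :=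
  ⟨fun h2 => ⟨fun _ hε => diameterGap_two h2 hε, fun ⟨_, hk⟩ => ⟨_, diameterGap_two_log h2 hk⟩⟩,
    fun h2 => ⟨fun _ hε => diameterGap_gt h2 hε, fun ⟨_, hk⟩ => ⟨_, diameterGap_gt_log h2 hk⟩⟩⟩
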